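/- **Conventions.** Let $K$ be a field. A *superadditive category* over $K$ is a small $K$-linear category $\mathcal A$ whose morphism spaces carry decompositions $\mathcal A(X,Y)=\mathcal A(X,Y)_0\oplus\mathcal A(X,Y)_1$ such that $ab\in\mathcal A(X,Z)_{i+j}$ for $a\in\mathcal A(X,Y)_i$, $b\in\mathcal A(Y,Z)_j$, $i,j\in\mathbb Z/2$; here $ab$ means first $a$, then $b$, and $|a|$ denotes the degree of a homogeneous morphism. (Finite direct sums of objects are not required.) A *graded functor* is a $K$-linear functor preserving degrees. The tensor product $\mathcal A\otimes\mathcal B$ has as objects the pairs of an object of $\mathcal A$ and an object of $\mathcal B$, as morphism spaces the graded tensor products $\mathcal A(X,X')\otimes_K\mathcal B(Y,Y')$, and composition $(\phi_1\otimes\phi_2)(\psi_1\otimes\psi_2)=(-1)^{|\phi_2||\psi_1|}\phi_1\psi_1\otimes\phi_2\psi_2$; graded functors $F,G$ induce a graded functor $F\otimes G$. For $n\ge 0$ put $$\mathscr N_n(\mathcal A)=\bigoplus_{(Y_0,\dots,Y_n)}\mathcal A(Y_0,Y_1)\otimes\mathcal A(Y_1,Y_2)\otimes\cdots\otimes\mathcal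 A(Y_n,Y_0),$$ the sum being over all $(n+1)$-tuples of objects, and define on homogeneous tensors $$\partial(a_0\otimes\cdots\otimes a_n)=\sum_{i=0}^{n-1}(-1)^i a_0\otimes\cdots\otimes a_ia_{i+1}\otimes\cdots\otimes a_n+(-1)^{n+|a_n|(|a_0|+\cdots+|a_{n-1}|)}a_na_0\otimes a_1\otimes\cdots\otimes a_{n-1}\quad(n\ge1),$$ $$t(a_0\otimes\cdots\otimes a_n)=(-1)^{n+|a_n|(|a_0|+\cdots+|a_{n-1}|)}a_n\otimes a_0\otimes\cdots\otimes a_{n-1},\qquad s(a_0\otimes\cdots\otimes a_n)=1\otimes a_0\otimes\cdots\otimes a_n,$$ with $\partial=0$ on $\mathscr N_0$, and $B=(1-t)\,s\sum_{i=0}^n t^i:\mathscr N_n(\mathcal A)\to\mathscr N_{n+1}(\mathcal A)$. The cyclic complex $C(\mathcal A)$ is $C(\mathcal A)_n=\bigoplus_{k\ge0}\mathscr N_{n-2k}(\mathcal A)$ with differential $\partial+B$ (where $B$ is $0$ on the summand $k=0$), and the cyclic homology is $\mathrm{HC}_n(\mathcal A)=H_n(C(\mathcal A))$, with $\mathrm{HC}_n(\mathcal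 A)=0$ for $n<0$. Connes' periodicity operator $S:\mathrm{HC}_n(\mathcal A)\to\mathrm{HC}_{n-2}(\mathcal A)$ is induced by the chain map $(a_n,a_{n-2},a_{n-4},\dots)\mapsto(a_{n-2},a_{n-4},\dots)$. **Theorem.** Let $K$ be a field. For all superadditive categories $\mathcal A$ and $\mathcal B$ over $K$ there is a long exact sequence of $K$-vector spaces $$\cdots\to \mathrm{HC}_n(\mathcal A\otimes\mathcal B)\to\bigoplus_{p+q=n}\mathrm{HC}_p(\mathcal A)\otimes_K\mathrm{HC}_q(\mathcal B)\xrightarrow{\;S\otimes\mathrm{id}-\mathrm{id}\otimes S\;}\bigoplus_{p+q=n-2}\mathrm{HC}_p(\mathcal A)\otimes_K\mathrm{HC}_q(\mathcal B)\to\mathrm{HC}_{n-1}(\mathcal A\otimes\mathcal B)\to\cdots$$ which is natural with respect to graded functors $\mathcal A\to\mathcal A'$ and $\mathcal B\to\mathcal B'$. Since the terms with a negative index vanish, the sequence ends with a surjection $\mathrm{HC}_1(\mathcal A\otimes\mathcal B)\to\bigoplus_{p+q=1}\mathrm{HC}_p(\mathcal A)\otimes_K\mathrm{HC}_q(\mathcal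 B)$ and an isomorphism $\mathrm{HC}_0(\mathcal A\otimes\mathcal B)\cong\mathrm{HC}_0(\mathcal A)\otimes_K\mathrm{HC}_0(\mathcal B)$. -/

import Mathlib

open CategoryTheory
open scoped TensorProduct DirectSum

universe w u v u₁ v₁ u₂ v₂ x

noncomputable section

/-! ## Superadditive categories -/

/-- A (small) superadditive category over `K`: a `K`-linear category all of whose morphism spaces
carry a `ℤ/2`-grading `V = V₀ ⊕ V₁` compatible with composition. (Identities are then
automatically even.) -/
structure SuperCat (K : Type w) [Field K] where
  Obj : Type u
  [cat : Category.{v} Obj]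
  [preadditive : Preadditive Obj]
  [linear : Linear K Obj]
  /-- `deg X Y i` is the homogeneous part of degree `i` of the morphism space. -/
  deg (X Y : Obj) (i : ZMod 2) : Submodule K (X ⟶ Y)
  isCompl (X Y : Obj) : IsCompl (deg X Y 0) (deg X Y 1)
  comp_mem {X Y Z : Obj} {i j : ZMod 2} {f : X ⟶ Y} {g : Y ⟶ Z} :
    f ∈ deg X Y i → g ∈ deg Y Z j → f ≫ g ∈ deg X Z (i + j)

namespace SuperCat

attribute [instance] SuperCat.cat SuperCat.preadditive SuperCat.linear

variable {K : Type w} [Field K]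

section Parts

variable (A : SuperCat.{w, u, v} K)

/-- The even component `f ↦ f₀` of a morphism. -/
def ev (X Y : A.Obj) : (X ⟶ Y) →ₗ[K] (X ⟶ Y) :=
  Submodule.projection (A.deg X Y 0) (A.deg X Y 1) (A.isCompl X Y)

/-- The odd component `f ↦ f₁` of a morphism. -/
def od (X Y : A.Obj) : (X ⟶ Y) →ₗ[K] (X ⟶ Y) :=
  Submodule.projection (A.deg X Y 1) (A.deg X Y 0) (A.isCompl X Y).symm

/-- The parity operator `f ↦ (-1)^|f| f`, that is `f₀ + f₁ ↦ f₀ - f₁`. -/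
def par (X Y : A.Obj) : (X ⟶ Y) →ₗ[K] (X ⟶ Y) := A.ev X Y - A.od X Y

variable {A} {X Y Z : A.Obj}

lemma ev_mem (f : X ⟶ Y) : A.ev X Y f ∈ A.deg X Y 0 :=
  Submodule.projection_apply_mem _ _

lemma od_mem (f : X ⟶ Y) : A.od X Y f ∈ A.deg X Y 1 :=
  Submodule.projection_apply_mem _ _

lemma ev_of_even {f : X ⟶ Y} (h : f ∈ A.deg X Y 0) : A.ev X Y f = f :=
  Submodule.projection_apply_of_mem_left _ h

lemma od_of_odd {f : X ⟶ Y} (h : f ∈ A.deg X Y 1) : A.od X Y f = f :=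
  Submodule.projection_apply_of_mem_left _ h

lemma ev_of_odd {f : X ⟶ Y} (h : f ∈ A.deg X Y 1) : A.ev X Y f = 0 :=
  (Submodule.projection_apply_eq_zero_iff _).2 h

lemma od_of_even {f : X ⟶ Y} (h : f ∈ A.deg X Y 0) : A.od X Y f = 0 :=
  (Submodule.projection_apply_eq_zero_iff _).2 h

lemma ev_add_od (f : X ⟶ Y) : A.ev X Y f + A.od X Y f = f := by
  have h : f ∈ A.deg X Y 0 ⊔ A.deg X Y 1 := by
    rw [(A.isCompl X Y).sup_eq_top]; trivial
  obtain ⟨a, ha, b, hb, rfl⟩ := Submodule.mem_sup.1 h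
  simp [ev_of_even ha, ev_of_odd hb, od_of_even ha, od_of_odd hb]

@[simp] lemma ev_ev (f : X ⟶ Y) : A.ev X Y (A.ev X Y f) = A.ev X Y f := ev_of_even (ev_mem f)
@[simp] lemma od_od (f : X ⟶ Y) : A.od X Y (A.od X Y f) = A.od X Y f := od_of_odd (od_mem f)
@[simp] lemma ev_od (f : X ⟶ Y) : A.ev X Y (A.od X Y f) = 0 := ev_of_odd (od_mem f)
@[simp] lemma od_ev (f : X ⟶ Y) : A.od X Y (A.ev X Y f) = 0 := od_of_even (ev_mem f)

lemma ev_comp (f : X ⟶ Y) (g : Y ⟶ Z) : A.ev X Z (f ≫ g) =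
    A.ev X Y f ≫ A.ev Y Z g + A.od X Y f ≫ A.od Y Z g := by
  conv_lhs => rw [← ev_add_od f, ← ev_add_od g]
  have h1 := A.comp_mem (ev_mem f) (ev_mem g)
  have h2 := A.comp_mem (ev_mem f) (od_mem g)
  have h3 := A.comp_mem (od_mem f) (ev_mem g)
  have h4 := A.comp_mem (od_mem f) (od_mem g)
  rw [show (0 : ZMod 2) + 0 = 0 from rfl] at h1
  rw [show (0 : ZMod 2) + 1 = 1 from rfl] at h2
  rw [show (1 : ZMod 2) + 0 = 1 from rfl] at h3
  rw [show (1 : ZMod 2) + 1 = 0 from rfl] at h4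
  simp [ev_of_even h1, ev_of_odd h2, ev_of_odd h3, ev_of_even h4]

lemma od_comp (f : X ⟶ Y) (g : Y ⟶ Z) : A.od X Z (f ≫ g) =
    A.ev X Y f ≫ A.od Y Z g + A.od X Y f ≫ A.ev Y Z g := by
  have h := ev_add_od (f ≫ g)
  rw [ev_comp] at h
  have h2 : f ≫ g = (A.ev X Y f + A.od X Y f) ≫ (A.ev Y Z g + A.od Y Z g) := by
    rw [ev_add_od, ev_add_od]
  rw [h2] at h
  simp only [Preadditive.add_comp, Preadditive.comp_add] at h
  rw [h2]
  simp only [Preadditive.add_comp, Preadditive.comp_add]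
  rw [← sub_eq_zero] at h ⊢
  rw [← h]
  simp only [map_add]
  abel

lemma id_even (X : A.Obj) : 𝟙 X ∈ A.deg X X 0 := by
  have h1 : A.ev X X (𝟙 X) ≫ A.od X X (𝟙 X) = 0 ∧ A.od X X (𝟙 X) ≫ A.od X X (𝟙 X) = 0 := by
    have h := ev_comp (A := A) (𝟙 X) (A.od X X (𝟙 X))
    have h' := od_comp (A := A) (𝟙 X) (A.od X X (𝟙 X))
    simp only [Category.id_comp, ev_od, od_od, Limits.comp_zero, zero_add, add_zero] at h h'
    refine ⟨?_, h.symm⟩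
    have h3 := ev_comp (A := A) (A.ev X X (𝟙 X)) (𝟙 X)
    have h4 := od_comp (A := A) (A.ev X X (𝟙 X)) (𝟙 X)
    simpa using h4.symm
  have h2 : A.od X X (𝟙 X) = 0 := by
    have : A.od X X (𝟙 X) = (A.ev X X (𝟙 X) + A.od X X (𝟙 X)) ≫ A.od X X (𝟙 X) := by
      rw [ev_add_od, Category.id_comp]
    rw [this, Preadditive.add_comp, h1.1, h1.2, add_zero]
  have h3 := ev_add_od (A := A) (𝟙 X)
  rw [h2, add_zero] at h3
  rw [← h3]
  exact ev_mem _

@[simp] lemma ev_id (X : A.Obj) : A.ev X X (𝟙 X) = 𝟙 X := ev_of_even (id_even X)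
@[simp] lemma od_id (X : A.Obj) : A.od X X (𝟙 X) = 0 := od_of_even (id_even X)
@[simp] lemma par_id (X : A.Obj) : A.par X X (𝟙 X) = 𝟙 X := by simp [par]

lemma par_comp (f : X ⟶ Y) (g : Y ⟶ Z) :
    A.par X Z (f ≫ g) = A.par X Y f ≫ A.par Y Z g := by
  simp only [par, LinearMap.sub_apply, ev_comp, od_comp, Preadditive.sub_comp,
    Preadditive.comp_sub]
  abel

@[simp] lemma par_par (f : X ⟶ Y) : A.par X Y (A.par X Y f) = f := by
  simp [par, ev_add_od]

lemma par_of_even {f : X ⟶ Y} (h : f ∈ A.deg X Y 0) : A.par X Y f = f := by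
  simp [par, ev_of_even h, od_of_even h]

lemma par_of_odd {f : X ⟶ Y} (h : f ∈ A.deg X Y 1) : A.par X Y f = -f := by
  simp [par, ev_of_odd h, od_of_odd h]

lemma par_mem {f : X ⟶ Y} {i : ZMod 2} (h : f ∈ A.deg X Y i) : A.par X Y f ∈ A.deg X Y i := by
  fin_cases i
  · rw [par_of_even h]; exact h
  · rw [par_of_odd h]; exact neg_mem h

end Parts

/-! ## Graded functors -/

/-- A graded functor: a `K`-linear functor which preserves the degree of morphisms. -/
structure GradedFunctor (A : SuperCat.{w, u₁, v₁} K) (B : SuperCat.{w, u₂, v₂} K) where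
  toFunctor : A.Obj ⥤ B.Obj
  [additive : toFunctor.Additive]
  [linear : toFunctor.Linear K]
  map_mem {X Y : A.Obj} {i : ZMod 2} {f : X ⟶ Y} :
    f ∈ A.deg X Y i → toFunctor.map f ∈ B.deg (toFunctor.obj X) (toFunctor.obj Y) i

attribute [instance] GradedFunctor.additive GradedFunctor.linear

namespace GradedFunctor

variable {A : SuperCat.{w, u₁, v₁} K} {B : SuperCat.{w, u₂, v₂} K} (F : GradedFunctor A B)

lemma map_ev {X Y : A.Obj} (f : X ⟶ Y) :
    F.toFunctor.map (A.ev X Y f) = B.ev _ _ (F.toFunctor.map f) := by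
  conv_rhs => rw [← ev_add_od f, F.toFunctor.map_add, map_add,
    ev_of_even (F.map_mem (ev_mem f)), ev_of_odd (F.map_mem (od_mem f)), add_zero]

lemma map_od {X Y : A.Obj} (f : X ⟶ Y) :
    F.toFunctor.map (A.od X Y f) = B.od _ _ (F.toFunctor.map f) := by
  conv_rhs => rw [← ev_add_od f, F.toFunctor.map_add, map_add,
    od_of_even (F.map_mem (ev_mem f)), od_of_odd (F.map_mem (od_mem f)), zero_add]

lemma map_par {X Y : A.Obj} (f : X ⟶ Y) :
    F.toFunctor.map (A.par X Y f) = B.par _ _ (F.toFunctor.map f) := by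
  simp only [par, LinearMap.sub_apply, Functor.map_sub, map_ev, map_od]

end GradedFunctor

/-! ## The tensor product of superadditive categories -/

section Tensor

variable (A : SuperCat.{w, u₁, v₁} K) (B : SuperCat.{w, u₂, v₂} K)

/-- Objects of `A ⊗ B`: pairs of an object of `A` and an object of `B`. -/
structure TensorObj where
  fst : A.Obj
  snd : B.Obj

variable {A B}

/-- Composition in `A ⊗ B`, i.e. the bilinear map with
`(φ₁ ⊗ φ₂)(ψ₁ ⊗ ψ₂) = (-1)^(|φ₂||ψ₁|) φ₁ψ₁ ⊗ φ₂ψ₂` on homogeneous elements. -/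
def tensorComp (P Q R : TensorObj A B) :
    ((P.fst ⟶ Q.fst) ⊗[K] (P.snd ⟶ Q.snd)) →ₗ[K] ((Q.fst ⟶ R.fst) ⊗[K] (Q.snd ⟶ R.snd)) →ₗ[K]
      ((P.fst ⟶ R.fst) ⊗[K] (P.snd ⟶ R.snd)) :=
  TensorProduct.map₂ (Linear.comp P.fst Q.fst R.fst)
      ((Linear.comp P.snd Q.snd R.snd).comp (B.ev P.snd Q.snd)) +
    TensorProduct.map₂ ((Linear.comp P.fst Q.fst R.fst).compl₂ (A.par Q.fst R.fst))
      ((Linear.comp P.snd Q.snd R.snd).comp (B.od P.snd Q.snd))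

lemma tensorComp_tmul (P Q R : TensorObj A B) (a : P.fst ⟶ Q.fst) (b : P.snd ⟶ Q.snd)
    (a' : Q.fst ⟶ R.fst) (b' : Q.snd ⟶ R.snd) :
    tensorComp P Q R (a ⊗ₜ b) (a' ⊗ₜ b') =
      (a ≫ a') ⊗ₜ[K] (B.ev _ _ b ≫ b') + (a ≫ A.par _ _ a') ⊗ₜ[K] (B.od _ _ b ≫ b') := by
  simp [tensorComp]

instance tensorCategory : Category (TensorObj A B) where
  Hom P Q := (P.fst ⟶ Q.fst) ⊗[K] (P.snd ⟶ Q.snd)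
  id P := 𝟙 P.fst ⊗ₜ[K] 𝟙 P.snd
  comp {P Q R} f g := tensorComp P Q R f g
  id_comp {P Q} f := by
    induction f using TensorProduct.induction_on with
    | zero => simp
    | tmul a b => simp [tensorComp_tmul]
    | add a b ha hb => rw [map_add, ha, hb]
  comp_id {P Q} f := by
    induction f using TensorProduct.induction_on with
    | zero => simp
    | tmul a b => simp [tensorComp_tmul, ← TensorProduct.tmul_add, ev_add_od]
    | add a b ha hb => rw [map_add, LinearMap.add_apply, ha, hb]
  assoc {P Q R S} f g h := by
    induction f using TensorProduct.induction_on with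
    | zero => simp
    | add a b ha hb => simp only [map_add, LinearMap.add_apply, ha, hb]
    | tmul a b =>
      induction g using TensorProduct.induction_on with
      | zero => simp
      | add a b ha hb => simp only [map_add, LinearMap.add_apply, ha, hb]
      | tmul a' b' =>
        induction h using TensorProduct.induction_on with
        | zero => simp
        | add a b ha hb => simp only [map_add, ha, hb]
        | tmul a'' b'' =>
          simp only [tensorComp_tmul, map_add, LinearMap.add_apply, ev_comp, od_comp, ev_ev,
            od_od, ev_od, od_ev, Limits.zero_comp, add_zero, zero_add, par_comp, par_par,
            Category.assoc]
          abel

lemma tensor_comp_def {P Q R : TensorObj A B} (f : P ⟶ Q) (g : Q ⟶ R) :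
    f ≫ g = tensorComp P Q R f g := rfl

instance (P Q : TensorObj A B) : AddCommGroup (P ⟶ Q) :=
  inferInstanceAs (AddCommGroup ((P.fst ⟶ Q.fst) ⊗[K] (P.snd ⟶ Q.snd)))

instance (P Q : TensorObj A B) : Module K (P ⟶ Q) :=
  inferInstanceAs (Module K ((P.fst ⟶ Q.fst) ⊗[K] (P.snd ⟶ Q.snd)))

instance tensorPreadditive : Preadditive (TensorObj A B) where
  homGroup _ _ := inferInstance
  add_comp P Q R f f' g := LinearMap.map_add₂ (tensorComp P Q R) f f' g
  comp_add P Q R f g g' := map_add (tensorComp P Q R f) g g'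

instance tensorLinear : Linear K (TensorObj A B) where
  homModule _ _ := inferInstance
  smul_comp P Q R r f g := LinearMap.map_smul₂ (tensorComp P Q R) r f g
  comp_smul P Q R f r g := map_smul (tensorComp P Q R f) r g

/-- `(V ⊗ W)ᵢ = ⊕_{j + k = i} Vⱼ ⊗ Wₖ`. -/
def tensorDeg (P Q : TensorObj A B) (i : ZMod 2) :
    Submodule K ((P.fst ⟶ Q.fst) ⊗[K] (P.snd ⟶ Q.snd)) :=
  Submodule.span K {t | ∃ j k : ZMod 2, j + k = i ∧
    ∃ a ∈ A.deg P.fst Q.fst j, ∃ b ∈ B.deg P.snd Q.snd k, t = a ⊗ₜ[K] b}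

lemma tmul_mem_tensorDeg {P Q : TensorObj A B} {j k : ZMod 2} {a : P.fst ⟶ Q.fst}
    {b : P.snd ⟶ Q.snd} (ha : a ∈ A.deg _ _ j) (hb : b ∈ B.deg _ _ k) :
    a ⊗ₜ[K] b ∈ tensorDeg P Q (j + k) :=
  Submodule.subset_span ⟨j, k, rfl, a, ha, b, hb, rfl⟩

lemma tmul_mem_tensorDeg' {P Q : TensorObj A B} {i j k : ZMod 2} {a : P.fst ⟶ Q.fst}
    {b : P.snd ⟶ Q.snd} (ha : a ∈ A.deg _ _ j) (hb : b ∈ B.deg _ _ k) (h : j + k = i) :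
    a ⊗ₜ[K] b ∈ tensorDeg P Q i :=
  h ▸ tmul_mem_tensorDeg ha hb

lemma tensorDeg_isCompl (P Q : TensorObj A B) :
    IsCompl (tensorDeg P Q 0) (tensorDeg P Q 1) := by
  have z2 : ∀ j : ZMod 2, j = 0 ∨ j = 1 := by decide
  let π : ((P.fst ⟶ Q.fst) ⊗[K] (P.snd ⟶ Q.snd)) →ₗ[K] _ :=
    TensorProduct.map (A.ev P.fst Q.fst) (B.ev P.snd Q.snd) +
      TensorProduct.map (A.od P.fst Q.fst) (B.od P.snd Q.snd)
  have h0 : ∀ t ∈ tensorDeg P Q 0, π t = t := by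
    intro t ht
    induction ht using Submodule.span_induction with
    | zero => simp
    | add x y _ _ hx hy => rw [map_add, hx, hy]
    | smul r x _ hx => rw [map_smul, hx]
    | mem t ht =>
      obtain ⟨j, k, hjk, a, ha, b, hb, rfl⟩ := ht
      rcases z2 j with rfl | rfl <;> rcases z2 k with rfl | rfl
      · simp [π, ev_of_even ha, ev_of_even hb, od_of_even ha]
      · exact absurd hjk (by decide)
      · exact absurd hjk (by decide)
      · simp [π, ev_of_odd ha, od_of_odd hb, od_of_odd ha]
  have h1 : ∀ t ∈ tensorDeg P Q 1, π t = 0 := by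
    intro t ht
    induction ht using Submodule.span_induction with
    | zero => simp
    | add x y _ _ hx hy => rw [map_add, hx, hy, add_zero]
    | smul r x _ hx => rw [map_smul, hx, smul_zero]
    | mem t ht =>
      obtain ⟨j, k, hjk, a, ha, b, hb, rfl⟩ := ht
      rcases z2 j with rfl | rfl <;> rcases z2 k with rfl | rfl
      · exact absurd hjk (by decide)
      · simp [π, ev_of_odd hb, od_of_even ha]
      · simp [π, ev_of_odd ha, od_of_even hb]
      · exact absurd hjk (by decide)
  constructor
  · rw [Submodule.disjoint_def]
    intro t ht ht'
    rw [← h0 t ht, h1 t ht']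
  · rw [codisjoint_iff, Submodule.eq_top_iff']
    intro t
    induction t using TensorProduct.induction_on with
    | zero => exact zero_mem _
    | add x y hx hy => exact add_mem hx hy
    | tmul a b =>
      rw [← ev_add_od a, ← ev_add_od b]
      simp only [TensorProduct.add_tmul, TensorProduct.tmul_add]
      refine add_mem (add_mem ?_ ?_) (add_mem ?_ ?_)
      · exact Submodule.mem_sup_left (tmul_mem_tensorDeg' (ev_mem a) (ev_mem b) (by decide))
      · exact Submodule.mem_sup_right (tmul_mem_tensorDeg' (od_mem a) (ev_mem b) (by decide))
      · exact Submodule.mem_sup_right (tmul_mem_tensorDeg' (ev_mem a) (od_mem b) (by decide))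
      · exact Submodule.mem_sup_left (tmul_mem_tensorDeg' (od_mem a) (od_mem b) (by decide))

lemma tensorComp_mem {P Q R : TensorObj A B} {i j : ZMod 2}
    {f : (P.fst ⟶ Q.fst) ⊗[K] (P.snd ⟶ Q.snd)} {g : (Q.fst ⟶ R.fst) ⊗[K] (Q.snd ⟶ R.snd)}
    (hf : f ∈ tensorDeg P Q i) (hg : g ∈ tensorDeg Q R j) :
    tensorComp P Q R f g ∈ tensorDeg P R (i + j) := by
  have z2 : ∀ j : ZMod 2, j = 0 ∨ j = 1 := by decide
  have key := Submodule.apply_mem_map₂ (tensorComp P Q R) hf hg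
  rw [tensorDeg, tensorDeg, Submodule.map₂_span_span] at key
  refine Submodule.span_le.2 ?_ key
  rintro _ ⟨_, ⟨k, l, rfl, a, ha, b, hb, rfl⟩, _, ⟨m, n, rfl, a', ha', b', hb', rfl⟩, rfl⟩
  change tensorComp P Q R (a ⊗ₜ b) (a' ⊗ₜ b') ∈ _
  rw [tensorComp_tmul, show k + l + (m + n) = (k + m) + (l + n) by ring]
  rcases z2 l with rfl | rfl
  · rw [ev_of_even hb, od_of_even hb, Limits.zero_comp, TensorProduct.tmul_zero, add_zero]
    exact tmul_mem_tensorDeg (A.comp_mem ha ha') (B.comp_mem hb hb')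
  · rw [ev_of_odd hb, od_of_odd hb, Limits.zero_comp, TensorProduct.tmul_zero, zero_add]
    exact tmul_mem_tensorDeg (A.comp_mem ha (par_mem ha')) (B.comp_mem hb hb')

variable (A B) in
/-- The tensor product `A ⊗ B` of superadditive categories. -/
def tensor : SuperCat.{w, max u₁ u₂, max v₁ v₂} K where
  Obj := TensorObj A B
  deg P Q i := tensorDeg P Q i
  isCompl := tensorDeg_isCompl
  comp_mem hf hg := tensorComp_mem hf hg

end Tensor

section TensorFunctor

variable {A A' : SuperCat.{w, u₁, v₁} K} {B B' : SuperCat.{w, u₂, v₂} K}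
  (F : GradedFunctor A A') (G : GradedFunctor B B')

/-- `(F ⊗ G)(X ⊗ Y) = F(X) ⊗ G(Y)`. -/
abbrev tensorObj (P : TensorObj A B) : TensorObj A' B' :=
  ⟨F.toFunctor.obj P.fst, G.toFunctor.obj P.snd⟩

/-- `(F ⊗ G)(a ⊗ b) = F(a) ⊗ G(b)`. -/
def tensorMap (P Q : TensorObj A B) :
    ((P.fst ⟶ Q.fst) ⊗[K] (P.snd ⟶ Q.snd)) →ₗ[K]
      (((tensorObj F G P).fst ⟶ (tensorObj F G Q).fst) ⊗[K]
        ((tensorObj F G P).snd ⟶ (tensorObj F G Q).snd)) :=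
  TensorProduct.map (F.toFunctor.mapLinearMap K) (G.toFunctor.mapLinearMap K)

lemma tensorMap_tmul (P Q : TensorObj A B) (a : P.fst ⟶ Q.fst) (b : P.snd ⟶ Q.snd) :
    tensorMap F G P Q (a ⊗ₜ b) = F.toFunctor.map a ⊗ₜ[K] G.toFunctor.map b := rfl

lemma tensorMap_id (P : TensorObj A B) : tensorMap F G P P (𝟙 P.fst ⊗ₜ[K] 𝟙 P.snd) =
    𝟙 (tensorObj F G P).fst ⊗ₜ[K] 𝟙 (tensorObj F G P).snd := by
  rw [tensorMap_tmul, CategoryTheory.Functor.map_id, CategoryTheory.Functor.map_id]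

lemma tensorMap_comp {P Q R : TensorObj A B} (f : (P.fst ⟶ Q.fst) ⊗[K] (P.snd ⟶ Q.snd))
    (g : (Q.fst ⟶ R.fst) ⊗[K] (Q.snd ⟶ R.snd)) :
    tensorMap F G P R (tensorComp P Q R f g) =
      tensorComp (tensorObj F G P) (tensorObj F G Q) (tensorObj F G R)
        (tensorMap F G P Q f) (tensorMap F G Q R g) := by
  induction f using TensorProduct.induction_on with
  | zero => simp
  | add a b ha hb => simp only [map_add, LinearMap.add_apply, ha, hb]
  | tmul a b =>
    induction g using TensorProduct.induction_on with
    | zero => simp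
    | add a b ha hb => simp only [map_add, ha, hb]
    | tmul a' b' =>
      rw [tensorComp_tmul, map_add, tensorMap_tmul, tensorMap_tmul, tensorMap_tmul,
        tensorMap_tmul]
      refine Eq.trans ?_ (tensorComp_tmul (tensorObj F G P) (tensorObj F G Q) (tensorObj F G R)
        (F.toFunctor.map a) (G.toFunctor.map b) (F.toFunctor.map a') (G.toFunctor.map b')).symm
      rw [← F.map_par, ← G.map_ev, ← G.map_od, ← CategoryTheory.Functor.map_comp,
        ← CategoryTheory.Functor.map_comp, ← CategoryTheory.Functor.map_comp,
        ← CategoryTheory.Functor.map_comp]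

lemma tensorMap_mem {P Q : TensorObj A B} {i : ZMod 2}
    {f : (P.fst ⟶ Q.fst) ⊗[K] (P.snd ⟶ Q.snd)} (hf : f ∈ tensorDeg P Q i) :
    tensorMap F G P Q f ∈ tensorDeg (tensorObj F G P) (tensorObj F G Q) i := by
  refine (Submodule.span_le (p := (tensorDeg (tensorObj F G P) (tensorObj F G Q) i).comap
    (tensorMap F G P Q))).2 ?_ hf
  rintro _ ⟨k, l, rfl, a, ha, b, hb, rfl⟩
  exact tmul_mem_tensorDeg (F.map_mem ha) (G.map_mem hb)

/-- The graded functor `F ⊗ G : A ⊗ B → A' ⊗ B'`. -/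
def GradedFunctor.tensor : GradedFunctor (A.tensor B) (A'.tensor B') where
  toFunctor :=
    { obj := tensorObj F G
      map := fun {P Q} => tensorMap F G P Q
      map_id := fun P => tensorMap_id F G P
      map_comp := fun f g => tensorMap_comp F G f g }
  additive := ⟨fun {P Q f g} => map_add (tensorMap F G P Q) f g⟩
  linear := ⟨fun {P Q} f r => map_smul (tensorMap F G P Q) r f⟩
  map_mem hf := tensorMap_mem F G hf

end TensorFunctor

end SuperCat

end

noncomputable section

namespace SuperCat

variable {K : Type w} [Field K]

/-! ## The total morphism space and its tensor powers -/

section Tot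

variable (A : SuperCat.{w, u, v} K)

/-- The space `⊕_{X, Y} A(X, Y)` of all morphisms of `A`. -/
def Tot : Type (max u v) := ⨁ p : A.Obj × A.Obj, (p.1 ⟶ p.2)

instance : AddCommGroup A.Tot := inferInstanceAs (AddCommGroup (⨁ p : A.Obj × A.Obj, (p.1 ⟶ p.2)))

instance : Module K A.Tot := inferInstanceAs (Module K (⨁ p : A.Obj × A.Obj, (p.1 ⟶ p.2)))

variable {A} in
open Classical in
/-- A morphism, viewed as an element of the total morphism space. -/
def inc {X Y : A.Obj} : (X ⟶ Y) →ₗ[K] A.Tot :=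
  DirectSum.lof K (A.Obj × A.Obj) (fun p => (p.1 ⟶ p.2)) (X, Y)

variable {A} in
open Classical in
/-- The linear map out of the total morphism space with given restrictions to the `A(X, Y)`. -/
def totLift {E : Type*} [AddCommMonoid E] [Module K E] (φ : ∀ X Y : A.Obj, (X ⟶ Y) →ₗ[K] E) :
    A.Tot →ₗ[K] E :=
  DirectSum.toModule K (A.Obj × A.Obj) E (fun p => φ p.1 p.2)

@[simp] lemma totLift_inc {E : Type*} [AddCommMonoid E] [Module K E]
    (φ : ∀ X Y : A.Obj, (X ⟶ Y) →ₗ[K] E) {X Y : A.Obj} (f : X ⟶ Y) :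
    totLift φ (inc f) = φ X Y f := by
  classical
  exact DirectSum.toModule_lof (M := fun p : A.Obj × A.Obj => (p.1 ⟶ p.2))
    (φ := fun p => φ p.1 p.2) K (X, Y) f

variable {A} in
lemma tot_ext {E : Type*} [AddCommMonoid E] [Module K E] {φ ψ : A.Tot →ₗ[K] E}
    (h : ∀ (X Y : A.Obj) (f : X ⟶ Y), φ (inc f) = ψ (inc f)) : φ = ψ := by
  classical
  refine DirectSum.linearMap_ext K (fun p => LinearMap.ext fun f => ?_)
  exact h p.1 p.2 f

/-- The even component on the total morphism space. -/
def totEv : A.Tot →ₗ[K] A.Tot := totLift fun X Y => inc ∘ₗ A.ev X Y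

/-- The odd component on the total morphism space. -/
def totOd : A.Tot →ₗ[K] A.Tot := totLift fun X Y => inc ∘ₗ A.od X Y

/-- The parity operator on the total morphism space. -/
def totPar : A.Tot →ₗ[K] A.Tot := totLift fun X Y => inc ∘ₗ A.par X Y

open Classical in
/-- The product on the total morphism space: composition (first `f`, then `g`) of composable
morphisms, and zero for non-composable ones. -/
def totMul : A.Tot →ₗ[K] A.Tot →ₗ[K] A.Tot :=
  totLift fun X Y => LinearMap.flip <| totLift fun Y' Z =>
    if h : Y = Y' then
      (((Linear.comp X Y Z).compl₂ (Linear.leftComp K Z (eqToHom h))).compr₂ inc).flip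
    else 0

lemma totMul_comp {X Y Z : A.Obj} (f : X ⟶ Y) (g : Y ⟶ Z) :
    A.totMul (inc f) (inc g) = inc (f ≫ g) := by
  simp [totMul]

lemma totMul_ne {X Y Y' Z : A.Obj} (h : Y ≠ Y') (f : X ⟶ Y) (g : Y' ⟶ Z) :
    A.totMul (inc f) (inc g) = 0 := by
  simp [totMul, h]

lemma totMul_assoc (x y z : A.Tot) :
    A.totMul (A.totMul x y) z = A.totMul x (A.totMul y z) := by
  have h : A.totMul.compr₂ A.totMul =
      (LinearMap.llcomp K A.Tot A.Tot A.Tot ∘ₗ A.totMul).compl₂ A.totMul := by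
    refine tot_ext fun X Y f => tot_ext fun Y' Z g => tot_ext fun Z' W k => ?_
    simp only [LinearMap.compr₂_apply, LinearMap.compl₂_apply, LinearMap.comp_apply,
      LinearMap.llcomp_apply]
    by_cases h1 : Y = Y'
    · subst h1
      by_cases h2 : Z = Z'
      · subst h2
        simp [totMul_comp]
      · rw [totMul_comp, totMul_ne _ h2, totMul_ne _ h2, map_zero]
    · rw [totMul_ne _ h1, map_zero, LinearMap.zero_apply]
      by_cases h2 : Z = Z'
      · subst h2
        rw [totMul_comp, totMul_ne _ h1]
      · rw [totMul_ne _ h2, map_zero]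
  exact LinearMap.congr_fun (LinearMap.congr_fun (LinearMap.congr_fun h x) y) z

lemma totPar_eq (x : A.Tot) : A.totPar x = A.totEv x - A.totOd x := by
  have h : A.totPar = A.totEv - A.totOd := by
    refine tot_ext fun X Y f => ?_
    simp [totPar, totEv, totOd, par]
  rw [h]; rfl

lemma totEv_mul (x y : A.Tot) : A.totEv (A.totMul x y) =
    A.totMul (A.totEv x) (A.totEv y) + A.totMul (A.totOd x) (A.totOd y) := by
  have h : A.totMul.compr₂ A.totEv = (A.totMul ∘ₗ A.totEv).compl₂ A.totEv +
      (A.totMul ∘ₗ A.totOd).compl₂ A.totOd := by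
    refine tot_ext fun X Y f => tot_ext fun Y' Z g => ?_
    by_cases h1 : Y = Y'
    · subst h1
      simp [totMul_comp, totEv, totOd, ev_comp]
    · simp [totMul_ne _ h1, totEv, totOd]
  exact LinearMap.congr_fun (LinearMap.congr_fun h x) y

lemma totOd_mul (x y : A.Tot) : A.totOd (A.totMul x y) =
    A.totMul (A.totEv x) (A.totOd y) + A.totMul (A.totOd x) (A.totEv y) := by
  have h : A.totMul.compr₂ A.totOd = (A.totMul ∘ₗ A.totEv).compl₂ A.totOd +
      (A.totMul ∘ₗ A.totOd).compl₂ A.totEv := by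
    refine tot_ext fun X Y f => tot_ext fun Y' Z g => ?_
    by_cases h1 : Y = Y'
    · subst h1
      simp [totMul_comp, totEv, totOd, od_comp]
    · simp [totMul_ne _ h1, totEv, totOd]
  exact LinearMap.congr_fun (LinearMap.congr_fun h x) y

/-- The `(n+1)`-st tensor power of the total morphism space. -/
abbrev Ten (n : ℕ) : Type (max u v w) := ⨂[K] _ : Fin (n + 1), A.Tot

/-- Cyclic rotation `(a₀, …, aₙ) ↦ (aₙ, a₀, …, aₙ₋₁)`. -/
def rot {α : Type*} {n : ℕ} (a : Fin (n + 1) → α) : Fin (n + 1) → α := fun i => a (i - 1)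

/-- The rotation with its Koszul sign,
`τ(a₀ ⊗ ⋯ ⊗ aₙ) = (-1)^(|aₙ|(|a₀| + ⋯ + |aₙ₋₁|)) aₙ ⊗ a₀ ⊗ ⋯ ⊗ aₙ₋₁`, written as a sum over the
even and the odd component of `aₙ`. -/
def tau (n : ℕ) : A.Ten n →ₗ[K] A.Ten n :=
  (PiTensorProduct.reindex K (fun _ => A.Tot) (Equiv.addRight (1 : Fin (n + 1)))).toLinearMap ∘ₗ
    (PiTensorProduct.map (fun i => if i = Fin.last n then A.totEv else LinearMap.id) +
      PiTensorProduct.map (fun i => if i = Fin.last n then A.totOd else A.totPar))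

lemma tau_tprod {n : ℕ} (a : Fin (n + 1) → A.Tot) : A.tau n (PiTensorProduct.tprod K a) =
    PiTensorProduct.tprod K (rot fun i => if i = Fin.last n then A.totEv (a i) else a i) +
    PiTensorProduct.tprod K
      (rot fun i => if i = Fin.last n then A.totOd (a i) else A.totPar (a i)) := by
  simp only [tau, LinearMap.comp_apply, LinearMap.add_apply, PiTensorProduct.map_tprod, map_add,
    LinearEquiv.coe_coe]
  erw [PiTensorProduct.reindex_tprod, PiTensorProduct.reindex_tprod]
  congr 2 <;> funext i <;> simp only [rot, Equiv.addRight_symm, Equiv.coe_addRight,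
    ← sub_eq_add_neg] <;> split_ifs <;> rfl

lemma contractNth_update {n : ℕ} (j : Fin (n + 1)) (a : Fin (n + 2) → A.Tot) (i : Fin (n + 2)) :
    ∃ (k : Fin (n + 1)) (L : A.Tot →ₗ[K] A.Tot), ∀ x,
      Fin.contractNth j.castSucc (fun x y => A.totMul x y) (Function.update a i x) =
        Function.update (Fin.contractNth j.castSucc (fun x y => A.totMul x y) a) k (L x) := by
  have hj := j.2
  have hi := i.2
  rcases lt_trichotomy (i : ℕ) (j : ℕ) with h | h | h
  · refine ⟨⟨i, by omega⟩, LinearMap.id, fun x => ?_⟩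
    funext l
    simp only [Fin.contractNth, Function.update_apply, Fin.ext_iff, Fin.val_castSucc, Fin.val_succ,
      LinearMap.id_apply]
    split_ifs <;> first | rfl | omega
  · refine ⟨j, A.totMul.flip (a j.succ), fun x => ?_⟩
    funext l
    simp only [Fin.contractNth, Function.update_apply, Fin.ext_iff, Fin.val_castSucc, Fin.val_succ,
      LinearMap.flip_apply]
    split_ifs <;> first | rfl | omega | skip
    have : l = j := Fin.ext (by omega)
    rw [this]
  · by_cases h' : (i : ℕ) = j + 1
    · refine ⟨j, A.totMul (a j.castSucc), fun x => ?_⟩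
      funext l
      simp only [Fin.contractNth, Function.update_apply, Fin.ext_iff, Fin.val_castSucc,
        Fin.val_succ]
      split_ifs <;> first | rfl | omega | skip
      have : l = j := Fin.ext (by omega)
      rw [this]
    · refine ⟨⟨i - 1, by omega⟩, LinearMap.id, fun x => ?_⟩
      funext l
      simp only [Fin.contractNth, Function.update_apply, Fin.ext_iff, Fin.val_castSucc,
        Fin.val_succ, LinearMap.id_apply]
      split_ifs <;> first | rfl | omega

/-- `dᵢ(a₀ ⊗ ⋯ ⊗ aₙ₊₁) = a₀ ⊗ ⋯ ⊗ aᵢaᵢ₊₁ ⊗ ⋯ ⊗ aₙ₊₁` for `0 ≤ i ≤ n`. -/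
def innerFace (n : ℕ) (j : Fin (n + 1)) : A.Ten (n + 1) →ₗ[K] A.Ten n :=
  PiTensorProduct.lift (MultilinearMap.mk'
    (fun a => PiTensorProduct.tprod K (Fin.contractNth j.castSucc (fun x y => A.totMul x y) a))
    (fun a i x y => by
      obtain ⟨k, L, h⟩ := A.contractNth_update j a i
      simp only [h, map_add, MultilinearMap.map_update_add])
    (fun a i c x => by
      obtain ⟨k, L, h⟩ := A.contractNth_update j a i
      simp only [h, map_smul, MultilinearMap.map_update_smul]))

@[simp] lemma innerFace_tprod {n : ℕ} (j : Fin (n + 1)) (a : Fin (n + 2) → A.Tot) :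
    A.innerFace n j (PiTensorProduct.tprod K a) =
      PiTensorProduct.tprod K (Fin.contractNth j.castSucc (fun x y => A.totMul x y) a) := by
  simp [innerFace]

/-- The last face
`dₙ₊₁(a₀ ⊗ ⋯ ⊗ aₙ₊₁) = (-1)^(|aₙ₊₁|(|a₀| + ⋯ + |aₙ|)) aₙ₊₁a₀ ⊗ a₁ ⊗ ⋯ ⊗ aₙ`. -/
def lastFace (n : ℕ) : A.Ten (n + 1) →ₗ[K] A.Ten n := A.innerFace n 0 ∘ₗ A.tau (n + 1)

/-- The faces `dᵢ`, `0 ≤ i ≤ n + 1`. -/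
def face (n : ℕ) (i : Fin (n + 2)) : A.Ten (n + 1) →ₗ[K] A.Ten n :=
  Fin.lastCases (A.lastFace n) (A.innerFace n) i

/-- The extra degeneracy `s(a₀ ⊗ ⋯ ⊗ aₙ) = 1_X ⊗ a₀ ⊗ ⋯ ⊗ aₙ`, where `X` is the source
of `a₀`. -/
def extra (n : ℕ) : A.Ten n →ₗ[K] A.Ten (n + 1) :=
  PiTensorProduct.lift <| LinearMap.uncurryLeft <| totLift fun X _ =>
    ((PiTensorProduct.tprod K (s := fun _ : Fin (n + 2) => A.Tot)).curryLeft
      (inc (𝟙 X))).curryLeft ∘ₗ inc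

lemma extra_tprod {n : ℕ} {a : Fin (n + 1) → A.Tot} {X Y : A.Obj} {f : X ⟶ Y}
    (h : a 0 = inc f) : A.extra n (PiTensorProduct.tprod K a) =
      PiTensorProduct.tprod K (Fin.cons (inc (𝟙 X)) a : Fin (n + 2) → A.Tot) := by
  rw [extra, PiTensorProduct.lift.tprod, LinearMap.uncurryLeft_apply, h, totLift_inc]
  simp only [LinearMap.comp_apply, MultilinearMap.curryLeft_apply]
  congr 1
  rw [← h]
  congr 1
  exact Fin.cons_self_tail a

end Tot

end SuperCat

end

noncomputable section

namespace SuperCat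

variable {K : Type w} [Field K]

/-! ## The cyclic identities -/

section Identities

variable (A : SuperCat.{w, u, v} K)

/-- `x` is homogeneous of parity `s`, where `1` stands for even and `-1` for odd. -/
def IsHomog (x : A.Tot) (s : ℤˣ) : Prop :=
  (s = 1 ∧ A.totEv x = x ∧ A.totOd x = 0) ∨ (s = -1 ∧ A.totEv x = 0 ∧ A.totOd x = x)

variable {A}

lemma IsHomog.par {x : A.Tot} {s : ℤˣ} (h : A.IsHomog x s) :
    A.totPar x = ((s : ℤ) : K) • x := by
  rw [totPar_eq]
  rcases h with ⟨rfl, h1, h2⟩ | ⟨rfl, h1, h2⟩ <;> simp [h1, h2]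

lemma IsHomog.mul {x y : A.Tot} {s t : ℤˣ} (hx : A.IsHomog x s) (hy : A.IsHomog y t) :
    A.IsHomog (A.totMul x y) (s * t) := by
  rcases hx with ⟨rfl, h1, h2⟩ | ⟨rfl, h1, h2⟩ <;> rcases hy with ⟨rfl, h3, h4⟩ | ⟨rfl, h3, h4⟩ <;>
    simp [IsHomog, totEv_mul, totOd_mul, h1, h2, h3, h4]

variable (A) in
/-- The homogeneous morphisms of `A`. -/
structure Gen where
  src : A.Obj
  tgt : A.Obj
  hom : src ⟶ tgt
  sgn : ℤˣ
  mem : (sgn = 1 ∧ hom ∈ A.deg src tgt 0) ∨ (sgn = -1 ∧ hom ∈ A.deg src tgt 1)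

/-- A homogeneous morphism as an element of the total morphism space. -/
def Gen.elt (g : A.Gen) : A.Tot := inc g.hom

lemma Gen.isHomog (g : A.Gen) : A.IsHomog g.elt g.sgn := by
  rcases g.mem with ⟨h, h'⟩ | ⟨h, h'⟩
  · left; simp [elt, totEv, totOd, h, ev_of_even h', od_of_even h']
  · right; simp [elt, totEv, totOd, h, ev_of_odd h', od_of_odd h']

lemma span_gen : Submodule.span K (Set.range (Gen.elt (A := A))) = ⊤ := by
  rw [← (Submodule.span K _).ker_mkQ, LinearMap.ker_eq_top]
  refine tot_ext fun X Y f => ?_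
  rw [LinearMap.zero_apply, Submodule.mkQ_apply, Submodule.Quotient.mk_eq_zero, ← ev_add_od f,
    map_add]
  refine add_mem (Submodule.subset_span ⟨⟨X, Y, A.ev X Y f, 1, Or.inl ⟨rfl, ev_mem f⟩⟩, rfl⟩)
    (Submodule.subset_span ⟨⟨X, Y, A.od X Y f, -1, Or.inr ⟨rfl, od_mem f⟩⟩, rfl⟩)

lemma ten_ext {n : ℕ} {E : Type*} [AddCommMonoid E] [Module K E] {φ ψ : A.Ten n →ₗ[K] E}
    (h : ∀ g : Fin (n + 1) → A.Gen, φ (PiTensorProduct.tprod K fun i => (g i).elt) =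
      ψ (PiTensorProduct.tprod K fun i => (g i).elt)) : φ = ψ :=
  PiTensorProduct.ext_of_span_eq_top (γ := fun _ => A.Gen) (g := fun _ => Gen.elt)
    (fun _ => span_gen) h

/-- The Koszul sign of the rotation of a homogeneous tensor. -/
def kos {n : ℕ} (s : Fin (n + 1) → ℤˣ) : ℤˣ := if s (Fin.last n) = 1 then 1 else -∏ i, s i

lemma tau_homog {n : ℕ} {a : Fin (n + 1) → A.Tot} {s : Fin (n + 1) → ℤˣ}
    (h : ∀ i, A.IsHomog (a i) (s i)) : A.tau n (PiTensorProduct.tprod K a) =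
      ((kos s : ℤ) : K) • PiTensorProduct.tprod K (rot a) := by
  have hz : ∀ b : Fin (n + 1) → A.Tot, b (Fin.last n) = 0 →
      PiTensorProduct.tprod K (rot b) = 0 := by
    intro b hb
    refine MultilinearMap.map_coord_zero _ (Fin.last n + 1) ?_
    change b (Fin.last n + 1 - 1) = 0
    rw [add_sub_cancel_right, hb]
  rw [tau_tprod]
  rcases h (Fin.last n) with ⟨h0, h1, h2⟩ | ⟨h0, h1, h2⟩
  · rw [hz (fun i => if i = Fin.last n then A.totOd (a i) else A.totPar (a i)) (by simp [h2])]
    have : (fun i => if i = Fin.last n then A.totEv (a i) else a i) = a := by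
      funext i; split_ifs with hi
      · rw [hi, h1]
      · rfl
    rw [this]
    simp [kos, h0]
  · rw [hz (fun i => if i = Fin.last n then A.totEv (a i) else a i) (by simp [h1]), zero_add]
    have h3 : (rot fun i => if i = Fin.last n then A.totOd (a i) else A.totPar (a i)) =
        fun i => rot (fun i => if i = Fin.last n then (1 : K) else ((s i : ℤ) : K)) i •
          rot a i := by
      funext i
      simp only [rot]
      split_ifs with hi
      · rw [hi, h2, one_smul]
      · rw [(h _).par]
    rw [h3, MultilinearMap.map_smul_univ]
    congr 1
    have h4 : ∏ i, rot (fun i => if i = Fin.last n then (1 : K) else ((s i : ℤ) : K)) i =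
        ∏ i, (if i = Fin.last n then (1 : K) else ((s i : ℤ) : K)) :=
      Equiv.prod_comp (Equiv.subRight (1 : Fin (n + 1)))
        (fun i => if i = Fin.last n then (1 : K) else ((s i : ℤ) : K))
    rw [h4, kos, h0, if_neg (by decide), Fin.prod_univ_castSucc, Fin.prod_univ_castSucc, h0]
    simp [Fin.castSucc_ne_last]

lemma prod_rot {n : ℕ} (s : Fin (n + 1) → ℤˣ) : ∏ i, rot s i = ∏ i, s i :=
  Equiv.prod_comp (Equiv.subRight (1 : Fin (n + 1))) _

lemma rot_iterate {α : Type*} {n : ℕ} (a : Fin (n + 1) → α) (k : ℕ) :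
    rot^[k] a = fun i => a (i - k • (1 : Fin (n + 1))) := by
  induction k with
  | zero => simp
  | succ k ih =>
    rw [Function.iterate_succ_apply', ih]
    funext i
    simp only [rot, succ_nsmul]
    congr 1
    abel

lemma tau_iterate {n : ℕ} {a : Fin (n + 1) → A.Tot} {s : Fin (n + 1) → ℤˣ}
    (h : ∀ i, A.IsHomog (a i) (s i)) (k : ℕ) :
    (A.tau n ^ k) (PiTensorProduct.tprod K a) =
      (((∏ j ∈ Finset.range k, kos (rot^[j] s) : ℤˣ) : ℤ) : K) •
        PiTensorProduct.tprod K (rot^[k] a) := by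
  induction k with
  | zero => simp
  | succ k ih =>
    have h' : ∀ i, A.IsHomog ((rot^[k] a) i) ((rot^[k] s) i) := by
      intro i; simp only [rot_iterate]; exact h _
    rw [pow_succ', Module.End.mul_apply, ih, map_smul, tau_homog h', smul_smul,
      Function.iterate_succ_apply', Finset.prod_range_succ]
    push_cast
    rfl

lemma prod_kos {n : ℕ} (s : Fin (n + 1) → ℤˣ) :
    ∏ j ∈ Finset.range (n + 1), kos (rot^[j] s) = 1 := by
  have h1 : ∀ j : ℕ, ∏ i, (rot^[j] s) i = ∏ i, s i := by
    intro j
    induction j with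
    | zero => rfl
    | succ j ih => rw [Function.iterate_succ_apply', prod_rot, ih]
  have h2 : ∀ j : ℕ, kos (rot^[j] s) =
      if s (Fin.last n - j • (1 : Fin (n + 1))) = 1 then 1 else -∏ i, s i := by
    intro j
    rw [kos, h1, rot_iterate]
  simp only [h2]
  rw [Finset.prod_range]
  have h3 : ∀ j : Fin (n + 1), (j : ℕ) • (1 : Fin (n + 1)) = j := by
    intro j
    open Fin.CommRing in
    rw [nsmul_one, Fin.cast_val_eq_self]
  simp only [h3]
  refine (Equiv.prod_comp (Equiv.subLeft (Fin.last n))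
    (fun i => if s i = 1 then (1 : ℤˣ) else -∏ i, s i)).trans ?_
  rcases Int.units_eq_one_or (∏ i, s i) with h | h
  · rw [h]
    rw [← h]
    refine Finset.prod_congr rfl fun i _ => ?_
    rcases Int.units_eq_one_or (s i) with h' | h' <;> simp [h', h]
  · rw [h]
    simp

lemma tau_pow (n : ℕ) : A.tau n ^ (n + 1) = 1 := by
  refine ten_ext fun g => ?_
  rw [tau_iterate (fun i => (g i).isHomog), prod_kos, rot_iterate]
  have : (n + 1) • (1 : Fin (n + 1)) = 0 := by
    open Fin.CommRing in
    rw [nsmul_one]; simp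
  simp [this]

lemma prod_contractNth {M : Type*} [CommMonoid M] {n : ℕ} (j : Fin (n + 1)) (s : Fin (n + 2) → M) :
    ∏ i, Fin.contractNth j.castSucc (· * ·) s i = ∏ i, s i := by
  have h := congrFun (Fin.partialProd_contractNth s j.castSucc) (Fin.last _)
  simp only [Function.comp_apply] at h
  have h' : ∀ (m : ℕ) (f : Fin m → M), Fin.partialProd f (Fin.last m) = ∏ i, f i := by
    intro m f
    rw [Fin.partialProd, ← List.prod_ofFn]
    congr 1
    rw [List.take_of_length_le]
    simp
  rw [h'] at h
  rw [h, ← h']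
  congr 1
  rw [Fin.succAbove_of_le_castSucc, Fin.succ_last]
  simp [Fin.le_def]
  omega

lemma contractNth_homog {n : ℕ} (j : Fin (n + 1)) {a : Fin (n + 2) → A.Tot}
    {s : Fin (n + 2) → ℤˣ} (h : ∀ i, A.IsHomog (a i) (s i)) (i : Fin (n + 1)) :
    A.IsHomog (Fin.contractNth j.castSucc (fun x y => A.totMul x y) a i)
      (Fin.contractNth j.castSucc (· * ·) s i) := by
  simp only [Fin.contractNth]
  split_ifs
  · exact h _
  · exact (h _).mul (h _)
  · exact h _

lemma rot_zero {α : Type*} {n : ℕ} (a : Fin (n + 1) → α) : rot a 0 = a (Fin.last n) := by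
  rw [rot]
  congr 1
  rw [sub_eq_iff_eq_add, Fin.last_add_one]

lemma rot_succ {α : Type*} {n : ℕ} (a : Fin (n + 2) → α) (i : Fin (n + 1)) :
    rot a i.succ = a i.castSucc := by
  rw [rot]
  congr 1
  rw [sub_eq_iff_eq_add, Fin.coeSucc_eq_succ]

lemma rot_last {α : Type*} {n : ℕ} (a : Fin (n + 2) → α) :
    rot a (Fin.last (n + 1)) = a (Fin.last n).castSucc := by
  rw [← Fin.succ_last, rot_succ]

lemma contractNth_rot {α : Type*} (op : α → α → α) {n : ℕ} (j : Fin (n + 1))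
    (a : Fin (n + 3) → α) :
    Fin.contractNth j.succ.castSucc op (rot a) =
      rot (Fin.contractNth j.castSucc.castSucc op a) := by
  funext i
  have hj := j.2
  cases i using Fin.cases with
  | zero =>
    rw [rot_zero, Fin.contractNth_apply_of_lt _ _ _ _ (by simp),
      Fin.contractNth_apply_of_gt _ _ _ _ (by simpa using hj), Fin.castSucc_zero, rot_zero,
      Fin.succ_last]
  | succ i =>
    rw [rot_succ, ← Fin.succ_castSucc j]
    simp only [Fin.contractNth, Fin.val_castSucc, Fin.val_succ, ← Fin.succ_castSucc, rot_succ,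
      add_lt_add_iff_right, add_left_inj]

lemma contractNth_rot_rot {α : Type*} (op : α → α → α) {n : ℕ} (a : Fin (n + 2) → α) :
    Fin.contractNth (0 : Fin (n + 1)).castSucc op (rot (rot a)) =
      rot (Fin.contractNth (Fin.last n).castSucc op a) := by
  funext i
  cases i using Fin.cases with
  | zero =>
    rw [rot_zero, Fin.contractNth_apply_of_eq _ _ _ _ (by simp),
      Fin.contractNth_apply_of_eq _ _ _ _ (by simp), Fin.castSucc_zero, rot_zero, rot_last,
      rot_succ, Fin.castSucc_zero, rot_zero, Fin.succ_last]
  | succ i =>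
    cases n with
    | zero => exact i.elim0
    | succ n =>
      rw [rot_succ, Fin.contractNth_apply_of_gt _ _ _ _ (by simp),
        Fin.contractNth_apply_of_lt _ _ _ _ (by have := i.2; simp; omega), rot_succ,
        ← Fin.succ_castSucc, rot_succ]

lemma contractNth_contractNth {α : Type*} (op : α → α → α)
    (hop : ∀ x y z, op (op x y) z = op x (op y z)) {n : ℕ} {i j : Fin (n + 1)} (hij : i ≤ j)
    (a : Fin (n + 3) → α) :
    Fin.contractNth i.castSucc op (Fin.contractNth j.succ.castSucc op a) =
      Fin.contractNth j.castSucc op (Fin.contractNth i.castSucc.castSucc op a) := by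
  funext k
  have hij' : (i : ℕ) ≤ j := hij
  simp only [Fin.contractNth, Fin.val_castSucc, Fin.val_succ]
  split_ifs <;> first | rfl | omega | exact hop _ _ _ | exact (hop _ _ _).symm

lemma innerFace_tau (n : ℕ) (j : Fin (n + 1)) :
    A.innerFace (n + 1) j.succ ∘ₗ A.tau (n + 2) =
      A.tau (n + 1) ∘ₗ A.innerFace (n + 1) j.castSucc := by
  refine ten_ext fun g => ?_
  have hj := j.2
  have hg := fun i => (g i).isHomog
  rw [LinearMap.comp_apply, LinearMap.comp_apply, tau_homog hg, map_smul, innerFace_tprod,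
    innerFace_tprod, tau_homog (contractNth_homog j.castSucc hg), contractNth_rot]
  congr 3
  rw [kos, kos, prod_contractNth, Fin.contractNth_apply_of_gt _ _ _ _ (by simpa using hj),
    Fin.succ_last]

lemma innerFace_tau_tau (n : ℕ) :
    A.innerFace n 0 ∘ₗ A.tau (n + 1) ∘ₗ A.tau (n + 1) =
      A.tau n ∘ₗ A.innerFace n (Fin.last n) := by
  refine ten_ext fun g => ?_
  have hg := fun i => (g i).isHomog
  have hg' : ∀ i, A.IsHomog (rot (fun i => (g i).elt) i) (rot (fun i => (g i).sgn) i) :=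
    fun i => hg _
  rw [LinearMap.comp_apply, LinearMap.comp_apply, LinearMap.comp_apply, tau_homog hg, map_smul,
    tau_homog hg', map_smul, map_smul, innerFace_tprod,
    innerFace_tprod, tau_homog (contractNth_homog (Fin.last n) hg), contractNth_rot_rot, smul_smul]
  congr 1
  rw [← Int.cast_mul, ← Units.val_mul]
  congr 2
  rw [kos, kos, kos, prod_contractNth, prod_rot, rot_last,
    Fin.contractNth_apply_of_eq _ _ _ _ (by simp), Fin.succ_last]
  rcases Int.units_eq_one_or (g (Fin.last (n + 1))).sgn with h1 | h1 <;>
  rcases Int.units_eq_one_or (g (Fin.last n).castSucc).sgn with h2 | h2 <;>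
    simp [h1, h2]

lemma innerFace_innerFace (n : ℕ) {i j : Fin (n + 1)} (hij : i ≤ j) :
    A.innerFace n i ∘ₗ A.innerFace (n + 1) j.succ =
      A.innerFace n j ∘ₗ A.innerFace (n + 1) i.castSucc := by
  refine ten_ext fun g => ?_
  rw [LinearMap.comp_apply, LinearMap.comp_apply, innerFace_tprod, innerFace_tprod,
    innerFace_tprod, innerFace_tprod,
    contractNth_contractNth _ (fun x y z => A.totMul_assoc x y z) hij]

lemma innerFace_zero_extra (n : ℕ) : A.innerFace n 0 ∘ₗ A.extra n = LinearMap.id := by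
  refine ten_ext fun g => ?_
  rw [LinearMap.comp_apply, A.extra_tprod (a := fun i => (g i).elt) (f := (g 0).hom) rfl, innerFace_tprod,
    LinearMap.id_apply]
  congr 1
  funext i
  cases i using Fin.cases with
  | zero =>
    rw [Fin.contractNth_apply_of_eq _ _ _ _ (by simp), Fin.castSucc_zero, Fin.cons_zero,
      Fin.cons_succ, Gen.elt, totMul_comp, Category.id_comp]
  | succ i =>
    rw [Fin.contractNth_apply_of_gt _ _ _ _ (by simp), Fin.cons_succ]

lemma contractNth_cons {α : Type*} (op : α → α → α) {n : ℕ} (j : Fin (n + 1)) (x : α)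
    (a : Fin (n + 2) → α) :
    Fin.contractNth j.succ.castSucc op (Fin.cons x a : Fin (n + 3) → α) =
      Fin.cons x (Fin.contractNth j.castSucc op a) := by
  funext i
  cases i using Fin.cases with
  | zero =>
    rw [Fin.contractNth_apply_of_lt _ _ _ _ (by simp), Fin.castSucc_zero, Fin.cons_zero,
      Fin.cons_zero]
  | succ i =>
    simp only [Fin.contractNth, Fin.val_castSucc, Fin.val_succ, ← Fin.succ_castSucc, Fin.cons_succ,
      add_lt_add_iff_right, add_left_inj]

lemma innerFace_extra (n : ℕ) (j : Fin (n + 1)) :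
    A.innerFace (n + 1) j.succ ∘ₗ A.extra (n + 1) = A.extra n ∘ₗ A.innerFace n j := by
  refine ten_ext fun g => ?_
  rw [LinearMap.comp_apply, LinearMap.comp_apply, A.extra_tprod (a := fun i => (g i).elt) (f := (g 0).hom) rfl,
    innerFace_tprod, innerFace_tprod, contractNth_cons]
  have h : ∃ (Y : A.Obj) (f : (g 0).src ⟶ Y),
      Fin.contractNth j.castSucc (fun x y => A.totMul x y) (fun i => (g i).elt) 0 = inc f := by
    rcases Nat.eq_zero_or_pos (j : ℕ) with h0 | h0
    · rw [Fin.contractNth_apply_of_eq _ _ _ _ (by simp [h0]), Fin.castSucc_zero]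
      by_cases hc : (g 0).tgt = (g (Fin.succ 0)).src
      · refine ⟨_, (g 0).hom ≫ eqToHom hc ≫ (g (Fin.succ 0)).hom, ?_⟩
        generalize g (Fin.succ 0) = g1 at hc
        generalize g 0 = g0 at hc
        obtain ⟨X, Y, f, _, _⟩ := g0
        obtain ⟨Y', Z, f', _, _⟩ := g1
        dsimp only at hc
        subst hc
        simp [Gen.elt, totMul_comp]
      · exact ⟨(g 0).src, 0, by rw [Gen.elt, Gen.elt, totMul_ne _ hc, map_zero]⟩
    · rw [Fin.contractNth_apply_of_lt _ _ _ _ (by simpa using h0)]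
      exact ⟨_, (g 0).hom, rfl⟩
  obtain ⟨Y, f, hf⟩ := h
  rw [A.extra_tprod hf]

end Identities

end SuperCat

end

noncomputable section

namespace SuperCat

variable {K : Type w} [Field K]

/-! ## The Hochschild boundary and the operator `B` -/

section Mixed

variable (A : SuperCat.{w, u, v} K)

/-- The Hochschild boundary `∂ = ∑_{i=0}^{n+1} (-1)^i dᵢ`. -/
def bd (n : ℕ) : A.Ten (n + 1) →ₗ[K] A.Ten n :=
  ∑ i : Fin (n + 2), (-1 : K) ^ (i : ℕ) • A.face n i

/-- The truncated boundary `∑_{i=0}^{n} (-1)^i dᵢ`. -/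
def bdPrime (n : ℕ) : A.Ten (n + 1) →ₗ[K] A.Ten n :=
  ∑ i : Fin (n + 1), (-1 : K) ^ (i : ℕ) • A.innerFace n i

/-- The signed cyclic operator
`t(a₀ ⊗ ⋯ ⊗ aₙ) = (-1)^(n + |aₙ|(|a₀| + ⋯ + |aₙ₋₁|)) aₙ ⊗ a₀ ⊗ ⋯ ⊗ aₙ₋₁`. -/
def cyc (n : ℕ) : A.Ten n →ₗ[K] A.Ten n := (-1 : K) ^ n • A.tau n

/-- The norm operator `N = 1 + t + ⋯ + tⁿ`. -/
def nrm (n : ℕ) : A.Ten n →ₗ[K] A.Ten n := ∑ k ∈ Finset.range (n + 1), A.cyc n ^ k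

/-- The operator `B = (1 - t) s N`. -/
def connes (n : ℕ) : A.Ten n →ₗ[K] A.Ten (n + 1) :=
  (LinearMap.id - A.cyc (n + 1)) ∘ₗ A.extra n ∘ₗ A.nrm n

variable {A}

lemma sum_comp' {ι E F G : Type*} [AddCommMonoid E] [Module K E] [AddCommMonoid F] [Module K F]
    [AddCommMonoid G] [Module K G] (s : Finset ι) (f : ι → F →ₗ[K] G) (g : E →ₗ[K] F) :
    (∑ i ∈ s, f i) ∘ₗ g = ∑ i ∈ s, f i ∘ₗ g := by
  ext x
  simp

lemma comp_sum' {ι E F G : Type*} [AddCommMonoid E] [Module K E] [AddCommMonoid F] [Module K F]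
    [AddCommMonoid G] [Module K G] (s : Finset ι) (f : ι → E →ₗ[K] F) (g : F →ₗ[K] G) :
    g ∘ₗ (∑ i ∈ s, f i) = ∑ i ∈ s, g ∘ₗ f i := by
  ext x
  simp

lemma face_castSucc (n : ℕ) (i : Fin (n + 1)) : A.face n i.castSucc = A.innerFace n i := by
  simp [face]

lemma face_last (n : ℕ) : A.face n (Fin.last (n + 1)) = A.lastFace n := by
  simp [face]

lemma face_face (n : ℕ) {i j : Fin (n + 2)} (hij : i ≤ j) :
    A.face n i ∘ₗ A.face (n + 1) j.succ = A.face n j ∘ₗ A.face (n + 1) i.castSucc := by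
  cases j using Fin.lastCases with
  | cast j =>
    cases i using Fin.lastCases with
    | last => exact absurd hij (by have := j.2; simp [Fin.le_def]; omega)
    | cast i =>
      rw [Fin.succ_castSucc, face_castSucc, face_castSucc, face_castSucc, face_castSucc]
      exact innerFace_innerFace n hij
  | last =>
    rw [Fin.succ_last, face_last, face_last, lastFace, lastFace]
    cases i using Fin.lastCases with
    | cast i =>
      rw [face_castSucc, face_castSucc, LinearMap.comp_assoc, ← innerFace_tau,
        ← LinearMap.comp_assoc, ← LinearMap.comp_assoc]
      have := innerFace_innerFace (A := A) n (Fin.zero_le i)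
      rw [Fin.castSucc_zero] at this
      rw [this]
    | last =>
      rw [face_castSucc, face_last, LinearMap.comp_assoc, ← innerFace_tau_tau, lastFace]
      have h := innerFace_tau (A := A) n 0
      rw [Fin.castSucc_zero] at h
      have h' := innerFace_innerFace (A := A) n (le_refl 0)
      rw [Fin.castSucc_zero] at h'
      calc _ = A.innerFace n 0 ∘ₗ (A.tau (n + 1) ∘ₗ A.innerFace (n + 1) 0) ∘ₗ A.tau (n + 2) := rfl
        _ = (A.innerFace n 0 ∘ₗ A.innerFace (n + 1) (Fin.succ 0)) ∘ₗ A.tau (n + 2) ∘ₗ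
            A.tau (n + 2) := by rw [← h]; rfl
        _ = _ := by rw [h']; rfl

lemma bd_bd (n : ℕ) : A.bd n ∘ₗ A.bd (n + 1) = 0 := by
  simp only [bd, comp_sum', sum_comp', ← Finset.sum_product']
  let P := Fin (n + 3) × Fin (n + 2)
  let S : Finset P := {ij : P | (ij.1 : ℕ) ≤ (ij.2 : ℕ)}
  rw [Finset.univ_product_univ, ← Finset.sum_add_sum_compl S, ← eq_neg_iff_add_eq_zero,
    ← Finset.sum_neg_distrib]
  let φ : ∀ ij : P, ij ∈ S → P := fun ij hij =>
    (ij.2.succ, Fin.castLT ij.1 (lt_of_le_of_lt (Finset.mem_filter.mp hij).right (Fin.is_lt ij.2)))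
  apply Finset.sum_bij φ
  · intro ij hij
    simp_rw [S, φ, Finset.compl_filter, Finset.mem_filter_univ, Fin.val_succ,
      Fin.val_castLT] at hij ⊢
    lia
  · rintro ⟨i, j⟩ hij ⟨i', j'⟩ hij' h
    rw [Prod.mk_inj]
    exact ⟨by simpa [φ, Fin.castSucc_castLT] using! congr_arg Fin.castSucc (congr_arg Prod.snd h),
      by simpa [φ] using! congr_arg Prod.fst h⟩
  · rintro ⟨i', j'⟩ hij'
    simp_rw [S, Finset.compl_filter, Finset.mem_filter_univ, not_le] at hij'
    refine ⟨(Fin.castSucc j', i'.pred <| ?_), ?_, ?_⟩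
    · rintro rfl
      simp only [Fin.val_zero, not_lt_zero] at hij'
    · simpa [S] using! Nat.le_sub_one_of_lt hij'
    · simp only [φ, Fin.castLT_castSucc, Fin.succ_pred]
  · rintro ⟨i, j⟩ hij
    have hij' : (i : ℕ) ≤ j := (Finset.mem_filter.mp hij).right
    obtain ⟨i, rfl⟩ : ∃ i' : Fin (n + 2), i = i'.castSucc :=
      ⟨i.castLT (lt_of_le_of_lt hij' j.2), by simp⟩
    simp only [φ, Fin.castLT_castSucc, LinearMap.smul_comp, LinearMap.comp_smul, smul_smul]
    rw [face_face n (show i ≤ j from hij'), ← neg_smul]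
    congr 1
    simp only [Fin.val_succ, Fin.val_castSucc, pow_succ]
    ring

lemma bd_eq (n : ℕ) : A.bd n = A.bdPrime n + A.innerFace n 0 ∘ₗ A.cyc (n + 1) := by
  rw [bd, Fin.sum_univ_castSucc, bdPrime, face_last, lastFace, cyc, LinearMap.comp_smul]
  simp only [face_castSucc, Fin.val_castSucc, Fin.val_last]

lemma cyc_pow (n : ℕ) : A.cyc n ^ (n + 1) = 1 := by
  rw [cyc, smul_pow, tau_pow, ← pow_mul, Even.neg_one_pow (Nat.even_mul_succ_self n), one_smul]

lemma innerFace_cyc (n : ℕ) (j : Fin (n + 1)) :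
    A.innerFace (n + 1) j.succ ∘ₗ A.cyc (n + 2) =
      -(A.cyc (n + 1) ∘ₗ A.innerFace (n + 1) j.castSucc) := by
  rw [cyc, cyc, LinearMap.comp_smul, LinearMap.smul_comp, innerFace_tau,
    show (-1 : K) ^ (n + 2) = -(-1) ^ (n + 1) by ring]
  exact neg_smul ((-1 : K) ^ (n + 1)) (A.tau (n + 1) ∘ₗ A.innerFace (n + 1) j.castSucc)

lemma innerFace_cyc_cyc (n : ℕ) : A.innerFace n 0 ∘ₗ A.cyc (n + 1) ∘ₗ A.cyc (n + 1) =
    (-1 : K) ^ n • A.cyc n ∘ₗ A.innerFace n (Fin.last n) := by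
  simp only [cyc, LinearMap.comp_smul, LinearMap.smul_comp, innerFace_tau_tau, smul_smul]
  congr 1
  ring_nf

lemma bdPrime_cyc (n : ℕ) : A.bdPrime n ∘ₗ A.cyc (n + 1) =
    A.innerFace n 0 ∘ₗ A.cyc (n + 1) + A.cyc n ∘ₗ A.bdPrime n -
      A.innerFace n 0 ∘ₗ A.cyc (n + 1) ∘ₗ A.cyc (n + 1) := by
  rw [innerFace_cyc_cyc]
  cases n with
  | zero => simp [bdPrime]
  | succ n =>
    have h1 : A.bdPrime (n + 1) ∘ₗ A.cyc (n + 2) = A.innerFace (n + 1) 0 ∘ₗ A.cyc (n + 2) +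
        ∑ i : Fin (n + 1), (-1 : K) ^ (i : ℕ) •
          A.cyc (n + 1) ∘ₗ A.innerFace (n + 1) i.castSucc := by
      rw [bdPrime, Fin.sum_univ_succ, LinearMap.add_comp, sum_comp']
      congr 1
      · simp
      · refine Finset.sum_congr rfl fun i _ => ?_
        rw [LinearMap.smul_comp, innerFace_cyc, Fin.val_succ, pow_succ]
        simp
    have h2 : A.cyc (n + 1) ∘ₗ A.bdPrime (n + 1) = ∑ i : Fin (n + 1), (-1 : K) ^ (i : ℕ) •
          A.cyc (n + 1) ∘ₗ A.innerFace (n + 1) i.castSucc +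
        (-1 : K) ^ (n + 1) • A.cyc (n + 1) ∘ₗ A.innerFace (n + 1) (Fin.last (n + 1)) := by
      rw [bdPrime, Fin.sum_univ_castSucc, LinearMap.comp_add, comp_sum']
      simp only [LinearMap.comp_smul, Fin.val_castSucc, Fin.val_last]
    rw [h1, h2]
    abel

lemma bd_one_sub (n : ℕ) : A.bd n ∘ₗ (LinearMap.id - A.cyc (n + 1)) =
    (LinearMap.id - A.cyc n) ∘ₗ A.bdPrime n := by
  rw [bd_eq, LinearMap.comp_sub, LinearMap.comp_id, LinearMap.add_comp, bdPrime_cyc,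
    LinearMap.sub_comp, LinearMap.id_comp, LinearMap.comp_assoc]
  abel

lemma cyc_nrm (n : ℕ) : A.cyc n * A.nrm n = A.nrm n := by
  rw [nrm, Finset.mul_sum]
  simp only [← pow_succ']
  rw [Finset.sum_range_succ, cyc_pow]
  conv_rhs => rw [Finset.sum_range_succ', pow_zero]

lemma nrm_cyc (n : ℕ) : A.nrm n * A.cyc n = A.nrm n := by
  rw [nrm, Finset.sum_mul]
  simp only [← pow_succ]
  rw [Finset.sum_range_succ, cyc_pow]
  conv_rhs => rw [Finset.sum_range_succ', pow_zero]

lemma cyc_pow_nrm (n k : ℕ) : A.cyc n ^ k * A.nrm n = A.nrm n := by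
  induction k with
  | zero => simp
  | succ k ih => rw [pow_succ, mul_assoc, cyc_nrm, ih]

lemma nrm_cyc_pow (n k : ℕ) : A.nrm n * A.cyc n ^ k = A.nrm n := by
  induction k with
  | zero => simp
  | succ k ih => rw [pow_succ', ← mul_assoc, nrm_cyc, ih]

lemma innerFace_cyc_pow (n : ℕ) (i : Fin (n + 1)) :
    (-1 : K) ^ (i : ℕ) • A.innerFace n i ∘ₗ (A.cyc (n + 1) ^ (i : ℕ) : A.Ten (n + 1) →ₗ[K] _) =
      (A.cyc n ^ (i : ℕ) : A.Ten n →ₗ[K] _) ∘ₗ A.innerFace n 0 := by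
  cases n with
  | zero =>
    obtain rfl : i = 0 := Fin.fin_one_eq_zero i
    simp [Module.End.one_eq_id]
  | succ n =>
    induction i using Fin.induction with
    | zero => simp [Module.End.one_eq_id]
    | succ i ih =>
      have h : A.innerFace (n + 1) i.succ ∘ₗ
          (A.cyc (n + 2) ^ (i + 1 : ℕ) : A.Ten (n + 2) →ₗ[K] _) =
          (A.innerFace (n + 1) i.succ ∘ₗ A.cyc (n + 2)) ∘ₗ
            (A.cyc (n + 2) ^ (i : ℕ) : A.Ten (n + 2) →ₗ[K] _) := by
        rw [pow_succ']; rfl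
      rw [Fin.val_succ, h, innerFace_cyc, pow_succ' (A.cyc (n + 1)), Module.End.mul_eq_comp,
        LinearMap.comp_assoc, ← Fin.val_castSucc, ← ih, LinearMap.comp_smul, LinearMap.neg_comp,
        LinearMap.comp_assoc, smul_neg, ← neg_smul, pow_succ]
      simp

lemma bdPrime_nrm (n : ℕ) : A.bdPrime n ∘ₗ A.nrm (n + 1) = A.nrm n ∘ₗ A.bd n := by
  have h1 : A.bdPrime n ∘ₗ A.nrm (n + 1) = A.nrm n ∘ₗ A.innerFace n 0 ∘ₗ A.nrm (n + 1) := by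
    have h : ∀ i : Fin (n + 1), ((-1 : K) ^ (i : ℕ) • A.innerFace n i) ∘ₗ A.nrm (n + 1) =
        (A.cyc n ^ (i : ℕ) : A.Ten n →ₗ[K] _) ∘ₗ A.innerFace n 0 ∘ₗ A.nrm (n + 1) := by
      intro i
      rw [← LinearMap.comp_assoc, ← innerFace_cyc_pow]
      conv_lhs => rw [← cyc_pow_nrm (n + 1) i]
      rfl
    rw [bdPrime, sum_comp']
    simp only [h]
    rw [← sum_comp', Fin.sum_univ_eq_sum_range (fun i => A.cyc n ^ i)]
    rfl
  have h2 : A.nrm n ∘ₗ A.bd n = A.nrm n ∘ₗ A.innerFace n 0 ∘ₗ A.nrm (n + 1) := by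
    have h : ∀ i : Fin (n + 1), A.nrm n ∘ₗ ((-1 : K) ^ (i : ℕ) • A.innerFace n i) =
        (A.nrm n ∘ₗ A.innerFace n 0) ∘ₗ
          (A.cyc (n + 1) ^ (n + 2 - i : ℕ) : A.Ten (n + 1) →ₗ[K] _) := by
      intro i
      have hi : (A.cyc (n + 1) ^ (i : ℕ) * A.cyc (n + 1) ^ (n + 2 - i : ℕ)) = 1 := by
        rw [← pow_add, ← cyc_pow]
        congr 1
        have := i.2
        omega
      calc _ = A.nrm n ∘ₗ ((-1 : K) ^ (i : ℕ) • A.innerFace n i) ∘ₗ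
            (A.cyc (n + 1) ^ (i : ℕ) * A.cyc (n + 1) ^ (n + 2 - i : ℕ)) := by
              rw [hi, Module.End.one_eq_id, LinearMap.comp_id]
        _ = A.nrm n ∘ₗ ((-1 : K) ^ (i : ℕ) • A.innerFace n i ∘ₗ
            (A.cyc (n + 1) ^ (i : ℕ) : A.Ten (n + 1) →ₗ[K] _)) ∘ₗ
              (A.cyc (n + 1) ^ (n + 2 - i : ℕ) : A.Ten (n + 1) →ₗ[K] _) := rfl
        _ = (A.nrm n * A.cyc n ^ (i : ℕ)) ∘ₗ A.innerFace n 0 ∘ₗ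
              (A.cyc (n + 1) ^ (n + 2 - i : ℕ) : A.Ten (n + 1) →ₗ[K] _) := by
              rw [innerFace_cyc_pow]; rfl
        _ = _ := by rw [nrm_cyc_pow]; rfl
    rw [bd_eq, LinearMap.comp_add, bdPrime, comp_sum']
    simp only [h]
    rw [← comp_sum', ← LinearMap.comp_assoc, ← LinearMap.comp_add, ← LinearMap.comp_assoc]
    congr 1
    rw [Fin.sum_univ_eq_sum_range (fun i => A.cyc (n + 1) ^ (n + 2 - i)) (n + 1),
      ← Finset.sum_range_reflect, nrm]
    have h3 : ∀ j ∈ Finset.range (n + 1), A.cyc (n + 1) ^ (n + 2 - (n + 1 - 1 - j)) =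
        A.cyc (n + 1) ^ (j + 2) := by
      intro j hj
      congr 1
      have := Finset.mem_range.1 hj
      omega
    rw [Finset.sum_congr rfl h3]
    conv_rhs => rw [Finset.sum_range_succ', Finset.sum_range_succ']
    rw [Finset.sum_range_succ, cyc_pow, zero_add, pow_one, pow_zero]
    abel
  rw [h1, h2]

lemma bdPrime_extra_zero : A.bdPrime 0 ∘ₗ A.extra 0 = LinearMap.id := by
  rw [← innerFace_zero_extra 0]
  simp [bdPrime]

lemma bdPrime_extra (n : ℕ) : A.bdPrime (n + 1) ∘ₗ A.extra (n + 1) + A.extra n ∘ₗ A.bdPrime n =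
    LinearMap.id := by
  have h1 : A.bdPrime (n + 1) ∘ₗ A.extra (n + 1) = LinearMap.id +
      ∑ i : Fin (n + 1), (-1 : K) ^ (i + 1 : ℕ) • A.extra n ∘ₗ A.innerFace n i := by
    rw [bdPrime, Fin.sum_univ_succ, LinearMap.add_comp, sum_comp', ← innerFace_zero_extra (n + 1)]
    congr 1
    · simp
    · refine Finset.sum_congr rfl fun i _ => ?_
      rw [LinearMap.smul_comp, innerFace_extra, Fin.val_succ]
  have h2 : A.extra n ∘ₗ A.bdPrime n =
      ∑ i : Fin (n + 1), (-1 : K) ^ (i : ℕ) • A.extra n ∘ₗ A.innerFace n i := by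
    rw [bdPrime, comp_sum']
    simp only [LinearMap.comp_smul]
  have h3 : ∑ i : Fin (n + 1), (-1 : K) ^ (i + 1 : ℕ) • A.extra n ∘ₗ A.innerFace n i +
      ∑ i : Fin (n + 1), (-1 : K) ^ (i : ℕ) • A.extra n ∘ₗ A.innerFace n i = 0 := by
    rw [← Finset.sum_add_distrib]
    refine Finset.sum_eq_zero fun i _ => ?_
    rw [pow_succ, ← add_smul]
    simp
  rw [h1, h2, add_assoc (LinearMap.id : A.Ten (n + 1) →ₗ[K] _), h3, add_zero]

lemma one_sub_nrm (n : ℕ) : (LinearMap.id - A.cyc n) ∘ₗ A.nrm n = 0 := by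
  rw [LinearMap.sub_comp, LinearMap.id_comp, ← Module.End.mul_eq_comp, cyc_nrm, sub_self]

lemma nrm_one_sub (n : ℕ) : A.nrm n ∘ₗ (LinearMap.id - A.cyc n) = 0 := by
  rw [LinearMap.comp_sub, LinearMap.comp_id, ← Module.End.mul_eq_comp, nrm_cyc, sub_self]

lemma connes_connes (n : ℕ) : A.connes (n + 1) ∘ₗ A.connes n = 0 := by
  calc _ = (LinearMap.id - A.cyc (n + 2)) ∘ₗ A.extra (n + 1) ∘ₗ
        (A.nrm (n + 1) ∘ₗ (LinearMap.id - A.cyc (n + 1))) ∘ₗ A.extra n ∘ₗ A.nrm n := rfl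
    _ = 0 := by rw [nrm_one_sub]; simp

lemma bd_connes_zero : A.bd 0 ∘ₗ A.connes 0 = 0 := by
  calc _ = (A.bd 0 ∘ₗ (LinearMap.id - A.cyc 1)) ∘ₗ A.extra 0 ∘ₗ A.nrm 0 := rfl
    _ = (LinearMap.id - A.cyc 0) ∘ₗ (A.bdPrime 0 ∘ₗ A.extra 0) ∘ₗ A.nrm 0 := by
        rw [bd_one_sub]; rfl
    _ = 0 := by rw [bdPrime_extra_zero, LinearMap.id_comp, one_sub_nrm]

lemma bd_connes (n : ℕ) :
    A.bd (n + 1) ∘ₗ A.connes (n + 1) + A.connes n ∘ₗ A.bd n = 0 := by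
  calc _ = (A.bd (n + 1) ∘ₗ (LinearMap.id - A.cyc (n + 2))) ∘ₗ A.extra (n + 1) ∘ₗ A.nrm (n + 1) +
        (LinearMap.id - A.cyc (n + 1)) ∘ₗ A.extra n ∘ₗ A.nrm n ∘ₗ A.bd n := rfl
    _ = (LinearMap.id - A.cyc (n + 1)) ∘ₗ (A.bdPrime (n + 1) ∘ₗ A.extra (n + 1) +
          A.extra n ∘ₗ A.bdPrime n) ∘ₗ A.nrm (n + 1) := by
        rw [bd_one_sub, ← bdPrime_nrm, LinearMap.add_comp, LinearMap.comp_add]; rfl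
    _ = 0 := by rw [bdPrime_extra, LinearMap.id_comp, one_sub_nrm]

end Mixed

end SuperCat

end

noncomputable section

/-! ## Mixed complexes and cyclic homology -/

/-- A mixed complex `(X, b, B)`. -/
structure MixedComplex (K : Type w) [Field K] where
  X : ℕ → ModuleCat.{x} K
  b (n : ℕ) : X (n + 1) →ₗ[K] X n
  B (n : ℕ) : X n →ₗ[K] X (n + 1)
  b_b (n : ℕ) : b n ∘ₗ b (n + 1) = 0
  B_B (n : ℕ) : B (n + 1) ∘ₗ B n = 0
  b_B_zero : b 0 ∘ₗ B 0 = 0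
  b_B (n : ℕ) : b (n + 1) ∘ₗ B (n + 1) + B n ∘ₗ b n = 0

namespace MixedComplex

variable {K : Type w} [Field K]

/-- A morphism of mixed complexes. -/
structure Hom (M N : MixedComplex.{w, x} K) where
  f (n : ℕ) : M.X n →ₗ[K] N.X n
  comm_b (n : ℕ) : f n ∘ₗ M.b n = N.b n ∘ₗ f (n + 1)
  comm_B (n : ℕ) : f (n + 1) ∘ₗ M.B n = N.B n ∘ₗ f n

variable (M : MixedComplex.{w, x} K)

/-- The cyclic `n`-chains `⊕_{k ≥ 0} X_{n - 2k}`, written as the sum over the pairs `(m, k)` with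
`m + 2k = n`. -/
abbrev Chain (n : ℕ) : Type x := ⨁ p : {p : ℕ × ℕ // p.1 + 2 * p.2 = n}, M.X p.1.1

/-- The inclusion of the summand with index `(m, k)` into the cyclic `n`-chains when
`m + 2k = n` (and zero otherwise). -/
def incl (n m k : ℕ) : M.X m →ₗ[K] M.Chain n :=
  if h : m + 2 * k = n then
    DirectSum.lof K {p : ℕ × ℕ // p.1 + 2 * p.2 = n} (fun p => M.X p.1.1) ⟨(m, k), h⟩
  else 0

/-- The component `b` of the cyclic boundary on the summand `(m, k)`. -/
def bPart (n : ℕ) : ∀ m : ℕ, ℕ → (M.X m →ₗ[K] M.Chain n)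
  | 0, _ => 0
  | m + 1, k => M.incl n m k ∘ₗ M.b m

/-- The component `B` of the cyclic boundary on the summand `(m, k)`. -/
def BPart (n m : ℕ) : ℕ → (M.X m →ₗ[K] M.Chain n)
  | 0 => 0
  | k + 1 => M.incl n (m + 1) k ∘ₗ M.B m

/-- The component of the periodicity operator on the summand `(m, k)`. -/
def sPart (n m : ℕ) : ℕ → (M.X m →ₗ[K] M.Chain n)
  | 0 => 0
  | k + 1 => M.incl n m k

/-- The cyclic boundary `b + B`. -/
def chainD (n : ℕ) : M.Chain (n + 1) →ₗ[K] M.Chain n :=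
  DirectSum.toModule K _ _ fun p => M.bPart n p.1.1 p.1.2 + M.BPart n p.1.1 p.1.2

/-- The periodicity operator
`(aₙ, aₙ₋₂, aₙ₋₄, …) ↦ (aₙ₋₂, aₙ₋₄, …)` from `i`-chains to `j`-chains if `i = j + 2` (and zero
otherwise). -/
def chainS (i j : ℕ) : M.Chain i →ₗ[K] M.Chain j :=
  DirectSum.toModule K _ _ fun p => M.sPart j p.1.1 p.1.2

variable {M}

lemma incl_eq (n m k : ℕ) (h : m + 2 * k = n) (a : M.X m) : M.incl n m k a =
    DirectSum.lof K {p : ℕ × ℕ // p.1 + 2 * p.2 = n} (fun p => M.X p.1.1) ⟨(m, k), h⟩ a := by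
  simp [incl, h]

lemma chain_ext {n : ℕ} {E : Type*} [AddCommMonoid E] [Module K E] {φ ψ : M.Chain n →ₗ[K] E}
    (h : ∀ (m k : ℕ), m + 2 * k = n → φ ∘ₗ M.incl n m k = ψ ∘ₗ M.incl n m k) : φ = ψ := by
  refine DirectSum.linearMap_ext K fun ⟨⟨m, k⟩, hp⟩ => LinearMap.ext fun a => ?_
  have := LinearMap.congr_fun (h m k hp) a
  rw [LinearMap.comp_apply, LinearMap.comp_apply, incl_eq _ _ _ hp] at this
  exact this

lemma chainD_incl {n m k : ℕ} (h : m + 2 * k = n + 1) :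
    M.chainD n ∘ₗ M.incl (n + 1) m k = M.bPart n m k + M.BPart n m k := by
  ext a
  rw [LinearMap.comp_apply, incl_eq _ _ _ h, chainD, DirectSum.toModule_lof]

lemma chainS_incl {i j m k : ℕ} (h : m + 2 * k = i) :
    M.chainS i j ∘ₗ M.incl i m k = M.sPart j m k := by
  ext a
  rw [LinearMap.comp_apply, incl_eq _ _ _ h, chainS, DirectSum.toModule_lof]

lemma chainD_incl_apply {n m k : ℕ} (h : m + 2 * k = n + 1) (a : M.X m) :
    M.chainD n (M.incl (n + 1) m k a) = M.bPart n m k a + M.BPart n m k a :=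
  LinearMap.congr_fun (chainD_incl h) a

lemma chainS_incl_apply {i j m k : ℕ} (h : m + 2 * k = i) (a : M.X m) :
    M.chainS i j (M.incl i m k a) = M.sPart j m k a :=
  LinearMap.congr_fun (chainS_incl h) a

lemma b_b_apply (n : ℕ) (a : M.X (n + 2)) : M.b n (M.b (n + 1) a) = 0 :=
  LinearMap.congr_fun (M.b_b n) a

lemma B_B_apply (n : ℕ) (a : M.X n) : M.B (n + 1) (M.B n a) = 0 :=
  LinearMap.congr_fun (M.B_B n) a

lemma b_B_zero_apply (a : M.X 0) : M.b 0 (M.B 0 a) = 0 :=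
  LinearMap.congr_fun M.b_B_zero a

lemma b_B_apply (n : ℕ) (a : M.X (n + 1)) : M.b (n + 1) (M.B (n + 1) a) = -M.B n (M.b n a) :=
  eq_neg_of_add_eq_zero_left (LinearMap.congr_fun (M.b_B n) a)

lemma bPart_zero (n k : ℕ) (a : M.X 0) : M.bPart n 0 k a = 0 := rfl

lemma bPart_succ (n m k : ℕ) (a : M.X (m + 1)) :
    M.bPart n (m + 1) k a = M.incl n m k (M.b m a) := rfl

lemma BPart_zero (n m : ℕ) (a : M.X m) : M.BPart n m 0 a = 0 := rfl

lemma BPart_succ (n m k : ℕ) (a : M.X m) :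
    M.BPart n m (k + 1) a = M.incl n (m + 1) k (M.B m a) := rfl

lemma sPart_zero (n m : ℕ) (a : M.X m) : M.sPart n m 0 a = 0 := rfl

lemma sPart_succ (n m k : ℕ) (a : M.X m) : M.sPart n m (k + 1) a = M.incl n m k a := rfl

lemma chainD_chainD (n : ℕ) : M.chainD n ∘ₗ M.chainD (n + 1) = 0 := by
  refine chain_ext fun m k h => LinearMap.ext fun a => ?_
  simp only [LinearMap.comp_apply, LinearMap.zero_apply]
  rw [chainD_incl_apply h]
  rcases m with _ | _ | m <;> rcases k with _ | _ | k <;>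
    simp (disch := omega) only [bPart_zero, bPart_succ, BPart_zero, BPart_succ, chainD_incl_apply,
      b_b_apply, B_B_apply, b_B_zero_apply, b_B_apply, map_add, map_zero, map_neg, add_zero,
      zero_add, add_neg_cancel]

lemma chainS_chainD (n : ℕ) :
    M.chainS (n + 2) n ∘ₗ M.chainD (n + 2) = M.chainD n ∘ₗ M.chainS (n + 3) (n + 1) := by
  refine chain_ext fun m k h => LinearMap.ext fun a => ?_
  simp only [LinearMap.comp_apply]
  rw [chainD_incl_apply h, chainS_incl_apply h]
  rcases m with _ | m <;> rcases k with _ | _ | k <;>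
    simp (disch := omega) only [bPart_zero, bPart_succ, BPart_zero, BPart_succ, sPart_zero,
      sPart_succ, chainD_incl_apply, chainS_incl_apply, map_add, map_zero, add_zero, zero_add]

lemma chainS_chainD_zero : M.chainS 1 0 = 0 := by
  refine chain_ext fun m k h => ?_
  obtain rfl : k = 0 := by omega
  rw [chainS_incl h, sPart, LinearMap.zero_comp]

variable (M)

/-- The cyclic complex of a mixed complex. -/
def cyclicComplex : ChainComplex (ModuleCat.{x} K) ℕ :=
  ChainComplex.of (fun n => ModuleCat.of K (M.Chain n)) (fun n => ModuleCat.ofHom (M.chainD n))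
    (fun n => by rw [← ModuleCat.ofHom_comp, chainD_chainD]; rfl)

/-- The cyclic homology of a mixed complex. -/
def HC (n : ℕ) : ModuleCat.{x} K := M.cyclicComplex.homology n

/-- The periodicity operator as a morphism `X_i → X_j`, nonzero only for `i = j + 2`. -/
def sHom (i j : ℕ) : M.cyclicComplex.X i ⟶ M.cyclicComplex.X j := ModuleCat.ofHom (M.chainS i j)

lemma cyclicComplex_d (n : ℕ) :
    M.cyclicComplex.d (n + 1) n = ModuleCat.ofHom (M.chainD n) :=
  ChainComplex.of_d (fun n => ModuleCat.of K (M.Chain n)) (fun n => ModuleCat.ofHom (M.chainD n))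
    n

lemma sHom_comm (n : ℕ) : M.sHom (n + 3) (n + 1) ≫ M.cyclicComplex.d (n + 1) n =
    M.cyclicComplex.d (n + 3) (n + 2) ≫ M.sHom (n + 2) n := by
  rw [cyclicComplex_d, cyclicComplex_d, sHom, sHom]
  exact congrArg ModuleCat.ofHom (M.chainS_chainD n).symm

/-- Connes' periodicity operator `S : HC_{n+2} → HC_n`, induced by the periodicity operator on
cyclic chains. -/
def S (n : ℕ) : M.HC (n + 2) ⟶ M.HC n :=
  ShortComplex.homologyMap (S₁ := M.cyclicComplex.sc (n + 2)) (S₂ := M.cyclicComplex.sc n)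
    { τ₁ := M.sHom _ _
      τ₂ := M.sHom _ _
      τ₃ := M.sHom _ _
      comm₁₂ := by
        change M.sHom _ _ ≫ M.cyclicComplex.d _ _ = M.cyclicComplex.d _ _ ≫ M.sHom _ _
        rw [ChainComplex.prev, ChainComplex.prev]
        exact M.sHom_comm n
      comm₂₃ := by
        change M.sHom _ _ ≫ M.cyclicComplex.d _ _ = M.cyclicComplex.d _ _ ≫ M.sHom _ _
        cases n with
        | zero =>
          rw [ChainComplex.next_nat_zero, ChainComplex.next_nat_succ]
          rw [M.cyclicComplex.shape 0 0 (by simp), Limits.comp_zero, sHom, chainS_chainD_zero]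
          exact Limits.comp_zero.symm
        | succ n =>
          rw [ChainComplex.next_nat_succ, ChainComplex.next_nat_succ]
          exact M.sHom_comm n }

variable {M} {N : MixedComplex.{w, x} K} (F : M.Hom N)

/-- The map on cyclic chains induced by a morphism of mixed complexes. -/
def Hom.chainMap (n : ℕ) : M.Chain n →ₗ[K] N.Chain n :=
  DirectSum.toModule K _ _ fun p => N.incl n p.1.1 p.1.2 ∘ₗ F.f p.1.1

lemma Hom.chainMap_incl {n m k : ℕ} (h : m + 2 * k = n) :
    F.chainMap n ∘ₗ M.incl n m k = N.incl n m k ∘ₗ F.f m := by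
  ext a
  rw [LinearMap.comp_apply, incl_eq _ _ _ h, chainMap, DirectSum.toModule_lof]

lemma Hom.chainMap_chainD (n : ℕ) :
    N.chainD n ∘ₗ F.chainMap (n + 1) = F.chainMap n ∘ₗ M.chainD n := by
  refine chain_ext fun m k h => ?_
  rw [LinearMap.comp_assoc, LinearMap.comp_assoc, chainD_incl h, F.chainMap_incl h,
    ← LinearMap.comp_assoc, chainD_incl h, LinearMap.add_comp, LinearMap.comp_add]
  congr 1
  · rcases m with _ | m
    · simp [bPart]
    · rw [bPart, bPart, ← LinearMap.comp_assoc, F.chainMap_incl (by omega), LinearMap.comp_assoc,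
        LinearMap.comp_assoc, F.comm_b]
  · rcases k with _ | k
    · simp [BPart]
    · rw [BPart, BPart, ← LinearMap.comp_assoc, F.chainMap_incl (by omega), LinearMap.comp_assoc,
        LinearMap.comp_assoc, F.comm_B]

/-- The chain map of cyclic complexes induced by a morphism of mixed complexes. -/
def Hom.cyclicMap : M.cyclicComplex ⟶ N.cyclicComplex where
  f n := ModuleCat.ofHom (F.chainMap n)
  comm' i j h := by
    obtain rfl : j + 1 = i := h
    rw [cyclicComplex_d, cyclicComplex_d]
    exact congrArg ModuleCat.ofHom (F.chainMap_chainD j)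

/-- The map on cyclic homology induced by a morphism of mixed complexes. -/
def Hom.mapHC (n : ℕ) : M.HC n ⟶ N.HC n := HomologicalComplex.homologyMap F.cyclicMap n

end MixedComplex

end

noncomputable section

namespace SuperCat

variable {K : Type w} [Field K]

/-! ## The nerve and the cyclic homology of a superadditive category -/

section Nerve

variable (A : SuperCat.{w, u, v} K)

/-- The `K`-nerve of degree `n` (with coefficients in `A`): the direct sum over all tuples
`(Y₀, …, Yₙ)` of objects of `A(Y₀, Y₁) ⊗ A(Y₁, Y₂) ⊗ ⋯ ⊗ A(Yₙ, Y₀)`. Indices are cyclic, that is,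
`i + 1 = 0` for `i = n`. -/
abbrev NerveSum (n : ℕ) : Type (max u v w) :=
  ⨁ Y : Fin (n + 1) → A.Obj, ⨂[K] i : Fin (n + 1), (Y i ⟶ Y (i + 1))

open Classical in
/-- The canonical embedding of the nerve into the tensor power of the total morphism space. -/
def nerveIncl (n : ℕ) : A.NerveSum n →ₗ[K] A.Ten n :=
  DirectSum.toModule K _ _ fun _ => PiTensorProduct.map fun _ => inc

theorem nerveIncl_injective (n : ℕ) : Function.Injective (A.nerveIncl n) := by
  classical
  let e : A.Ten n ≃ₗ[K]
      ⨁ p : Fin (n + 1) → A.Obj × A.Obj, ⨂[K] i, ((p i).1 ⟶ (p i).2) :=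
    PiTensorProduct.ofDirectSumEquiv (R := K) (ι := Fin (n + 1)) (κ := fun _ => A.Obj × A.Obj)
      (M := fun _ p => (p.1 ⟶ p.2))
  have he : ∀ Y : Fin (n + 1) → A.Obj, e.toLinearMap ∘ₗ A.nerveIncl n ∘ₗ
      DirectSum.lof K _ (fun Y : Fin (n + 1) → A.Obj => ⨂[K] i, (Y i ⟶ Y (i + 1))) Y =
        DirectSum.lof K _ (fun p : Fin (n + 1) → A.Obj × A.Obj => ⨂[K] i, ((p i).1 ⟶ (p i).2))
          (fun i => (Y i, Y (i + 1))) := by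
    intro Y
    refine PiTensorProduct.ext (MultilinearMap.ext fun f => ?_)
    simp only [LinearMap.compMultilinearMap_apply, LinearMap.comp_apply]
    rw [nerveIncl, DirectSum.toModule_lof, PiTensorProduct.map_tprod]
    exact PiTensorProduct.ofDirectSumEquiv_tprod_lof (R := K) (ι := Fin (n + 1))
      (κ := fun _ => A.Obj × A.Obj) (M := fun _ p => (p.1 ⟶ p.2)) (fun i => (Y i, Y (i + 1))) f
  have hc : ∀ Y : Fin (n + 1) → A.Obj,
      DirectSum.component K _ (fun p : Fin (n + 1) → A.Obj × A.Obj =>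
        ⨂[K] i, ((p i).1 ⟶ (p i).2)) (fun i => (Y i, Y (i + 1))) ∘ₗ e.toLinearMap ∘ₗ
          A.nerveIncl n =
        DirectSum.component K _ (fun Y : Fin (n + 1) → A.Obj => ⨂[K] i, (Y i ⟶ Y (i + 1))) Y := by
    intro Y
    refine DirectSum.linearMap_ext K fun Y' => ?_
    rw [LinearMap.comp_assoc, LinearMap.comp_assoc, he]
    ext z
    simp only [LinearMap.compMultilinearMap_apply, LinearMap.comp_apply]
    by_cases hY : Y' = Y
    · subst hY
      rw [DirectSum.component.lof_self, DirectSum.component.lof_self]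
    · have hY' : (fun i => (Y' i, Y' (i + 1))) ≠ fun i => (Y i, Y (i + 1)) := fun h =>
        hY (funext fun i => congrArg Prod.fst (congrFun h i))
      rw [DirectSum.component.of, DirectSum.component.of, dif_neg hY, dif_neg hY']
  intro x y hxy
  refine DirectSum.ext_component K fun Y => ?_
  rw [← hc Y]
  simp only [LinearMap.comp_apply]
  rw [hxy]

/-- The nerve as a subspace of the tensor power of the total morphism space (see
`nerveIncl_injective`). -/
def nerve (n : ℕ) : Submodule K (A.Ten n) := LinearMap.range (A.nerveIncl n)

variable {A}

/-- `a` is a cyclically composable tuple of morphisms along the objects `Y`. -/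
def IsLoop {n : ℕ} (Y : Fin (n + 1) → A.Obj) (a : Fin (n + 1) → A.Tot) : Prop :=
  ∀ i, ∃ f : Y i ⟶ Y (i + 1), a i = inc f

lemma tprod_mem_nerve {n : ℕ} {Y : Fin (n + 1) → A.Obj} {a : Fin (n + 1) → A.Tot}
    (h : IsLoop Y a) : PiTensorProduct.tprod K a ∈ A.nerve n := by
  classical
  choose f hf using h
  refine ⟨DirectSum.lof K _ _ Y (PiTensorProduct.tprod K f), ?_⟩
  rw [nerveIncl, DirectSum.toModule_lof, PiTensorProduct.map_tprod]
  congr 1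
  funext i
  exact (hf i).symm

lemma nerve_le {n : ℕ} {p : Submodule K (A.Ten n)}
    (h : ∀ (Y : Fin (n + 1) → A.Obj) (a : Fin (n + 1) → A.Tot), IsLoop Y a →
      PiTensorProduct.tprod K a ∈ p) : A.nerve n ≤ p := by
  classical
  rw [nerve, LinearMap.range_le_iff_comap, ← Submodule.ker_mkQ p, ← LinearMap.ker_comp,
    LinearMap.ker_eq_top]
  refine DirectSum.linearMap_ext K fun Y => PiTensorProduct.ext (MultilinearMap.ext fun f => ?_)
  simp only [LinearMap.compMultilinearMap_apply, LinearMap.comp_apply, LinearMap.zero_apply]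
  rw [nerveIncl, DirectSum.toModule_lof, PiTensorProduct.map_tprod, Submodule.mkQ_apply,
    Submodule.Quotient.mk_eq_zero]
  exact h Y _ fun i => ⟨f i, rfl⟩

lemma IsLoop.rot {n : ℕ} {Y : Fin (n + 1) → A.Obj} {a : Fin (n + 1) → A.Tot} (h : IsLoop Y a) :
    IsLoop (rot Y) (rot a) := by
  intro i
  have := h (i - 1)
  rw [sub_add_cancel] at this
  change ∃ f : Y (i - 1) ⟶ Y (i + 1 - 1), a (i - 1) = inc f
  rwa [add_sub_cancel_right]

lemma tau_mem {n : ℕ} {x : A.Ten n} (hx : x ∈ A.nerve n) : A.tau n x ∈ A.nerve n := by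
  revert x
  change A.nerve n ≤ (A.nerve n).comap (A.tau n)
  refine nerve_le fun Y a h => ?_
  rw [Submodule.mem_comap, tau_tprod]
  refine add_mem (tprod_mem_nerve (IsLoop.rot (Y := Y) fun i => ?_))
    (tprod_mem_nerve (IsLoop.rot (Y := Y) fun i => ?_))
  · obtain ⟨f, hf⟩ := h i
    split_ifs
    · exact ⟨A.ev _ _ f, by rw [hf]; exact A.totLift_inc _ f⟩
    · exact ⟨f, hf⟩
  · obtain ⟨f, hf⟩ := h i
    split_ifs
    · exact ⟨A.od _ _ f, by rw [hf]; exact A.totLift_inc _ f⟩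
    · exact ⟨A.par _ _ f, by rw [hf]; exact A.totLift_inc _ f⟩

lemma succAbove_add_one {n : ℕ} (i j : Fin (n + 1)) :
    j.succ.succAbove (i + 1) = if i < j then i.succ else i.succ + 1 := by
  have hi := i.2
  have hj := j.2
  by_cases h : i = Fin.last n
  · subst h
    rw [Fin.last_add_one, if_neg (not_lt.2 (Fin.le_last j)), Fin.succ_last, Fin.last_add_one,
      Fin.succAbove_of_castSucc_lt _ _ (by simp), Fin.castSucc_zero]
  · have h1 : (i : ℕ) < n := Fin.val_lt_last h
    have h2 : ((i + 1 : Fin (n + 1)) : ℕ) = i + 1 := Fin.val_add_one_of_lt h1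
    have h3 : ((i.succ + 1 : Fin (n + 2)) : ℕ) = i + 2 :=
      Fin.val_add_one_of_lt (show i.succ < Fin.last _ by simpa [Fin.lt_def] using h1)
    apply Fin.ext
    simp only [Fin.succAbove, Fin.lt_def, Fin.val_castSucc, Fin.val_succ, h2]
    split_ifs <;> simp only [Fin.val_castSucc, Fin.val_succ, h2, h3] <;> omega

lemma IsLoop.contract {n : ℕ} {Y : Fin (n + 2) → A.Obj} {a : Fin (n + 2) → A.Tot}
    (h : IsLoop Y a) (j : Fin (n + 1)) :
    IsLoop (fun i => Y (j.succ.succAbove i))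
      (Fin.contractNth j.castSucc (fun x y => A.totMul x y) a) := by
  intro i
  have h1 := h i.castSucc
  have h2 := h i.succ
  rw [Fin.coeSucc_eq_succ] at h1
  change ∃ f : Y (j.succ.succAbove i) ⟶ Y (j.succ.succAbove (i + 1)), _ = inc f
  rw [succAbove_add_one]
  rcases lt_trichotomy (i : ℕ) j with hij | hij | hij
  · rw [Fin.contractNth_apply_of_lt _ _ _ _ (by simpa using hij), if_pos (Fin.lt_def.2 hij),
      Fin.succAbove_of_castSucc_lt _ _ (by simp [Fin.lt_def]; omega)]
    exact h1
  · rw [Fin.contractNth_apply_of_eq _ _ _ _ (by simpa using hij),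
      if_neg (by rw [Fin.lt_def]; omega),
      Fin.succAbove_of_castSucc_lt _ _ (by simp [Fin.lt_def]; omega)]
    obtain ⟨f, hf⟩ := h1
    obtain ⟨g, hg⟩ := h2
    exact ⟨f ≫ g, by rw [hf, hg, totMul_comp]⟩
  · rw [Fin.contractNth_apply_of_gt _ _ _ _ (by simpa using hij),
      if_neg (by rw [Fin.lt_def]; omega),
      Fin.succAbove_of_le_castSucc _ _ (by simp [Fin.le_def]; omega)]
    exact h2

lemma innerFace_mem {n : ℕ} (j : Fin (n + 1)) {x : A.Ten (n + 1)} (hx : x ∈ A.nerve (n + 1)) :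
    A.innerFace n j x ∈ A.nerve n := by
  revert x
  change A.nerve (n + 1) ≤ (A.nerve n).comap (A.innerFace n j)
  refine nerve_le fun Y a h => ?_
  rw [Submodule.mem_comap, innerFace_tprod]
  exact tprod_mem_nerve (h.contract j)

lemma extra_mem {n : ℕ} {x : A.Ten n} (hx : x ∈ A.nerve n) : A.extra n x ∈ A.nerve (n + 1) := by
  revert x
  change A.nerve n ≤ (A.nerve (n + 1)).comap (A.extra n)
  refine nerve_le fun Y a h => ?_
  obtain ⟨f, hf⟩ := h 0
  rw [Submodule.mem_comap, A.extra_tprod hf]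
  refine tprod_mem_nerve (Y := Fin.cons (Y 0) Y) fun i => ?_
  cases i using Fin.cases with
  | zero => exact ⟨𝟙 (Y 0), rfl⟩
  | succ i =>
    have hi : (Fin.cons (Y 0) Y : Fin (n + 2) → A.Obj) (i.succ + 1) = Y (i + 1) := by
      by_cases hl : i = Fin.last n
      · subst hl
        rw [Fin.succ_last, Fin.last_add_one, Fin.last_add_one, Fin.cons_zero]
      · obtain ⟨k, rfl⟩ := Fin.exists_castSucc_eq.2 hl
        cases n with
        | zero => exact k.elim0
        | succ n =>
          rw [← Fin.castSucc_succ, Fin.coeSucc_eq_succ, Fin.cons_succ, Fin.coeSucc_eq_succ]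
    rw [hi]
    exact h i

end Nerve

end SuperCat

end

noncomputable section

namespace SuperCat

variable {K : Type w} [Field K]

section Homology

variable (A : SuperCat.{w, u, v} K)

variable {A} in
lemma bd_mem {n : ℕ} {x : A.Ten (n + 1)} (hx : x ∈ A.nerve (n + 1)) : A.bd n x ∈ A.nerve n := by
  rw [bd, LinearMap.sum_apply]
  refine Submodule.sum_mem _ fun i _ => Submodule.smul_mem _ _ ?_
  cases i using Fin.lastCases with
  | cast i => rw [face_castSucc]; exact innerFace_mem i hx
  | last => rw [face_last]; exact innerFace_mem 0 (tau_mem hx)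

variable {A} in
lemma cyc_mem {n : ℕ} {x : A.Ten n} (hx : x ∈ A.nerve n) : A.cyc n x ∈ A.nerve n :=
  Submodule.smul_mem _ _ (tau_mem hx)

variable {A} in
lemma nrm_mem {n : ℕ} {x : A.Ten n} (hx : x ∈ A.nerve n) : A.nrm n x ∈ A.nerve n := by
  rw [nrm, LinearMap.sum_apply]
  refine Submodule.sum_mem _ fun k hk => ?_
  clear hk
  induction k with
  | zero => exact hx
  | succ k ih => rw [pow_succ']; exact cyc_mem ih

variable {A} in
lemma connes_mem {n : ℕ} {x : A.Ten n} (hx : x ∈ A.nerve n) :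
    A.connes n x ∈ A.nerve (n + 1) := by
  have h := extra_mem (nrm_mem hx)
  exact sub_mem h (cyc_mem h)

/-- The mixed complex of `A`: the nerve `N_*(A)` with the Hochschild boundary `∂` and the
operator `B = (1 - t) s N`. -/
def mixed : MixedComplex.{w, max u v w} K where
  X n := ModuleCat.of K (A.nerve n)
  b n := (A.bd n).restrict fun _ hx => bd_mem hx
  B n := (A.connes n).restrict fun _ hx => connes_mem hx
  b_b n := LinearMap.ext fun x => Subtype.ext (LinearMap.congr_fun (bd_bd n) x.1)
  B_B n := LinearMap.ext fun x => Subtype.ext (LinearMap.congr_fun (connes_connes n) x.1)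
  b_B_zero := LinearMap.ext fun x => Subtype.ext (LinearMap.congr_fun bd_connes_zero x.1)
  b_B n := LinearMap.ext fun x => Subtype.ext (LinearMap.congr_fun (bd_connes n) x.1)

/-- The cyclic homology `HC_n(A)`: the homology of the complex of the cyclic chains
`⊕_{k ≥ 0} N_{n-2k}(A)` with boundary `∂ + B`. -/
abbrev HC (n : ℕ) : ModuleCat.{max u v w} K := A.mixed.HC n

/-- Connes' periodicity operator `S : HC_{n+2}(A) → HC_n(A)`. -/
def S (n : ℕ) : A.HC (n + 2) →ₗ[K] A.HC n := (A.mixed.S n).hom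

end Homology

/-! ## Functoriality -/

section Functoriality

variable {A : SuperCat.{w, u₁, v₁} K} {A' : SuperCat.{w, u₂, v₂} K} (F : GradedFunctor A A')

/-- The map of total morphism spaces induced by a graded functor. -/
def totMap : A.Tot →ₗ[K] A'.Tot := totLift fun _ _ => inc ∘ₗ F.toFunctor.mapLinearMap K

lemma totMap_inc {X Y : A.Obj} (f : X ⟶ Y) : totMap F (inc f) = inc (F.toFunctor.map f) :=
  A.totLift_inc _ f

lemma totMap_ev (x : A.Tot) : totMap F (A.totEv x) = A'.totEv (totMap F x) := by
  have h : totMap F ∘ₗ A.totEv = A'.totEv ∘ₗ totMap F := tot_ext fun X Y f => by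
    simp [totEv, totMap_inc, F.map_ev]
  exact LinearMap.congr_fun h x

lemma totMap_od (x : A.Tot) : totMap F (A.totOd x) = A'.totOd (totMap F x) := by
  have h : totMap F ∘ₗ A.totOd = A'.totOd ∘ₗ totMap F := tot_ext fun X Y f => by
    simp [totOd, totMap_inc, F.map_od]
  exact LinearMap.congr_fun h x

lemma totMap_par (x : A.Tot) : totMap F (A.totPar x) = A'.totPar (totMap F x) := by
  simp only [totPar_eq, map_sub, totMap_ev, totMap_od]

/-- The map `a₀ ⊗ ⋯ ⊗ aₙ ↦ F(a₀) ⊗ ⋯ ⊗ F(aₙ)`. -/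
def tenMap (n : ℕ) : A.Ten n →ₗ[K] A'.Ten n := PiTensorProduct.map fun _ => totMap F

lemma tenMap_tprod {n : ℕ} (a : Fin (n + 1) → A.Tot) :
    tenMap F n (PiTensorProduct.tprod K a) = PiTensorProduct.tprod K fun i => totMap F (a i) :=
  PiTensorProduct.map_tprod _ _

lemma IsLoop.map {n : ℕ} {Y : Fin (n + 1) → A.Obj} {a : Fin (n + 1) → A.Tot} (h : IsLoop Y a) :
    IsLoop (fun i => F.toFunctor.obj (Y i)) (fun i => totMap F (a i)) := by
  intro i
  obtain ⟨f, hf⟩ := h i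
  exact ⟨F.toFunctor.map f, by simp only [hf, totMap_inc]⟩

lemma tenMap_mem {n : ℕ} {x : A.Ten n} (hx : x ∈ A.nerve n) : tenMap F n x ∈ A'.nerve n := by
  revert x
  change A.nerve n ≤ (A'.nerve n).comap (tenMap F n)
  refine nerve_le fun Y a h => ?_
  rw [Submodule.mem_comap, tenMap_tprod]
  exact tprod_mem_nerve (h.map F)

lemma tenMap_tau {n : ℕ} (x : A.Ten n) : tenMap F n (A.tau n x) = A'.tau n (tenMap F n x) := by
  have h : tenMap F n ∘ₗ A.tau n = A'.tau n ∘ₗ tenMap F n := by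
    refine PiTensorProduct.ext (MultilinearMap.ext fun a => ?_)
    simp only [LinearMap.compMultilinearMap_apply, LinearMap.comp_apply]
    rw [tau_tprod, tenMap_tprod, tau_tprod, map_add, tenMap_tprod, tenMap_tprod]
    congr 2 <;> funext i <;> simp only [rot] <;> split_ifs <;>
      simp only [totMap_ev, totMap_od, totMap_par]
  exact LinearMap.congr_fun h x

lemma tenMap_innerFace {n : ℕ} (j : Fin (n + 1)) {x : A.Ten (n + 1)} (hx : x ∈ A.nerve (n + 1)) :
    tenMap F n (A.innerFace n j x) = A'.innerFace n j (tenMap F (n + 1) x) := by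
  revert x
  change A.nerve (n + 1) ≤ LinearMap.eqLocus (tenMap F n ∘ₗ A.innerFace n j)
    (A'.innerFace n j ∘ₗ tenMap F (n + 1))
  refine nerve_le fun Y a h => ?_
  rw [LinearMap.mem_eqLocus, LinearMap.comp_apply, LinearMap.comp_apply, innerFace_tprod,
    tenMap_tprod, tenMap_tprod, innerFace_tprod]
  congr 1
  funext i
  simp only [Fin.contractNth]
  split_ifs
  · rfl
  · have h1 := h i.castSucc
    have h2 := h i.succ
    rw [Fin.coeSucc_eq_succ] at h1
    obtain ⟨f, hf⟩ := h1
    obtain ⟨g, hg⟩ := h2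
    rw [hf, hg, totMul_comp, totMap_inc, totMap_inc, totMap_inc, totMul_comp,
      CategoryTheory.Functor.map_comp]
  · rfl

lemma tenMap_extra {n : ℕ} {x : A.Ten n} (hx : x ∈ A.nerve n) :
    tenMap F (n + 1) (A.extra n x) = A'.extra n (tenMap F n x) := by
  revert x
  change A.nerve n ≤ LinearMap.eqLocus (tenMap F (n + 1) ∘ₗ A.extra n)
    (A'.extra n ∘ₗ tenMap F n)
  refine nerve_le fun Y a h => ?_
  obtain ⟨f, hf⟩ := h 0
  rw [LinearMap.mem_eqLocus, LinearMap.comp_apply, LinearMap.comp_apply, A.extra_tprod hf,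
    tenMap_tprod, tenMap_tprod,
    A'.extra_tprod (a := fun i => totMap F (a i)) (by rw [hf, totMap_inc])]
  congr 1
  funext i
  cases i using Fin.cases with
  | zero => rw [Fin.cons_zero, Fin.cons_zero, totMap_inc, CategoryTheory.Functor.map_id]
  | succ i => rw [Fin.cons_succ, Fin.cons_succ]

lemma tenMap_cyc {n : ℕ} (x : A.Ten n) : tenMap F n (A.cyc n x) = A'.cyc n (tenMap F n x) := by
  rw [cyc, cyc, LinearMap.smul_apply, LinearMap.smul_apply, map_smul, tenMap_tau]

lemma tenMap_nrm {n : ℕ} (x : A.Ten n) : tenMap F n (A.nrm n x) = A'.nrm n (tenMap F n x) := by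
  rw [nrm, nrm, LinearMap.sum_apply, LinearMap.sum_apply, map_sum]
  refine Finset.sum_congr rfl fun k hk => ?_
  clear hk
  induction k with
  | zero => rfl
  | succ k ih =>
    rw [pow_succ', pow_succ', Module.End.mul_apply, Module.End.mul_apply, tenMap_cyc, ih]

lemma tenMap_bd {n : ℕ} {x : A.Ten (n + 1)} (hx : x ∈ A.nerve (n + 1)) :
    tenMap F n (A.bd n x) = A'.bd n (tenMap F (n + 1) x) := by
  rw [bd, bd, LinearMap.sum_apply, LinearMap.sum_apply, map_sum]
  refine Finset.sum_congr rfl fun i _ => ?_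
  rw [LinearMap.smul_apply, LinearMap.smul_apply, map_smul]
  congr 1
  cases i using Fin.lastCases with
  | cast i => rw [face_castSucc, face_castSucc, tenMap_innerFace F i hx]
  | last =>
    rw [face_last, face_last, lastFace, lastFace, LinearMap.comp_apply, LinearMap.comp_apply,
      tenMap_innerFace F 0 (tau_mem hx), tenMap_tau]

lemma tenMap_connes {n : ℕ} {x : A.Ten n} (hx : x ∈ A.nerve n) :
    tenMap F (n + 1) (A.connes n x) = A'.connes n (tenMap F n x) := by
  simp only [connes, LinearMap.comp_apply, LinearMap.sub_apply, LinearMap.id_apply, map_sub,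
    tenMap_cyc, tenMap_extra F (nrm_mem hx), tenMap_nrm]

end Functoriality

variable {A A' : SuperCat.{w, u₁, v₁} K} (F : GradedFunctor A A')

/-- The morphism of mixed complexes induced by a graded functor. -/
def mixedMap : A.mixed.Hom A'.mixed where
  f n := (tenMap F n).restrict fun _ hx => tenMap_mem F hx
  comm_b _ := LinearMap.ext fun x => Subtype.ext (tenMap_bd F x.2)
  comm_B _ := LinearMap.ext fun x => Subtype.ext (tenMap_connes F x.2)

/-- The map `HC_n(A) → HC_n(A')` induced by a graded functor `A → A'`. -/
def mapHC (n : ℕ) : A.HC n →ₗ[K] A'.HC n := ((mixedMap F).mapHC n).hom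

/-! ## The Künneth terms -/

section Kunneth

variable (A : SuperCat.{w, u₁, v₁} K) (B : SuperCat.{w, u₂, v₂} K)

/-- `⊕_{p + q = n} HC_p(A) ⊗ HC_q(B)`. -/
abbrev HCTensor (n : ℕ) : Type (max u₁ v₁ u₂ v₂ w) :=
  ⨁ p : {p : ℕ × ℕ // p.1 + p.2 = n}, (A.HC p.1.1 ⊗[K] B.HC p.1.2)

/-- The inclusion of the summand `HC_p(A) ⊗ HC_q(B)` when `p + q = n` (and zero otherwise). -/
def hcIncl (n p q : ℕ) : (A.HC p ⊗[K] B.HC q) →ₗ[K] HCTensor A B n :=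
  if h : p + q = n then
    DirectSum.lof K {p : ℕ × ℕ // p.1 + p.2 = n} (fun p => A.HC p.1.1 ⊗[K] B.HC p.1.2) ⟨(p, q), h⟩
  else 0

/-- The restriction of `S ⊗ id` to the summand `HC_p(A) ⊗ HC_q(B)`. It vanishes for `p < 2`. -/
def leftPart (n : ℕ) : ∀ p q : ℕ, (A.HC p ⊗[K] B.HC q) →ₗ[K] HCTensor A B n
  | 0, _ => 0
  | 1, _ => 0
  | p + 2, q => hcIncl A B n p q ∘ₗ (A.S p).rTensor (B.HC q)

/-- The restriction of `id ⊗ S` to the summand `HC_p(A) ⊗ HC_q(B)`. It vanishes for `q < 2`. -/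
def rightPart (n p : ℕ) : ∀ q : ℕ, (A.HC p ⊗[K] B.HC q) →ₗ[K] HCTensor A B n
  | 0 => 0
  | 1 => 0
  | q + 2 => hcIncl A B n p q ∘ₗ (B.S q).lTensor (A.HC p)

/-- `S ⊗ id - id ⊗ S : ⊕_{p + q = n + 2} HC_p(A) ⊗ HC_q(B) → ⊕_{p + q = n} HC_p(A) ⊗ HC_q(B)`. -/
def sDiff (n : ℕ) : HCTensor A B (n + 2) →ₗ[K] HCTensor A B n :=
  DirectSum.toModule K _ _ fun p =>
    leftPart A B n p.1.1 p.1.2 - rightPart A B n p.1.1 p.1.2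

variable {A B} {A' : SuperCat.{w, u₁, v₁} K} {B' : SuperCat.{w, u₂, v₂} K}

/-- The map `⊕_{p + q = n} HC_p(F) ⊗ HC_q(G)`. -/
def mapHCTensor (F : GradedFunctor A A') (G : GradedFunctor B B') (n : ℕ) :
    HCTensor A B n →ₗ[K] HCTensor A' B' n :=
  DirectSum.lmap fun p => TensorProduct.map (mapHC F p.1.1) (mapHC G p.1.2)

end Kunneth

end SuperCat

end

/-!
The long exact sequence is that of a surjection of complexes: `S ⊗ 1 - 1 ⊗ S` is an endomorphism of
degree `-2` of the tensor product `C(𝒜) ⊗ C(ℬ)` of the cyclic complexes, it is surjective, and its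
kernel is quasi-isomorphic to `C(𝒜 ⊗ ℬ)`. Over a field the homology of `C(𝒜) ⊗ C(ℬ)` is
`HC(𝒜) ⊗ HC(ℬ)` (`isHomology_dbl`), and `Gysin` gives the sequence. All the work is in the
quasi-isomorphism, which has to be natural.

The nerve of `𝒜` is a cyclic module (`nerveL`). It is convenient to view a loop of `n + 1`
homogeneous morphisms as a periodic diagram on `ℤ` (`Loop`); the simplicial operators and the
rotations then act by composition with the monotone maps `f : ℤ → ℤ` with
`f (i + m + 1) = f i + n + 1` (`LHom`), which are the morphisms of the paracyclic category. The
nerve of `𝒜 ⊗ ℬ` is the diagonal tensor product of the nerves of `𝒜` and of `ℬ`: the isomorphism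
`unshuffle` sorts the factors of an elementary tensor with the Koszul sign and commutes with all
operators.

By the Eilenberg–Zilber theorem (`SMod.coneExact`), the Alexander–Whitney map
`g₀ : (X × Y, b) → (X ⊗ Y, b)` from the diagonal is a quasi-isomorphism for all simplicial modules.
It does not commute with the operators `B`, but there are natural maps `g_l` of degree `2l` with
`[b, g_{l+1}] = g_l B - B g_l` (`CyclicAW`, `nerveAW`). They define a chain map from the cyclic
complex of the diagonal to the kernel of `S ⊗ 1 - 1 ⊗ S`, which can be described as
`(X ⊗ Y)[u⁻¹]` with the differential `b + B`, where `u⁻¹` has degree two. Filtering by powers of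
`u⁻¹`, this map is a quasi-isomorphism because `g₀` is; this is `CyclicAW.gysin`.

The maps `g_l` come from acyclic models. A natural operation on the diagonal of degree `n` is given
by its value on the pair of generators of two free modules, so that `g_{l+1}` can be constructed one
degree at a time if the cycles that arise are boundaries in the tensor square of a free module.
Free cyclic modules are not acyclic: they have the homology of a circle, and their tensor squares
are exact only in degrees at least three (`bar_exact`). This suffices for all `g_l` with `l ≥ 2`
but not for `g₁`, where the obstruction has degree `n + 1`. The remedy is to construct `g₁` for all
paracyclic modules, in which the `(n + 1)`-st power of the rotation need not be the identity: free
paracyclic modules are acyclic in positive degrees (`free_exact`). Cyclic modules are needed for the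
higher corrections, because `B ∘ B = 0` only holds there. `LMod.exists_universal` combines the two
steps.

Every map involved is natural in `𝒜` and `ℬ` (`map_nerveAW`), hence so is the sequence.
-/

universe y z

noncomputable section

namespace CyclicKunneth

section

/-! ### Simplicial modules -/

/-- A simplicial `K`-module, given by its faces `d` and degeneracies `s`. Only the identities
between two faces and between a face and a degeneracy are recorded. The indices of faces and
degeneracies are natural numbers; out of range they carry no information. -/
structure SMod (K : Type w) [Field K] where
  obj : ℕ → Type x
  [acg : ∀ n, AddCommGroup (obj n)]
  [mod : ∀ n, Module K (obj n)]
  d (n : ℕ) (i : ℕ) : obj (n + 1) →ₗ[K] obj n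
  s (n : ℕ) (j : ℕ) : obj n →ₗ[K] obj (n + 1)
  d_d (n i j : ℕ) (hij : i ≤ j) (hj : j ≤ n + 1) (x : obj (n + 2)) :
    d n i (d (n + 1) (j + 1) x) = d n j (d (n + 1) i x)
  d_s_self (n j : ℕ) (hj : j ≤ n) (x : obj n) : d n j (s n j x) = x
  d_succ_s (n j : ℕ) (hj : j ≤ n) (x : obj n) : d n (j + 1) (s n j x) = x
  d_s_lt (n i j : ℕ) (hij : i ≤ j) (hj : j ≤ n) (x : obj (n + 1)) :
    d (n + 1) i (s (n + 1) (j + 1) x) = s n j (d n i x)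
  d_s_gt (n i j : ℕ) (hij : j < i) (hi : i ≤ n + 1) (x : obj (n + 1)) :
    d (n + 1) (i + 1) (s (n + 1) j x) = s n j (d n i x)

attribute [instance] SMod.acg SMod.mod

namespace SMod

variable {K : Type w} [Field K] (X : SMod.{w, x} K)

/-- The alternating sum of all faces. -/
def bd (n : ℕ) : X.obj (n + 1) →ₗ[K] X.obj n :=
  ∑ i ∈ Finset.range (n + 2), (-1 : K) ^ i • X.d n i

lemma bd_apply (n : ℕ) (x : X.obj (n + 1)) :
    X.bd n x = ∑ i ∈ Finset.range (n + 2), (-1 : K) ^ i • X.d n i x := by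
  simp [bd]

lemma bd_bd (n : ℕ) (x : X.obj (n + 2)) : X.bd n (X.bd (n + 1) x) = 0 := by
  -- the involution `(i, j) ↔ (j - 1, i)`, for `i < j`, pairs terms of opposite signs
  simp only [bd_apply, map_sum, map_smul, Finset.smul_sum, smul_smul]
  rw [Finset.sum_comm]
  rw [← Finset.sum_product' (f := fun i j => ((-1 : K) ^ j * (-1) ^ i) • X.d n i (X.d (n + 1) j x))]
  refine Finset.sum_involution
    (fun p _ => if p.1 < p.2 then (p.2 - 1, p.1) else (p.2, p.1 + 1)) ?_ ?_ ?_ ?_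
  · rintro ⟨i, j⟩ hp
    simp only [Finset.mem_product, Finset.mem_range] at hp
    by_cases h : i < j
    · obtain ⟨j, rfl⟩ : ∃ k, j = k + 1 := ⟨j - 1, by omega⟩
      simp only [h, if_true, Nat.add_sub_cancel]
      rw [X.d_d n i j (by omega) (by omega), ← add_smul, pow_succ]
      ring_nf
      simp
    · simp only [h, if_false]
      rw [X.d_d n j i (by omega) (by omega), ← add_smul, pow_succ]
      ring_nf
      simp
  · rintro ⟨i, j⟩ hp _ h
    by_cases h' : i < j <;> simp only [h', if_true, if_false, Prod.mk.injEq] at h <;> omega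
  · rintro ⟨i, j⟩ hp
    simp only [Finset.mem_product, Finset.mem_range] at hp ⊢
    split_ifs <;> simp only <;> omega
  · rintro ⟨i, j⟩ hp
    by_cases h : i < j
    · simp only [h, if_true]
      rw [if_neg (by omega)]
      ext <;> simp only; omega
    · simp only [h, if_false]
      rw [if_pos (by omega)]
      ext <;> simp

end SMod

/-! ### The paracyclic category -/

/-- A morphism `[m] → [n]` of the paracyclic category: a monotone map `f : ℤ → ℤ` such that
`f (i + (m + 1)) = f i + (n + 1)`. -/
structure LHom (m n : ℕ) where
  toFun : ℤ → ℤ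
  mono : Monotone toFun
  per (i : ℤ) : toFun (i + (m + 1)) = toFun i + (n + 1)

namespace LHom

variable {m n p : ℕ}

instance : CoeFun (LHom m n) fun _ => ℤ → ℤ := ⟨toFun⟩

lemma ext' {f g : LHom m n} (h : ∀ i, f i = g i) : f = g := by
  cases f; cases g; congr; exact funext h

lemma per_mul (f : LHom m n) (i k : ℤ) : f (i + (m + 1) * k) = f i + (n + 1) * k := by
  induction k using Int.induction_on with
  | zero => simp
  | succ k ih =>
    rw [show i + (m + 1) * ((k : ℤ) + 1) = i + (m + 1) * k + (m + 1) by ring, f.per, ih]; ring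
  | pred k ih =>
    have := f.per (i + (m + 1) * (-(k : ℤ) - 1))
    rw [show i + (m + 1) * (-(k : ℤ) - 1) + (m + 1) = i + (m + 1) * -k by ring, ih] at this
    linarith

/-- By periodicity, a morphism is determined by its values on `m + 1` consecutive integers. -/
lemma ext_window (a : ℤ) {f g : LHom m n} (h : ∀ i, a ≤ i → i ≤ a + m → f i = g i) : f = g := by
  refine ext' fun i => ?_
  have hm : (0 : ℤ) < m + 1 := by positivity
  have h1 := Int.emod_add_mul_ediv (i - a) (m + 1)
  have h2 := Int.emod_nonneg (i - a) hm.ne'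
  have h3 := Int.emod_lt_of_pos (i - a) hm
  rw [show i = (a + (i - a) % (m + 1)) + (m + 1) * ((i - a) / (m + 1)) by linarith, f.per_mul,
    g.per_mul, h _ (by linarith) (by linarith)]

/-- The identity. -/
protected def id (n : ℕ) : LHom n n := ⟨fun i => i, monotone_id, fun _ => rfl⟩

/-- The composite `f ∘ g`. -/
def comp (f : LHom n p) (g : LHom m n) : LHom m p :=
  ⟨fun i => f (g i), f.mono.comp g.mono, fun i => by rw [g.per, f.per]⟩

@[simp] lemma id_apply (i : ℤ) : LHom.id n i = i := rfl
@[simp] lemma comp_apply (f : LHom n p) (g : LHom m n) (i : ℤ) : f.comp g i = f (g i) := rfl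

/-- The periodic extension of a function on the window `1 ≤ i ≤ m + 1`. -/
def ofWindow (v : ℤ → ℤ) (hv : ∀ i j : ℤ, 1 ≤ i → i ≤ j → j ≤ m + 1 → v i ≤ v j)
    (hm : v (m + 1) ≤ v 1 + (n + 1)) : LHom m n where
  toFun i := v ((i - 1) % (m + 1) + 1) + (n + 1) * ((i - 1) / (m + 1))
  mono := by
    refine monotone_int_of_le_succ fun i => ?_
    have hm0 : (0 : ℤ) < m + 1 := by positivity
    have h1 := Int.emod_add_mul_ediv (i - 1) (m + 1)
    have h2 := Int.emod_nonneg (i - 1) hm0.ne'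
    have h3 := Int.emod_lt_of_pos (i - 1) hm0
    set r := (i - 1) % (m + 1)
    set k := (i - 1) / (m + 1)
    by_cases h : r < m
    · have h4 : (i + 1 - 1) % (m + 1) = r + 1 := by
        rw [show i + 1 - 1 = (r + 1) + (m + 1) * k by linarith, Int.add_mul_emod_self_left,
          Int.emod_eq_of_lt (by linarith) (by linarith)]
      have h5 : (i + 1 - 1) / (m + 1) = k := by
        rw [show i + 1 - 1 = (r + 1) + (m + 1) * k by linarith,
          Int.add_mul_ediv_left _ _ hm0.ne', Int.ediv_eq_zero_of_lt (by linarith) (by linarith)]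
        simp
      rw [h4, h5]
      linarith [hv (r + 1) (r + 1 + 1) (by linarith) (by linarith) (by linarith)]
    · have h4 : r = m := by linarith
      have h6 : (i + 1 - 1) % (m + 1) = 0 := by
        rw [show i + 1 - 1 = (m + 1) * (k + 1) by rw [h4] at h1; linarith, Int.mul_emod_right]
      have h5 : (i + 1 - 1) / (m + 1) = k + 1 := by
        rw [show i + 1 - 1 = (m + 1) * (k + 1) by rw [h4] at h1; linarith,
          Int.mul_ediv_cancel_left _ hm0.ne']
      rw [h6, h5, h4]
      simp only [zero_add]
      linarith
  per i := by
    have hm0 : (0 : ℤ) < m + 1 := by positivity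
    rw [show i + (m + 1 : ℤ) - 1 = (i - 1) + (m + 1) * 1 by ring, Int.add_mul_emod_self_left,
      Int.add_mul_ediv_left _ _ hm0.ne']
    ring

lemma ofWindow_apply {v : ℤ → ℤ} (hv : ∀ i j : ℤ, 1 ≤ i → i ≤ j → j ≤ m + 1 → v i ≤ v j)
    (hm : v (m + 1) ≤ v 1 + (n + 1)) {i : ℤ} (h1 : 1 ≤ i) (h2 : i ≤ m + 1) :
    (ofWindow v hv hm : LHom m n) i = v i := by
  have hm0 : (0 : ℤ) < m + 1 := by positivity
  change v ((i - 1) % (m + 1) + 1) + (n + 1) * ((i - 1) / (m + 1)) = v i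
  rw [Int.emod_eq_of_lt (by linarith) (by linarith),
    Int.ediv_eq_zero_of_lt (by linarith) (by linarith)]
  simp

/-- A morphism `f : [m] → [n]` is thought of as the simplex with vertices
`f 1 ≤ f 2 ≤ ⋯ ≤ f (m + 1)`; composition with `δ i` deletes the vertex `f (i + 1)`. -/
def δ (m i : ℕ) : LHom m (m + 1) :=
  ofWindow (fun x => if x ≤ i then x else x + 1) (fun i j _ _ _ => by split_ifs <;> omega)
    (by split_ifs <;> push_cast <;> omega)

/-- Composition with `σ j` doubles the vertex `f (j + 1)`. -/
def σ (m j : ℕ) : LHom (m + 1) m :=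
  ofWindow (fun x => if x ≤ j + 1 then x else x - 1) (fun i j _ _ _ => by split_ifs <;> omega)
    (by split_ifs <;> push_cast <;> omega)

/-- The extra degeneracy, which takes a simplex with vertices `f 1, …, f (m + 1)` to the one with
vertices `f 0, f 1, …, f (m + 1)`. -/
def ex (m : ℕ) : LHom (m + 1) m :=
  ofWindow (fun x => x - 1) (fun i j _ _ _ => by omega) (by push_cast; omega)

/-- The rotation. It has infinite order in the paracyclic category. -/
def τ (m : ℕ) : LHom m m := ⟨fun i => i - 1, fun _ _ h => by simpa using h, fun _ => by ring⟩

/-- The full turn `τ ^ (m + 1)`, which is central. The cyclic category is the quotient by it. -/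
def turn (m : ℕ) : LHom m m :=
  ⟨fun i => i - (m + 1), fun _ _ h => by simpa using h, fun _ => by ring⟩

lemma δ_apply {m i : ℕ} {x : ℤ} (h1 : 1 ≤ x) (h2 : x ≤ m + 1) :
    δ m i x = if x ≤ i then x else x + 1 := ofWindow_apply _ _ h1 h2

lemma δ_zero {m i : ℕ} : δ m i 0 = if (m + 1 : ℤ) ≤ i then -1 else 0 := by
  have h := (δ m i).per 0
  rw [zero_add, δ_apply (by omega) le_rfl] at h
  push_cast at h
  split_ifs at h ⊢ <;> omega

lemma σ_apply {m j : ℕ} {x : ℤ} (h1 : 1 ≤ x) (h2 : x ≤ m + 2) :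
    σ m j x = if x ≤ j + 1 then x else x - 1 :=
  ofWindow_apply _ _ h1 (by push_cast; omega)

lemma ex_apply {m : ℕ} {x : ℤ} (h1 : 1 ≤ x) (h2 : x ≤ m + 2) : ex m x = x - 1 :=
  ofWindow_apply _ _ h1 (by push_cast; omega)

@[simp] lemma τ_apply {m : ℕ} (x : ℤ) : τ m x = x - 1 := rfl

@[simp] lemma turn_apply {m : ℕ} (x : ℤ) : turn m x = x - (m + 1) := rfl

lemma comp_turn (f : LHom m n) : f.comp (turn m) = (turn n).comp f := by
  refine ext' fun i => ?_
  simp only [comp_apply, turn_apply]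
  have := f.per (i - (m + 1))
  rw [sub_add_cancel] at this
  linarith

lemma δ_comp_δ {m i j : ℕ} (hij : i ≤ j) :
    (δ (m + 1) (j + 1)).comp (δ m i) = (δ (m + 1) i).comp (δ m j) := by
  refine ext_window 1 fun x h1 h2 => ?_
  simp only [comp_apply]
  rw [δ_apply h1 (by omega), δ_apply h1 (by omega)]
  split_ifs <;> (repeat rw [δ_apply (by omega) (by push_cast; omega)]) <;> push_cast <;>
    split_ifs <;> omega

lemma σ_comp_δ_self {m j : ℕ} : (σ m j).comp (δ m j) = LHom.id m := by
  refine ext_window 1 fun x h1 h2 => ?_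
  simp only [comp_apply, id_apply]
  rw [δ_apply h1 (by omega)]
  split_ifs <;> rw [σ_apply (by omega) (by omega)] <;> split_ifs <;> omega

lemma σ_comp_δ_succ {m j : ℕ} : (σ m j).comp (δ m (j + 1)) = LHom.id m := by
  refine ext_window 1 fun x h1 h2 => ?_
  simp only [comp_apply, id_apply]
  rw [δ_apply h1 (by omega)]
  push_cast
  split_ifs <;> rw [σ_apply (by omega) (by omega)] <;> split_ifs <;> omega

lemma σ_comp_δ_lt {m i j : ℕ} (hij : i ≤ j) (hj : j ≤ m) :
    (σ (m + 1) (j + 1)).comp (δ (m + 1) i) = (δ m i).comp (σ m j) := by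
  refine ext_window 1 fun x h1 h2 => ?_
  simp only [comp_apply]
  push_cast at h2
  rw [δ_apply h1 (by push_cast; omega), σ_apply h1 (by omega)]
  split_ifs <;> rw [σ_apply (by omega) (by push_cast; omega), δ_apply (by omega) (by omega)] <;>
    push_cast <;> split_ifs <;> omega

lemma σ_comp_δ_gt {m i j : ℕ} (hij : j < i) (hi : i ≤ m + 1) :
    (σ (m + 1) j).comp (δ (m + 1) (i + 1)) = (δ m i).comp (σ m j) := by
  refine ext_window 1 fun x h1 h2 => ?_
  simp only [comp_apply]
  push_cast at h2
  rw [δ_apply h1 (by push_cast; omega), σ_apply h1 (by omega)]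
  push_cast
  split_ifs <;> rw [σ_apply (by omega) (by push_cast; omega), δ_apply (by omega) (by omega)] <;>
    split_ifs <;> omega

lemma ex_comp_δ_zero {m : ℕ} : (ex m).comp (δ m 0) = LHom.id m := by
  refine ext_window 1 fun x h1 h2 => ?_
  simp only [comp_apply, id_apply]
  rw [δ_apply h1 (by omega), if_neg (by push_cast; omega), ex_apply (by omega) (by omega)]
  omega

lemma ex_comp_δ_succ {m i : ℕ} (hi : i ≤ m) :
    (ex (m + 1)).comp (δ (m + 1) (i + 1)) = (δ m i).comp (ex m) := by
  refine ext_window 1 fun x h1 h2 => ?_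
  simp only [comp_apply]
  push_cast at h2
  rw [δ_apply h1 (by push_cast; omega), ex_apply h1 (by omega)]
  rcases eq_or_lt_of_le h1 with rfl | h1'
  · rw [if_pos (by push_cast; omega), ex_apply le_rfl (by push_cast; omega), sub_self, δ_zero,
      if_neg (by omega)]
  · rw [δ_apply (by omega) (by omega)]
    push_cast
    split_ifs <;> rw [ex_apply (by omega) (by push_cast; omega)] <;> omega

lemma τ_comp_δ_succ {m i : ℕ} (hi : i ≤ m) :
    (τ (m + 1)).comp (δ m (i + 1)) = (δ m i).comp (τ m) := by
  refine ext_window 1 fun x h1 h2 => ?_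
  simp only [comp_apply, τ_apply]
  rw [δ_apply h1 (by omega)]
  rcases eq_or_lt_of_le h1 with rfl | h1'
  · rw [if_pos (by push_cast; omega), sub_self, δ_zero, if_neg (by omega)]
  · rw [δ_apply (by omega) (by omega)]
    push_cast
    split_ifs <;> omega

lemma τ_comp_δ_zero {m : ℕ} : (τ (m + 1)).comp (δ m 0) = δ m (m + 1) := by
  refine ext_window 1 fun x h1 h2 => ?_
  simp only [comp_apply, τ_apply]
  rw [δ_apply h1 (by omega), δ_apply h1 (by omega), if_neg (by push_cast; omega),
    if_pos (by push_cast; omega)]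
  omega

end LHom

end

section

/-! ### Paracyclic modules -/

/-- A paracyclic module: a contravariant functor from the paracyclic category to vector spaces. -/
structure LMod (K : Type w) [Field K] where
  obj : ℕ → Type x
  [acg : ∀ n, AddCommGroup (obj n)]
  [mod : ∀ n, Module K (obj n)]
  act {m n : ℕ} (f : LHom m n) : obj n →ₗ[K] obj m
  act_id (n : ℕ) (x : obj n) : act (LHom.id n) x = x
  act_comp {m n p : ℕ} (f : LHom n p) (g : LHom m n) (x : obj p) :
    act (f.comp g) x = act g (act f x)

attribute [instance] LMod.acg LMod.mod

namespace LMod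

variable {K : Type w} [Field K] (X : LMod.{w, x} K)

/-- The underlying simplicial module. -/
abbrev toSMod : SMod.{w, x} K where
  obj := X.obj
  d n i := X.act (LHom.δ n i)
  s n j := X.act (LHom.σ n j)
  d_d n i j hij _ x := by rw [← act_comp, ← act_comp, LHom.δ_comp_δ hij]
  d_s_self n j _ x := by rw [← act_comp, LHom.σ_comp_δ_self, act_id]
  d_succ_s n j _ x := by rw [← act_comp, LHom.σ_comp_δ_succ, act_id]
  d_s_lt n i j hij hj x := by rw [← act_comp, ← act_comp, LHom.σ_comp_δ_lt hij hj]
  d_s_gt n i j hij hi x := by rw [← act_comp, ← act_comp, LHom.σ_comp_δ_gt hij hi]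

/-- The Hochschild boundary. -/
def b (n : ℕ) : X.obj (n + 1) →ₗ[K] X.obj n := X.toSMod.bd n

/-- The boundary without the last face. -/
def b' (n : ℕ) : X.obj (n + 1) →ₗ[K] X.obj n :=
  ∑ i ∈ Finset.range (n + 1), (-1 : K) ^ i • X.act (LHom.δ n i)

/-- The signed rotation. -/
def t (n : ℕ) : X.obj n →ₗ[K] X.obj n := (-1 : K) ^ n • X.act (LHom.τ n)

/-- The extra degeneracy. -/
def e (n : ℕ) : X.obj n →ₗ[K] X.obj (n + 1) := X.act (LHom.ex n)

/-- The norm operator `1 + t + ⋯ + tⁿ`. -/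
def N (n : ℕ) : X.obj n →ₗ[K] X.obj n := ∑ k ∈ Finset.range (n + 1), X.t n ^ k

/-- Connes' operator `(1 - t) e N`. -/
def B (n : ℕ) : X.obj n →ₗ[K] X.obj (n + 1) :=
  (LinearMap.id - X.t (n + 1)) ∘ₗ X.e n ∘ₗ X.N n

/-- The action of the full turn. -/
def T (n : ℕ) : X.obj n →ₗ[K] X.obj n := X.act (LHom.turn n)

/-- A cyclic module is a paracyclic module on which the full turn acts as the identity. -/
def IsCyclic : Prop := ∀ n (x : X.obj n), X.T n x = x

lemma b_apply (n : ℕ) (x : X.obj (n + 1)) :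
    X.b n x = ∑ i ∈ Finset.range (n + 2), (-1 : K) ^ i • X.act (LHom.δ n i) x :=
  X.toSMod.bd_apply n x

lemma b'_apply (n : ℕ) (x : X.obj (n + 1)) :
    X.b' n x = ∑ i ∈ Finset.range (n + 1), (-1 : K) ^ i • X.act (LHom.δ n i) x := by
  simp [b']

lemma t_apply (n : ℕ) (x : X.obj n) : X.t n x = (-1 : K) ^ n • X.act (LHom.τ n) x := rfl

lemma N_apply (n : ℕ) (x : X.obj n) : X.N n x = ∑ k ∈ Finset.range (n + 1), (X.t n ^ k) x := by
  simp [N]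

lemma B_apply (n : ℕ) (x : X.obj n) :
    X.B n x = X.e n (X.N n x) - X.t (n + 1) (X.e n (X.N n x)) := rfl

lemma b_b (n : ℕ) (x : X.obj (n + 2)) : X.b n (X.b (n + 1) x) = 0 := X.toSMod.bd_bd n x

lemma T_act {m n : ℕ} (f : LHom m n) (x : X.obj n) : X.T m (X.act f x) = X.act f (X.T n x) := by
  rw [T, T, ← act_comp, ← act_comp, LHom.comp_turn]

/-- A morphism of paracyclic modules, possibly between different universes. -/
structure Hom (X : LMod.{w, x} K) (Y : LMod.{w, y} K) where
  f (n : ℕ) : X.obj n →ₗ[K] Y.obj n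
  comm {m n : ℕ} (g : LHom m n) (x : X.obj n) : f m (X.act g x) = Y.act g (f n x)

section Hom

variable {X} {Y : LMod.{w, y} K} (φ : X.Hom Y)

lemma Hom.comm_b (n : ℕ) (x : X.obj (n + 1)) : φ.f n (X.b n x) = Y.b n (φ.f (n + 1) x) := by
  simp only [b_apply, map_sum, map_smul, φ.comm]

lemma Hom.comm_b' (n : ℕ) (x : X.obj (n + 1)) : φ.f n (X.b' n x) = Y.b' n (φ.f (n + 1) x) := by
  simp only [b'_apply, map_sum, map_smul, φ.comm]

lemma Hom.comm_t (n : ℕ) (x : X.obj n) : φ.f n (X.t n x) = Y.t n (φ.f n x) := by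
  simp only [t_apply, map_smul, φ.comm]

lemma Hom.comm_e (n : ℕ) (x : X.obj n) : φ.f (n + 1) (X.e n x) = Y.e n (φ.f n x) := φ.comm _ x

lemma Hom.comm_T (n : ℕ) (x : X.obj n) : φ.f n (X.T n x) = Y.T n (φ.f n x) := φ.comm _ x

lemma Hom.comm_N (n : ℕ) (x : X.obj n) : φ.f n (X.N n x) = Y.N n (φ.f n x) := by
  rw [N_apply, N_apply, map_sum]
  refine Finset.sum_congr rfl fun k hk => ?_
  clear hk
  induction k with
  | zero => rfl
  | succ k ih =>
    rw [pow_succ', pow_succ', Module.End.mul_apply, Module.End.mul_apply, φ.comm_t, ih]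

lemma Hom.comm_B (n : ℕ) (x : X.obj n) : φ.f (n + 1) (X.B n x) = Y.B n (φ.f n x) := by
  simp only [B_apply, map_sub, φ.comm_t, φ.comm_e, φ.comm_N]

end Hom

/-- The full turn as a natural endomorphism. -/
def turnHom : X.Hom X := ⟨X.T, fun g x => X.T_act g x⟩

/-- `b (1 - t) = (1 - t) b'`. -/
lemma b_one_sub_t (n : ℕ) (x : X.obj (n + 1)) :
    X.b n x - X.b n (X.t (n + 1) x) = X.b' n x - X.t n (X.b' n x) := by
  have h1 : X.b n x = X.b' n x + (-1 : K) ^ (n + 1) • X.act (LHom.δ n (n + 1)) x := by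
    rw [b_apply, b'_apply, Finset.sum_range_succ]
  have h2 : X.b n (X.t (n + 1) x) =
      (-1 : K) ^ (n + 1) • X.act (LHom.δ n (n + 1)) x + X.t n (X.b' n x) := by
    rw [b_apply, Finset.sum_range_succ', b'_apply, map_sum, add_comm, t_apply, pow_zero, one_smul,
      map_smul, ← act_comp, LHom.τ_comp_δ_zero]
    congr 1
    refine Finset.sum_congr rfl fun i hi => ?_
    rw [map_smul, map_smul, ← act_comp,
      LHom.τ_comp_δ_succ (Nat.lt_succ_iff.1 (Finset.mem_range.1 hi)), act_comp, t_apply, smul_smul,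
      smul_smul]
    congr 1
    ring
  rw [h1, h2]
  abel

lemma b'_e_zero (x : X.obj 0) : X.b' 0 (X.e 0 x) = x := by
  rw [b'_apply]
  simp [e, ← act_comp, LHom.ex_comp_δ_zero, act_id]

/-- The extra degeneracy contracts the complex with boundary `b'`. -/
lemma b'_e (n : ℕ) (x : X.obj (n + 1)) : X.b' (n + 1) (X.e (n + 1) x) + X.e n (X.b' n x) = x := by
  have h : ∀ i ∈ Finset.range (n + 1), (-1 : K) ^ (i + 1) •
      X.act (LHom.δ (n + 1) (i + 1)) (X.e (n + 1) x) =
        -X.e n ((-1 : K) ^ i • X.act (LHom.δ n i) x) := fun i hi => by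
    rw [e, ← act_comp, LHom.ex_comp_δ_succ (Nat.lt_succ_iff.1 (Finset.mem_range.1 hi)), act_comp,
      map_smul, e, pow_succ, mul_neg_one, neg_smul]
  have h0 : X.act (LHom.δ (n + 1) 0) (X.e (n + 1) x) = x := by
    rw [e, ← act_comp, LHom.ex_comp_δ_zero, act_id]
  rw [b'_apply, Finset.sum_range_succ', Finset.sum_congr rfl h, b'_apply, map_sum,
    Finset.sum_neg_distrib, pow_zero, one_smul, h0]
  abel

lemma act_τ_pow (n k : ℕ) (x : X.obj n) : (X.t n ^ k) x =
    (-1 : K) ^ (n * k) • X.act ⟨fun i => i - k, fun _ _ h => by simpa using h,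
      fun _ => by ring⟩ x := by
  induction k with
  | zero =>
    simp only [pow_zero, mul_zero, one_smul, Module.End.one_apply]
    conv_lhs => rw [← X.act_id n x]
    congr 2
    exact LHom.ext' fun i => by simp
  | succ k ih =>
    rw [pow_succ', Module.End.mul_apply, ih, map_smul, t_apply, smul_smul, ← act_comp, ← pow_add]
    congr 3
    exact LHom.ext' fun i => by simp only [LHom.comp_apply, LHom.τ_apply]; push_cast; ring

lemma t_pow_eq_T (n : ℕ) (x : X.obj n) : (X.t n ^ (n + 1)) x = X.T n x := by
  rw [act_τ_pow, Even.neg_one_pow (Nat.even_mul_succ_self n), one_smul, T]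
  simp only [Nat.cast_add, Nat.cast_one]
  rfl

lemma N_one_sub_t (n : ℕ) (x : X.obj n) : X.N n x - X.N n (X.t n x) = x - X.T n x := by
  rw [← t_pow_eq_T]
  have h : X.N n * (1 - X.t n) = 1 - X.t n ^ (n + 1) := geom_sum_mul_neg (X.t n) (n + 1)
  have := LinearMap.congr_fun h x
  simpa [Module.End.mul_apply] using this

lemma one_sub_t_N (n : ℕ) (x : X.obj n) : X.N n x - X.t n (X.N n x) = x - X.T n x := by
  rw [← t_pow_eq_T]
  have h : (1 - X.t n) * X.N n = 1 - X.t n ^ (n + 1) := mul_neg_geom_sum (X.t n) (n + 1)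
  have := LinearMap.congr_fun h x
  simpa [Module.End.mul_apply] using this

/-! ### Free paracyclic modules -/

variable (K) in
/-- The free paracyclic module on one generator of degree `n`. -/
def free (n : ℕ) : LMod.{w, w} K where
  obj m := LHom m n →₀ K
  act f := Finsupp.lmapDomain K K fun g => g.comp f
  act_id m x := Finsupp.mapDomain_id
  act_comp f g x := by
    simp only [Finsupp.lmapDomain_apply, ← Finsupp.mapDomain_comp]
    rfl

/-- The basis element of a free paracyclic module given by a morphism. -/
def sgl {m n : ℕ} (f : LHom m n) : (free K n).obj m := Finsupp.single f 1

variable (K) in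
/-- The canonical generator. -/
def gen (n : ℕ) : (free K n).obj n := sgl (LHom.id n)

lemma free_act_sgl {k m n : ℕ} (f : LHom k m) (g : LHom m n) :
    (free K n).act f (sgl g) = sgl (g.comp f) :=
  Finsupp.mapDomain_single

/-- The linear map on a free paracyclic module with given values on the basis elements. -/
def freeLift {m n : ℕ} {V : Type*} [AddCommGroup V] [Module K V] (φ : LHom m n → V) :
    (free K n).obj m →ₗ[K] V :=
  Finsupp.linearCombination K φ

@[simp] lemma freeLift_sgl {m n : ℕ} {V : Type*} [AddCommGroup V] [Module K V]
    (φ : LHom m n → V) (f : LHom m n) : freeLift φ (sgl (K := K) f) = φ f := by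
  refine (Finsupp.linearCombination_single K 1 f).trans ?_
  rw [one_smul]

lemma span_range_sgl (m n : ℕ) :
    Submodule.span K (Set.range fun f : LHom m n => sgl (K := K) f) = ⊤ := by
  have := Finsupp.basisSingleOne (R := K) (ι := LHom m n) |>.span_eq
  rw [Finsupp.coe_basisSingleOne] at this
  exact this

lemma free_induction {m n : ℕ} {p : (free K n).obj m → Prop} (z : (free K n).obj m) (h0 : p 0)
    (ha : ∀ x y, p x → p y → p (x + y)) (hc : ∀ (c : K) x, p x → p (c • x))
    (hs : ∀ f, p (sgl f)) : p z := by
  have hz : z ∈ Submodule.span K (Set.range fun f : LHom m n => sgl (K := K) f) := by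
    rw [span_range_sgl]; trivial
  refine Submodule.span_induction ?_ h0 (fun x y _ _ => ha x y) (fun c x _ => hc c x) hz
  rintro _ ⟨f, rfl⟩
  exact hs f

lemma free_ext {m n : ℕ} {V : Type*} [AddCommGroup V] [Module K V]
    {φ ψ : (free K n).obj m →ₗ[K] V} (h : ∀ f : LHom m n, φ (sgl f) = ψ (sgl f)) : φ = ψ :=
  LinearMap.ext fun z => free_induction (p := fun z => φ z = ψ z) z (by simp)
    (fun x y hx hy => by simp [hx, hy]) (fun c x hx => by simp [hx]) h

/-- The morphism from a free paracyclic module which sends the generator to `x`. -/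
def hat {n : ℕ} (x : X.obj n) : (free K n).Hom X where
  f m := freeLift fun f : LHom m n => X.act f x
  comm {m p} g y := by
    have : freeLift (fun f : LHom m n => X.act f x) ∘ₗ (free K n).act g =
        X.act g ∘ₗ freeLift (fun f : LHom p n => X.act f x) := by
      refine free_ext fun f => ?_
      rw [LinearMap.comp_apply, LinearMap.comp_apply, free_act_sgl, freeLift_sgl, freeLift_sgl,
        act_comp]
    exact LinearMap.congr_fun this y

lemma hat_gen {n : ℕ} (x : X.obj n) : (X.hat x).f n (gen K n) = x := by
  change freeLift _ (sgl (LHom.id n)) = x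
  rw [freeLift_sgl, act_id]

/-- If no orbit of an injective map `g` is finite, then a nonzero finitely supported function is not
a multiple of its own translate by `g`, as its support would be invariant under `g`. -/
lemma sub_mapDomain_injective {ι : Type*} (g : ι → ι)
    (hg : ∀ x, Function.Injective fun k : ℕ => g^[k] x)
    (hinj : Function.Injective g) (c : K) (hc : c ≠ 0) (z : ι →₀ K)
    (hz : z = c • Finsupp.mapDomain g z) : z = 0 := by
  by_contra h
  obtain ⟨x, hx⟩ := Finsupp.support_nonempty_iff.2 h
  have step : ∀ y ∈ z.support, g y ∈ z.support := fun y hy => by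
    rw [Finsupp.mem_support_iff] at hy ⊢
    rw [hz, Finsupp.smul_apply, Finsupp.mapDomain_apply hinj, smul_eq_mul]
    exact mul_ne_zero hc hy
  have all : ∀ k : ℕ, g^[k] x ∈ z.support := fun k => by
    induction k with
    | zero => exact hx
    | succ k ih => rw [Function.iterate_succ_apply']; exact step _ ih
  exact Set.infinite_of_injective_forall_mem (hg x) all z.support.finite_toSet

/-- A translation acts on the basis of a free paracyclic module without finite orbits, since a
morphism is unbounded; hence a multiple of it fixes only zero. -/
lemma free_shift_injective {m n : ℕ} (c : K) (hc : c ≠ 0) (r : LHom m m) (a : ℤ) (ha : 0 < a)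
    (hr : ∀ i, r i = i - a) (z : (free K n).obj m) (hz : z = c • (free K n).act r z) : z = 0 := by
  have hit : ∀ (k : ℕ) (f : LHom m n) (i : ℤ), ((fun g : LHom m n => g.comp r)^[k] f) i =
      f (i - k * a) := fun k => by
    induction k with
    | zero => simp
    | succ k ih =>
      intro f i
      rw [Function.iterate_succ_apply, ih, LHom.comp_apply, hr]
      congr 1
      push_cast
      ring
  have hm : (0 : ℤ) < m + 1 := by positivity
  have hn : (0 : ℤ) < n + 1 := by positivity
  -- a morphism with a period `(l - k) a > 0` would be bounded, contrary to `per_mul`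
  have key : ∀ (f : LHom m n) (k l : ℕ), k < l →
      (fun g : LHom m n => g.comp r)^[k] f ≠ (fun g : LHom m n => g.comp r)^[l] f := by
    intro f k l hkl h
    have h1 : ∀ i, f (i - k * a) = f (i - l * a) := fun i => by rw [← hit, ← hit, h]
    have h3 : ∀ j : ℕ, f (-(j * ((l - k) * a))) = f 0 := fun j => by
      induction j with
      | zero => simp
      | succ j ih =>
        rw [← ih]
        have := h1 (-(j * ((l - k) * a)) + k * a)
        rw [show -((j : ℤ) * ((l - k) * a)) + k * a - k * a = -(j * ((l - k) * a)) by ring] at this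
        rw [this]
        congr 1
        push_cast
        ring
    have h4 := h3 (m + 1)
    have h5 := f.per_mul 0 (-((l - k) * a))
    rw [show (0 : ℤ) + (m + 1) * -((l - k) * a) = -(((m + 1 : ℕ) : ℤ) * ((l - k) * a)) by
      push_cast; ring, h4] at h5
    have h6 : (0 : ℤ) < (l - k) * a := mul_pos (by omega) ha
    nlinarith
  refine sub_mapDomain_injective (fun g : LHom m n => g.comp r) (fun f k l h => ?_)
    (fun f g h => ?_) c hc z hz
  · rcases lt_trichotomy k l with h' | h' | h'
    · exact absurd h (key f k l h')
    · exact h'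
    · exact absurd h.symm (key f l k h')
  · refine LHom.ext' fun i => ?_
    have := congrArg (fun q : LHom m n => q (i + a)) h
    simpa [hr] using this

lemma free_t_injective {m n : ℕ} (z : (free K n).obj m) (hz : z = (free K n).t m z) : z = 0 :=
  free_shift_injective ((-1 : K) ^ m) (pow_ne_zero _ (by simp)) (LHom.τ m) 1 one_pos
    (fun _ => rfl) z hz

lemma free_T_injective {m n : ℕ} (z : (free K n).obj m) (hz : z = (free K n).T m z) : z = 0 :=
  free_shift_injective 1 one_ne_zero (LHom.turn m) (m + 1) (by positivity) (fun _ => rfl) z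
    (by rw [one_smul]; exact hz)

/-- On a free module, `b' N = N b` follows from the injectivity of `1 - t`; it then holds on
every paracyclic module. -/
lemma b'_N (n : ℕ) (x : X.obj (n + 1)) : X.b' n (X.N (n + 1) x) = X.N n (X.b n x) := by
  suffices h : ∀ y : (free K (n + 1)).obj (n + 1),
      (free K (n + 1)).b' n ((free K (n + 1)).N (n + 1) y) =
        (free K (n + 1)).N n ((free K (n + 1)).b n y) by
    have := congrArg ((X.hat x).f n) (h (gen K (n + 1)))
    simpa only [Hom.comm_b', Hom.comm_b, Hom.comm_N, hat_gen] using this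
  intro y
  rw [← sub_eq_zero]
  refine free_t_injective _ ?_
  rw [← sub_eq_zero, map_sub]
  have h1 := (free K (n + 1)).b_one_sub_t n ((free K (n + 1)).N (n + 1) y)
  rw [← map_sub, one_sub_t_N, map_sub] at h1
  have h2 := (free K (n + 1)).one_sub_t_N n ((free K (n + 1)).b n y)
  have h3 := (free K (n + 1)).turnHom.comm_b n y
  have h3' : (free K (n + 1)).T n ((free K (n + 1)).b n y) =
    (free K (n + 1)).b n ((free K (n + 1)).T (n + 1) y) := h3
  rw [h3'] at h2
  rw [sub_sub_sub_comm, ← h1, h2, sub_self]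

lemma b_B_zero (x : X.obj 0) : X.b 0 (X.B 0 x) = x - X.T 0 x := by
  rw [B_apply, map_sub, b_one_sub_t, b'_e_zero, one_sub_t_N]

/-- On a paracyclic module, `b` and `B` anticommute up to the deviation of the full turn from the
identity. -/
lemma b_B (n : ℕ) (x : X.obj (n + 1)) :
    X.b (n + 1) (X.B (n + 1) x) + X.B n (X.b n x) = x - X.T (n + 1) x := by
  have h := X.b'_e n (X.N (n + 1) x)
  rw [← one_sub_t_N, B_apply, map_sub, b_one_sub_t, B_apply, ← b'_N]
  conv_rhs => rw [← h]
  simp only [map_add]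
  abel

variable {X} in
lemma IsCyclic.B_B (hX : X.IsCyclic) (n : ℕ) (x : X.obj n) : X.B (n + 1) (X.B n x) = 0 := by
  have h : X.N (n + 1) (X.B n x) = 0 := by
    rw [B_apply, map_sub, N_one_sub_t, hX, sub_self]
  rw [B_apply, h, map_zero, map_zero, sub_self]

end LMod

end

section

/-! ### Acyclicity of the free paracyclic modules -/

namespace LHom

variable {m n : ℕ}

/-- The translation by an integer, as a morphism. -/
def shift (m : ℕ) (k : ℤ) : LHom m m :=
  ⟨fun i => i + k, fun _ _ h => by simpa using h, fun _ => by ring⟩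

@[simp] lemma shift_apply (k i : ℤ) : shift m k i = i + k := rfl

/-- The values of `f` are unbounded in both directions, so there is a last index at which `f` is
negative. -/
lemma exists_level (f : LHom m n) : ∃ k : ℤ, f k < 0 ∧ 0 ≤ f (k + 1) := by
  have h1 := f.per_mul 0 (|f 0|)
  have h2 := f.per_mul 0 (-(|f 0| + 1))
  have h3 := neg_abs_le (f 0)
  have h4 := le_abs_self (f 0)
  have h5 := abs_nonneg (f 0)
  have hn : (0 : ℤ) ≤ n := by positivity
  obtain ⟨k, hk, hk'⟩ := Int.exists_greatest_of_bdd (P := fun k => f k < 0)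
    ⟨0 + (m + 1) * |f 0|, fun k hk => by
      by_contra hlt
      have := f.mono (le_of_not_ge hlt)
      nlinarith⟩
    ⟨0 + (m + 1) * -(|f 0| + 1), by nlinarith⟩
  refine ⟨k, hk, ?_⟩
  by_contra hlt
  have := hk' (k + 1) (not_le.1 hlt)
  omega

/-- The last index at which `f` is negative. -/
def level (f : LHom m n) : ℤ := f.exists_level.choose

lemma level_spec (f : LHom m n) : f f.level < 0 ∧ 0 ≤ f (f.level + 1) := f.exists_level.choose_spec

lemma level_eq (f : LHom m n) {k : ℤ} (h1 : f k < 0) (h2 : 0 ≤ f (k + 1)) : f.level = k := by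
  obtain ⟨h3, h4⟩ := f.level_spec
  refine le_antisymm ?_ ?_ <;> by_contra h
  · have := f.mono (show k + 1 ≤ f.level by omega)
    omega
  · have := f.mono (show f.level + 1 ≤ k by omega)
    omega

/-- A simplex is normal if its vertices `f 1 ≤ ⋯ ≤ f (m + 1)` lie in `[0, n]`. -/
def Normal (f : LHom m n) : Prop := f 0 < 0 ∧ 0 ≤ f 1

lemma normal_shift_level (f : LHom m n) : (f.comp (shift m f.level)).Normal := by
  have h := f.level_spec
  simpa [Normal, add_comm] using h

lemma level_comp_τ (f : LHom m n) : (f.comp (τ m)).level = f.level + 1 := by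
  have h := f.level_spec
  exact level_eq _ (by simpa using h.1) (by simpa using h.2)

lemma Normal.comp_δ {f : LHom (m + 1) n} (hf : f.Normal) (i : ℕ) : (f.comp (δ m i)).Normal := by
  constructor
  · refine lt_of_le_of_lt (f.mono ?_) hf.1
    rw [δ_zero]
    split_ifs <;> omega
  · refine hf.2.trans (f.mono ?_)
    rw [δ_apply le_rfl (by omega)]
    split_ifs <;> omega

lemma Normal.bounds {f : LHom m n} (hf : f.Normal) {i : ℤ} (h1 : 1 ≤ i) (h2 : i ≤ m + 1) :
    0 ≤ f i ∧ f i ≤ n := by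
  refine ⟨hf.2.trans (f.mono h1), (f.mono h2).trans ?_⟩
  have := f.per 0
  rw [zero_add] at this
  have := hf.1
  omega

/-- The cone with vertex `0`. The simplex is clamped to `[0, n + 1]`, so that the cone is defined
without a normality assumption. -/
def cone (f : LHom m n) : LHom (m + 1) n :=
  ofWindow (fun i => if i ≤ 1 then 0 else max 0 (min (n + 1) (f (i - 1))))
    (fun i j _ h _ => by
      have : f (i - 1) ≤ f (j - 1) := f.mono (by omega)
      split_ifs <;> omega)
    (by push_cast; split_ifs <;> omega)

lemma Normal.cone_apply {f : LHom m n} (hf : f.Normal) {i : ℤ} (h1 : 1 ≤ i) (h2 : i ≤ m + 2) :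
    cone f i = if i ≤ 1 then 0 else f (i - 1) := by
  rw [cone, ofWindow_apply _ _ h1 (by push_cast; omega)]
  split_ifs with h
  · rfl
  · have := hf.bounds (i := i - 1) (by omega) (by omega)
    omega

lemma Normal.cone_comp_δ_zero {f : LHom m n} (hf : f.Normal) : f.cone.comp (δ m 0) = f := by
  refine ext_window 1 fun i h1 h2 => ?_
  rw [comp_apply, δ_apply h1 (by omega), if_neg (by push_cast; omega),
    hf.cone_apply (by omega) (by omega), if_neg (by omega)]
  simp

lemma Normal.cone_comp_δ_succ {f : LHom (m + 1) n} (hf : f.Normal) (i : ℕ) :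
    f.cone.comp (δ (m + 1) (i + 1)) = (f.comp (δ m i)).cone := by
  refine ext_window 1 fun x h1 h2 => ?_
  push_cast at h2
  rw [comp_apply, (hf.comp_δ i).cone_apply h1 (by omega), δ_apply h1 (by push_cast; omega)]
  rcases eq_or_lt_of_le h1 with rfl | h1'
  · rw [if_pos (by push_cast; omega), hf.cone_apply le_rfl (by push_cast; omega), if_pos le_rfl,
      if_pos le_rfl]
  · rw [if_neg (by omega : ¬ x ≤ 1), comp_apply, δ_apply (by omega) (by omega)]
    by_cases hx : x ≤ ((i + 1 : ℕ) : ℤ)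
    · rw [if_pos hx, hf.cone_apply h1 (by push_cast; omega), if_neg (by omega),
        if_pos (by push_cast at hx; omega)]
    · rw [if_neg hx, hf.cone_apply (by omega) (by push_cast; omega), if_neg (by omega),
        if_neg (by push_cast at hx; omega)]
      congr 1
      ring

end LHom

namespace LMod

variable {K : Type w} [Field K]

section Free

variable (n : ℕ)

variable (K) in
/-- The projection which rotates every simplex into its normal position. -/
def freeProj (m : ℕ) : (free K n).obj m →ₗ[K] (free K n).obj m :=
  freeLift fun f : LHom m n =>
    (((-1 : K) ^ m) ^ f.level) • sgl (f.comp (LHom.shift m f.level))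

variable (K) in
/-- Coning off with the vertex `0`. -/
def freeCone (m : ℕ) : (free K n).obj m →ₗ[K] (free K n).obj (m + 1) :=
  freeLift fun f => sgl f.cone

variable (K) in
/-- The combinations of normal simplices. -/
def freeNormal (m : ℕ) : Submodule K ((free K n).obj m) :=
  Submodule.span K {z | ∃ f : LHom m n, f.Normal ∧ sgl f = z}

lemma sgl_mem_freeNormal {m : ℕ} {f : LHom m n} (hf : f.Normal) : sgl f ∈ freeNormal K n m :=
  Submodule.subset_span ⟨f, hf, rfl⟩

lemma freeNormal_le {m : ℕ} {P : Submodule K ((free K n).obj m)}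
    (h : ∀ f : LHom m n, f.Normal → sgl f ∈ P) : freeNormal K n m ≤ P :=
  Submodule.span_le.2 fun _ ⟨f, hf, hz⟩ => hz ▸ h f hf

lemma freeProj_mem {m : ℕ} (z : (free K n).obj m) : freeProj K n m z ∈ freeNormal K n m := by
  refine free_induction (p := fun z => freeProj K n m z ∈ freeNormal K n m) z (by simp)
    (fun x y hx hy => by rw [map_add]; exact add_mem hx hy)
    (fun c x hx => by rw [map_smul]; exact Submodule.smul_mem _ _ hx) fun f => ?_
  rw [freeProj, freeLift_sgl]
  exact Submodule.smul_mem _ _ (sgl_mem_freeNormal n f.normal_shift_level)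

lemma freeProj_of_mem {m : ℕ} {z : (free K n).obj m} (hz : z ∈ freeNormal K n m) :
    freeProj K n m z = z := by
  refine freeNormal_le n (P := LinearMap.eqLocus (freeProj K n m) LinearMap.id)
    (fun f hf => ?_) hz
  have h0 : f.level = 0 := f.level_eq hf.1 hf.2
  have h1 : f.comp (LHom.shift m 0) = f := LHom.ext' fun i => by simp
  rw [LinearMap.mem_eqLocus, freeProj, freeLift_sgl, h0, h1, zpow_zero, one_smul,
    LinearMap.id_apply]

lemma free_t_sgl {m : ℕ} (f : LHom m n) :
    (free K n).t m (sgl f) = (-1 : K) ^ m • sgl (f.comp (LHom.τ m)) := by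
  rw [t_apply, free_act_sgl]

lemma neg_one_pow_mul_self (m : ℕ) : (-1 : K) ^ m * (-1) ^ m = 1 := by
  rw [← mul_pow]; simp

lemma freeProj_t {m : ℕ} (z : (free K n).obj m) :
    freeProj K n m ((free K n).t m z) = freeProj K n m z := by
  have : freeProj K n m ∘ₗ (free K n).t m = freeProj K n m := by
    refine free_ext fun f => ?_
    have h1 : (f.comp (LHom.τ m)).comp (LHom.shift m (f.level + 1)) =
        f.comp (LHom.shift m f.level) := LHom.ext' fun i => by
      simp only [LHom.comp_apply, LHom.τ_apply, LHom.shift_apply]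
      congr 1
      ring
    rw [LinearMap.comp_apply, free_t_sgl, map_smul, freeProj, freeLift_sgl, freeLift_sgl,
      LHom.level_comp_τ, h1, smul_smul, zpow_add₀ (by simp), zpow_one]
    congr 1
    linear_combination (((-1 : K) ^ m) ^ f.level) * neg_one_pow_mul_self (K := K) m
  exact LinearMap.congr_fun this z

/-- Rotating a simplex into its normal position changes it by an element of the image of `1 - t`. -/
lemma sub_freeProj {m : ℕ} (z : (free K n).obj m) :
    ∃ y, z - freeProj K n m z = y - (free K n).t m y := by
  refine free_induction
    (p := fun z => ∃ y, z - freeProj K n m z = y - (free K n).t m y) z ⟨0, by simp⟩ ?_ ?_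
    fun f => ?_
  · rintro x y ⟨x', hx⟩ ⟨y', hy⟩
    refine ⟨x' + y', ?_⟩
    rw [map_add, map_add, add_sub_add_comm, hx, hy, add_sub_add_comm]
  · rintro c x ⟨y, hy⟩
    exact ⟨c • y, by rw [map_smul, map_smul, ← smul_sub, hy, smul_sub]⟩
  · let g : ℤ → (free K n).obj m := fun k =>
      (((-1 : K) ^ m) ^ k) • sgl (f.comp (LHom.shift m k))
    have step : ∀ k, (free K n).t m (g (k + 1)) = g k := fun k => by
      have h1 : (f.comp (LHom.shift m (k + 1))).comp (LHom.τ m) = f.comp (LHom.shift m k) :=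
        LHom.ext' fun i => by
          simp only [LHom.comp_apply, LHom.τ_apply, LHom.shift_apply]
          congr 1
          ring
      simp only [g]
      rw [map_smul, free_t_sgl, h1, smul_smul, zpow_add₀ (by simp), zpow_one]
      congr 1
      linear_combination (((-1 : K) ^ m) ^ k) * neg_one_pow_mul_self (K := K) m
    have all : ∀ k, ∃ y, g 0 - g k = y - (free K n).t m y := fun k => by
      induction k using Int.induction_on with
      | zero => exact ⟨0, by simp⟩
      | succ k ih =>
        obtain ⟨y, hy⟩ := ih
        refine ⟨y - g (k + 1), ?_⟩
        rw [map_sub, step, sub_sub_sub_comm, ← hy]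
        abel
      | pred k ih =>
        obtain ⟨y, hy⟩ := ih
        have := step (-k - 1)
        rw [sub_add_cancel] at this
        refine ⟨y + g (-k), ?_⟩
        rw [map_add, this, add_sub_add_comm, ← hy]
        abel
    obtain ⟨y, hy⟩ := all f.level
    refine ⟨y, ?_⟩
    have h1 : f.comp (LHom.shift m 0) = f := LHom.ext' fun i => by simp
    rw [← hy, freeProj, freeLift_sgl]
    simp only [g, h1, zpow_zero, one_smul]

lemma b_mem_freeNormal {m : ℕ} {z : (free K n).obj (m + 1)}
    (hz : z ∈ freeNormal K n (m + 1)) : (free K n).b m z ∈ freeNormal K n m := by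
  refine freeNormal_le n (P := (freeNormal K n m).comap ((free K n).b m)) (fun f hf => ?_) hz
  rw [Submodule.mem_comap, b_apply]
  refine Submodule.sum_mem _ fun i _ => Submodule.smul_mem _ _ ?_
  rw [free_act_sgl]
  exact sgl_mem_freeNormal n (hf.comp_δ i)

/-- Coning off contracts the complex of normal simplices in positive degrees. -/
lemma b_freeCone {m : ℕ} {z : (free K n).obj (m + 1)} (hz : z ∈ freeNormal K n (m + 1)) :
    (free K n).b (m + 1) (freeCone K n (m + 1) z) + freeCone K n m ((free K n).b m z) = z := by
  refine freeNormal_le n (P := LinearMap.eqLocus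
    ((free K n).b (m + 1) ∘ₗ freeCone K n (m + 1) + freeCone K n m ∘ₗ (free K n).b m)
    LinearMap.id) (fun f hf => ?_) hz
  rw [LinearMap.mem_eqLocus, LinearMap.add_apply, LinearMap.comp_apply, LinearMap.comp_apply,
    LinearMap.id_apply, b_apply, b_apply, Finset.sum_range_succ', map_sum, freeCone, freeLift_sgl,
    free_act_sgl, hf.cone_comp_δ_zero, pow_zero, one_smul, add_right_comm,
    ← Finset.sum_add_distrib]
  convert zero_add _
  refine Finset.sum_eq_zero fun i _ => ?_
  rw [map_smul, free_act_sgl, free_act_sgl, freeCone, freeLift_sgl, hf.cone_comp_δ_succ, pow_succ]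
  simp

/-- The Hochschild complex of a free paracyclic module is exact in positive degrees. Modulo the
image of `1 - t`, which is a copy of the acyclic complex with boundary `b'`, it is spanned by the
simplices with vertices in `[0, n]`, and these form a cone. -/
theorem free_exact {m : ℕ} {z : (free K n).obj (m + 1)} (hz : (free K n).b m z = 0) :
    ∃ y, (free K n).b (m + 1) y = z := by
  -- `z = p + (1 - t) y`, where `p` is a combination of normal simplices; both terms are cycles
  obtain ⟨y, hy⟩ := sub_freeProj n z
  have h1 : (free K n).b m (z - freeProj K n (m + 1) z) =
      (free K n).b' m y - (free K n).t m ((free K n).b' m y) := by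
    rw [hy, map_sub, b_one_sub_t]
  have h2 : (free K n).b m (freeProj K n (m + 1) z) = 0 := by
    have h3 := freeProj_of_mem n (b_mem_freeNormal n (freeProj_mem n z))
    have h4 := congrArg (freeProj K n m) h1
    rw [map_sub, hz, zero_sub, map_neg, map_sub, freeProj_t, sub_self, h3, neg_eq_zero] at h4
    exact h4
  rw [map_sub, hz, h2, sub_zero] at h1
  -- `1 - t` is injective, so `b' y = 0`, and `y` is the `b'`-boundary of its extra degeneracy
  have h5 := free_t_injective _ (sub_eq_zero.1 h1.symm)
  have h6 := (free K n).b'_e m y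
  rw [h5, map_zero, add_zero] at h6
  have h7 := b_freeCone n (freeProj_mem n z)
  rw [h2, map_zero, add_zero] at h7
  refine ⟨freeCone K n (m + 1) (freeProj K n (m + 1) z) +
    ((free K n).e (m + 1) y - (free K n).t _ ((free K n).e (m + 1) y)), ?_⟩
  rw [map_add, h7, map_sub, b_one_sub_t, h6, ← hy]
  abel

end Free

/-! ### Free cyclic modules -/

variable (K) in
/-- The free cyclic module on one generator of degree `n`. -/
def bar (n : ℕ) : LMod.{w, w} K where
  obj m := (free K n).obj m ⧸ LinearMap.range (LinearMap.id - (free K n).T m)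
  act {m p} f := Submodule.mapQ _ _ ((free K n).act f) (by
    rintro _ ⟨y, rfl⟩
    exact ⟨(free K n).act f y, by simp [T_act]⟩)
  act_id m x := by
    obtain ⟨x, rfl⟩ := Submodule.mkQ_surjective _ x
    simp [act_id]
  act_comp f g x := by
    obtain ⟨x, rfl⟩ := Submodule.mkQ_surjective _ x
    simp [act_comp]

variable (K) in
/-- The projection from the free paracyclic to the free cyclic module. -/
def barMk (n : ℕ) : (free K n).Hom (bar K n) := ⟨fun _ => Submodule.mkQ _, fun _ _ => rfl⟩

lemma barMk_surjective (n m : ℕ) : Function.Surjective ((barMk K n).f m) :=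
  Submodule.mkQ_surjective _

lemma barMk_eq_zero {n m : ℕ} {x : (free K n).obj m} (h : (barMk K n).f m x = 0) :
    ∃ y, y - (free K n).T m y = x :=
  (Submodule.Quotient.mk_eq_zero _).1 h

lemma barMk_T {n m : ℕ} (x : (free K n).obj m) :
    (barMk K n).f m ((free K n).T m x) = (barMk K n).f m x := by
  refine ((Submodule.Quotient.eq _).2 ⟨-x, ?_⟩)
  simp
  abel

lemma bar_isCyclic (n : ℕ) : (bar K n).IsCyclic := fun m x => by
  obtain ⟨x, rfl⟩ := barMk_surjective n m x
  rw [← Hom.comm_T, barMk_T]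

/-- The morphism from a free cyclic module which sends the generator to `x`. -/
def IsCyclic.hat {X : LMod.{w, x} K} (hX : X.IsCyclic) {n : ℕ} (x : X.obj n) :
    (bar K n).Hom X where
  f m := Submodule.liftQ _ ((X.hat x).f m) (by
    rintro _ ⟨y, rfl⟩
    rw [LinearMap.mem_ker, LinearMap.sub_apply, map_sub, Hom.comm_T, hX, LinearMap.id_apply,
      sub_self])
  comm g y := by
    obtain ⟨y, rfl⟩ := barMk_surjective n _ y
    exact (X.hat x).comm g y

/-- The Hochschild complex of a free cyclic module is exact in degrees at least two. The quotient of
the free paracyclic module by the injective chain map `1 - T` can only acquire homology in one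
degree more. -/
theorem bar_exact (n : ℕ) {m : ℕ} {z : (bar K n).obj (m + 2)} (hz : (bar K n).b (m + 1) z = 0) :
    ∃ y, (bar K n).b (m + 2) y = z := by
  obtain ⟨z, rfl⟩ := barMk_surjective n _ z
  rw [← Hom.comm_b] at hz
  -- the boundary of a lift of the cycle is `(1 - T) u`, where `u` is again a cycle
  obtain ⟨u, hu⟩ := barMk_eq_zero hz
  have hT : ∀ (k : ℕ) (x : (free K n).obj (k + 1)),
      (free K n).T k ((free K n).b k x) = (free K n).b k ((free K n).T (k + 1) x) :=
    fun k x => (free K n).turnHom.comm_b k x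
  have h1 : (free K n).b m u = 0 := by
    refine free_T_injective _ (sub_eq_zero.1 ?_)
    rw [hT, ← map_sub, hu, b_b]
  obtain ⟨v, hv⟩ := free_exact n h1
  have h2 : (free K n).b (m + 1) (z - (v - (free K n).T _ v)) = 0 := by
    rw [map_sub, map_sub, ← hT, hv, hu, sub_self]
  obtain ⟨y, hy⟩ := free_exact n h2
  refine ⟨(barMk K n).f _ y, ?_⟩
  rw [← Hom.comm_b, hy, map_sub, map_sub, barMk_T, sub_self, sub_zero]

end LMod

end

section

/-! ### Tensor products of complexes -/

section Fam

variable (K : Type*) [Field K]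

/-- Families of elements of the tensor products `X p ⊗ Y q`. A homogeneous element of total degree
`N` of the tensor product of `X` and `Y` is such a family supported in the bidegrees with
`p + q = N`. -/
abbrev Fam (X Y : ℕ → Type*) [∀ n, AddCommGroup (X n)] [∀ n, Module K (X n)]
    [∀ n, AddCommGroup (Y n)] [∀ n, Module K (Y n)] :=
  ∀ p q, X p ⊗[K] Y q

end Fam

namespace Fam

variable {K : Type*} [Field K]

section Basic

variable {X Y X' Y' X'' Y'' : ℕ → Type*}
  [∀ n, AddCommGroup (X n)] [∀ n, Module K (X n)] [∀ n, AddCommGroup (Y n)] [∀ n, Module K (Y n)]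
  [∀ n, AddCommGroup (X' n)] [∀ n, Module K (X' n)]
  [∀ n, AddCommGroup (Y' n)] [∀ n, Module K (Y' n)]
  [∀ n, AddCommGroup (X'' n)] [∀ n, Module K (X'' n)]
  [∀ n, AddCommGroup (Y'' n)] [∀ n, Module K (Y'' n)]

/-- The family is concentrated in total degree `N`. -/
def Supp (N : ℕ) (w : Fam K X Y) : Prop := ∀ p q, p + q ≠ N → w p q = 0

/-- The projection to the component of total degree `N`. -/
def trunc (N : ℕ) : Fam K X Y →ₗ[K] Fam K X Y where
  toFun w p q := if p + q = N then w p q else 0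
  map_add' w w' := by funext p q; simp only [Pi.add_apply]; split_ifs <;> simp
  map_smul' c w := by funext p q; simp only [Pi.smul_apply, RingHom.id_apply]; split_ifs <;> simp

lemma trunc_apply (N : ℕ) (w : Fam K X Y) (p q : ℕ) :
    trunc N w p q = if p + q = N then w p q else 0 := rfl

lemma trunc_supp (N : ℕ) (w : Fam K X Y) : Supp N (trunc N w) := fun p q h => by
  rw [trunc_apply, if_neg h]

lemma Supp.zero (N : ℕ) : Supp N (0 : Fam K X Y) := fun _ _ _ => rfl

lemma Supp.add {N : ℕ} {w w' : Fam K X Y} (h : Supp N w) (h' : Supp N w') : Supp N (w + w') :=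
  fun p q hpq => by rw [Pi.add_apply, Pi.add_apply, h p q hpq, h' p q hpq, add_zero]

lemma Supp.neg {N : ℕ} {w : Fam K X Y} (h : Supp N w) : Supp N (-w) :=
  fun p q hpq => by rw [Pi.neg_apply, Pi.neg_apply, h p q hpq, neg_zero]

lemma Supp.sub {N : ℕ} {w w' : Fam K X Y} (h : Supp N w) (h' : Supp N w') : Supp N (w - w') :=
  sub_eq_add_neg w w' ▸ h.add h'.neg

lemma Supp.smul {N : ℕ} {w : Fam K X Y} (h : Supp N w) (c : K) : Supp N (c • w) :=
  fun p q hpq => by rw [Pi.smul_apply, Pi.smul_apply, h p q hpq, smul_zero]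

/-- The map induced by families of linear maps. -/
def map (φ : ∀ n, X n →ₗ[K] X' n) (ψ : ∀ n, Y n →ₗ[K] Y' n) : Fam K X Y →ₗ[K] Fam K X' Y' where
  toFun w p q := TensorProduct.map (φ p) (ψ q) (w p q)
  map_add' w w' := by funext p q; simp
  map_smul' c w := by funext p q; simp

lemma map_apply (φ : ∀ n, X n →ₗ[K] X' n) (ψ : ∀ n, Y n →ₗ[K] Y' n) (w : Fam K X Y) (p q : ℕ) :
    map φ ψ w p q = TensorProduct.map (φ p) (ψ q) (w p q) := rfl

lemma Supp.map {N : ℕ} {w : Fam K X Y} (h : Supp N w) (φ : ∀ n, X n →ₗ[K] X' n)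
    (ψ : ∀ n, Y n →ₗ[K] Y' n) : Supp N (Fam.map φ ψ w) := fun p q hpq => by
  rw [map_apply, h p q hpq, map_zero]

lemma map_map (φ : ∀ n, X n →ₗ[K] X' n) (ψ : ∀ n, Y n →ₗ[K] Y' n) (φ' : ∀ n, X' n →ₗ[K] X'' n)
    (ψ' : ∀ n, Y' n →ₗ[K] Y'' n) (w : Fam K X Y) :
    map φ' ψ' (map φ ψ w) = map (fun n => φ' n ∘ₗ φ n) (fun n => ψ' n ∘ₗ ψ n) w := by
  funext p q
  rw [map_apply, map_apply, map_apply, TensorProduct.map_map]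

end Basic

lemma tmap_map {A A' A'' B B' B'' : Type*} [AddCommGroup A] [Module K A] [AddCommGroup A']
    [Module K A'] [AddCommGroup A''] [Module K A''] [AddCommGroup B] [Module K B]
    [AddCommGroup B'] [Module K B'] [AddCommGroup B''] [Module K B'']
    (f : A →ₗ[K] A') (f' : A' →ₗ[K] A'') (g : B →ₗ[K] B') (g' : B' →ₗ[K] B'') (w : A ⊗[K] B) :
    TensorProduct.map f' g' (TensorProduct.map f g w) =
      TensorProduct.map (f' ∘ₗ f) (g' ∘ₗ g) w := TensorProduct.map_map ..

lemma tmap_sub_left {A A' B B' : Type*} [AddCommGroup A] [Module K A] [AddCommGroup A']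
    [Module K A'] [AddCommGroup B] [Module K B] [AddCommGroup B'] [Module K B']
    (f f' : A →ₗ[K] A') (g : B →ₗ[K] B') :
    TensorProduct.map (f - f') g = TensorProduct.map f g - TensorProduct.map f' g :=
  TensorProduct.ext' fun x y => by
    simp only [TensorProduct.map_tmul, LinearMap.sub_apply, TensorProduct.sub_tmul]

lemma tmap_sub_right {A A' B B' : Type*} [AddCommGroup A] [Module K A] [AddCommGroup A']
    [Module K A'] [AddCommGroup B] [Module K B] [AddCommGroup B'] [Module K B']
    (f : A →ₗ[K] A') (g g' : B →ₗ[K] B') :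
    TensorProduct.map f (g - g') = TensorProduct.map f g - TensorProduct.map f g' :=
  TensorProduct.ext' fun x y => by
    simp only [TensorProduct.map_tmul, LinearMap.sub_apply, TensorProduct.tmul_sub]

section Differential

variable {X Y X' Y' : ℕ → Type*}
  [∀ n, AddCommGroup (X n)] [∀ n, Module K (X n)] [∀ n, AddCommGroup (Y n)] [∀ n, Module K (Y n)]
  [∀ n, AddCommGroup (X' n)] [∀ n, Module K (X' n)]
  [∀ n, AddCommGroup (Y' n)] [∀ n, Module K (Y' n)]

/-- The differential of a tensor product of complexes. -/
def d (dX : ∀ n, X (n + 1) →ₗ[K] X n) (dY : ∀ n, Y (n + 1) →ₗ[K] Y n) :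
    Fam K X Y →ₗ[K] Fam K X Y where
  toFun w p q := TensorProduct.map (dX p) LinearMap.id (w (p + 1) q) +
    (-1 : K) ^ p • TensorProduct.map LinearMap.id (dY q) (w p (q + 1))
  map_add' w w' := by
    funext p q
    simp only [Pi.add_apply, map_add, smul_add]
    abel
  map_smul' c w := by
    funext p q
    simp only [Pi.smul_apply, map_smul, RingHom.id_apply, smul_add, smul_comm c]

/-- The family of the elements `(BX ⊗ 1) w`, for an operator `BX` raising the degree. -/
def upL (BX : ∀ n, X n →ₗ[K] X (n + 1)) : Fam K X Y →ₗ[K] Fam K X Y where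
  toFun w p q := match p with
    | 0 => 0
    | p + 1 => TensorProduct.map (BX p) LinearMap.id (w p q)
  map_add' w w' := by funext p q; cases p <;> simp
  map_smul' c w := by funext p q; cases p <;> simp

/-- The family of the elements `± (TX ⊗ BY) w`, for an operator `BY` raising the degree. -/
def upR (TX : ∀ n, X n →ₗ[K] X n) (BY : ∀ n, Y n →ₗ[K] Y (n + 1)) : Fam K X Y →ₗ[K] Fam K X Y where
  toFun w p q := match q with
    | 0 => 0
    | q + 1 => (-1 : K) ^ p • TensorProduct.map (TX p) (BY q) (w p q)
  map_add' w w' := by funext p q; cases q <;> simp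
  map_smul' c w := by funext p q; cases q <;> simp [smul_comm c]

variable (dX : ∀ n, X (n + 1) →ₗ[K] X n) (dY : ∀ n, Y (n + 1) →ₗ[K] Y n)
  (BX : ∀ n, X n →ₗ[K] X (n + 1)) (BY : ∀ n, Y n →ₗ[K] Y (n + 1)) (TX : ∀ n, X n →ₗ[K] X n)
  (TY : ∀ n, Y n →ₗ[K] Y n)

lemma d_apply (w : Fam K X Y) (p q : ℕ) :
    d dX dY w p q = TensorProduct.map (dX p) LinearMap.id (w (p + 1) q) +
      (-1 : K) ^ p • TensorProduct.map LinearMap.id (dY q) (w p (q + 1)) := rfl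

lemma upL_zero (w : Fam K X Y) (q : ℕ) : upL BX w 0 q = 0 := rfl

lemma upL_succ (w : Fam K X Y) (p q : ℕ) :
    upL BX w (p + 1) q = TensorProduct.map (BX p) LinearMap.id (w p q) := rfl

lemma upR_zero (w : Fam K X Y) (p : ℕ) : upR TX BY w p 0 = 0 := rfl

lemma upR_succ (w : Fam K X Y) (p q : ℕ) :
    upR TX BY w p (q + 1) = (-1 : K) ^ p • TensorProduct.map (TX p) (BY q) (w p q) := rfl

/-- The total operator of degree one. -/
def up : Fam K X Y →ₗ[K] Fam K X Y := upL BX + upR TX BY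

lemma up_apply (w : Fam K X Y) (p q : ℕ) :
    up BX BY TX w p q = upL BX w p q + upR TX BY w p q := rfl

variable {dX dY BX BY TX TY}

lemma Supp.d {N : ℕ} {w : Fam K X Y} (h : Supp (N + 1) w) : Supp N (Fam.d dX dY w) :=
  fun p q hpq => by
    rw [d_apply, h _ _ (by omega), h _ _ (by omega), map_zero, map_zero, smul_zero, add_zero]

lemma Supp.d_zero {w : Fam K X Y} (h : Supp 0 w) : Fam.d dX dY w = 0 := by
  funext p q
  rw [d_apply, h _ _ (by omega), h _ _ (by omega), map_zero, map_zero, smul_zero, add_zero]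
  rfl

lemma Supp.upL {N : ℕ} {w : Fam K X Y} (h : Supp N w) : Supp (N + 1) (Fam.upL BX w) :=
  fun p q hpq => by
    cases p with
    | zero => rfl
    | succ p => rw [upL_succ, h _ _ (by omega), map_zero]

lemma Supp.upR {N : ℕ} {w : Fam K X Y} (h : Supp N w) : Supp (N + 1) (Fam.upR TX BY w) :=
  fun p q hpq => by
    cases q with
    | zero => rfl
    | succ q => rw [upR_succ, h _ _ (by omega), map_zero, smul_zero]

lemma Supp.up {N : ℕ} {w : Fam K X Y} (h : Supp N w) : Supp (N + 1) (Fam.up BX BY TX w) :=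
  h.upL.add h.upR

lemma d_d (hX : ∀ n, dX n ∘ₗ dX (n + 1) = 0) (hY : ∀ n, dY n ∘ₗ dY (n + 1) = 0) (w : Fam K X Y) :
    d dX dY (d dX dY w) = 0 := by
  funext p q
  simp only [d_apply, map_add, map_smul, tmap_map, hX, hY, LinearMap.comp_id, LinearMap.id_comp,
    TensorProduct.map_zero_left, TensorProduct.map_zero_right, LinearMap.zero_apply, smul_zero,
    add_zero, zero_add, pow_succ, mul_neg_one, neg_smul, map_neg, Pi.zero_apply, neg_add_cancel]

/-- The operators `d` and `up` anticommute up to `1 - TX ⊗ TY`. -/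
lemma d_up (hX : ∀ n, dX (n + 1) ∘ₗ BX (n + 1) + BX n ∘ₗ dX n = LinearMap.id - TX (n + 1))
    (hX0 : dX 0 ∘ₗ BX 0 = LinearMap.id - TX 0)
    (hY : ∀ n, dY (n + 1) ∘ₗ BY (n + 1) + BY n ∘ₗ dY n = LinearMap.id - TY (n + 1))
    (hY0 : dY 0 ∘ₗ BY 0 = LinearMap.id - TY 0)
    (hT : ∀ n, dX n ∘ₗ TX (n + 1) = TX n ∘ₗ dX n) (w : Fam K X Y) :
    d dX dY (up BX BY TX w) + up BX BY TX (d dX dY w) = w - map TX TY w := by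
  have hL : ∀ p q, TensorProduct.map (dX p) LinearMap.id (TensorProduct.map (BX p) LinearMap.id
      (w p q)) + upL BX (fun p q => TensorProduct.map (dX p) LinearMap.id (w (p + 1) q)) p q =
        w p q - TensorProduct.map (TX p) LinearMap.id (w p q) := fun p q => by
    rw [tmap_map]
    cases p with
    | zero =>
      rw [hX0, upL_zero, LinearMap.comp_id, tmap_sub_left, TensorProduct.map_id,
        LinearMap.sub_apply, LinearMap.id_apply, add_zero]
    | succ p =>
      rw [upL_succ, tmap_map, ← LinearMap.add_apply, LinearMap.comp_id,
        ← TensorProduct.map_add_left, hX, tmap_sub_left, TensorProduct.map_id,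
        LinearMap.sub_apply, LinearMap.id_apply]
  have hR : ∀ p q, TensorProduct.map (TX p) (dY q ∘ₗ BY q) (w p q) + (match q with
      | 0 => 0
      | q + 1 => TensorProduct.map (TX p) (BY q ∘ₗ dY q) (w p (q + 1))) =
        TensorProduct.map (TX p) LinearMap.id (w p q) - TensorProduct.map (TX p) (TY q) (w p q) :=
    fun p q => by
    cases q with
    | zero => rw [hY0, add_zero, tmap_sub_right, LinearMap.sub_apply]
    | succ q =>
      simp only
      rw [← LinearMap.add_apply, ← TensorProduct.map_add_right, hY, tmap_sub_right,
        LinearMap.sub_apply]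
  funext p q
  have h1 := hL p q
  have h2 := hR p q
  rw [Pi.sub_apply, Pi.sub_apply, map_apply]
  rw [← sub_add_sub_cancel (w p q) (TensorProduct.map (TX p) LinearMap.id (w p q)), ← h1, ← h2,
    Pi.add_apply, Pi.add_apply]
  cases p with
  | zero =>
    cases q with
    | zero =>
      simp only [up_apply, d_apply, upL_zero, upR_zero, upL_succ, upR_succ, tmap_map,
        LinearMap.comp_id, LinearMap.id_comp, pow_zero, one_smul, zero_add, add_zero]
    | succ q =>
      simp only [up_apply, d_apply, upL_zero, upL_succ, upR_succ, tmap_map, LinearMap.comp_id,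
        LinearMap.id_comp, pow_zero, pow_succ, mul_neg_one, neg_smul, one_smul, map_add, map_neg,
        zero_add, add_zero, hT]
      abel
  | succ p =>
    cases q with
    | zero =>
      simp only [up_apply, d_apply, upL_succ, upR_zero, upR_succ, tmap_map, LinearMap.comp_id,
        LinearMap.id_comp, map_add, map_smul, add_zero]
      simp only [pow_succ]
      rcases neg_one_pow_eq_or K p with hp | hp <;> simp only [hp] <;> module
    | succ q =>
      simp only [up_apply, d_apply, upL_succ, upR_succ, tmap_map, LinearMap.comp_id,
        LinearMap.id_comp, map_add, map_smul, hT]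
      simp only [pow_succ]
      rcases neg_one_pow_eq_or K p with hp | hp <;> simp only [hp] <;> module

lemma up_up (hX : ∀ n, BX (n + 1) ∘ₗ BX n = 0) (hY : ∀ n, BY (n + 1) ∘ₗ BY n = 0)
    (hT : ∀ n, BX n ∘ₗ TX n = TX (n + 1) ∘ₗ BX n) (w : Fam K X Y) :
    up BX BY TX (up BX BY TX w) = 0 := by
  funext p q
  rw [up_apply]
  rcases p with _ | _ | p <;> rcases q with _ | _ | q <;>
    simp only [up_apply, upL_zero, upR_zero, upL_succ, upR_succ, map_add, map_zero, map_smul,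
      tmap_map, hX, hY, LinearMap.comp_id, LinearMap.id_comp, TensorProduct.map_zero_left,
      TensorProduct.map_zero_right, LinearMap.zero_apply, smul_zero, add_zero, zero_add, pow_succ,
      mul_neg_one, neg_smul, neg_neg, pow_zero, one_smul, hT, Pi.zero_apply, map_neg,
      add_neg_cancel, neg_add_cancel, neg_zero]

lemma map_d {dX' : ∀ n, X' (n + 1) →ₗ[K] X' n} {dY' : ∀ n, Y' (n + 1) →ₗ[K] Y' n}
    {φ : ∀ n, X n →ₗ[K] X' n} {ψ : ∀ n, Y n →ₗ[K] Y' n}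
    (hφ : ∀ n, φ n ∘ₗ dX n = dX' n ∘ₗ φ (n + 1)) (hψ : ∀ n, ψ n ∘ₗ dY n = dY' n ∘ₗ ψ (n + 1))
    (w : Fam K X Y) : map φ ψ (d dX dY w) = d dX' dY' (map φ ψ w) := by
  funext p q
  simp only [map_apply, d_apply, map_add, map_smul, tmap_map, hφ, hψ, LinearMap.comp_id,
    LinearMap.id_comp]

lemma map_upL {BX' : ∀ n, X' n →ₗ[K] X' (n + 1)} {φ : ∀ n, X n →ₗ[K] X' n}
    {ψ : ∀ n, Y n →ₗ[K] Y' n} (hφ : ∀ n, φ (n + 1) ∘ₗ BX n = BX' n ∘ₗ φ n) (w : Fam K X Y) :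
    map φ ψ (upL BX w) = upL BX' (map φ ψ w) := by
  funext p q
  cases p with
  | zero => rw [map_apply, upL_zero, upL_zero, map_zero]
  | succ p => rw [map_apply, upL_succ, upL_succ, map_apply, tmap_map, tmap_map, hφ]; rfl

lemma map_upR {TX' : ∀ n, X' n →ₗ[K] X' n} {BY' : ∀ n, Y' n →ₗ[K] Y' (n + 1)}
    {φ : ∀ n, X n →ₗ[K] X' n} {ψ : ∀ n, Y n →ₗ[K] Y' n}
    (hφ : ∀ n, φ n ∘ₗ TX n = TX' n ∘ₗ φ n) (hψ : ∀ n, ψ (n + 1) ∘ₗ BY n = BY' n ∘ₗ ψ n)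
    (w : Fam K X Y) : map φ ψ (upR TX BY w) = upR TX' BY' (map φ ψ w) := by
  funext p q
  cases q with
  | zero => rw [map_apply, upR_zero, upR_zero, map_zero]
  | succ q =>
    rw [map_apply, upR_succ, upR_succ, map_apply, map_smul, tmap_map, tmap_map, hφ, hψ]

end Differential

end Fam

/-! ### Complexes of vector spaces split -/

section Retract

variable {K : Type*} [Field K] {X : ℕ → Type*} [∀ n, AddCommGroup (X n)] [∀ n, Module K (X n)]

/-- A deformation retraction `ϖ` of a complex onto a complex with zero differential, with a
homotopy `h` between the identity and `ϖ`. -/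
structure Retract (d : ∀ n, X (n + 1) →ₗ[K] X n) where
  h (n : ℕ) : X n →ₗ[K] X (n + 1)
  ϖ (n : ℕ) : X n →ₗ[K] X n
  d_h (n : ℕ) : d (n + 1) ∘ₗ h (n + 1) + h n ∘ₗ d n = LinearMap.id - ϖ (n + 1)
  d_h_zero : d 0 ∘ₗ h 0 = LinearMap.id - ϖ 0
  ϖ_d (n : ℕ) : ϖ n ∘ₗ d n = 0
  d_ϖ (n : ℕ) : d n ∘ₗ ϖ (n + 1) = 0
  idem (n : ℕ) : ϖ n ∘ₗ ϖ n = ϖ n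

lemma exists_generalized_inverse {V W : Type*} [AddCommGroup V] [Module K V] [AddCommGroup W]
    [Module K W] (f : V →ₗ[K] W) : ∃ g : W →ₗ[K] V, ∀ x, f (g (f x)) = f x := by
  obtain ⟨r, hr⟩ := (LinearMap.range f).subtype.exists_leftInverse_of_injective
    (Submodule.ker_subtype _)
  obtain ⟨s, hs⟩ := f.rangeRestrict.exists_rightInverse_of_surjective f.range_rangeRestrict
  refine ⟨s ∘ₗ r, fun x => ?_⟩
  have h1 : r (f x) = f.rangeRestrict x := LinearMap.congr_fun hr (f.rangeRestrict x)
  have h2 := congrArg Subtype.val (LinearMap.congr_fun hs (f.rangeRestrict x))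
  rw [LinearMap.comp_apply, h1]
  exact h2

/-- Over a field every complex has such a retraction: if `d e d = d`, then `e d` and `d e` are
projections, and `ϖ = (1 - d e) (1 - e d)` works. -/
theorem exists_retract (d : ∀ n, X (n + 1) →ₗ[K] X n) (hd : ∀ n x, d n (d (n + 1) x) = 0) :
    Nonempty (Retract d) := by
  choose e he using fun n => exists_generalized_inverse (d n)
  let q : ∀ n, X n →ₗ[K] X n := fun n => match n with
    | 0 => 0
    | n + 1 => e n ∘ₗ d n
  have hq : ∀ n x, q (n + 1) x = e n (d n x) := fun _ _ => rfl
  have hq0 : ∀ x, q 0 x = 0 := fun _ => rfl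
  have hqd : ∀ n x, q n (d n x) = 0 := fun n x => by
    cases n with
    | zero => rfl
    | succ n => rw [hq, hd, map_zero]
  have hqq : ∀ n x, q n (q n x) = q n x := fun n x => by
    cases n with
    | zero => rfl
    | succ n => rw [hq, hq, he]
  refine ⟨⟨fun n => e n ∘ₗ (LinearMap.id - q n),
    fun n => (LinearMap.id - d n ∘ₗ e n) ∘ₗ (LinearMap.id - q n), fun n => ?_, ?_, fun n => ?_,
    fun n => ?_, fun n => ?_⟩⟩ <;> refine LinearMap.ext fun x => ?_ <;>
    simp only [LinearMap.add_apply, LinearMap.comp_apply, LinearMap.sub_apply, LinearMap.id_apply,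
      LinearMap.zero_apply, map_sub, hqd, hqq, he, hq, hq0, hd, map_zero, sub_zero, sub_self]
  all_goals abel

variable {d : ∀ n, X (n + 1) →ₗ[K] X n}

namespace Retract

lemma ϖ_of_cycle (R : Retract d) {n : ℕ} {x : X (n + 1)} (hx : d n x = 0) :
    R.ϖ (n + 1) x = x - d (n + 1) (R.h (n + 1) x) := by
  have := LinearMap.congr_fun (R.d_h n) x
  simp only [LinearMap.add_apply, LinearMap.comp_apply, LinearMap.sub_apply, LinearMap.id_apply,
    hx, map_zero, add_zero] at this
  rw [this, sub_sub_cancel]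

lemma ϖ_of_cycle_zero (R : Retract d) (x : X 0) : R.ϖ 0 x = x - d 0 (R.h 0 x) := by
  have := LinearMap.congr_fun R.d_h_zero x
  simp only [LinearMap.comp_apply, LinearMap.sub_apply, LinearMap.id_apply] at this
  rw [this, sub_sub_cancel]

lemma ϖ_eq_zero (R : Retract d) {n : ℕ} (h : ∀ x, d n x = 0 → ∃ y, d (n + 1) y = x) :
    R.ϖ (n + 1) = 0 := by
  refine LinearMap.ext fun x => ?_
  obtain ⟨y, hy⟩ := h (R.ϖ (n + 1) x) (LinearMap.congr_fun (R.d_ϖ n) x)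
  rw [← R.idem, LinearMap.comp_apply, ← hy]
  exact LinearMap.congr_fun (R.ϖ_d (n + 1)) y

end Retract

namespace Fam

variable {Y : ℕ → Type*} [∀ n, AddCommGroup (Y n)] [∀ n, Module K (Y n)]
  {dY : ∀ n, Y (n + 1) →ₗ[K] Y n}

/-- The homotopy of the tensor product of two retractions. -/
def hom (R : Retract d) (R' : Retract dY) : Fam K X Y →ₗ[K] Fam K X Y := up R.h R'.h R.ϖ

lemma d_hom (R : Retract d) (R' : Retract dY) (w : Fam K X Y) :
    Fam.d d dY (hom R R' w) + hom R R' (Fam.d d dY w) = w - map R.ϖ R'.ϖ w :=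
  d_up R.d_h R.d_h_zero R'.d_h R'.d_h_zero (fun n => by rw [R.d_ϖ, R.ϖ_d]) w

lemma eq_of_cycle (R : Retract d) (R' : Retract dY) {w : Fam K X Y} (hw : Fam.d d dY w = 0) :
    w = map R.ϖ R'.ϖ w + Fam.d d dY (hom R R' w) := by
  have := d_hom R R' w
  rw [hw, map_zero, add_zero] at this
  rw [this, add_sub_cancel]

/-- The tensor product of two complexes which are exact in degrees at least `a` and `a'` is exact
in degrees at least `a + a' - 1`. -/
theorem exact_of_exact (hd : ∀ n x, d n (d (n + 1) x) = 0) (hdY : ∀ n x, dY n (dY (n + 1) x) = 0)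
    {a a' : ℕ} (hX : ∀ n, a ≤ n → ∀ x, d n x = 0 → ∃ y, d (n + 1) y = x)
    (hY : ∀ n, a' ≤ n → ∀ x, dY n x = 0 → ∃ y, dY (n + 1) y = x) {N : ℕ} (hN : a + a' < N)
    {w : Fam K X Y} (hw : Supp N w) (hdw : Fam.d d dY w = 0) :
    ∃ v, Supp (N + 1) v ∧ Fam.d d dY v = w := by
  obtain ⟨R⟩ := exists_retract d hd
  obtain ⟨R'⟩ := exists_retract dY hdY
  refine ⟨hom R R' w, hw.up, ?_⟩
  have h := eq_of_cycle R R' hdw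
  suffices h0 : map R.ϖ R'.ϖ w = 0 by rw [h0, zero_add] at h; exact h.symm
  funext p q
  by_cases hpq : p + q = N
  · rw [map_apply]
    by_cases hp : a < p
    · obtain ⟨p, rfl⟩ : ∃ k, p = k + 1 := ⟨p - 1, by omega⟩
      rw [R.ϖ_eq_zero (hX p (by omega)), TensorProduct.map_zero_left]
      rfl
    · obtain ⟨q, rfl⟩ : ∃ k, q = k + 1 := ⟨q - 1, by omega⟩
      rw [R'.ϖ_eq_zero (hY q (by omega)), TensorProduct.map_zero_right]
      rfl
  · rw [hw.map _ _ p q hpq]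
    rfl

end Fam

end Retract

end

section

/-! ### The Alexander–Whitney map -/

namespace SMod

variable {K : Type w} [Field K]

/-- The diagonal of the tensor product of two simplicial modules. -/
abbrev diag (X : SMod.{w, x} K) (Y : SMod.{w, y} K) : SMod.{w, max x y} K where
  obj n := X.obj n ⊗[K] Y.obj n
  d n i := TensorProduct.map (X.d n i) (Y.d n i)
  s n j := TensorProduct.map (X.s n j) (Y.s n j)
  d_d n i j hij hj x := by
    induction x with
    | zero => simp only [map_zero]
    | add a b ha hb => simp only [map_add, ha, hb]
    | tmul a b => simp only [TensorProduct.map_tmul, X.d_d n i j hij hj, Y.d_d n i j hij hj]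
  d_s_self n j hj x := by
    induction x with
    | zero => simp only [map_zero]
    | add a b ha hb => simp only [map_add, ha, hb]
    | tmul a b => simp only [TensorProduct.map_tmul, X.d_s_self n j hj, Y.d_s_self n j hj]
  d_succ_s n j hj x := by
    induction x with
    | zero => simp only [map_zero]
    | add a b ha hb => simp only [map_add, ha, hb]
    | tmul a b => simp only [TensorProduct.map_tmul, X.d_succ_s n j hj, Y.d_succ_s n j hj]
  d_s_lt n i j hij hj x := by
    induction x with
    | zero => simp only [map_zero]
    | add a b ha hb => simp only [map_add, ha, hb]
    | tmul a b => simp only [TensorProduct.map_tmul, X.d_s_lt n i j hij hj, Y.d_s_lt n i j hij hj]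
  d_s_gt n i j hij hi x := by
    induction x with
    | zero => simp only [map_zero]
    | add a b ha hb => simp only [map_add, ha, hb]
    | tmul a b => simp only [TensorProduct.map_tmul, X.d_s_gt n i j hij hi, Y.d_s_gt n i j hij hi]

section Faces

variable (X : SMod.{w, x} K)

/-- The front face `X n → X i`, which is the iterated last face. -/
def front : ∀ n i : ℕ, X.obj n →ₗ[K] X.obj i
  | 0, i => if h : 0 = i then h ▸ LinearMap.id else 0
  | n + 1, i => if h : n + 1 = i then h ▸ LinearMap.id else front n i ∘ₗ X.d n (n + 1)

/-- The back face `X n → X j`, which is the iterated face with index zero. -/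
def back : ∀ n j : ℕ, X.obj n →ₗ[K] X.obj j
  | 0, j => if h : 0 = j then h ▸ LinearMap.id else 0
  | n + 1, j => if h : n + 1 = j then h ▸ LinearMap.id else back n j ∘ₗ X.d n 0

lemma front_self (n : ℕ) (x : X.obj n) : X.front n n x = x := by
  cases n <;> simp [front]

lemma back_self (n : ℕ) (x : X.obj n) : X.back n n x = x := by
  cases n <;> simp [back]

lemma front_succ {n i : ℕ} (h : i ≤ n) (x : X.obj (n + 1)) :
    X.front (n + 1) i x = X.front n i (X.d n (n + 1) x) := by
  rw [front, dif_neg (by omega)]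
  rfl

lemma back_succ {n j : ℕ} (h : j ≤ n) (x : X.obj (n + 1)) :
    X.back (n + 1) j x = X.back n j (X.d n 0 x) := by
  rw [back, dif_neg (by omega)]
  rfl

lemma front_d_le {n i k : ℕ} (hk : k ≤ i) (hi : i ≤ n) (x : X.obj (n + 1)) :
    X.front n i (X.d n k x) = X.d i k (X.front (n + 1) (i + 1) x) := by
  induction n, hi using Nat.le_induction with
  | base => rw [front_self, front_self]
  | succ n hi ih =>
    rw [X.front_succ hi, X.front_succ (by omega), ← ih, X.d_d n k (n + 1) (by omega) le_rfl]

lemma d_front_last {n i : ℕ} (hi : i ≤ n) (x : X.obj (n + 1)) :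
    X.d i (i + 1) (X.front (n + 1) (i + 1) x) = X.front (n + 1) i x := by
  induction n, hi using Nat.le_induction with
  | base => rw [X.front_succ le_rfl, front_self, front_self]
  | succ n hi ih => rw [X.front_succ (by omega), ih, ← X.front_succ (by omega)]

lemma front_d_gt {n i k : ℕ} (hk : i < k) (hk' : k ≤ n + 1) (x : X.obj (n + 1)) :
    X.front n i (X.d n k x) = X.front (n + 1) i x := by
  have hi : i ≤ n := by omega
  rw [X.front_succ hi]
  induction n, hi using Nat.le_induction generalizing k with
  | base =>
    obtain rfl : k = i + 1 := by omega
    rfl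
  | succ n hi ih =>
    rcases Nat.lt_or_ge k (n + 2) with h | h
    · rw [X.front_succ hi, X.front_succ hi, ← X.d_d n k (n + 1) (by omega) le_rfl,
        ih hk (by omega)]
    · obtain rfl : k = n + 2 := by omega
      rfl

lemma back_d_lt {n j k : ℕ} (hk : j + k ≤ n) (x : X.obj (n + 1)) :
    X.back n j (X.d n k x) = X.back (n + 1) j x := by
  rw [X.back_succ (by omega)]
  induction k generalizing n with
  | zero => rfl
  | succ k ih =>
    obtain ⟨n, rfl⟩ : ∃ m, n = m + 1 := ⟨n - 1, by omega⟩
    rw [X.back_succ (by omega), X.back_succ (by omega), X.d_d n 0 k (by omega) (by omega),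
      ih (by omega)]

lemma back_d_ge {i j l : ℕ} (hl : l ≤ j + 1) (x : X.obj (i + j + 1)) :
    X.back (i + j) j (X.d (i + j) (i + l) x) = X.d j l (X.back (i + j + 1) (j + 1) x) := by
  suffices h : ∀ n (_ : n = i + j) (x : X.obj (n + 1)),
      X.back n j (X.d n (i + l) x) = X.d j l (X.back (n + 1) (j + 1) x) from h _ rfl x
  clear x
  induction i with
  | zero =>
    intro n hn x
    obtain rfl : n = j := by omega
    rw [back_self, back_self, zero_add]
  | succ i ih =>
    intro n hn x
    obtain ⟨n, rfl⟩ : ∃ m, n = m + 1 := ⟨n - 1, by omega⟩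
    rw [X.back_succ (by omega), X.back_succ (by omega), ← ih n (by omega),
      show i + 1 + l = (i + l) + 1 by omega, X.d_d n 0 (i + l) (by omega) (by omega)]

end Faces

/-- A morphism of simplicial modules; only the faces are taken into account. -/
structure Hom (X : SMod.{w, x} K) (Y : SMod.{w, y} K) where
  f (n : ℕ) : X.obj n →ₗ[K] Y.obj n
  comm (n i : ℕ) (hi : i ≤ n + 1) (x : X.obj (n + 1)) : f n (X.d n i x) = Y.d n i (f (n + 1) x)

section Hom

variable {X : SMod.{w, x} K} {Y : SMod.{w, y} K} (φ : X.Hom Y)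

lemma Hom.comm_bd (n : ℕ) (x : X.obj (n + 1)) : φ.f n (X.bd n x) = Y.bd n (φ.f (n + 1) x) := by
  rw [bd_apply, bd_apply, map_sum]
  refine Finset.sum_congr rfl fun i hi => ?_
  rw [map_smul, φ.comm n i (by simpa [Nat.lt_succ_iff] using hi)]

lemma Hom.comm_front {n i : ℕ} (hi : i ≤ n) (x : X.obj n) :
    φ.f i (X.front n i x) = Y.front n i (φ.f n x) := by
  induction n, hi using Nat.le_induction with
  | base => rw [front_self, front_self]
  | succ n hi ih => rw [X.front_succ hi, Y.front_succ hi, ih, φ.comm _ _ le_rfl]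

lemma Hom.comm_back {n i : ℕ} (hi : i ≤ n) (x : X.obj n) :
    φ.f i (X.back n i x) = Y.back n i (φ.f n x) := by
  induction n, hi using Nat.le_induction with
  | base => rw [back_self, back_self]
  | succ n hi ih => rw [X.back_succ hi, Y.back_succ hi, ih, φ.comm _ _ (by omega)]

variable (X) in
/-- The identity. -/
protected def Hom.id : X.Hom X := ⟨fun _ => LinearMap.id, fun _ _ _ _ => rfl⟩

/-- The tensor product of two morphisms. -/
def Hom.diag {X' : SMod.{w, z} K} {Y' : SMod.{w, u} K} (φ : X.Hom X') (ψ : Y.Hom Y') :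
    (X.diag Y).Hom (X'.diag Y') where
  f n := TensorProduct.map (φ.f n) (ψ.f n)
  comm n i hi x := by
    have : TensorProduct.map (φ.f n) (ψ.f n) ∘ₗ TensorProduct.map (X.d n i) (Y.d n i) =
        TensorProduct.map (X'.d n i) (Y'.d n i) ∘ₗ TensorProduct.map (φ.f (n + 1)) (ψ.f (n + 1)) :=
      TensorProduct.ext' fun a b => by
        simp only [LinearMap.comp_apply, TensorProduct.map_tmul, φ.comm n i hi, ψ.comm n i hi]
    exact LinearMap.congr_fun this x

end Hom

/-- Boundaries of families of elements of all degrees. -/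
def bdAll (X : SMod.{w, x} K) : (∀ n, X.obj n) →ₗ[K] (∀ n, X.obj n) where
  toFun z n := X.bd n (z (n + 1))
  map_add' _ _ := funext fun _ => map_add _ _ _
  map_smul' _ _ := funext fun _ => map_smul _ _ _

lemma bdAll_apply (X : SMod.{w, x} K) (z : ∀ n, X.obj n) (n : ℕ) :
    X.bdAll z n = X.bd n (z (n + 1)) := rfl

section AW

variable (X : SMod.{w, x} K) (Y : SMod.{w, y} K)

/-- The Alexander–Whitney map. -/
def aw : (∀ n, (X.diag Y).obj n) →ₗ[K] Fam K X.obj Y.obj where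
  toFun z p q := TensorProduct.map (X.front (p + q) p) (Y.back (p + q) q) (z (p + q))
  map_add' z z' := by funext p q; simp only [Pi.add_apply]; exact map_add _ _ _
  map_smul' c z := by funext p q; simp only [Pi.smul_apply]; exact map_smul _ _ _

lemma aw_apply (z : ∀ n, (X.diag Y).obj n) (p q : ℕ) :
    aw X Y z p q = TensorProduct.map (X.front (p + q) p) (Y.back (p + q) q) (z (p + q)) := rfl

lemma diag_bd_apply (n : ℕ) (x : (X.diag Y).obj (n + 1)) : (X.diag Y).bd n x =
    ∑ k ∈ Finset.range (n + 2), (-1 : K) ^ k • TensorProduct.map (X.d n k) (Y.d n k) x :=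
  bd_apply _ n x

/-- The Alexander–Whitney map is a chain map. -/
theorem aw_bdAll (z : ∀ n, (X.diag Y).obj n) :
    aw X Y ((X.diag Y).bdAll z) = Fam.d X.bd Y.bd (aw X Y z) := by
  funext p q
  rw [Fam.d_apply, aw_apply, aw_apply, aw_apply, bdAll_apply, diag_bd_apply,
    show p + 1 + q = p + q + 1 by omega, ← add_assoc p q 1]
  generalize z (p + q + 1) = x
  change X.obj (p + q + 1) ⊗[K] Y.obj (p + q + 1) at x
  induction x using TensorProduct.induction_on with
  | zero => simp only [map_zero, smul_zero, Finset.sum_const_zero, add_zero]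
  | add a b ha hb =>
    simp only [map_add, smul_add, Finset.sum_add_distrib] at ha hb ⊢
    rw [ha, hb]
    abel
  | tmul a b =>
    simp only [TensorProduct.map_tmul, LinearMap.id_apply, map_sum, map_smul, bd_apply,
      TensorProduct.sum_tmul, TensorProduct.tmul_sum, ← TensorProduct.smul_tmul',
      TensorProduct.tmul_smul]
    rw [show p + q + 2 = (p + 1) + (q + 1) by omega, Finset.sum_range_add,
      Finset.sum_range_succ _ (p + 1), Finset.sum_range_succ' _ (q + 1),
      X.d_front_last (by omega), ← Y.back_d_ge (by omega), Y.back_d_lt (k := p + 0) (by omega)]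
    have h1 : ∀ k ∈ Finset.range (p + 1), (-1 : K) ^ k •
        (X.front (p + q) p (X.d (p + q) k a)) ⊗ₜ[K] (Y.back (p + q) q (Y.d (p + q) k b)) =
        (-1 : K) ^ k • (X.d p k (X.front (p + q + 1) (p + 1) a)) ⊗ₜ[K]
          (Y.back (p + q + 1) q b) := fun k hk => by
      have := Finset.mem_range.1 hk
      rw [X.front_d_le (by omega) (by omega), Y.back_d_lt (by omega)]
    have h2 : ∀ l ∈ Finset.range (q + 1), (-1 : K) ^ (p + 1 + l) •
        (X.front (p + q) p (X.d (p + q) (p + 1 + l) a)) ⊗ₜ[K]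
          (Y.back (p + q) q (Y.d (p + q) (p + 1 + l) b)) =
        (-1 : K) ^ p • (-1 : K) ^ (l + 1) • (X.front (p + q + 1) p a) ⊗ₜ[K]
          (Y.d q (l + 1) (Y.back (p + q + 1) (q + 1) b)) := fun l hl => by
      have := Finset.mem_range.1 hl
      rw [X.front_d_gt (by omega) (by omega), show p + 1 + l = p + (l + 1) by omega,
        Y.back_d_ge (by omega), smul_smul, ← pow_add]
    rw [Finset.sum_congr rfl h1, Finset.sum_congr rfl h2, smul_add, Finset.smul_sum, pow_succ]
    module

end AW

/-! ### The Eilenberg–Zilber theorem -/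

section Dec

variable (X : SMod.{w, x} K)

/-- The décalage of `X`: the simplicial module `n ↦ X (n + 1)` obtained by forgetting the face and
the degeneracy with index zero. -/
abbrev dec : SMod.{w, x} K where
  obj n := X.obj (n + 1)
  d n i := X.d (n + 1) (i + 1)
  s n j := X.s (n + 1) (j + 1)
  d_d n i j hij hj x := X.d_d (n + 1) (i + 1) (j + 1) (by omega) (by omega) x
  d_s_self n j hj x := X.d_s_self (n + 1) (j + 1) (by omega) x
  d_succ_s n j hj x := X.d_succ_s (n + 1) (j + 1) (by omega) x
  d_s_lt n i j hij hj x := X.d_s_lt (n + 1) (i + 1) (j + 1) (by omega) (by omega) x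
  d_s_gt n i j hij hi x := X.d_s_gt (n + 1) (i + 1) (j + 1) (by omega) (by omega) x

/-- The projection from the décalage, given by the face with index zero. -/
def decProj : X.dec.Hom X := ⟨fun n => X.d n 0, fun n i hi x => X.d_d n 0 i (by omega) hi x⟩

/-- The kernel of the projection from the décalage. The faces out of range are set to zero. -/
def decKer : SMod.{w, x} K where
  obj n := LinearMap.ker (X.d n 0)
  d n i := if h : i ≤ n + 1 then (X.d (n + 1) (i + 1)).restrict fun x hx => by
    rw [LinearMap.mem_ker] at hx ⊢
    rw [X.d_d n 0 i (by omega) h, hx, map_zero] else 0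
  s n j := if h : j ≤ n then (X.s (n + 1) (j + 1)).restrict fun x hx => by
    rw [LinearMap.mem_ker] at hx ⊢
    rw [X.d_s_lt n 0 j (by omega) h, hx, map_zero] else 0
  d_d n i j hij hj x := by
    rw [dif_pos (by omega), dif_pos (by omega), dif_pos (by omega), dif_pos (by omega)]
    exact Subtype.ext (X.d_d (n + 1) (i + 1) (j + 1) (by omega) (by omega) x.1)
  d_s_self n j hj x := by
    rw [dif_pos (by omega), dif_pos (by omega)]
    exact Subtype.ext (X.d_s_self (n + 1) (j + 1) (by omega) x.1)
  d_succ_s n j hj x := by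
    rw [dif_pos (by omega), dif_pos (by omega)]
    exact Subtype.ext (X.d_succ_s (n + 1) (j + 1) (by omega) x.1)
  d_s_lt n i j hij hj x := by
    rw [dif_pos (by omega), dif_pos (by omega), dif_pos (by omega), dif_pos (by omega)]
    exact Subtype.ext (X.d_s_lt (n + 1) (i + 1) (j + 1) (by omega) (by omega) x.1)
  d_s_gt n i j hij hi x := by
    rw [dif_pos (by omega), dif_pos (by omega), dif_pos (by omega), dif_pos (by omega)]
    exact Subtype.ext (X.d_s_gt (n + 1) (i + 1) (j + 1) (by omega) (by omega) x.1)

/-- The inclusion of the kernel. -/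
def decIncl : X.decKer.Hom X.dec where
  f n := (LinearMap.ker (X.d n 0)).subtype
  comm n i hi x := by
    have h : X.decKer.d n i = (X.d (n + 1) (i + 1)).restrict _ := dif_pos hi
    rw [h]
    rfl

/-- The degreewise retraction onto the kernel. -/
def decRetr (n : ℕ) : X.dec.obj n →ₗ[K] X.decKer.obj n :=
  LinearMap.codRestrict _ (LinearMap.id - X.s n 0 ∘ₗ X.d n 0) fun x => by
    rw [LinearMap.mem_ker, LinearMap.sub_apply, map_sub, LinearMap.comp_apply,
      X.d_s_self n 0 (by omega), LinearMap.id_apply, sub_self]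

lemma decRetr_decIncl (n : ℕ) : X.decRetr n ∘ₗ X.decIncl.f n = LinearMap.id :=
  LinearMap.ext fun x => Subtype.ext (by
    change x.1 - X.s n 0 (X.d n 0 x.1) = x.1
    rw [LinearMap.mem_ker.1 x.2, map_zero, sub_zero])

lemma decIncl_decRetr (n : ℕ) :
    X.decIncl.f n ∘ₗ X.decRetr n = LinearMap.id - X.s n 0 ∘ₗ X.decProj.f n := rfl

lemma decProj_s (n : ℕ) : X.decProj.f n ∘ₗ X.s n 0 = LinearMap.id :=
  LinearMap.ext fun x => X.d_s_self n 0 (by omega) x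

/-- A system of extra degeneracies contracts a simplicial module in positive degrees. -/
lemma bd_extra (η : ∀ n, X.obj n →ₗ[K] X.obj (n + 1)) (h0 : ∀ n x, X.d n 0 (η n x) = x)
    (h : ∀ n i, i ≤ n + 1 → ∀ x, X.d (n + 1) (i + 1) (η (n + 1) x) = η n (X.d n i x)) (n : ℕ)
    (x : X.obj (n + 1)) : X.bd (n + 1) (η (n + 1) x) + η n (X.bd n x) = x := by
  rw [bd_apply, Finset.sum_range_succ', h0, pow_zero, one_smul, bd_apply, map_sum, add_right_comm,
    ← Finset.sum_add_distrib]
  convert zero_add x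
  refine Finset.sum_eq_zero fun i hi => ?_
  rw [h n i (by simpa [Nat.lt_succ_iff] using hi), map_smul, pow_succ]
  module

end Dec

section Cone

variable (X : SMod.{w, x} K) (Y : SMod.{w, y} K)

/-- The mapping cone of the Alexander–Whitney map, as families of elements of all degrees. -/
abbrev Cone := (∀ n, (X.diag Y).obj n) × Fam K X.obj Y.obj

/-- The differential of the mapping cone. -/
def coneD : Cone X Y →ₗ[K] Cone X Y :=
  LinearMap.prod ((X.diag Y).bdAll ∘ₗ LinearMap.fst K _ _)
    (aw X Y ∘ₗ LinearMap.fst K _ _ - Fam.d X.bd Y.bd ∘ₗ LinearMap.snd K _ _)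

lemma coneD_apply (c : Cone X Y) :
    coneD X Y c = ((X.diag Y).bdAll c.1, aw X Y c.1 - Fam.d X.bd Y.bd c.2) := rfl

/-- The elements of the mapping cone of degree `N`. -/
def coneDeg (N : ℕ) : Submodule K (Cone X Y) where
  carrier := {c | (∀ n, n + 1 ≠ N → c.1 n = 0) ∧ c.2.Supp N}
  add_mem' := fun {a b} ha hb => ⟨fun n hn => by
    rw [Prod.fst_add, Pi.add_apply, ha.1 n hn, hb.1 n hn, add_zero], ha.2.add hb.2⟩
  zero_mem' := ⟨fun _ _ => rfl, Fam.Supp.zero N⟩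
  smul_mem' := fun r a ha => ⟨fun n hn => by
    rw [Prod.smul_fst, Pi.smul_apply, ha.1 n hn, smul_zero], ha.2.smul r⟩

lemma coneD_coneD (c : Cone X Y) : coneD X Y (coneD X Y c) = 0 := by
  have h : ∀ z, (X.diag Y).bdAll ((X.diag Y).bdAll z) = 0 := fun z => by
    funext n
    exact bd_bd _ _ _
  rw [coneD_apply, coneD_apply, h, map_sub, aw_bdAll, sub_sub_cancel,
    Fam.d_d (fun n => LinearMap.ext fun x => X.bd_bd n x)
      (fun n => LinearMap.ext fun x => Y.bd_bd n x)]
  rfl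

lemma aw_supp {N : ℕ} {z : ∀ n, (X.diag Y).obj n} (h : ∀ n, n ≠ N → z n = 0) :
    (aw X Y z).Supp N := fun p q hpq => by
  rw [aw_apply, h _ hpq]
  exact map_zero _

lemma coneD_mem {N : ℕ} {c : Cone X Y} (hc : c ∈ coneDeg X Y (N + 1)) :
    coneD X Y c ∈ coneDeg X Y N := by
  refine ⟨fun n hn => ?_, (aw_supp X Y fun n hn => hc.1 n (by omega)).sub hc.2.d⟩
  change (X.diag Y).bd n (c.1 (n + 1)) = 0
  rw [hc.1 _ (by omega), map_zero]

/-- Exactness of the mapping cone in degree `N`. -/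
def ConeExact (N : ℕ) : Prop :=
  ∀ c ∈ coneDeg X Y N, coneD X Y c = 0 → ∃ v ∈ coneDeg X Y (N + 1), coneD X Y v = c

section Map

variable {X Y} {X' : SMod.{w, z} K} {Y' : SMod.{w, u} K} {X'' : SMod.{w, u₁} K}
  {Y'' : SMod.{w, u₂} K}

/-- The map of cones induced by families of linear maps. -/
def coneMap (φ : ∀ n, X.obj n →ₗ[K] X'.obj n) (ψ : ∀ n, Y.obj n →ₗ[K] Y'.obj n) :
    Cone X Y →ₗ[K] Cone X' Y' :=
  LinearMap.prodMap (LinearMap.pi fun n => TensorProduct.map (φ n) (ψ n) ∘ₗ LinearMap.proj n)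
    (Fam.map φ ψ)

lemma coneMap_apply (φ : ∀ n, X.obj n →ₗ[K] X'.obj n) (ψ : ∀ n, Y.obj n →ₗ[K] Y'.obj n)
    (c : Cone X Y) :
    coneMap φ ψ c = (fun n => TensorProduct.map (φ n) (ψ n) (c.1 n), Fam.map φ ψ c.2) := rfl

lemma coneMap_mem (φ : ∀ n, X.obj n →ₗ[K] X'.obj n) (ψ : ∀ n, Y.obj n →ₗ[K] Y'.obj n) {N : ℕ}
    {c : Cone X Y} (hc : c ∈ coneDeg X Y N) : coneMap φ ψ c ∈ coneDeg X' Y' N :=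
  ⟨fun n hn => by rw [coneMap_apply]; simp only; rw [hc.1 n hn]; exact map_zero _,
    hc.2.map φ ψ⟩

lemma coneMap_coneMap (φ : ∀ n, X.obj n →ₗ[K] X'.obj n) (ψ : ∀ n, Y.obj n →ₗ[K] Y'.obj n)
    (φ' : ∀ n, X'.obj n →ₗ[K] X''.obj n) (ψ' : ∀ n, Y'.obj n →ₗ[K] Y''.obj n) (c : Cone X Y) :
    coneMap φ' ψ' (coneMap φ ψ c) =
      coneMap (fun n => φ' n ∘ₗ φ n) (fun n => ψ' n ∘ₗ ψ n) c := by
  refine Prod.ext (funext fun n => ?_) ?_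
  · exact TensorProduct.map_map ..
  · exact Fam.map_map ..

lemma coneMap_eq_self {φ : ∀ n, X.obj n →ₗ[K] X.obj n} {ψ : ∀ n, Y.obj n →ₗ[K] Y.obj n}
    (hφ : ∀ n, φ n = LinearMap.id) (hψ : ∀ n, ψ n = LinearMap.id) (c : Cone X Y) :
    coneMap φ ψ c = c := by
  rw [coneMap_apply]
  refine Prod.ext (funext fun n => ?_) (funext fun p => funext fun q => ?_)
  · simp only [hφ, hψ]
    rw [TensorProduct.map_id, LinearMap.id_apply]
  · simp only
    rw [Fam.map_apply, hφ, hψ, TensorProduct.map_id, LinearMap.id_apply]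

lemma coneMap_sub_left (φ φ' : ∀ n, X.obj n →ₗ[K] X'.obj n) (ψ : ∀ n, Y.obj n →ₗ[K] Y'.obj n)
    (c : Cone X Y) :
    coneMap (fun n => φ n - φ' n) ψ c = coneMap φ ψ c - coneMap φ' ψ c := by
  refine Prod.ext (funext fun n => ?_) (funext fun p => funext fun q => ?_) <;>
    exact LinearMap.congr_fun (Fam.tmap_sub_left ..) _

lemma coneMap_sub_right (φ : ∀ n, X.obj n →ₗ[K] X'.obj n) (ψ ψ' : ∀ n, Y.obj n →ₗ[K] Y'.obj n)
    (c : Cone X Y) :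
    coneMap φ (fun n => ψ n - ψ' n) c = coneMap φ ψ c - coneMap φ ψ' c := by
  refine Prod.ext (funext fun n => ?_) (funext fun p => funext fun q => ?_) <;>
    exact LinearMap.congr_fun (Fam.tmap_sub_right ..) _

lemma coneMap_coneD (φ : X.Hom X') (ψ : Y.Hom Y') (c : Cone X Y) :
    coneMap φ.f ψ.f (coneD X Y c) = coneD X' Y' (coneMap φ.f ψ.f c) := by
  refine Prod.ext (funext fun n => (φ.diag ψ).comm_bd n (c.1 (n + 1))) ?_
  change Fam.map φ.f ψ.f (aw X Y c.1 - Fam.d X.bd Y.bd c.2) =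
    aw X' Y' (coneMap φ.f ψ.f c).1 - Fam.d X'.bd Y'.bd (Fam.map φ.f ψ.f c.2)
  rw [map_sub, Fam.map_d (fun n => LinearMap.ext fun x => φ.comm_bd n x)
    (fun n => LinearMap.ext fun x => ψ.comm_bd n x)]
  congr 1
  funext p q
  rw [Fam.map_apply, aw_apply, aw_apply, coneMap_apply]
  simp only
  refine (TensorProduct.map_map ..).trans (Eq.trans ?_ (TensorProduct.map_map ..).symm)
  congr 2 <;> refine LinearMap.ext fun x => ?_
  · exact φ.comm_front (by omega) x
  · exact ψ.comm_back (by omega) x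

end Map

end Cone

/-- One step of the long exact sequence of a degreewise split short exact sequence: if the
subcomplex is exact in degree `N` and the whole complex in degree `N + 1`, then the quotient is
exact in degree `N + 1`. The maps `s` and `r` are the splitting of the inclusion `i` and the projection `p`. -/
lemma exact_of_split {C C' C'' : Type*} [AddCommGroup C] [Module K C] [AddCommGroup C']
    [Module K C'] [AddCommGroup C''] [Module K C''] {D : C →ₗ[K] C} {D' : C' →ₗ[K] C'}
    {D'' : C'' →ₗ[K] C''} {deg : ℕ → Submodule K C} {deg' : ℕ → Submodule K C'}
    {deg'' : ℕ → Submodule K C''} (hD : ∀ c, D (D c) = 0)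
    (hdeg : ∀ N c, c ∈ deg (N + 1) → D c ∈ deg N)
    (i : C' →ₗ[K] C) (p : C →ₗ[K] C'') (s : C'' →ₗ[K] C) (r : C →ₗ[K] C')
    (hi : ∀ N c, c ∈ deg' N → i c ∈ deg N) (hp : ∀ N c, c ∈ deg N → p c ∈ deg'' N)
    (hs : ∀ N c, c ∈ deg'' N → s c ∈ deg N) (hr : ∀ N c, c ∈ deg N → r c ∈ deg' N)
    (iD : ∀ c, i (D' c) = D (i c)) (pD : ∀ c, p (D c) = D'' (p c))
    (ps : ∀ c, p (s c) = c) (ri : ∀ c, r (i c) = c) (ir : ∀ c, i (r c) = c - s (p c)) (N : ℕ)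
    (h' : ∀ c ∈ deg' N, D' c = 0 → ∃ v ∈ deg' (N + 1), D' v = c)
    (h : ∀ c ∈ deg (N + 1), D c = 0 → ∃ v ∈ deg (N + 2), D v = c) (c : C'')
    (hc : c ∈ deg'' (N + 1)) (hc' : D'' c = 0) : ∃ v ∈ deg'' (N + 2), D'' v = c := by
  have h1 : i (r (D (s c))) = D (s c) := by rw [ir, pD, ps, hc', map_zero, sub_zero]
  have pi : ∀ c, p (i c) = 0 := fun c => by
    have := ir (i c)
    rw [ri] at this
    have h2 : s (p (i c)) = 0 := by
      rw [eq_comm, sub_eq_self] at this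
      exact this
    rw [← ps (p (i c)), h2, map_zero]
  have inj : ∀ c, i c = 0 → c = 0 := fun c hc => by rw [← ri c, hc, map_zero]
  obtain ⟨v, hv, hv'⟩ := h' (r (D (s c))) (hr _ _ (hdeg _ _ (hs _ _ hc)))
    (inj _ (by rw [iD, h1, hD]))
  obtain ⟨v', hv1, hv2⟩ := h (s c - i v) (sub_mem (hs _ _ hc) (hi _ _ hv))
    (by rw [map_sub, ← iD, hv', h1, sub_self])
  exact ⟨p v', hp _ _ hv1, by rw [← pD, hv2, map_sub, ps, pi, sub_zero]⟩

lemma coneExact_zero (X : SMod.{w, x} K) (Y : SMod.{w, y} K) : ConeExact X Y 0 := by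
  intro c hc _
  refine ⟨(Pi.single 0 (c.2 0 0), 0), ⟨fun n hn => ?_, Fam.Supp.zero _⟩, ?_⟩
  · exact Pi.single_eq_of_ne (by omega) _
  · refine Prod.ext (funext fun n => ?_) (funext fun p => funext fun q => ?_)
    · rw [hc.1 n (by omega)]
      change (X.diag Y).bd n (Pi.single 0 (c.2 0 0) (n + 1)) = 0
      rw [Pi.single_eq_of_ne (by omega), map_zero]
    · rw [coneD_apply]
      simp only
      rw [map_zero, sub_zero, aw_apply]
      by_cases h : p + q = 0
      · obtain rfl : p = 0 := by omega
        obtain rfl : q = 0 := by omega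
        change TensorProduct.map (X.front 0 0) (Y.back 0 0) (c.2 0 0) = c.2 0 0
        rw [show X.front 0 0 = LinearMap.id from LinearMap.ext (X.front_self 0),
          show Y.back 0 0 = LinearMap.id from LinearMap.ext (Y.back_self 0), TensorProduct.map_id,
          LinearMap.id_apply]
      · rw [hc.2 p q h, Pi.single_eq_of_ne h]
        exact map_zero _

section Main

variable (X : SMod.{w, x} K) (Y : SMod.{w, y} K)

/-- The degeneracy with index zero, which the décalage forgets, contracts it in positive degrees. -/
lemma dec_exact (n : ℕ) (x : X.dec.obj (n + 1)) (hx : X.dec.bd n x = 0) :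
    ∃ y, X.dec.bd (n + 1) y = x := by
  refine ⟨X.s (n + 2) 0 x, ?_⟩
  have h := X.dec.bd_extra (fun n => X.s (n + 1) 0) (fun n x => X.d_succ_s (n + 1) 0 (by omega) x)
    (fun n i hi x => X.d_s_gt (n + 1) (i + 1) 0 (by omega) (by omega) x) n x
  rw [hx, map_zero, add_zero] at h
  exact h

/-- A cycle of positive degree in the diagonal of two décalages bounds; in degree zero an element
bounds as soon as its image under the Alexander–Whitney map does. -/
lemma dec_diag_exact {N : ℕ} {c : Cone X.dec Y.dec} (hc : c ∈ coneDeg X.dec Y.dec (N + 1))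
    (hc' : coneD X.dec Y.dec c = 0) :
    ∃ v, (∀ n, n + 1 ≠ N + 2 → v n = 0) ∧ (X.dec.diag Y.dec).bdAll v = c.1 := by
  set Z := X.dec.diag Y.dec
  let η : ∀ n, Z.obj n →ₗ[K] Z.obj (n + 1) :=
    fun n => TensorProduct.map (X.s (n + 1) 0) (Y.s (n + 1) 0)
  have hη0 : ∀ n x, Z.d n 0 (η n x) = x := fun n x => by
    have : TensorProduct.map (X.dec.d n 0) (Y.dec.d n 0) ∘ₗ
        TensorProduct.map (X.s (n + 1) 0) (Y.s (n + 1) 0) = LinearMap.id :=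
      TensorProduct.ext' fun a b => congrArg₂ (TensorProduct.tmul K)
        (X.d_succ_s (n + 1) 0 (by omega) a) (Y.d_succ_s (n + 1) 0 (by omega) b)
    exact LinearMap.congr_fun this x
  have hη : ∀ n i, i ≤ n + 1 → ∀ x, Z.d (n + 1) (i + 1) (η (n + 1) x) = η n (Z.d n i x) :=
    fun n i hi x => by
    have : TensorProduct.map (X.dec.d (n + 1) (i + 1)) (Y.dec.d (n + 1) (i + 1)) ∘ₗ
        TensorProduct.map (X.s (n + 2) 0) (Y.s (n + 2) 0) =
        TensorProduct.map (X.s (n + 1) 0) (Y.s (n + 1) 0) ∘ₗ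
          TensorProduct.map (X.dec.d n i) (Y.dec.d n i) :=
      TensorProduct.ext' fun a b => congrArg₂ (TensorProduct.tmul K)
        (X.d_s_gt (n + 1) (i + 1) 0 (by omega) (by omega) a)
        (Y.d_s_gt (n + 1) (i + 1) 0 (by omega) (by omega) b)
    exact LinearMap.congr_fun this x
  let v : ∀ n, Z.obj n := fun n => match n with
    | 0 => 0
    | n + 1 => η n (c.1 n)
  have hb : Z.bdAll c.1 = 0 := congrArg Prod.fst hc'
  have ha : aw X.dec Y.dec c.1 = Fam.d X.dec.bd Y.dec.bd c.2 :=
    sub_eq_zero.1 (congrArg Prod.snd hc')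
  refine ⟨v, fun n hn => ?_, funext fun n => ?_⟩
  · cases n with
    | zero => rfl
    | succ n =>
      change η n (c.1 n) = 0
      rw [hc.1 n (by omega), map_zero]
  · change Z.bd n (η n (c.1 n)) = c.1 n
    cases n with
    | succ n =>
      have h1 := Z.bd_extra η hη0 hη n (c.1 (n + 1))
      have h2 : Z.bd n (c.1 (n + 1)) = 0 := congrFun hb n
      rw [h2, map_zero, add_zero] at h1
      exact h1
    | zero =>
      -- in degree zero the map `d 1` of both factors is an augmentation of the décalage; it
      -- vanishes on boundaries, and the contraction is the identity up to the augmentation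
      have hX : X.d 0 1 ∘ₗ X.dec.bd 0 = 0 := LinearMap.ext fun x => by
        have h1 := X.d_d 0 1 1 le_rfl le_rfl x
        have h2 : X.dec.bd 0 x = X.d 1 1 x - X.d 1 2 x := by
          rw [bd_apply, Finset.sum_range_succ, Finset.sum_range_one, pow_zero, one_smul, pow_one,
            neg_one_smul, ← sub_eq_add_neg]
        rw [LinearMap.comp_apply, h2, map_sub, ← h1, sub_self, LinearMap.zero_apply]
      have hY : Y.d 0 1 ∘ₗ Y.dec.bd 0 = 0 := LinearMap.ext fun x => by
        have h1 := Y.d_d 0 1 1 le_rfl le_rfl x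
        have h2 : Y.dec.bd 0 x = Y.d 1 1 x - Y.d 1 2 x := by
          rw [bd_apply, Finset.sum_range_succ, Finset.sum_range_one, pow_zero, one_smul, pow_one,
            neg_one_smul, ← sub_eq_add_neg]
        rw [LinearMap.comp_apply, h2, map_sub, ← h1, sub_self, LinearMap.zero_apply]
      have h0 : aw X.dec Y.dec c.1 0 0 = c.1 0 := by
        change TensorProduct.map (X.dec.front 0 0) (Y.dec.back 0 0) (c.1 0) = c.1 0
        rw [show X.dec.front 0 0 = LinearMap.id from LinearMap.ext (X.dec.front_self 0),
          show Y.dec.back 0 0 = LinearMap.id from LinearMap.ext (Y.dec.back_self 0),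
          TensorProduct.map_id, LinearMap.id_apply]
      have haug : TensorProduct.map (X.d 0 1) (Y.d 0 1) (c.1 0) = 0 := by
        rw [← h0, ha, Fam.d_apply, map_add, map_smul]
        refine (congrArg₂ (· + ·) (TensorProduct.map_map ..)
          (congrArg _ (TensorProduct.map_map ..))).trans ?_
        rw [hX, hY, TensorProduct.map_zero_left, TensorProduct.map_zero_right]
        simp only [LinearMap.zero_apply, smul_zero, add_zero]
      have hd : Z.d 0 1 (η 0 (c.1 0)) = 0 := by
        have : TensorProduct.map (X.dec.d 0 1) (Y.dec.d 0 1) ∘ₗ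
            TensorProduct.map (X.s 1 0) (Y.s 1 0) =
            TensorProduct.map (X.s 0 0) (Y.s 0 0) ∘ₗ TensorProduct.map (X.d 0 1) (Y.d 0 1) :=
          TensorProduct.ext' fun a b => congrArg₂ (TensorProduct.tmul K)
            (X.d_s_gt 0 1 0 (by omega) (by omega) a) (Y.d_s_gt 0 1 0 (by omega) (by omega) b)
        refine (LinearMap.congr_fun this (c.1 0)).trans ?_
        rw [LinearMap.comp_apply, haug, map_zero]
      rw [bd_apply, Finset.sum_range_succ, Finset.sum_range_one, hη0, hd, smul_zero, add_zero,
        pow_zero, one_smul]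

/-- For two décalages the diagonal and the tensor product are both exact in positive degrees. -/
lemma coneExact_dec_dec (N : ℕ) : ConeExact X.dec Y.dec N := by
  cases N with
  | zero => exact coneExact_zero _ _
  | succ N =>
    intro c hc hc'
    obtain ⟨v, hv, hv'⟩ := dec_diag_exact X Y hc hc'
    have hs : (aw X.dec Y.dec v - c.2).Supp (N + 1) :=
      (aw_supp _ _ fun n hn => hv n (by omega)).sub hc.2
    have hcy : Fam.d X.dec.bd Y.dec.bd (aw X.dec Y.dec v - c.2) = 0 := by
      rw [map_sub, ← aw_bdAll, hv']
      exact congrArg Prod.snd hc'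
    obtain ⟨w, hw, hw'⟩ := Fam.exact_of_exact (a := 0) (a' := 0) X.dec.bd_bd Y.dec.bd_bd
      (fun n _ => dec_exact X n) (fun n _ => dec_exact Y n) (by omega) hs hcy
    refine ⟨(v, w), ⟨hv, hw⟩, ?_⟩
    rw [coneD_apply, hw', hv', sub_sub_cancel]

/-- The mapping cone of the Alexander–Whitney map is exact. The exact sequences
`0 → ker → Dec X → X → 0` reduce this to décalages, where all complexes are contractible. -/
theorem coneExact (N : ℕ) : ∀ (X : SMod.{w, x} K) (Y : SMod.{w, y} K), ConeExact X Y N := by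
  induction N with
  | zero => exact coneExact_zero
  | succ N ih =>
    -- first the second factor is replaced by its décalage, then the first one
    have h1 : ∀ (X : SMod.{w, x} K) (Y : SMod.{w, y} K), ConeExact X.dec Y (N + 1) := fun X Y =>
      exact_of_split (D := coneD X.dec Y.dec) (D' := coneD X.dec Y.decKer) (D'' := coneD X.dec Y)
        (deg := coneDeg X.dec Y.dec) (deg' := coneDeg X.dec Y.decKer) (deg'' := coneDeg X.dec Y)
        (coneD_coneD _ _) (fun N c hc => coneD_mem _ _ hc)
        (coneMap (Hom.id X.dec).f Y.decIncl.f) (coneMap (Hom.id X.dec).f Y.decProj.f)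
        (coneMap (fun _ => LinearMap.id) fun n => Y.s n 0)
        (coneMap (fun _ => LinearMap.id) Y.decRetr)
        (fun _ _ hc => coneMap_mem _ _ hc) (fun _ _ hc => coneMap_mem _ _ hc)
        (fun _ _ hc => coneMap_mem _ _ hc) (fun _ _ hc => coneMap_mem _ _ hc)
        (coneMap_coneD _ _) (coneMap_coneD _ _)
        (fun c => (coneMap_coneMap ..).trans (coneMap_eq_self (fun _ => rfl) Y.decProj_s c))
        (fun c => (coneMap_coneMap ..).trans (coneMap_eq_self (fun _ => rfl) Y.decRetr_decIncl c))
        (fun c => by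
          rw [coneMap_coneMap, coneMap_coneMap]
          refine (congrArg (fun ψ => coneMap _ ψ c) (funext Y.decIncl_decRetr)).trans
            ((coneMap_sub_right ..).trans (congrArg (· - _) ?_))
          exact coneMap_eq_self (fun _ => rfl) (fun _ => rfl) c)
        N (ih _ _) (coneExact_dec_dec X Y (N + 1))
    exact fun X Y =>
      exact_of_split (D := coneD X.dec Y) (D' := coneD X.decKer Y) (D'' := coneD X Y)
        (deg := coneDeg X.dec Y) (deg' := coneDeg X.decKer Y) (deg'' := coneDeg X Y)
        (coneD_coneD _ _) (fun N c hc => coneD_mem _ _ hc)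
        (coneMap X.decIncl.f (Hom.id Y).f) (coneMap X.decProj.f (Hom.id Y).f)
        (coneMap (fun n => X.s n 0) fun _ => LinearMap.id) (coneMap X.decRetr fun _ => LinearMap.id)
        (fun _ _ hc => coneMap_mem _ _ hc) (fun _ _ hc => coneMap_mem _ _ hc)
        (fun _ _ hc => coneMap_mem _ _ hc) (fun _ _ hc => coneMap_mem _ _ hc)
        (coneMap_coneD _ _) (coneMap_coneD _ _)
        (fun c => (coneMap_coneMap ..).trans (coneMap_eq_self X.decProj_s (fun _ => rfl) c))
        (fun c => (coneMap_coneMap ..).trans (coneMap_eq_self X.decRetr_decIncl (fun _ => rfl) c))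
        (fun c => by
          rw [coneMap_coneMap, coneMap_coneMap]
          refine (congrArg (fun φ => coneMap φ _ c) (funext X.decIncl_decRetr)).trans
            ((coneMap_sub_left ..).trans (congrArg (· - _) ?_))
          exact coneMap_eq_self (fun _ => rfl) (fun _ => rfl) c)
        N (ih _ _) (h1 X Y)

end Main

end SMod

end

section

/-! ### Natural operations from the diagonal to the tensor product -/

/-- A form of dependent choice: a sequence can be constructed term by term, if the condition `P n`
only depends on the terms with index at most `n`. -/
lemma exists_seq {V : ℕ → Type*} [∀ n, Inhabited (V n)] (P : ℕ → (∀ k, V k) → Prop)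
    (hP : ∀ n u v, (∀ k, k ≤ n → u k = v k) → P n u → P n v)
    (h : ∀ n u, (∀ k, k < n → P k u) → ∃ a, P n (Function.update u n a)) : ∃ u, ∀ n, P n u := by
  classical
  choose! f hf using h
  let s : ℕ → ∀ k, V k := fun n =>
    Nat.rec (fun _ => default) (fun n u => Function.update u n (f n u)) n
  have hs : ∀ n, s (n + 1) = Function.update (s n) n (f n (s n)) := fun _ => rfl
  have hk : ∀ k m, s (k + 1 + m) k = s (k + 1) k := fun k m => by
    induction m with
    | zero => rfl
    | succ m ih => rw [← ih, ← add_assoc, hs, Function.update_of_ne (by omega)]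
  have hlt : ∀ k n, k < n → s n k = s (k + 1) k := fun k n hkn => by
    obtain ⟨m, rfl⟩ := Nat.exists_eq_add_of_le (Nat.succ_le_of_lt hkn)
    exact hk k m
  have all : ∀ n, P n (s (n + 1)) := fun n => by
    induction n using Nat.strong_induction_on with
    | _ n ih =>
      rw [hs]
      refine hf n (s n) fun k hkn => hP k _ _ (fun i hi => ?_) (ih k hkn)
      rw [hlt i (k + 1) (by omega), hlt i n (by omega)]
  exact ⟨fun k => s (k + 1) k, fun n => hP n _ _ (fun k hkn => hlt k (n + 1) (by omega)) (all n)⟩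

namespace LMod

variable {K : Type w} [Field K]

/-- The diagonal of the tensor product of two paracyclic modules. -/
abbrev diag (X : LMod.{w, x} K) (Y : LMod.{w, y} K) : LMod.{w, max x y} K where
  obj n := X.obj n ⊗[K] Y.obj n
  act f := TensorProduct.map (X.act f) (Y.act f)
  act_id n x := by
    rw [show X.act (LHom.id n) = LinearMap.id from LinearMap.ext (X.act_id n),
      show Y.act (LHom.id n) = LinearMap.id from LinearMap.ext (Y.act_id n), TensorProduct.map_id,
      LinearMap.id_apply]
  act_comp f g x := by
    rw [TensorProduct.map_map, show X.act (f.comp g) = X.act g ∘ₗ X.act f from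
      LinearMap.ext (X.act_comp f g), show Y.act (f.comp g) = Y.act g ∘ₗ Y.act f from
      LinearMap.ext (Y.act_comp f g)]

lemma IsCyclic.diag {X : LMod.{w, x} K} {Y : LMod.{w, y} K} (hX : X.IsCyclic) (hY : Y.IsCyclic) :
    (X.diag Y).IsCyclic := fun n x => by
  change TensorProduct.map (X.T n) (Y.T n) x = x
  rw [show X.T n = LinearMap.id from LinearMap.ext (hX n),
    show Y.T n = LinearMap.id from LinearMap.ext (hY n), TensorProduct.map_id, LinearMap.id_apply]

section

variable {X : LMod.{w, x} K} {Y : LMod.{w, y} K} {X' : LMod.{w, z} K} {Y' : LMod.{w, u} K}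

/-- The tensor product of two morphisms. -/
def Hom.diag (φ : X.Hom X') (ψ : Y.Hom Y') : (X.diag Y).Hom (X'.diag Y') where
  f n := TensorProduct.map (φ.f n) (ψ.f n)
  comm g x := by
    have h1 : φ.f _ ∘ₗ X.act g = X'.act g ∘ₗ φ.f _ := LinearMap.ext (φ.comm g)
    have h2 : ψ.f _ ∘ₗ Y.act g = Y'.act g ∘ₗ ψ.f _ := LinearMap.ext (ψ.comm g)
    rw [TensorProduct.map_map, TensorProduct.map_map, h1, h2]

/-- The underlying morphism of simplicial modules. -/
def Hom.toSMod (φ : X.Hom X') : X.toSMod.Hom X'.toSMod := ⟨φ.f, fun _ _ _ x => φ.comm _ x⟩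

variable (X Y) in
/-- The total operator `B` on the tensor product. It anticommutes with the boundary up to
`1 - T ⊗ T`. -/
abbrev upB : Fam K X.obj Y.obj →ₗ[K] Fam K X.obj Y.obj := Fam.up X.B Y.B X.T

lemma b_upB (w : Fam K X.obj Y.obj) : Fam.d X.b Y.b (upB X Y w) + upB X Y (Fam.d X.b Y.b w) =
    w - Fam.map X.T Y.T w :=
  Fam.d_up (fun n => LinearMap.ext (X.b_B n)) (LinearMap.ext X.b_B_zero)
    (fun n => LinearMap.ext (Y.b_B n)) (LinearMap.ext Y.b_B_zero)
    (fun n => LinearMap.ext fun x => (X.turnHom.comm_b n x).symm) w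

lemma IsCyclic.upB_upB (hX : X.IsCyclic) (hY : Y.IsCyclic) (w : Fam K X.obj Y.obj) :
    upB X Y (upB X Y w) = 0 :=
  Fam.up_up (fun n => LinearMap.ext (hX.B_B n)) (fun n => LinearMap.ext (hY.B_B n))
    (fun n => LinearMap.ext fun x => (X.turnHom.comm_B n x).symm) w

variable (φ : X.Hom X') (ψ : Y.Hom Y')

lemma map_b (w : Fam K X.obj Y.obj) :
    Fam.map φ.f ψ.f (Fam.d X.b Y.b w) = Fam.d X'.b Y'.b (Fam.map φ.f ψ.f w) :=
  Fam.map_d (fun n => LinearMap.ext (φ.comm_b n)) (fun n => LinearMap.ext (ψ.comm_b n)) w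

lemma map_upB (w : Fam K X.obj Y.obj) :
    Fam.map φ.f ψ.f (upB X Y w) = upB X' Y' (Fam.map φ.f ψ.f w) := by
  change Fam.map φ.f ψ.f (Fam.upL X.B w + Fam.upR X.T Y.B w) =
    Fam.upL X'.B (Fam.map φ.f ψ.f w) + Fam.upR X'.T Y'.B (Fam.map φ.f ψ.f w)
  rw [map_add, Fam.map_upL (BX' := X'.B) (fun n => LinearMap.ext fun x => φ.comm_B n x),
    Fam.map_upR (TX' := X'.T) (BY' := Y'.B) (fun n => LinearMap.ext fun x => φ.comm_T n x)
      (fun n => LinearMap.ext fun x => ψ.comm_B n x)]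

end

section Op

variable (X : LMod.{w, x} K) (Y : LMod.{w, y} K)

lemma hat_add {n : ℕ} (a a' : X.obj n) (m : ℕ) :
    (X.hat (a + a')).f m = (X.hat a).f m + (X.hat a').f m :=
  free_ext fun f => by
    simp only [hat, freeLift_sgl, LinearMap.add_apply, map_add]

lemma hat_smul {n : ℕ} (c : K) (a : X.obj n) (m : ℕ) :
    (X.hat (c • a)).f m = c • (X.hat a).f m :=
  free_ext fun f => by
    simp only [hat, freeLift_sgl, LinearMap.smul_apply, map_smul]

variable {X} in
lemma Hom.hat {X' : LMod.{w, z} K} (φ : X.Hom X') {n : ℕ} (a : X.obj n) (m : ℕ) :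
    φ.f m ∘ₗ (X.hat a).f m = (X'.hat (φ.f n a)).f m :=
  free_ext fun f => by
    rw [LinearMap.comp_apply]
    simp only [LMod.hat, freeLift_sgl, φ.comm]

/-- Families in the tensor square of the free module on one generator of degree `n`. -/
abbrev Univ (K : Type w) [Field K] (n : ℕ) := Fam K (free K n).obj (free K n).obj

/-- The natural operation on `X n ⊗ Y n` given by its value on the tensor square of the canonical
generator. -/
def op {n : ℕ} (v : Univ K n) : (X.diag Y).obj n →ₗ[K] Fam K X.obj Y.obj :=
  TensorProduct.lift (LinearMap.mk₂ K (fun a c => Fam.map (X.hat a).f (Y.hat c).f v)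
    (fun a a' c => by
      funext p q
      simp only [Fam.map_apply, hat_add, TensorProduct.map_add_left, LinearMap.add_apply,
        Pi.add_apply])
    (fun r a c => by
      funext p q
      simp only [Fam.map_apply, hat_smul, TensorProduct.map_smul_left, LinearMap.smul_apply,
        Pi.smul_apply])
    (fun a c c' => by
      funext p q
      simp only [Fam.map_apply, hat_add, TensorProduct.map_add_right, LinearMap.add_apply,
        Pi.add_apply])
    (fun r a c => by
      funext p q
      simp only [Fam.map_apply, hat_smul, TensorProduct.map_smul_right, LinearMap.smul_apply,
        Pi.smul_apply]))

lemma op_tmul {n : ℕ} (v : Univ K n) (a : X.obj n) (c : Y.obj n) :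
    op X Y v (a ⊗ₜ c) = Fam.map (X.hat a).f (Y.hat c).f v := rfl

lemma op_supp {n N : ℕ} {v : Univ K n} (hv : Fam.Supp N v) (x : (X.diag Y).obj n) :
    Fam.Supp N (op X Y v x) := by
  induction x using TensorProduct.induction_on with
  | zero => rw [map_zero]; exact Fam.Supp.zero N
  | tmul a c => exact hv.map _ _
  | add a c ha hc => rw [map_add]; exact ha.add hc

variable {X Y} in
lemma map_op {X' : LMod.{w, z} K} {Y' : LMod.{w, u} K} (φ : X.Hom X') (ψ : Y.Hom Y') {n : ℕ}
    (v : Univ K n) (x : (X.diag Y).obj n) :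
    Fam.map φ.f ψ.f (op X Y v x) = op X' Y' v ((φ.diag ψ).f n x) := by
  induction x using TensorProduct.induction_on with
  | zero => simp only [map_zero]
  | add a c ha hc => rw [map_add, map_add, ha, hc, map_add, map_add]
  | tmul a c =>
    change _ = op X' Y' v (φ.f n a ⊗ₜ ψ.f n c)
    rw [op_tmul, op_tmul, Fam.map_map]
    simp only [Hom.hat]

variable (K) in
/-- The tensor square of the canonical generator. -/
def gen₂ (n : ℕ) : ((free K n).diag (free K n)).obj n := gen K n ⊗ₜ gen K n

/-- Precomposition of a family of operations with the boundary. -/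
def preB {X : LMod.{w, x} K} {Y : LMod.{w, y} K}
    (g : ∀ n, (X.diag Y).obj n →ₗ[K] Fam K X.obj Y.obj) :
    ∀ n, (X.diag Y).obj n →ₗ[K] Fam K X.obj Y.obj
  | 0 => 0
  | n + 1 => g n ∘ₗ (X.diag Y).b n

/-- The right hand side of the equation `b g = g b + g' B - B g'`, where `g'` is the family of
operations preceding `g`. -/
def rhs {X : LMod.{w, x} K} {Y : LMod.{w, y} K}
    (g g' : ∀ n, (X.diag Y).obj n →ₗ[K] Fam K X.obj Y.obj) (n : ℕ) :
    (X.diag Y).obj n →ₗ[K] Fam K X.obj Y.obj :=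
  preB g n + g' (n + 1) ∘ₗ (X.diag Y).B n - upB X Y ∘ₗ g' n

lemma rhs_apply {X : LMod.{w, x} K} {Y : LMod.{w, y} K}
    (g g' : ∀ n, (X.diag Y).obj n →ₗ[K] Fam K X.obj Y.obj) (n : ℕ) (x : (X.diag Y).obj n) :
    rhs g g' n x = preB g n x + g' (n + 1) ((X.diag Y).B n x) - upB X Y (g' n x) := rfl

/-- The right hand side of the recursion is a cycle, if the recursion holds for the preceding
operations, and in lower degree. -/
lemma b_rhs {X : LMod.{w, x} K} {Y : LMod.{w, y} K}
    (g g' g'' : ∀ n, (X.diag Y).obj n →ₗ[K] Fam K X.obj Y.obj) (n : ℕ)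
    (h1 : ∀ k, k < n → ∀ x, Fam.d X.b Y.b (g k x) = rhs g g' k x)
    (h2 : ∀ k x, Fam.d X.b Y.b (g' k x) = rhs g' g'' k x)
    (hT : ∀ k x, g' k ((X.diag Y).T k x) = Fam.map X.T Y.T (g' k x))
    (hB : ∀ k x, g'' (k + 2) ((X.diag Y).B (k + 1) ((X.diag Y).B k x)) =
      upB X Y (upB X Y (g'' k x))) (x : (X.diag Y).obj n) :
    Fam.d X.b Y.b (rhs g g' n x) = 0 := by
  have h3 := b_upB (g' n x)
  rw [h2, rhs_apply, map_sub, map_add, ← hB n x] at h3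
  rw [rhs_apply, map_sub, map_add, h2 (n + 1), rhs_apply]
  rw [← eq_sub_iff_add_eq] at h3
  rw [h3]
  cases n with
  | zero =>
    change Fam.d X.b Y.b 0 + (g' 0 ((X.diag Y).b 0 ((X.diag Y).B 0 x)) + _ - _) -
      (_ - (upB X Y 0 + _ - _)) = 0
    rw [b_B_zero, map_sub, hT, map_zero, map_zero]
    abel
  | succ n =>
    have h4 := (X.diag Y).b_B n x
    rw [← eq_sub_iff_add_eq] at h4
    change Fam.d X.b Y.b (g n ((X.diag Y).b n x)) +
      (g' (n + 1) ((X.diag Y).b (n + 1) ((X.diag Y).B (n + 1) x)) + _ - _) -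
      (_ - (upB X Y (g' n ((X.diag Y).b n x)) + _ - _)) = 0
    have h5 : preB g n ((X.diag Y).b n x) = 0 := by
      cases n with
      | zero => rfl
      | succ n => exact (congrArg (g n) (b_b _ _ _)).trans (map_zero _)
    rw [h1 n (by omega), rhs_apply, h5, h4, map_sub, map_sub, hT]
    abel

/-- The family of operations given by a family of universal elements. -/
def ops (U : ∀ n, Univ K n) (n : ℕ) : (X.diag Y).obj n →ₗ[K] Fam K X.obj Y.obj := op X Y (U n)

variable {X Y} in
lemma map_rhs {X' : LMod.{w, z} K} {Y' : LMod.{w, u} K} (φ : X.Hom X') (ψ : Y.Hom Y')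
    (U U' : ∀ n, Univ K n) (n : ℕ) (x : (X.diag Y).obj n) :
    Fam.map φ.f ψ.f (rhs (ops X Y U) (ops X Y U') n x) =
      rhs (ops X' Y' U) (ops X' Y' U') n ((φ.diag ψ).f n x) := by
  rw [rhs_apply, rhs_apply, map_sub, map_add, map_upB, ops, ops, ops, ops, map_op, map_op,
    Hom.comm_B]
  congr 2
  cases n with
  | zero => exact map_zero _
  | succ n =>
    refine (map_op φ ψ _ _).trans ?_
    rw [Hom.comm_b]
    rfl

variable {X Y} in
/-- A natural operation commutes with the full turn, which is a natural endomorphism. -/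
lemma ops_T (U : ∀ n, Univ K n) (n : ℕ) (x : (X.diag Y).obj n) :
    ops X Y U n ((X.diag Y).T n x) = Fam.map X.T Y.T (ops X Y U n x) :=
  (map_op X.turnHom Y.turnHom (U n) x).symm

/-- The recursion holds for the operations on all paracyclic modules, if it holds for the
universal elements. -/
lemma rec_of_free {U U' : ∀ n, Univ K n} {n : ℕ}
    (h : Fam.d (free K n).b (free K n).b (U n) =
      rhs (ops (free K n) (free K n) U) (ops (free K n) (free K n) U') n (gen₂ K n))
    (x : (X.diag Y).obj n) : Fam.d X.b Y.b (ops X Y U n x) = rhs (ops X Y U) (ops X Y U') n x := by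
  induction x using TensorProduct.induction_on with
  | zero => simp only [map_zero]
  | add a c ha hc => rw [map_add, map_add, map_add, ha, hc]
  | tmul a c =>
    have h1 := congrArg (Fam.map (X.hat a).f (Y.hat c).f) h
    rw [map_b, map_rhs] at h1
    refine h1.trans (congrArg _ ?_)
    exact congrArg₂ (TensorProduct.tmul K) (X.hat_gen a) (Y.hat_gen c)

variable (K) in
/-- The projection of families to the tensor square of the free cyclic module. -/
abbrev red (n : ℕ) : Univ K n →ₗ[K] Fam K (bar K n).obj (bar K n).obj :=
  Fam.map (barMk K n).f (barMk K n).f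

variable {X Y} in
/-- The recursion holds for the operations on all cyclic modules, if it holds for the universal
elements after reduction to free cyclic modules. -/
lemma rec_of_bar (hX : X.IsCyclic) (hY : Y.IsCyclic) {U U' : ∀ n, Univ K n} {n : ℕ}
    (h : red K n (Fam.d (free K n).b (free K n).b (U n)) =
      red K n (rhs (ops (free K n) (free K n) U) (ops (free K n) (free K n) U') n (gen₂ K n)))
    (x : (X.diag Y).obj n) : Fam.d X.b Y.b (ops X Y U n x) = rhs (ops X Y U) (ops X Y U') n x := by
  induction x using TensorProduct.induction_on with
  | zero => simp only [map_zero]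
  | add a c ha hc => rw [map_add, map_add, map_add, ha, hc]
  | tmul a c =>
    have h1 := congrArg (Fam.map (hX.hat a).f (hY.hat c).f) h
    have h2 : ∀ v : Univ K n, Fam.map (hX.hat a).f (hY.hat c).f (red K n v) =
      Fam.map (X.hat a).f (Y.hat c).f v := fun v => Fam.map_map ..
    rw [h2, h2, map_b, map_rhs] at h1
    refine h1.trans (congrArg _ ?_)
    exact congrArg₂ (TensorProduct.tmul K) (X.hat_gen a) (Y.hat_gen c)

end Op

section AW

variable (X : LMod.{w, x} K) (Y : LMod.{w, y} K)

/-- The Alexander–Whitney map on elements of degree `n`. -/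
def awOne (n : ℕ) : (X.diag Y).obj n →ₗ[K] Fam K X.obj Y.obj where
  toFun x p q := if p + q = n then
    TensorProduct.map (X.toSMod.front n p) (Y.toSMod.back n q) x else 0
  map_add' a c := by
    funext p q
    simp only [Pi.add_apply]
    split_ifs
    · exact map_add _ _ _
    · rw [add_zero]
  map_smul' r a := by
    funext p q
    simp only [Pi.smul_apply, RingHom.id_apply]
    split_ifs
    · exact map_smul _ _ _
    · rw [smul_zero]

lemma awOne_apply {n p q : ℕ} (h : p + q = n) (x : (X.diag Y).obj n) :
    awOne X Y n x p q = TensorProduct.map (X.toSMod.front n p) (Y.toSMod.back n q) x := if_pos h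

lemma awOne_supp (n : ℕ) (x : (X.diag Y).obj n) : Fam.Supp n (awOne X Y n x) :=
  fun _ _ h => if_neg h

lemma aw_single (n : ℕ) (x : (X.diag Y).obj n) :
    SMod.aw X.toSMod Y.toSMod (Pi.single n x) = awOne X Y n x := by
  funext p q
  rw [SMod.aw_apply]
  by_cases h : p + q = n
  · subst h
    rw [awOne_apply X Y rfl, Pi.single_eq_same]
  · rw [awOne_supp X Y n x p q h, Pi.single_eq_of_ne h, map_zero]

lemma b_awOne (n : ℕ) (x : (X.diag Y).obj n) :
    Fam.d X.b Y.b (awOne X Y n x) = preB (awOne X Y) n x := by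
  cases n with
  | zero => exact (awOne_supp X Y 0 x).d_zero
  | succ n =>
    change _ = awOne X Y n ((X.diag Y).b n x)
    rw [← aw_single, ← aw_single]
    refine (SMod.aw_bdAll X.toSMod Y.toSMod (Pi.single (n + 1) x)).symm.trans (congrArg _ ?_)
    funext m
    rw [SMod.bdAll_apply]
    by_cases h : m = n
    · subst h
      rw [Pi.single_eq_same, Pi.single_eq_same]
      rfl
    · rw [Pi.single_eq_of_ne h, Pi.single_eq_of_ne (by omega), map_zero]

variable {X Y} in
lemma map_awOne {X' : LMod.{w, z} K} {Y' : LMod.{w, u} K} (φ : X.Hom X') (ψ : Y.Hom Y') (n : ℕ)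
    (x : (X.diag Y).obj n) :
    Fam.map φ.f ψ.f (awOne X Y n x) = awOne X' Y' n ((φ.diag ψ).f n x) := by
  funext p q
  rw [Fam.map_apply]
  by_cases h : p + q = n
  · rw [awOne_apply X Y h, awOne_apply X' Y' h]
    refine (TensorProduct.map_map ..).trans (Eq.trans ?_ (TensorProduct.map_map ..).symm)
    congr 2 <;> refine LinearMap.ext fun x => ?_
    · exact φ.toSMod.comm_front (by omega) x
    · exact ψ.toSMod.comm_back (by omega) x
  · rw [awOne_supp X Y n x p q h, awOne_supp X' Y' n _ p q h, map_zero]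

variable (K) in
/-- The universal elements of the Alexander–Whitney map. -/
def awU (n : ℕ) : Univ K n := awOne (free K n) (free K n) n (gen₂ K n)

/-- The Alexander–Whitney map is natural, hence given by its universal elements. -/
lemma ops_awU : ops X Y (awU K) = awOne X Y := by
  funext n
  refine TensorProduct.ext' fun a c => ?_
  refine (map_awOne (X.hat a) (Y.hat c) n (gen₂ K n)).trans (congrArg _ ?_)
  exact congrArg₂ (TensorProduct.tmul K) (X.hat_gen a) (Y.hat_gen c)

end AW

section Universal

/-- The tensor square of a free paracyclic module is exact in positive degrees. -/
lemma free_fam_exact {n N : ℕ} {v : Univ K n} (hv : Fam.Supp (N + 1) v)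
    (hd : Fam.d (free K n).b (free K n).b v = 0) :
    ∃ v', Fam.Supp (N + 2) v' ∧ Fam.d (free K n).b (free K n).b v' = v :=
  Fam.exact_of_exact (a := 0) (a' := 0) (free K n).b_b (free K n).b_b
    (fun _ _ _ h => free_exact n h) (fun _ _ _ h => free_exact n h) (by omega) hv hd

/-- The tensor square of a free cyclic module, whose homology lives in degrees zero and one, is
exact in degrees at least three. -/
lemma bar_fam_exact {n N : ℕ} {v : Fam K (bar K n).obj (bar K n).obj} (hv : Fam.Supp (N + 3) v)
    (hd : Fam.d (bar K n).b (bar K n).b v = 0) :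
    ∃ v', Fam.Supp (N + 4) v' ∧ Fam.d (bar K n).b (bar K n).b v' = v := by
  have h : ∀ m, 1 ≤ m → ∀ x : (bar K n).obj (m + 1), (bar K n).b m x = 0 →
      ∃ y, (bar K n).b (m + 1) y = x := fun m hm x hx => by
    obtain ⟨m, rfl⟩ : ∃ k, m = k + 1 := ⟨m - 1, by omega⟩
    exact bar_exact n hx
  exact Fam.exact_of_exact (a := 1) (a' := 1) (bar K n).b_b (bar K n).b_b h h (by omega) hv hd

lemma red_surjective {n N : ℕ} {v : Fam K (bar K n).obj (bar K n).obj} (hv : Fam.Supp N v) :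
    ∃ v' : Univ K n, Fam.Supp N v' ∧ red K n v' = v := by
  have h := fun p q => TensorProduct.map_surjective (barMk_surjective (K := K) n p)
    (barMk_surjective (K := K) n q)
  choose f hf using fun p q => h p q (v p q)
  refine ⟨Fam.trunc N f, Fam.trunc_supp N f, funext fun p => funext fun q => ?_⟩
  rw [Fam.map_apply, Fam.trunc_apply]
  split_ifs with hpq
  · exact hf p q
  · rw [hv p q hpq, map_zero]

/-- The universal form of the right hand side of the recursion. -/
abbrev rhsU (U U' : ∀ n, Univ K n) (n : ℕ) : Univ K n :=
  rhs (ops (free K n) (free K n) U) (ops (free K n) (free K n) U') n (gen₂ K n)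

lemma preB_supp {X : LMod.{w, x} K} {Y : LMod.{w, y} K}
    {g : ∀ n, (X.diag Y).obj n →ₗ[K] Fam K X.obj Y.obj} {n a : ℕ}
    (h : ∀ k, k + 1 = n → ∀ x, Fam.Supp (k + 2 + a) (g k x)) (x : (X.diag Y).obj n) :
    Fam.Supp (n + 1 + a) (preB g n x) := by
  cases n with
  | zero => exact Fam.Supp.zero _
  | succ n => exact h n rfl _

lemma rhsU_supp {U U' : ∀ n, Univ K n} {a n : ℕ}
    (h : ∀ k, k + 1 = n → Fam.Supp (k + 2 + a) (U k))
    (h' : ∀ k, Fam.Supp (k + a) (U' k)) : Fam.Supp (n + 1 + a) (rhsU U U' n) := by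
  refine Fam.Supp.sub (Fam.Supp.add (preB_supp (fun k hk x => op_supp _ _ (h k hk) x) _)
    (op_supp _ _ (h' (n + 1)) _)) ?_
  rw [show n + 1 + a = n + a + 1 by omega]
  exact (op_supp _ _ (h' n) _).up

lemma rhsU_congr {U V U' : ∀ n, Univ K n} {n : ℕ} (h : ∀ k, k < n → U k = V k) :
    rhsU U U' n = rhsU V U' n := by
  rw [rhsU, rhsU, rhs_apply, rhs_apply]
  congr 2
  cases n with
  | zero => rfl
  | succ n =>
    change op _ _ (U n) _ = op _ _ (V n) _
    rw [h n (by omega)]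

instance (n : ℕ) : Inhabited (Univ K n) := ⟨0⟩

/-- The first correction of the Alexander–Whitney map. It exists for all paracyclic modules, since
the tensor square of a free paracyclic module is exact in positive degrees. -/
lemma exists_first : ∃ U : ∀ n, Univ K n, ∀ n, Fam.Supp (n + 2) (U n) ∧
    Fam.d (free K n).b (free K n).b (U n) = rhsU U (awU K) n := by
  refine exists_seq (fun n U => Fam.Supp (n + 2) (U n) ∧
    Fam.d (free K n).b (free K n).b (U n) = rhsU U (awU K) n) ?_ ?_
  · rintro n U V h ⟨h1, h2⟩
    rw [← h n le_rfl]
    exact ⟨h1, h2.trans (rhsU_congr fun k hk => h k hk.le)⟩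
  · intro n U h
    have hs : Fam.Supp (n + 1) (rhsU U (awU K) n) :=
      rhsU_supp (a := 0) (fun k hk => (h k (by omega)).1) fun k => awOne_supp _ _ _ _
    obtain ⟨v, hv, hv'⟩ := free_fam_exact hs (b_rhs _ _ (fun _ => 0) n
      (fun k hk x => rec_of_free _ _ (h k hk).2 x)
      (fun k x => by
        rw [ops_awU, b_awOne, rhs_apply]
        simp) (ops_T _) (fun k x => by simp) _)
    refine ⟨v, ?_⟩
    rw [Function.update_self]
    refine ⟨hv, hv'.trans (rhsU_congr fun k hk => ?_)⟩
    rw [Function.update_of_ne hk.ne]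

/-- The higher corrections exist for cyclic modules, since the tensor square of a free cyclic
module is exact in degrees at least three, and the right hand side of the equation for a correction
of degree `a + 4` on elements of degree `n` has degree `n + a + 3`. -/
lemma exists_higher {U' U'' : ∀ n, Univ K n} {a : ℕ} (h' : ∀ n, Fam.Supp (n + (a + 2)) (U' n))
    (h : ∀ n, red K n (Fam.d (free K n).b (free K n).b (U' n)) = red K n (rhsU U' U'' n)) :
    ∃ U : ∀ n, Univ K n, ∀ n, Fam.Supp (n + (a + 4)) (U n) ∧
      red K n (Fam.d (free K n).b (free K n).b (U n)) = red K n (rhsU U U' n) := by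
  refine exists_seq (fun n U => Fam.Supp (n + (a + 4)) (U n) ∧
    red K n (Fam.d (free K n).b (free K n).b (U n)) = red K n (rhsU U U' n)) ?_ ?_
  · rintro n U V h ⟨h1, h2⟩
    rw [← h n le_rfl]
    exact ⟨h1, h2.trans (congrArg _ (rhsU_congr fun k hk => h k hk.le))⟩
  · intro n U hU
    have hs : Fam.Supp (n + a + 3) (rhsU U U' n) := by
      rw [show n + a + 3 = n + 1 + (a + 2) by omega]
      refine rhsU_supp (fun k hk => ?_) h'
      rw [show k + 2 + (a + 2) = k + (a + 4) by omega]
      exact (hU k (by omega)).1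
    have hc := bar_isCyclic (K := K) n
    have hz : Fam.d (bar K n).b (bar K n).b (red K n (rhsU U U' n)) = 0 := by
      rw [map_rhs]
      refine b_rhs _ _ (ops _ _ U'') n (fun k hk x => rec_of_bar hc hc (hU k hk).2 x)
        (fun k x => rec_of_bar hc hc (h k) x) (ops_T _) (fun k x => ?_) _
      rw [(hc.diag hc).B_B, map_zero, hc.upB_upB hc]
    obtain ⟨v, hv, hv'⟩ := bar_fam_exact (hs.map _ _) hz
    obtain ⟨v, hv1, rfl⟩ := red_surjective hv
    refine ⟨v, ?_⟩
    rw [Function.update_self, map_b, hv', rhsU_congr fun k hk => ?_]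
    · exact ⟨by rw [show n + (a + 4) = n + a + 4 by omega]; exact hv1, rfl⟩
    · rw [Function.update_of_ne hk.ne]

/-- The universal elements of a system of higher corrections of the Alexander–Whitney map. The
recursion is only required after reduction to free cyclic modules, that is, on cyclic modules. -/
theorem exists_universal : ∃ U : ℕ → ∀ n, Univ K n, U 0 = awU K ∧
    (∀ l n, Fam.Supp (n + 2 * l) (U l n)) ∧ ∀ l n,
      red K n (Fam.d (free K n).b (free K n).b (U (l + 1) n)) =
        red K n (rhsU (U (l + 1)) (U l) n) := by
  suffices h : ∃ U : ℕ → ∀ n, Univ K n, ∀ l, (l = 0 → U 0 = awU K) ∧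
      (∀ n, Fam.Supp (n + 2 * l) (U l n)) ∧ ∀ k, k + 1 = l → ∀ n,
      red K n (Fam.d (free K n).b (free K n).b (U l n)) = red K n (rhsU (U l) (U k) n) by
    obtain ⟨U, hU⟩ := h
    exact ⟨U, (hU 0).1 rfl, fun l => (hU l).2.1, fun l => (hU (l + 1)).2.2 l rfl⟩
  refine exists_seq (V := fun _ => ∀ n, Univ K n) (fun l U =>
    (l = 0 → U 0 = awU K) ∧ (∀ n, Fam.Supp (n + 2 * l) (U l n)) ∧ ∀ k, k + 1 = l → ∀ n,
      red K n (Fam.d (free K n).b (free K n).b (U l n)) = red K n (rhsU (U l) (U k) n))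
    (fun l U V h hU => ?_) (fun l U hU => ?_)
  · rw [← h 0 (by omega), ← h l le_rfl]
    refine ⟨hU.1, hU.2.1, fun k hk => ?_⟩
    rw [← h k (by omega)]
    exact hU.2.2 k hk
  -- the right hand side for the first correction has degree `n + 1`, where free cyclic modules need
  -- not be exact: this correction is constructed on all paracyclic modules
  · rcases l with _ | _ | l
    · refine ⟨awU K, ?_⟩
      rw [Function.update_self]
      exact ⟨fun _ => rfl, fun n => awOne_supp _ _ _ _, fun k hk => absurd hk (by omega)⟩
    · obtain ⟨V, hV⟩ := exists_first (K := K)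
      refine ⟨V, fun h => absurd h (by omega), ?_⟩
      rw [Function.update_self]
      refine ⟨fun n => (hV n).1, fun k hk n => ?_⟩
      obtain rfl : k = 0 := by omega
      rw [Function.update_of_ne (by omega), (hU 0 (by omega)).1 rfl, (hV n).2]
    · have h1 := hU (l + 1) (by omega)
      obtain ⟨V, hV⟩ := exists_higher (a := 2 * l)
        (fun n => by rw [show n + (2 * l + 2) = n + 2 * (l + 1) by omega]; exact h1.2.1 n)
        (h1.2.2 l rfl)
      refine ⟨V, fun h => absurd h (by omega), ?_⟩
      rw [Function.update_self]
      refine ⟨fun n => by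
        rw [show n + 2 * (l + 1 + 1) = n + (2 * l + 4) by omega]; exact (hV n).1, fun k hk n => ?_⟩
      obtain rfl : k = l + 1 := by omega
      rw [Function.update_of_ne (by omega), (hV n).2]

end Universal

end LMod

end

section

/-! ### The long exact sequence of a surjection of graded differential modules -/

section Gysin

variable {K : Type*} [Field K]

/-- The linear map with a given graph. -/
lemma exists_linearMap_of_graph {V W : Type*} [AddCommGroup V] [Module K V] [AddCommGroup W]
    [Module K W] (Γ : Submodule K (V × W)) (h : ∀ v, ∃ c, (v, c) ∈ Γ)
    (h0 : ∀ c, ((0 : V), c) ∈ Γ → c = 0) : ∃ f : V →ₗ[K] W, ∀ v, (v, f v) ∈ Γ := by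
  choose f hf using h
  have huniq : ∀ v c c', (v, c) ∈ Γ → (v, c') ∈ Γ → c = c' := fun v c c' hc hc' => by
    have := Γ.sub_mem hc hc'
    rw [Prod.mk_sub_mk, sub_self] at this
    exact sub_eq_zero.1 (h0 _ this)
  exact ⟨{ toFun := f
           map_add' := fun v v' => huniq _ _ _ (hf _) (Γ.add_mem (hf v) (hf v'))
           map_smul' := fun r v => huniq _ _ _ (hf _) (Γ.smul_mem r (hf v)) }, hf⟩

/-- `r` exhibits `H` as the homology of the differential module `(Z, d)`, graded by `deg`, up to
the values of `r` on elements which are not cycles. -/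
structure IsHomology {Z H : Type*} [AddCommGroup Z] [Module K Z] [AddCommGroup H] [Module K H]
    (deg : ℕ → Submodule K Z) (d : Z →ₗ[K] Z) (degH : ℕ → Submodule K H) (r : Z →ₗ[K] H) :
    Prop where
  r_d (z : Z) : r (d z) = 0
  r_mem (n : ℕ) (z : Z) : z ∈ deg n → r z ∈ degH n
  lift : ∃ s : H →ₗ[K] Z, (∀ c, d (s c) = 0) ∧ (∀ c, r (s c) = c) ∧
    ∀ n, ∀ c ∈ degH n, s c ∈ deg n
  exact (n : ℕ) (z : Z) : z ∈ deg n → d z = 0 → r z = 0 → ∃ y ∈ deg (n + 1), d y = z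

/-- A surjection `σ` of degree `-2` of a graded differential module `(E, D)`, together with a
quasi-isomorphism `G` from `(Z, d)` to the kernel of `σ`, and homology modules of all of them. -/
structure Gysin (K : Type*) [Field K] (Z E HZ H : Type*) [AddCommGroup Z] [Module K Z]
    [AddCommGroup E] [Module K E] [AddCommGroup HZ] [Module K HZ] [AddCommGroup H]
    [Module K H] where
  deg : ℕ → Submodule K Z
  degE : ℕ → Submodule K E
  degHZ : ℕ → Submodule K HZ
  degH : ℕ → Submodule K H
  d : Z →ₗ[K] Z
  D : E →ₗ[K] E
  σ : E →ₗ[K] E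
  G : Z →ₗ[K] E
  r : Z →ₗ[K] HZ
  ρ : E →ₗ[K] H
  σH : H →ₗ[K] H
  isHomology : IsHomology deg d degHZ r
  isHomologyE : IsHomology degE D degH ρ
  D_D (e : E) : D (D e) = 0
  D_mem (n : ℕ) (e : E) : e ∈ degE (n + 1) → D e ∈ degE n
  D_σ (e : E) : D (σ e) = σ (D e)
  D_G (z : Z) : D (G z) = G (d z)
  σ_G (z : Z) : σ (G z) = 0
  G_mem (n : ℕ) (z : Z) : z ∈ deg n → G z ∈ degE n
  σ_mem (n : ℕ) (e : E) : e ∈ degE (n + 2) → σ e ∈ degE n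
  σ_low (n : ℕ) (e : E) : n < 2 → e ∈ degE n → σ e = 0
  σ_surj (n : ℕ) (e : E) : e ∈ degE n → ∃ e' ∈ degE (n + 2), σ e' = e
  ρ_σ (e : E) : D e = 0 → ρ (σ e) = σH (ρ e)
  quasi (n : ℕ) (z : Z) (t : E) : z ∈ deg n → t ∈ degE (n + 1) → d z = 0 → σ t = 0 → G z = D t →
    ∃ z' ∈ deg (n + 1), ∃ t' ∈ degE (n + 2), σ t' = 0 ∧ d z' = z ∧ t - G z' = D t'
  quasi_zero (t : E) : t ∈ degE 0 → ∃ z' ∈ deg 0, ∃ t', d z' = 0 ∧ t - G z' = D t'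

namespace Gysin

variable {Z E HZ H : Type*} [AddCommGroup Z] [Module K Z] [AddCommGroup E] [Module K E]
  [AddCommGroup HZ] [Module K HZ] [AddCommGroup H] [Module K H] (L : Gysin K Z E HZ H)

/-- A linear choice of cycles representing homology classes. -/
def lift : HZ →ₗ[K] Z := L.isHomology.lift.choose

lemma d_lift (c : HZ) : L.d (L.lift c) = 0 := L.isHomology.lift.choose_spec.1 c

lemma r_lift (c : HZ) : L.r (L.lift c) = c := L.isHomology.lift.choose_spec.2.1 c

lemma lift_mem {n : ℕ} {c : HZ} (hc : c ∈ L.degHZ n) : L.lift c ∈ L.deg n :=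
  L.isHomology.lift.choose_spec.2.2 n c hc

/-- The map induced by `G` in homology. -/
def α : HZ →ₗ[K] H := L.ρ ∘ₗ L.G ∘ₗ L.lift

lemma α_r {n : ℕ} {z : Z} (hz : z ∈ L.deg n) (hd : L.d z = 0) : L.α (L.r z) = L.ρ (L.G z) := by
  obtain ⟨y, -, hy⟩ := L.isHomology.exact n (L.lift (L.r z) - z)
    (sub_mem (L.lift_mem (L.isHomology.r_mem n z hz)) hz)
    (by rw [map_sub, L.d_lift, hd, sub_zero]) (by rw [map_sub, L.r_lift, sub_self])
  have : L.ρ (L.G (L.lift (L.r z) - z)) = 0 := by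
    rw [← hy, ← L.D_G, L.isHomologyE.r_d]
  rw [map_sub, map_sub, sub_eq_zero] at this
  exact this

lemma α_mem {n : ℕ} {c : HZ} (hc : c ∈ L.degHZ n) : L.α c ∈ L.degH n :=
  L.isHomologyE.r_mem n _ (L.G_mem n _ (L.lift_mem hc))

/-- The graph of the connecting homomorphism: if `σ e` is a cycle, then `D e` lies in the kernel of
`σ` and is the image of a cycle `z`; the class of `σ e` is mapped to the class of `z`. Here `z` is
only determined up to boundaries, after a change of `e` by an element of the kernel. -/
def graph (n : ℕ) : Submodule K (H × HZ) where
  carrier := {p | ∃ e ∈ L.degE (n + 2), ∃ z ∈ L.deg (n + 1), L.d z = 0 ∧ L.G z = L.D e ∧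
    L.ρ (L.σ e) = p.1 ∧ L.r z = p.2}
  zero_mem' := ⟨0, zero_mem _, 0, zero_mem _, by simp⟩
  add_mem' := by
    rintro ⟨f, c⟩ ⟨f', c'⟩ ⟨e, he, z, hz, h1, h2, rfl, rfl⟩ ⟨e', he', z', hz', h1', h2', rfl, rfl⟩
    exact ⟨e + e', add_mem he he', z + z', add_mem hz hz', by simp [h1, h1'], by simp [h2, h2'],
      by simp, by simp⟩
  smul_mem' := by
    rintro k ⟨f, c⟩ ⟨e, he, z, hz, h1, h2, rfl, rfl⟩
    exact ⟨k • e, Submodule.smul_mem _ k he, k • z, Submodule.smul_mem _ k hz, by simp [h1],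
      by simp [h2], by simp, by simp⟩

/-- The connecting homomorphism is defined everywhere. -/
lemma exists_graph {n : ℕ} {f : H} (hf : f ∈ L.degH n) : ∃ c, (f, c) ∈ L.graph n := by
  obtain ⟨s, h1, h2, h3⟩ := L.isHomologyE.lift
  obtain ⟨e, he, hs⟩ := L.σ_surj n (s f) (h3 n f hf)
  have hσ : L.σ (L.D e) = 0 := by rw [← L.D_σ, hs, h1]
  obtain ⟨z, hz, t, ht, hσt, hz', hzt⟩ := L.quasi n 0 (L.D e) (zero_mem _)
    (L.D_mem _ _ he) (map_zero _) hσ (by rw [L.D_D, map_zero])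
  refine ⟨L.r z, e - t, sub_mem he ht, z, hz, hz', ?_, ?_, rfl⟩
  · rw [map_sub, ← hzt, sub_sub_cancel]
  · rw [map_sub, hσt, sub_zero, hs, h2]

/-- The connecting homomorphism is well defined. -/
lemma graph_zero {n : ℕ} {c : HZ} (h : ((0 : H), c) ∈ L.graph n) : c = 0 := by
  obtain ⟨e, he, z, hz, h1, h2, h3, rfl⟩ := h
  obtain ⟨v, hv, hv'⟩ := L.isHomologyE.exact n (L.σ e) (L.σ_mem n e he)
    (by rw [L.D_σ, ← h2, L.σ_G]) h3
  obtain ⟨v, hm, rfl⟩ := L.σ_surj _ _ hv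
  obtain ⟨z', -, -, -, -, rfl, -⟩ := L.quasi (n + 1) z (e - L.D v) hz
    (sub_mem he (L.D_mem (n + 2) v hm)) h1
    (by rw [map_sub, ← L.D_σ, hv', sub_self]) (by rw [map_sub, L.D_D, sub_zero, h2])
  exact L.isHomology.r_d z'

/-- A cycle whose image under `σ` represents zero is homologous to an element of the kernel of
`σ`. -/
lemma exists_kernel {n : ℕ} {e : E} (he : e ∈ L.degE n) (hd : L.D e = 0)
    (h : L.ρ (L.σ e) = 0) : ∃ v ∈ L.degE (n + 1), L.σ (e - L.D v) = 0 := by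
  by_cases hn : n < 2
  · exact ⟨0, zero_mem _, by rw [map_zero, sub_zero, L.σ_low n e hn he]⟩
  · obtain ⟨n, rfl⟩ : ∃ m, n = m + 2 := ⟨n - 2, by omega⟩
    obtain ⟨v, hv, hv'⟩ := L.isHomologyE.exact n (L.σ e) (L.σ_mem n e he)
      (by rw [L.D_σ, hd, map_zero]) h
    obtain ⟨v, hm, rfl⟩ := L.σ_surj _ _ hv
    exact ⟨v, hm, by rw [map_sub, ← L.D_σ, hv', sub_self]⟩

lemma σH_α (c : HZ) : L.σH (L.α c) = 0 := by
  have h : L.D (L.G (L.lift c)) = 0 := by rw [L.D_G, L.d_lift, map_zero]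
  change L.σH (L.ρ (L.G (L.lift c))) = 0
  rw [← L.ρ_σ _ h, L.σ_G, map_zero]

lemma exists_α_eq {n : ℕ} {f : H} (hf : f ∈ L.degH n) (h : L.σH f = 0) :
    ∃ c ∈ L.degHZ n, L.α c = f := by
  obtain ⟨s, h1, h2, h3⟩ := L.isHomologyE.lift
  obtain ⟨v, hv, hv'⟩ := L.exists_kernel (h3 n f hf) (h1 f) (by rw [L.ρ_σ _ (h1 f), h2, h])
  have hm := sub_mem (h3 n f hf) (L.D_mem n v hv)
  have hD : L.D (s f - L.D v) = 0 := by rw [map_sub, h1, L.D_D, sub_zero]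
  obtain ⟨z, hz, t, hz', hzt⟩ : ∃ z ∈ L.deg n, ∃ t, L.d z = 0 ∧ s f - L.D v - L.G z = L.D t := by
    cases n with
    | zero => exact L.quasi_zero _ hm
    | succ n =>
      obtain ⟨z, hz, t, -, -, h5, h6⟩ := L.quasi n 0 _ (zero_mem _) hm (map_zero _) hv'
        (by rw [hD, map_zero])
      exact ⟨z, hz, t, h5, h6⟩
  refine ⟨L.r z, L.isHomology.r_mem n z hz, ?_⟩
  have h4 : L.ρ (s f - L.D v - L.G z) = 0 := by rw [hzt, L.isHomologyE.r_d]
  rw [map_sub, map_sub, L.isHomologyE.r_d, sub_zero, h2, sub_eq_zero] at h4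
  rw [L.α_r hz hz', h4]

lemma graph_σH {n : ℕ} {f : H} (hf : f ∈ L.degH (n + 2)) : (L.σH f, (0 : HZ)) ∈ L.graph n := by
  obtain ⟨s, h1, h2, h3⟩ := L.isHomologyE.lift
  exact ⟨s f, h3 _ f hf, 0, zero_mem _, map_zero _, by rw [h1, map_zero],
    by rw [L.ρ_σ _ (h1 f), h2], map_zero _⟩

lemma exists_σH_eq {n : ℕ} {f : H} (h : (f, (0 : HZ)) ∈ L.graph n) :
    ∃ f' ∈ L.degH (n + 2), L.σH f' = f := by
  obtain ⟨e, he, z, hz, h1, h2, rfl, h3⟩ := h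
  obtain ⟨y, hy, rfl⟩ := L.isHomology.exact _ z hz h1 h3
  refine ⟨L.ρ (e - L.G y), L.isHomologyE.r_mem _ _ (sub_mem he (L.G_mem _ _ hy)), ?_⟩
  rw [← L.ρ_σ _ (by rw [map_sub, L.D_G, h2, sub_self]), map_sub, L.σ_G, sub_zero]

lemma graph_α {n : ℕ} {f : H} {c : HZ} (h : (f, c) ∈ L.graph n) : L.α c = 0 := by
  obtain ⟨e, he, z, hz, h1, h2, rfl, rfl⟩ := h
  rw [L.α_r hz h1, h2, L.isHomologyE.r_d]

lemma exists_graph_of_α {n : ℕ} {c : HZ} (hc : c ∈ L.degHZ (n + 1)) (h : L.α c = 0) :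
    ∃ f ∈ L.degH n, (f, c) ∈ L.graph n := by
  have hG : L.D (L.G (L.lift c)) = 0 := by rw [L.D_G, L.d_lift, map_zero]
  obtain ⟨v, hv, hv'⟩ := L.isHomologyE.exact (n + 1) _ (L.G_mem _ _ (L.lift_mem hc)) hG h
  exact ⟨L.ρ (L.σ v), L.isHomologyE.r_mem _ _ (L.σ_mem _ _ hv), v, hv, L.lift c, L.lift_mem hc,
    L.d_lift c, hv'.symm, rfl, L.r_lift c⟩

lemma eq_zero_of_α {c : HZ} (hc : c ∈ L.degHZ 0) (h : L.α c = 0) : c = 0 := by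
  have hG : L.D (L.G (L.lift c)) = 0 := by rw [L.D_G, L.d_lift, map_zero]
  obtain ⟨v, hv, hv'⟩ := L.isHomologyE.exact 0 _ (L.G_mem _ _ (L.lift_mem hc)) hG h
  obtain ⟨z, -, -, -, -, hz, -⟩ := L.quasi 0 _ v (L.lift_mem hc) hv (L.d_lift c)
    (L.σ_low 1 v (by norm_num) hv) hv'.symm
  rw [← L.r_lift c, ← hz, L.isHomology.r_d]

section Naturality

variable {Z' E' HZ' H' : Type*} [AddCommGroup Z'] [Module K Z'] [AddCommGroup E'] [Module K E']
  [AddCommGroup HZ'] [Module K HZ'] [AddCommGroup H'] [Module K H'] {L} {L' : Gysin K Z' E' HZ' H'}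
  {φ : Z →ₗ[K] Z'} {ψ : E →ₗ[K] E'} {φH : HZ →ₗ[K] HZ'} {ψH : H →ₗ[K] H'}

lemma map_α (hφ : ∀ n, ∀ z ∈ L.deg n, φ z ∈ L'.deg n) (hd : ∀ z, φ (L.d z) = L'.d (φ z))
    (hG : ∀ z, ψ (L.G z) = L'.G (φ z)) (hr : ∀ z, L.d z = 0 → φH (L.r z) = L'.r (φ z))
    (hρ : ∀ e, L.D e = 0 → ψH (L.ρ e) = L'.ρ (ψ e)) {n : ℕ} {c : HZ} (hc : c ∈ L.degHZ n) :
    ψH (L.α c) = L'.α (φH c) := by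
  conv_rhs => rw [← L.r_lift c, hr _ (L.d_lift c), L'.α_r (hφ _ _ (L.lift_mem hc))
    (by rw [← hd, L.d_lift, map_zero]), ← hG]
  exact hρ _ (by rw [LinearMap.comp_apply, L.D_G, L.d_lift, map_zero])

lemma map_graph (hφ : ∀ n, ∀ z ∈ L.deg n, φ z ∈ L'.deg n)
    (hψ : ∀ n, ∀ e ∈ L.degE n, ψ e ∈ L'.degE n) (hd : ∀ z, φ (L.d z) = L'.d (φ z))
    (hD : ∀ e, ψ (L.D e) = L'.D (ψ e)) (hσ : ∀ e, ψ (L.σ e) = L'.σ (ψ e))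
    (hG : ∀ z, ψ (L.G z) = L'.G (φ z)) (hr : ∀ z, L.d z = 0 → φH (L.r z) = L'.r (φ z))
    (hρ : ∀ e, L.D e = 0 → ψH (L.ρ e) = L'.ρ (ψ e)) {n : ℕ} {f : H} {c : HZ}
    (h : (f, c) ∈ L.graph n) : (ψH f, φH c) ∈ L'.graph n := by
  obtain ⟨e, he, z, hz, h1, h2, rfl, rfl⟩ := h
  refine ⟨ψ e, hψ _ _ he, φ z, hφ _ _ hz, by rw [← hd, h1, map_zero], by rw [← hG, h2, hD], ?_,
    (hr _ h1).symm⟩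
  rw [← hσ, ← hρ]
  rw [L.D_σ, ← h2, L.σ_G]

end Naturality

end Gysin
end Gysin

end

section

/-! ### Cyclic homology classes -/

section Class

variable {K : Type w} [Field K]

/-- The homology class of a cycle. -/
def homologyClass (S : ShortComplex (ModuleCat.{x} K)) : LinearMap.ker S.g.hom →ₗ[K] S.homology :=
  (S.moduleCatCyclesIso.inv ≫ S.homologyπ).hom

lemma homologyClass_surjective (S : ShortComplex (ModuleCat.{x} K)) :
    Function.Surjective (homologyClass S) :=
  (ModuleCat.epi_iff_surjective (S.moduleCatCyclesIso.inv ≫ S.homologyπ)).1 inferInstance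

lemma homologyClass_eq_zero {S : ShortComplex (ModuleCat.{x} K)} (c : LinearMap.ker S.g.hom) :
    homologyClass S c = 0 ↔ ∃ y, S.f.hom y = c.1 := by
  have h : homologyClass S c = S.moduleCatHomologyIso.inv.hom
      ((LinearMap.range S.moduleCatToCycles).mkQ c) := by
    rw [homologyClass, S.moduleCatCyclesIso_inv_π]
    rfl
  rw [h]
  refine (map_eq_zero_iff _ ((ModuleCat.mono_iff_injective _).1 inferInstance)).trans ?_
  refine (Submodule.Quotient.mk_eq_zero (LinearMap.range S.moduleCatToCycles)).trans ?_
  exact exists_congr fun y => Subtype.ext_iff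

lemma homologyMap_class {S S' : ShortComplex (ModuleCat.{x} K)} (φ : S ⟶ S')
    (c : LinearMap.ker S.g.hom) (c' : LinearMap.ker S'.g.hom) (h : c'.1 = φ.τ₂.hom c.1) :
    (ShortComplex.homologyMap φ).hom (homologyClass S c) = homologyClass S' c' := by
  have h1 : (ShortComplex.homologyMap φ).hom (homologyClass S c) =
      (S.moduleCatCyclesIso.inv ≫ S.homologyπ ≫ ShortComplex.homologyMap φ).hom c := rfl
  have h2 : ShortComplex.cyclesMap φ ≫ S'.moduleCatCyclesIso.hom ≫
      S'.moduleCatLeftHomologyData.i = S.iCycles ≫ φ.τ₂ := by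
    rw [S'.moduleCatCyclesIso_hom_i, ShortComplex.cyclesMap_i]
  have h3 : (S.moduleCatCyclesIso.inv ≫ ShortComplex.cyclesMap φ ≫
      S'.moduleCatCyclesIso.hom).hom c = c' := by
    refine Subtype.ext ?_
    change (S.moduleCatCyclesIso.inv ≫ ShortComplex.cyclesMap φ ≫
      S'.moduleCatCyclesIso.hom ≫ S'.moduleCatLeftHomologyData.i).hom c = c'.1
    rw [h2, S.moduleCatCyclesIso_inv_iCycles_assoc, h]
    rfl
  rw [h1, ShortComplex.homologyπ_naturality, ← h3]
  change _ = (S.moduleCatCyclesIso.inv ≫ ShortComplex.cyclesMap φ ≫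
    S'.moduleCatCyclesIso.hom ≫ S'.moduleCatCyclesIso.inv ≫ S'.homologyπ).hom c
  rw [Iso.hom_inv_id_assoc]

variable (M : MixedComplex.{w, x} K)

/-- The cyclic cycles. -/
def cycles : ∀ n, Submodule K (M.Chain n)
  | 0 => ⊤
  | n + 1 => LinearMap.ker (M.chainD n)

lemma ker_sc (n : ℕ) : LinearMap.ker (M.cyclicComplex.sc n).g.hom = cycles M n := by
  change LinearMap.ker (M.cyclicComplex.d n ((ComplexShape.down ℕ).next n)).hom = _
  cases n with
  | zero =>
    rw [M.cyclicComplex.shape _ _ (by rw [ChainComplex.next_nat_zero]; simp)]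
    exact LinearMap.ker_zero
  | succ n =>
    rw [ChainComplex.next_nat_succ, M.cyclicComplex_d]
    rfl

lemma sc_f_iff (n : ℕ) (c : M.Chain n) :
    (∃ y, (M.cyclicComplex.sc n).f.hom y = c) ↔ ∃ y, M.chainD n y = c := by
  change (∃ y, (M.cyclicComplex.d _ n).hom y = c) ↔ _
  rw [ChainComplex.prev, M.cyclicComplex_d]
  rfl

/-- The class of a cyclic cycle. -/
def cls (n : ℕ) : cycles M n →ₗ[K] M.HC n :=
  homologyClass (M.cyclicComplex.sc n) ∘ₗ LinearMap.codRestrict _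
    (show cycles M n →ₗ[K] (M.cyclicComplex.sc n).X₂ from (cycles M n).subtype)
    fun c => (ker_sc M n).ge c.2

lemma cls_surjective (n : ℕ) : Function.Surjective (cls M n) :=
  (homologyClass_surjective _).comp fun c => ⟨⟨c.1, (ker_sc M n).le c.2⟩, rfl⟩

variable {M}

lemma cls_eq_zero {n : ℕ} (c : cycles M n) : cls M n c = 0 ↔ ∃ y, M.chainD n y = c.1 :=
  (homologyClass_eq_zero _).trans (sc_f_iff M n c.1)

lemma mapHC_cls {N : MixedComplex.{w, x} K} (F : M.Hom N) {n : ℕ} (c : cycles M n)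
    (c' : cycles N n) (h : c'.1 = F.chainMap n c.1) :
    (F.mapHC n).hom (cls M n c) = cls N n c' :=
  homologyMap_class _ _ _ h

lemma S_cls {n : ℕ} (c : cycles M (n + 2)) (c' : cycles M n)
    (h : c'.1 = M.chainS (n + 2) n c.1) : (M.S n).hom (cls M (n + 2) c) = cls M n c' :=
  homologyMap_class _ _ _ h

variable (M)

lemma chainD_chainD_apply (n : ℕ) (y : M.Chain (n + 2)) : M.chainD n (M.chainD (n + 1) y) = 0 :=
  LinearMap.congr_fun (MixedComplex.chainD_chainD n) y

/-- A deformation retraction of the cyclic complex onto a complex with zero differential. -/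
def retract : Retract M.chainD := (exists_retract M.chainD (chainD_chainD_apply M)).some

lemma ϖ_mem (n : ℕ) (c : M.Chain n) : (retract M).ϖ n c ∈ cycles M n := by
  cases n with
  | zero => trivial
  | succ n => exact LinearMap.congr_fun ((retract M).d_ϖ n) c

/-- The linear extension of the class map to all chains given by the retraction. -/
def toHC (n : ℕ) : M.Chain n →ₗ[K] M.HC n :=
  cls M n ∘ₗ ((retract M).ϖ n).codRestrict (cycles M n) (ϖ_mem M n)

variable {M}

lemma toHC_apply (n : ℕ) (c : M.Chain n) : toHC M n c = cls M n ⟨_, ϖ_mem M n c⟩ := rfl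

lemma toHC_cycle {n : ℕ} (c : cycles M n) : toHC M n c.1 = cls M n c := by
  rw [toHC_apply, ← sub_eq_zero, ← map_sub, cls_eq_zero]
  refine ⟨-(retract M).h n c.1, ?_⟩
  rw [map_neg]
  cases n with
  | zero =>
    change _ = (retract M).ϖ 0 c.1 - c.1
    rw [(retract M).ϖ_of_cycle_zero]
    abel
  | succ n =>
    change _ = (retract M).ϖ (n + 1) c.1 - c.1
    rw [(retract M).ϖ_of_cycle c.2]
    abel

lemma toHC_d (n : ℕ) : toHC M n ∘ₗ M.chainD n = 0 := by
  refine LinearMap.ext fun c => ?_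
  rw [LinearMap.comp_apply, toHC_apply, LinearMap.zero_apply, cls_eq_zero]
  refine ⟨0, ?_⟩
  rw [map_zero]
  exact (LinearMap.congr_fun ((retract M).ϖ_d n) c).symm

lemma toHC_ϖ (n : ℕ) : toHC M n ∘ₗ (retract M).ϖ n = toHC M n :=
  LinearMap.ext fun c => by
    rw [LinearMap.comp_apply, toHC_apply, toHC_apply]
    congr 2
    exact LinearMap.congr_fun ((retract M).idem n) c

variable (M) in
lemma exists_section (n : ℕ) : ∃ s : M.HC n →ₗ[K] M.Chain n,
    (∀ c, s c ∈ cycles M n) ∧ toHC M n ∘ₗ s = LinearMap.id := by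
  obtain ⟨s, hs⟩ := (cls M n).exists_rightInverse_of_surjective
    (LinearMap.range_eq_top.2 (cls_surjective M n))
  refine ⟨(cycles M n).subtype ∘ₗ s, fun c => (s c).2, LinearMap.ext fun c => ?_⟩
  exact (toHC_cycle (s c)).trans (LinearMap.congr_fun hs c)

variable (M) in
/-- A linear choice of cyclic cycles representing the cyclic homology classes. -/
def sec (n : ℕ) : M.HC n →ₗ[K] M.Chain n := (exists_section M n).choose

lemma sec_mem {n : ℕ} (c : M.HC n) : sec M n c ∈ cycles M n := (exists_section M n).choose_spec.1 c

lemma toHC_sec (n : ℕ) : toHC M n ∘ₗ sec M n = LinearMap.id := (exists_section M n).choose_spec.2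

lemma chainD_sec (n : ℕ) : M.chainD n ∘ₗ sec M (n + 1) = 0 :=
  LinearMap.ext fun c => sec_mem c

/-- The retraction factors through homology. -/
lemma ϖ_eq (n : ℕ) : (retract M).ϖ n = ((retract M).ϖ n ∘ₗ sec M n) ∘ₗ toHC M n := by
  refine LinearMap.ext fun c => ?_
  have h : toHC M n (c - sec M n (toHC M n c)) = 0 := by
    rw [map_sub]
    exact sub_eq_zero.2 (LinearMap.congr_fun (toHC_sec n) (toHC M n c)).symm
  rw [toHC_apply, cls_eq_zero] at h
  obtain ⟨y, hy⟩ := h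
  have h2 := LinearMap.congr_fun ((retract M).idem n) (c - sec M n (toHC M n c))
  rw [LinearMap.comp_apply] at h2
  change M.chainD n y = (retract M).ϖ n _ at hy
  rw [← hy] at h2
  have h3 := h2.symm.trans (LinearMap.congr_fun ((retract M).ϖ_d n) y)
  rw [LinearMap.zero_apply, hy, map_sub, sub_eq_zero] at h3
  exact h3

lemma mapHC_toHC {N : MixedComplex.{w, x} K} (F : M.Hom N) {n : ℕ} {c : M.Chain n}
    (hc : c ∈ cycles M n) : (F.mapHC n).hom (toHC M n c) = toHC N n (F.chainMap n c) := by
  have h : F.chainMap n c ∈ cycles N n := by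
    cases n with
    | zero => trivial
    | succ n =>
      have := LinearMap.congr_fun (F.chainMap_chainD n) c
      simp only [LinearMap.comp_apply] at this
      change N.chainD n _ = 0
      rw [this, show M.chainD n c = 0 from hc, map_zero]
  exact (congrArg _ (toHC_cycle ⟨c, hc⟩)).trans
    ((mapHC_cls F ⟨c, hc⟩ ⟨_, h⟩ rfl).trans (toHC_cycle ⟨_, h⟩).symm)

lemma S_toHC {n : ℕ} {c : M.Chain (n + 2)} (hc : c ∈ cycles M (n + 2)) :
    (M.S n).hom (toHC M (n + 2) c) = toHC M n (M.chainS (n + 2) n c) := by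
  have h : M.chainS (n + 2) n c ∈ cycles M n := by
    cases n with
    | zero => trivial
    | succ n =>
      have := LinearMap.congr_fun (MixedComplex.chainS_chainD (M := M) n) c
      simp only [LinearMap.comp_apply] at this
      change M.chainD n _ = 0
      rw [← this, show M.chainD (n + 2) c = 0 from hc, map_zero]
  exact (congrArg _ (toHC_cycle ⟨c, hc⟩)).trans
    ((S_cls ⟨c, hc⟩ ⟨_, h⟩ rfl).trans (toHC_cycle ⟨_, h⟩).symm)

end Class

end

section

/-! ### Homology of tensor products of cyclic complexes -/

section Families

variable {K : Type w} [Field K]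

/-- The families concentrated in degree `N`. -/
def Fam.deg {X Y : ℕ → Type*} [∀ n, AddCommGroup (X n)] [∀ n, Module K (X n)]
    [∀ n, AddCommGroup (Y n)] [∀ n, Module K (Y n)] (N : ℕ) : Submodule K (Fam K X Y) where
  carrier := {w | Fam.Supp N w}
  zero_mem' := Fam.Supp.zero N
  add_mem' h h' := Fam.Supp.add h h'
  smul_mem' c _ h := Fam.Supp.smul h c

/-- The families of elements of all `X n` which are concentrated in degree `N`. -/
def degAll (K : Type*) [Field K] (X : ℕ → Type*) [∀ n, AddCommGroup (X n)] [∀ n, Module K (X n)]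
    (N : ℕ) : Submodule K (∀ n, X n) where
  carrier := {z | ∀ n, n ≠ N → z n = 0}
  zero_mem' _ _ := rfl
  add_mem' h h' n hn := by rw [Pi.add_apply, h n hn, h' n hn, add_zero]
  smul_mem' c z h n hn := by rw [Pi.smul_apply, h n hn, smul_zero]

lemma single_mem_degAll {X : ℕ → Type*} [∀ n, AddCommGroup (X n)] [∀ n, Module K (X n)] (N : ℕ)
    (a : X N) : Pi.single N a ∈ degAll K X N := fun _ h => Pi.single_eq_of_ne h a

lemma eq_single {X : ℕ → Type*} [∀ n, AddCommGroup (X n)] [∀ n, Module K (X n)] {N : ℕ}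
    {z : ∀ n, X n} (hz : z ∈ degAll K X N) : z = Pi.single N (z N) := by
  funext n
  by_cases h : n = N
  · subst h; rw [Pi.single_eq_same]
  · rw [Pi.single_eq_of_ne h, hz n h]

variable (P : MixedComplex.{w, z} K)

/-- The cyclic boundary on families of chains of all degrees. -/
def chainDAll : (∀ n, P.Chain n) →ₗ[K] (∀ n, P.Chain n) :=
  LinearMap.pi fun n => P.chainD n ∘ₗ LinearMap.proj (n + 1)

/-- The classes of families of chains of all degrees. -/
def toHCAll : (∀ n, P.Chain n) →ₗ[K] (∀ n, P.HC n) :=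
  LinearMap.pi fun n => toHC P n ∘ₗ LinearMap.proj n

lemma chainDAll_apply (z : ∀ n, P.Chain n) (n : ℕ) : chainDAll P z n = P.chainD n (z (n + 1)) := rfl

lemma toHCAll_apply (z : ∀ n, P.Chain n) (n : ℕ) : toHCAll P z n = toHC P n (z n) := rfl

variable {P} in
lemma mem_cycles_of {z : ∀ n, P.Chain n} (hz : chainDAll P z = 0) (n : ℕ) : z n ∈ cycles P n := by
  cases n with
  | zero => trivial
  | succ n => exact congrFun hz n

variable {P} in
lemma chainDAll_single {n : ℕ} {c : P.Chain n} (hc : c ∈ cycles P n) :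
    chainDAll P (Pi.single n c) = 0 := by
  funext m
  rw [chainDAll_apply]
  by_cases h : m + 1 = n
  · subst h
    rw [Pi.single_eq_same]
    exact hc
  · rw [Pi.single_eq_of_ne h, map_zero]
    rfl

lemma chainDAll_single_succ {n : ℕ} (c : P.Chain (n + 1)) :
    chainDAll P (Pi.single (n + 1) c) = Pi.single n (P.chainD n c) := by
  funext m
  rw [chainDAll_apply]
  by_cases h : m = n
  · subst h
    rw [Pi.single_eq_same, Pi.single_eq_same]
  · rw [Pi.single_eq_of_ne (by omega), Pi.single_eq_of_ne h, map_zero]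

/-- Cyclic homology is the homology of the cyclic complex, in all degrees together. -/
theorem isHomology_chain : IsHomology (degAll K P.Chain) (chainDAll P)
    (degAll K fun n => P.HC n) (toHCAll P) where
  r_d z := funext fun n => LinearMap.congr_fun (toHC_d n) (z (n + 1))
  r_mem N z hz n hn := by rw [toHCAll_apply, hz n hn, map_zero]
  lift := ⟨LinearMap.pi fun n => sec P n ∘ₗ LinearMap.proj n,
    fun c => funext fun n => LinearMap.congr_fun (chainD_sec n) (c (n + 1)),
    fun c => funext fun n => LinearMap.congr_fun (toHC_sec n) (c n),
    fun N c hc n hn => by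
      change sec P n (c n) = 0
      rw [hc n hn, map_zero]⟩
  exact N z hz hd h := by
    have h1 : cls P N ⟨z N, mem_cycles_of hd N⟩ = 0 :=
      (toHC_cycle (M := P) ⟨z N, mem_cycles_of hd N⟩).symm.trans (congrFun h N)
    obtain ⟨y, hy⟩ := (cls_eq_zero _).1 h1
    refine ⟨Pi.single (N + 1) y, single_mem_degAll _ _, ?_⟩
    rw [chainDAll_single_succ, hy, ← eq_single hz]

variable (M : MixedComplex.{w, x} K) (N : MixedComplex.{w, y} K)

/-- Families of tensors of cyclic homology classes. -/
abbrev FamHC := Fam K (fun n => M.HC n) fun n => N.HC n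

/-- The map from families of tensors of chains to families of tensors of homology classes. -/
abbrev famToHC : Fam K M.Chain N.Chain →ₗ[K] FamHC M N := Fam.map (toHC M) (toHC N)

/-- The Künneth theorem over a field, for the tensor product of the cyclic complexes. -/
theorem isHomology_fam : IsHomology (Fam.deg (K := K) (X := M.Chain) (Y := N.Chain))
    (Fam.d M.chainD N.chainD) Fam.deg (famToHC M N) where
  r_d w := by
    funext p q
    rw [Fam.map_apply, Fam.d_apply, map_add, map_smul, Fam.tmap_map, Fam.tmap_map, toHC_d, toHC_d,
      TensorProduct.map_zero_left, TensorProduct.map_zero_right, LinearMap.zero_apply,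
      LinearMap.zero_apply, smul_zero, add_zero]
    rfl
  r_mem n w hw := Fam.Supp.map hw _ _
  lift := ⟨Fam.map (sec M) (sec N), fun c => by
      funext p q
      rw [Fam.d_apply, Fam.map_apply, Fam.map_apply, Fam.tmap_map, Fam.tmap_map, chainD_sec,
        chainD_sec, TensorProduct.map_zero_left, TensorProduct.map_zero_right,
        LinearMap.zero_apply, LinearMap.zero_apply, smul_zero, add_zero]
      rfl,
    fun c => by
      funext p q
      rw [Fam.map_apply, Fam.map_apply, Fam.tmap_map, toHC_sec, toHC_sec, TensorProduct.map_id,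
        LinearMap.id_apply],
    fun n c hc => Fam.Supp.map hc _ _⟩
  exact n w hw hd h := by
    -- the projection `ϖ ⊗ ϖ` onto homology kills `w`, so the homotopy exhibits `w` as a boundary
    refine ⟨Fam.hom (retract M) (retract N) w, Fam.Supp.up hw, ?_⟩
    have h1 : Fam.map (retract M).ϖ (retract N).ϖ w = 0 := by
      funext p q
      rw [Fam.map_apply, ϖ_eq (M := M), ϖ_eq (M := N), ← Fam.tmap_map,
        ← Fam.map_apply (toHC M) (toHC N), h]
      exact map_zero _
    have h2 := Fam.eq_of_cycle (retract M) (retract N) hd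
    rw [h1, zero_add] at h2
    exact h2.symm

/-- Transport along an isomorphism of differential modules. -/
lemma IsHomology.congr {Z Z' H : Type*} [AddCommGroup Z] [Module K Z] [AddCommGroup Z']
    [Module K Z'] [AddCommGroup H] [Module K H] {deg : ℕ → Submodule K Z} {d : Z →ₗ[K] Z}
    {degH : ℕ → Submodule K H} {r : Z →ₗ[K] H} (h : IsHomology deg d degH r) (e : Z ≃ₗ[K] Z')
    {deg' : ℕ → Submodule K Z'} {d' : Z' →ₗ[K] Z'} (hdeg : ∀ n z, z ∈ deg n ↔ e z ∈ deg' n)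
    (hd : ∀ z, e (d z) = d' (e z)) : IsHomology deg' d' degH (r ∘ₗ e.symm.toLinearMap) where
  r_d z := by
    obtain ⟨z, rfl⟩ := e.surjective z
    rw [← hd]
    simpa using h.r_d z
  r_mem n z hz := by
    obtain ⟨z, rfl⟩ := e.surjective z
    simpa using h.r_mem n z ((hdeg n z).2 hz)
  lift := by
    obtain ⟨s, h1, h2, h3⟩ := h.lift
    refine ⟨e.toLinearMap ∘ₗ s, fun c => ?_, fun c => ?_, fun n c hc => (hdeg _ _).1 (h3 n c hc)⟩
    · change d' (e (s c)) = 0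
      rw [← hd, h1, map_zero]
    · simp [h2]
  exact n z hz hdz hr := by
    obtain ⟨z, rfl⟩ := e.surjective z
    obtain ⟨y, hy, hy'⟩ := h.exact n z ((hdeg n z).2 hz)
      (e.injective (by rw [hd, hdz, map_zero])) (by simpa using hr)
    exact ⟨e y, (hdeg _ _).1 hy, by rw [← hd, hy']⟩

end Families

section Components

variable {K : Type w} [Field K] (M : MixedComplex.{w, x} K)

/-- The component of a cyclic `n`-chain with index `(m, k)` when `m + 2k = n` (and zero
otherwise). -/
def pr (n m k : ℕ) : M.Chain n →ₗ[K] M.X m :=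
  if h : m + 2 * k = n then
    DirectSum.component K {p : ℕ × ℕ // p.1 + 2 * p.2 = n} (fun p => M.X p.1.1) ⟨(m, k), h⟩
  else 0

variable {M}

lemma pr_eq_zero {n m k : ℕ} (h : m + 2 * k ≠ n) : pr M n m k = 0 := dif_neg h

lemma incl_eq_zero {n m k : ℕ} (h : m + 2 * k ≠ n) : M.incl n m k = 0 := dif_neg h

lemma pr_incl {n m k : ℕ} (h : m + 2 * k = n) (a : M.X m) : pr M n m k (M.incl n m k a) = a := by
  rw [pr, dif_pos h, MixedComplex.incl_eq _ _ _ h, DirectSum.component.lof_self]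

lemma pr_incl_of_ne {n m k m' k' : ℕ} (hk : k ≠ k') (a : M.X m') :
    pr M n m k (M.incl n m' k' a) = 0 := by
  by_cases h : m + 2 * k = n
  · by_cases h' : m' + 2 * k' = n
    · rw [pr, dif_pos h, MixedComplex.incl_eq _ _ _ h', DirectSum.component.of, dif_neg]
      intro h2
      exact hk (congrArg (fun p => p.1.2) h2).symm
    · rw [incl_eq_zero h', LinearMap.zero_apply, map_zero]
  · rw [pr_eq_zero h, LinearMap.zero_apply]

lemma pr_incl_of_ne' {n m k m' k' : ℕ} (hm : m ≠ m') (a : M.X m') :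
    pr M n m k (M.incl n m' k' a) = 0 := by
  by_cases hk : k = k'
  · subst hk
    by_cases h : m + 2 * k = n
    · rw [incl_eq_zero (by omega), LinearMap.zero_apply, map_zero]
    · rw [pr_eq_zero h, LinearMap.zero_apply]
  · exact pr_incl_of_ne hk a

lemma chain_eq_zero {n : ℕ} {c : M.Chain n} (h : ∀ m k, pr M n m k c = 0) : c = 0 := by
  refine DirectSum.ext_component K fun ⟨⟨m, k⟩, hp⟩ => ?_
  have := h m k
  rw [pr, dif_pos hp] at this
  rw [this, map_zero]

lemma sum_incl_pr (n : ℕ) : ∑ m ∈ Finset.range (n + 1), ∑ k ∈ Finset.range (n + 1),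
    M.incl n m k ∘ₗ pr M n m k = LinearMap.id := by
  refine MixedComplex.chain_ext fun m k h => LinearMap.ext fun a => ?_
  simp only [LinearMap.comp_apply, LinearMap.sum_apply, LinearMap.id_apply]
  rw [Finset.sum_eq_single m, Finset.sum_eq_single k, pr_incl h]
  · intro k' _ hk'
    rw [pr_incl_of_ne hk', map_zero]
  · intro hk
    exact absurd (Finset.mem_range.2 (by omega)) hk
  · intro m' _ hm'
    exact Finset.sum_eq_zero fun k' _ => by rw [pr_incl_of_ne' hm', map_zero]
  · intro hm
    exact absurd (Finset.mem_range.2 (by omega)) hm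

/-- The component of index `(m, k)` of the part `B` of the boundary. -/
def prB (n k : ℕ) : ∀ m, M.Chain n →ₗ[K] M.X m
  | 0 => 0
  | m + 1 => M.B m ∘ₗ pr M n m (k + 1)

lemma pr_chainD {n m k : ℕ} (h : m + 2 * k = n) :
    pr M n m k ∘ₗ M.chainD n = M.b m ∘ₗ pr M (n + 1) (m + 1) k + prB (n + 1) k m := by
  refine MixedComplex.chain_ext fun m' k' h' => LinearMap.ext fun a => ?_
  rw [LinearMap.comp_assoc, MixedComplex.chainD_incl h']
  simp only [LinearMap.comp_apply, LinearMap.add_apply, map_add]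
  congr 1
  · cases m' with
    | zero =>
      rw [MixedComplex.bPart_zero, map_zero, pr_incl_of_ne' (by omega), map_zero]
    | succ m' =>
      rw [MixedComplex.bPart_succ]
      by_cases hk : k = k'
      · subst hk
        obtain rfl : m = m' := by omega
        rw [pr_incl h, pr_incl h']
      · rw [pr_incl_of_ne hk, pr_incl_of_ne hk, map_zero]
  · cases k' with
    | zero =>
      rw [MixedComplex.BPart_zero, map_zero]
      cases m with
      | zero => rfl
      | succ m => rw [prB, LinearMap.comp_apply, pr_incl_of_ne (by omega), map_zero]
    | succ k' =>
      rw [MixedComplex.BPart_succ]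
      by_cases hk : k = k'
      · subst hk
        obtain rfl : m = m' + 1 := by omega
        rw [pr_incl h, prB, LinearMap.comp_apply, pr_incl h']
      · rw [pr_incl_of_ne hk]
        cases m with
        | zero => rfl
        | succ m => rw [prB, LinearMap.comp_apply, pr_incl_of_ne (by omega), map_zero]

lemma pr_chainS {n m k : ℕ} (h : m + 2 * k = n) :
    pr M n m k ∘ₗ M.chainS (n + 2) n = pr M (n + 2) m (k + 1) := by
  refine MixedComplex.chain_ext fun m' k' h' => LinearMap.ext fun a => ?_
  rw [LinearMap.comp_assoc, MixedComplex.chainS_incl h']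
  simp only [LinearMap.comp_apply]
  cases k' with
  | zero => rw [MixedComplex.sPart_zero, map_zero, pr_incl_of_ne (by omega)]
  | succ k' =>
    rw [MixedComplex.sPart_succ]
    by_cases hk : k = k'
    · subst hk
      obtain rfl : m = m' := by omega
      rw [pr_incl h, pr_incl h']
    · rw [pr_incl_of_ne hk, pr_incl_of_ne (by omega)]

lemma pr_chainMap {M' : MixedComplex.{w, x} K} (F : M.Hom M') {n m k : ℕ} :
    pr M' n m k ∘ₗ F.chainMap n = F.f m ∘ₗ pr M n m k := by
  refine MixedComplex.chain_ext fun m' k' h' => LinearMap.ext fun a => ?_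
  rw [LinearMap.comp_assoc, F.chainMap_incl h']
  simp only [LinearMap.comp_apply]
  by_cases hk : k = k'
  · subst hk
    by_cases hm : m = m'
    · subst hm
      rw [pr_incl h', pr_incl h']
    · rw [pr_incl_of_ne' hm, pr_incl_of_ne' hm, map_zero]
  · rw [pr_incl_of_ne hk, pr_incl_of_ne hk, map_zero]

end Components

end

section

/-! ### The tensor product of two cyclic complexes -/

section Double

variable {K : Type w} [Field K] (M : MixedComplex.{w, x} K) (N : MixedComplex.{w, y} K)

/-- Families of elements of the tensor products of two mixed complexes. -/
abbrev FamX := Fam K (fun n => M.X n) fun n => N.X n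

/-- Families of elements of the tensor products of two cyclic complexes: the entry with index
`(i, j)` is the component in the tensor product of the `i`-th and the `j`-th summand of the two
cyclic complexes. -/
abbrev Dbl := ℕ → ℕ → FamX M N

/-- The total operator `b`. -/
abbrev bT : FamX M N →ₗ[K] FamX M N := Fam.d M.b N.b

/-- The operator `B ⊗ 1`. -/
abbrev BL : FamX M N →ₗ[K] FamX M N := Fam.upL M.B

/-- The operator `1 ⊗ B`. -/
abbrev BR : FamX M N →ₗ[K] FamX M N := Fam.upR (fun _ => LinearMap.id) N.B

/-- The differential of the tensor product of the cyclic complexes. -/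
def dblD : Dbl M N →ₗ[K] Dbl M N where
  toFun e i j := bT M N (e i j) + BL M N (e (i + 1) j) + BR M N (e i (j + 1))
  map_add' e e' := by
    funext i j
    simp only [Pi.add_apply, map_add]
    abel
  map_smul' c e := by
    funext i j
    simp only [Pi.smul_apply, map_smul, smul_add, RingHom.id_apply]

/-- The operator `S ⊗ 1 - 1 ⊗ S`. -/
def dblσ : Dbl M N →ₗ[K] Dbl M N where
  toFun e i j := e (i + 1) j - e i (j + 1)
  map_add' e e' := by
    funext i j
    simp only [Pi.add_apply]
    abel
  map_smul' c e := by
    funext i j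
    simp only [Pi.smul_apply, smul_sub, RingHom.id_apply]

variable {M N}

lemma dblD_apply (e : Dbl M N) (i j : ℕ) :
    dblD M N e i j = bT M N (e i j) + BL M N (e (i + 1) j) + BR M N (e i (j + 1)) := rfl

lemma dblσ_apply (e : Dbl M N) (i j : ℕ) : dblσ M N e i j = e (i + 1) j - e i (j + 1) := rfl

lemma dblD_dblσ (e : Dbl M N) : dblD M N (dblσ M N e) = dblσ M N (dblD M N e) := by
  funext i j
  simp only [dblD_apply, dblσ_apply, map_sub]
  abel

variable (M N) in
/-- The elements of degree `n`. -/
def dblDeg (n : ℕ) : Submodule K (Dbl M N) where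
  carrier := {e | ∀ i j p q, p + q + 2 * (i + j) ≠ n → e i j p q = 0}
  zero_mem' _ _ _ _ _ := rfl
  add_mem' h h' i j p q hn := by
    simp only [Pi.add_apply]
    rw [h _ _ _ _ hn, h' _ _ _ _ hn, add_zero]
  smul_mem' c e h i j p q hn := by
    simp only [Pi.smul_apply]
    rw [h _ _ _ _ hn, smul_zero]

lemma dblD_mem {n : ℕ} {e : Dbl M N} (he : e ∈ dblDeg M N (n + 1)) : dblD M N e ∈ dblDeg M N n := by
  intro i j p q hn
  rw [dblD_apply, Pi.add_apply, Pi.add_apply, Pi.add_apply, Pi.add_apply, Fam.d_apply,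
    he _ _ _ _ (by omega), he _ _ _ _ (by omega), map_zero, map_zero, smul_zero, add_zero, zero_add]
  have h1 : BL M N (e (i + 1) j) p q = 0 := by
    cases p with
    | zero => rfl
    | succ p => rw [Fam.upL_succ, he _ _ _ _ (by omega), map_zero]
  have h2 : BR M N (e i (j + 1)) p q = 0 := by
    cases q with
    | zero => rfl
    | succ q => rw [Fam.upR_succ, he _ _ _ _ (by omega), map_zero, smul_zero]
  rw [h1, h2, add_zero]

lemma dblσ_mem {n : ℕ} {e : Dbl M N} (he : e ∈ dblDeg M N (n + 2)) : dblσ M N e ∈ dblDeg M N n := by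
  intro i j p q hn
  rw [dblσ_apply, Pi.sub_apply, Pi.sub_apply, he _ _ _ _ (by omega), he _ _ _ _ (by omega),
    sub_zero]

lemma dblσ_low {n : ℕ} {e : Dbl M N} (hn : n < 2) (he : e ∈ dblDeg M N n) : dblσ M N e = 0 := by
  funext i j p q
  rw [dblσ_apply, Pi.sub_apply, Pi.sub_apply, he _ _ _ _ (by omega), he _ _ _ _ (by omega),
    sub_zero]
  rfl

/-- A preimage under `S ⊗ 1 - 1 ⊗ S`; it is the one with vanishing entries of index `(0, j)`. -/
def dblLift (e : Dbl M N) : Dbl M N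
  | 0, _ => 0
  | i + 1, j => e i j + dblLift e i (j + 1)

lemma dblσ_dblLift (e : Dbl M N) : dblσ M N (dblLift e) = e := by
  funext i j
  rw [dblσ_apply, dblLift, add_sub_cancel_right]

lemma dblLift_mem {n : ℕ} {e : Dbl M N} (he : e ∈ dblDeg M N n) :
    dblLift e ∈ dblDeg M N (n + 2) := by
  intro i
  induction i with
  | zero => intro j p q _; rfl
  | succ i ih =>
    intro j p q hn
    rw [dblLift, Pi.add_apply, Pi.add_apply, he _ _ _ _ (by omega), ih _ _ _ (by omega), add_zero]

/-- The elements of the kernel of `S ⊗ 1 - 1 ⊗ S` depend on `i + j` only. -/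
lemma eq_of_dblσ {e : Dbl M N} (he : dblσ M N e = 0) (i j : ℕ) : e i j = e 0 (i + j) := by
  induction i generalizing j with
  | zero => rw [zero_add]
  | succ i ih =>
    have := congrFun (congrFun he i) j
    rw [dblσ_apply] at this
    rw [sub_eq_zero.1 this, ih, show i + (j + 1) = i + 1 + j by omega]

section Phi

/-- The components of a family of tensors of cyclic chains. -/
def phi : Fam K M.Chain N.Chain →ₗ[K] Dbl M N where
  toFun w i j p q := TensorProduct.map (pr M (p + 2 * i) p i) (pr N (q + 2 * j) q j)
    (w (p + 2 * i) (q + 2 * j))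
  map_add' w w' := by
    funext i j p q
    simp only [Pi.add_apply, map_add]
  map_smul' c w := by
    funext i j p q
    simp only [Pi.smul_apply, map_smul, RingHom.id_apply]

lemma phi_apply (w : Fam K M.Chain N.Chain) {i j p q P Q : ℕ} (hP : p + 2 * i = P)
    (hQ : q + 2 * j = Q) :
    phi w i j p q = TensorProduct.map (pr M P p i) (pr N Q q j) (w P Q) := by
  subst hP hQ
  rfl

lemma phi_injective : Function.Injective (phi (M := M) (N := N)) := by
  refine (injective_iff_map_eq_zero _).2 fun w hw => funext fun P => funext fun Q => ?_
  have h : ∀ p i q j, TensorProduct.map (pr M P p i) (pr N Q q j) (w P Q) = 0 := fun p i q j => by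
    by_cases hP : p + 2 * i = P
    · by_cases hQ : q + 2 * j = Q
      · rw [← phi_apply w hP hQ, hw]
        rfl
      · rw [pr_eq_zero hQ, TensorProduct.map_zero_right, LinearMap.zero_apply]
    · rw [pr_eq_zero hP, TensorProduct.map_zero_left, LinearMap.zero_apply]
  have h2 : w P Q = TensorProduct.map LinearMap.id LinearMap.id (w P Q) := by
    rw [TensorProduct.map_id, LinearMap.id_apply]
  rw [h2, ← sum_incl_pr (M := M), ← sum_incl_pr (M := N)]
  have h3 : ∀ p i q j, TensorProduct.map (M.incl P p i ∘ₗ pr M P p i)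
      (N.incl Q q j ∘ₗ pr N Q q j) (w P Q) = 0 := fun p i q j => by
    rw [← Fam.tmap_map, h, map_zero]
  have h4 : ∀ (f : M.Chain P →ₗ[K] M.Chain P),
      (∀ q j, TensorProduct.map f (N.incl Q q j ∘ₗ pr N Q q j) (w P Q) = 0) →
      TensorProduct.map f (∑ m ∈ Finset.range (Q + 1), ∑ k ∈ Finset.range (Q + 1),
        N.incl Q m k ∘ₗ pr N Q m k) (w P Q) = 0 := fun f hf => by
    rw [← TensorProduct.mapBilinear_apply (R := K), map_sum, LinearMap.sum_apply]
    refine Finset.sum_eq_zero fun q _ => ?_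
    rw [map_sum, LinearMap.sum_apply]
    exact Finset.sum_eq_zero fun j _ => hf q j
  refine h4 _ fun q j => ?_
  rw [← TensorProduct.mapBilinear_apply (R := K), map_sum, LinearMap.sum_apply, LinearMap.sum_apply]
  refine Finset.sum_eq_zero fun p _ => ?_
  rw [map_sum, LinearMap.sum_apply, LinearMap.sum_apply]
  exact Finset.sum_eq_zero fun i _ => h3 p i q j

/-- The family of tensors of cyclic chains with given components. -/
def psi (e : Dbl M N) : Fam K M.Chain N.Chain := fun P Q =>
  ∑ p ∈ Finset.range (P + 1), ∑ i ∈ Finset.range (P + 1), ∑ q ∈ Finset.range (Q + 1),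
    ∑ j ∈ Finset.range (Q + 1), TensorProduct.map (M.incl P p i) (N.incl Q q j) (e i j p q)

lemma phi_psi (e : Dbl M N) : phi (psi e) = e := by
  funext i j p q
  have hz : ∀ (a a' : ℕ) (t : M.X a ⊗[K] N.X a'), ∀ i' j', (p ≠ a ∨ i ≠ i' ∨ q ≠ a' ∨ j ≠ j') →
      TensorProduct.map (pr M (p + 2 * i) p i) (pr N (q + 2 * j) q j)
        (TensorProduct.map (M.incl (p + 2 * i) a i') (N.incl (q + 2 * j) a' j') t) = 0 := by
    intro a a' t i' j' h
    rw [Fam.tmap_map]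
    rcases h with h | h | h | h
    · rw [show pr M (p + 2 * i) p i ∘ₗ M.incl (p + 2 * i) a i' = 0 from
        LinearMap.ext (pr_incl_of_ne' h), TensorProduct.map_zero_left, LinearMap.zero_apply]
    · rw [show pr M (p + 2 * i) p i ∘ₗ M.incl (p + 2 * i) a i' = 0 from
        LinearMap.ext (pr_incl_of_ne h), TensorProduct.map_zero_left, LinearMap.zero_apply]
    · rw [show pr N (q + 2 * j) q j ∘ₗ N.incl (q + 2 * j) a' j' = 0 from
        LinearMap.ext (pr_incl_of_ne' h), TensorProduct.map_zero_right, LinearMap.zero_apply]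
    · rw [show pr N (q + 2 * j) q j ∘ₗ N.incl (q + 2 * j) a' j' = 0 from
        LinearMap.ext (pr_incl_of_ne h), TensorProduct.map_zero_right, LinearMap.zero_apply]
  rw [phi_apply _ rfl rfl, psi]
  simp only [map_sum]
  rw [Finset.sum_eq_single p, Finset.sum_eq_single i, Finset.sum_eq_single q,
    Finset.sum_eq_single j, Fam.tmap_map,
    show pr M (p + 2 * i) p i ∘ₗ M.incl (p + 2 * i) p i = LinearMap.id from
      LinearMap.ext (pr_incl rfl),
    show pr N (q + 2 * j) q j ∘ₗ N.incl (q + 2 * j) q j = LinearMap.id from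
      LinearMap.ext (pr_incl rfl), TensorProduct.map_id, LinearMap.id_apply]
  · exact fun j' _ h => hz _ _ _ _ _ (Or.inr (Or.inr (Or.inr h.symm)))
  · exact fun h => absurd (Finset.mem_range.2 (by omega)) h
  · exact fun q' _ h => Finset.sum_eq_zero fun j' _ =>
      hz _ _ _ _ _ (Or.inr (Or.inr (Or.inl h.symm)))
  · exact fun h => absurd (Finset.mem_range.2 (by omega)) h
  · exact fun i' _ h => Finset.sum_eq_zero fun q' _ => Finset.sum_eq_zero fun j' _ =>
      hz _ _ _ _ _ (Or.inr (Or.inl h.symm))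
  · exact fun h => absurd (Finset.mem_range.2 (by omega)) h
  · exact fun p' _ h => Finset.sum_eq_zero fun i' _ => Finset.sum_eq_zero fun q' _ =>
      Finset.sum_eq_zero fun j' _ => hz _ _ _ _ _ (Or.inl h.symm)
  · exact fun h => absurd (Finset.mem_range.2 (by omega)) h

lemma psi_supp {n : ℕ} {e : Dbl M N} (he : e ∈ dblDeg M N n) : Fam.Supp n (psi e) := by
  intro P Q h
  refine Finset.sum_eq_zero fun p _ => Finset.sum_eq_zero fun i _ => Finset.sum_eq_zero fun q _ =>
    Finset.sum_eq_zero fun j _ => ?_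
  by_cases hP : p + 2 * i = P
  · by_cases hQ : q + 2 * j = Q
    · rw [he _ _ _ _ (by omega), map_zero]
    · rw [incl_eq_zero hQ, TensorProduct.map_zero_right, LinearMap.zero_apply]
  · rw [incl_eq_zero hP, TensorProduct.map_zero_left, LinearMap.zero_apply]

variable (M N) in
/-- A family of tensors of cyclic chains is determined by its components. -/
def phiEquiv : Fam K M.Chain N.Chain ≃ₗ[K] Dbl M N :=
  LinearEquiv.ofBijective phi ⟨phi_injective, fun e => ⟨psi e, phi_psi e⟩⟩

lemma phi_mem {n : ℕ} (w : Fam K M.Chain N.Chain) : w ∈ Fam.deg n ↔ phi w ∈ dblDeg M N n := by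
  constructor
  · intro h i j p q hn
    rw [phi_apply w rfl rfl, h _ _ (by omega), map_zero]
  · intro h
    have := psi_supp h
    rwa [phi_injective (phi_psi (phi w))] at this

lemma neg_one_pow_add_two (p i : ℕ) : (-1 : K) ^ (p + 2 * i) = (-1) ^ p := by
  rw [pow_add, pow_mul, neg_one_sq, one_pow, mul_one]

lemma phi_d (w : Fam K M.Chain N.Chain) :
    phi (Fam.d M.chainD N.chainD w) = dblD M N (phi w) := by
  funext i j p q
  have hL : BL M N (phi w (i + 1) j) p q =
      TensorProduct.map (prB (p + 2 * i + 1) i p) (pr N (q + 2 * j) q j)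
        (w (p + 2 * i + 1) (q + 2 * j)) := by
    cases p with
    | zero => rw [Fam.upL_zero, prB, TensorProduct.map_zero_left, LinearMap.zero_apply]
    | succ p =>
      rw [Fam.upL_succ, phi_apply w (P := p + 1 + 2 * i + 1) (by omega) rfl, Fam.tmap_map, prB,
        LinearMap.id_comp]
  have hR : BR M N (phi w i (j + 1)) p q =
      (-1 : K) ^ p • TensorProduct.map (pr M (p + 2 * i) p i) (prB (q + 2 * j + 1) j q)
        (w (p + 2 * i) (q + 2 * j + 1)) := by
    cases q with
    | zero => rw [Fam.upR_zero, prB, TensorProduct.map_zero_right, LinearMap.zero_apply, smul_zero]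
    | succ q =>
      rw [Fam.upR_succ, phi_apply w (Q := q + 1 + 2 * j + 1) rfl (by omega), Fam.tmap_map, prB,
        LinearMap.id_comp]
  rw [phi_apply _ rfl rfl, dblD_apply, Pi.add_apply, Pi.add_apply, Pi.add_apply, Pi.add_apply, hL,
    hR, Fam.d_apply, Fam.d_apply, map_add, map_smul, Fam.tmap_map, Fam.tmap_map, pr_chainD rfl,
    pr_chainD rfl, LinearMap.comp_id, LinearMap.comp_id,
    phi_apply w (i := i) (P := p + 2 * i + 1) (by omega) (rfl : q + 2 * j = _),
    phi_apply w (j := j) (Q := q + 2 * j + 1) (rfl : p + 2 * i = _) (by omega), Fam.tmap_map,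
    Fam.tmap_map, LinearMap.id_comp, LinearMap.id_comp, TensorProduct.map_add_left,
    TensorProduct.map_add_right, LinearMap.add_apply, LinearMap.add_apply, neg_one_pow_add_two,
    smul_add]
  abel

lemma dblD_dblD (e : Dbl M N) : dblD M N (dblD M N e) = 0 := by
  obtain ⟨w, rfl⟩ := (phiEquiv M N).surjective e
  change dblD M N (dblD M N (phi w)) = 0
  rw [← phi_d, ← phi_d, Fam.d_d MixedComplex.chainD_chainD MixedComplex.chainD_chainD, map_zero]

/-- The operator `S ⊗ 1 - 1 ⊗ S` on tensors of cyclic chains. -/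
def chainσ (w : Fam K M.Chain N.Chain) : Fam K M.Chain N.Chain := fun P Q =>
  TensorProduct.map (M.chainS (P + 2) P) LinearMap.id (w (P + 2) Q) -
    TensorProduct.map LinearMap.id (N.chainS (Q + 2) Q) (w P (Q + 2))

lemma phi_chainσ (w : Fam K M.Chain N.Chain) : phi (chainσ w) = dblσ M N (phi w) := by
  funext i j p q
  rw [phi_apply _ rfl rfl, chainσ, map_sub, Fam.tmap_map, Fam.tmap_map, pr_chainS rfl,
    pr_chainS rfl, LinearMap.comp_id, LinearMap.comp_id, dblσ_apply, Pi.sub_apply, Pi.sub_apply,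
    phi_apply w (i := i + 1) (P := p + 2 * i + 2) (by omega) (rfl : q + 2 * j = _),
    phi_apply w (j := j + 1) (Q := q + 2 * j + 2) (rfl : p + 2 * i = _) (by omega)]

variable (M N) in
/-- The operator `S ⊗ 1 - 1 ⊗ S` on tensors of cyclic homology classes. -/
def homologyσ : FamHC M N →ₗ[K] FamHC M N where
  toFun f P Q := TensorProduct.map (M.S P).hom LinearMap.id (f (P + 2) Q) -
    TensorProduct.map LinearMap.id (N.S Q).hom (f P (Q + 2))
  map_add' f f' := by
    funext P Q
    simp only [Pi.add_apply, map_add]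
    abel
  map_smul' c f := by
    funext P Q
    simp only [Pi.smul_apply, map_smul, smul_sub, RingHom.id_apply]

lemma homologyσ_apply (f : FamHC M N) (P Q : ℕ) : homologyσ M N f P Q =
    TensorProduct.map (M.S P).hom LinearMap.id (f (P + 2) Q) -
      TensorProduct.map LinearMap.id (N.S Q).hom (f P (Q + 2)) := rfl

lemma S_comp_toHC_ϖ (P : ℕ) : (M.S P).hom ∘ₗ toHC M (P + 2) =
    toHC M P ∘ₗ M.chainS (P + 2) P ∘ₗ (retract M).ϖ (P + 2) := by
  refine LinearMap.ext fun c => ?_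
  refine Eq.trans ?_ (S_toHC (ϖ_mem M (P + 2) c))
  exact congrArg (M.S P).hom (LinearMap.congr_fun (toHC_ϖ (P + 2)) c).symm

lemma chainσ_add (w w' : Fam K M.Chain N.Chain) : chainσ (w + w') = chainσ w + chainσ w' :=
  phi_injective (by rw [phi_chainσ, map_add, map_add, map_add, phi_chainσ, phi_chainσ])

lemma chainσ_d (w : Fam K M.Chain N.Chain) : chainσ (Fam.d M.chainD N.chainD w) =
    Fam.d M.chainD N.chainD (chainσ w) :=
  phi_injective (by rw [phi_chainσ, phi_d, phi_d, phi_chainσ, dblD_dblσ])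

/-- On cycles, `S ⊗ 1 - 1 ⊗ S` is compatible with the passage to homology classes: a cycle may be
replaced by its projection to the tensor product of spaces of cycles. -/
lemma toHC_chainσ {w : Fam K M.Chain N.Chain} (hw : Fam.d M.chainD N.chainD w = 0) :
    famToHC M N (chainσ w) = homologyσ M N (famToHC M N w) := by
  conv_lhs => rw [Fam.eq_of_cycle (retract M) (retract N) hw]
  rw [chainσ_add, chainσ_d, map_add, (isHomology_fam M N).r_d, add_zero]
  funext P Q
  rw [Fam.map_apply, chainσ, map_sub, homologyσ_apply, Fam.map_apply, Fam.map_apply, Fam.map_apply,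
    Fam.map_apply, Fam.tmap_map, Fam.tmap_map, Fam.tmap_map, Fam.tmap_map, Fam.tmap_map,
    Fam.tmap_map, S_comp_toHC_ϖ, S_comp_toHC_ϖ]
  simp only [LinearMap.comp_id, LinearMap.id_comp, toHC_ϖ, LinearMap.comp_assoc]

end Phi

variable (M N) in
/-- The map from the tensor product of the cyclic complexes to tensors of homology classes. -/
def dblToHC : Dbl M N →ₗ[K] FamHC M N := famToHC M N ∘ₗ (phiEquiv M N).symm.toLinearMap

lemma dblToHC_phi (w : Fam K M.Chain N.Chain) : dblToHC M N (phi w) = famToHC M N w :=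
  congrArg (famToHC M N) ((phiEquiv M N).symm_apply_apply w)

/-- The Künneth theorem for the tensor product of the cyclic complexes, in terms of components. -/
theorem isHomology_dbl : IsHomology (dblDeg M N) (dblD M N) Fam.deg (dblToHC M N) :=
  (isHomology_fam M N).congr (phiEquiv M N) (fun _ w => phi_mem w) phi_d

lemma dblToHC_dblσ {e : Dbl M N} (he : dblD M N e = 0) :
    dblToHC M N (dblσ M N e) = homologyσ M N (dblToHC M N e) := by
  obtain ⟨w, rfl⟩ := (phiEquiv M N).surjective e
  change dblToHC M N (dblσ M N (phi w)) = homologyσ M N (dblToHC M N (phi w))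
  rw [← phi_chainσ, dblToHC_phi, dblToHC_phi, toHC_chainσ]
  exact phi_injective (by rw [phi_d, map_zero]; exact he)

section Map

variable {M' : MixedComplex.{w, x} K} {N' : MixedComplex.{w, y} K} (F : M.Hom M') (F' : N.Hom N')

/-- The map induced by morphisms of mixed complexes. -/
def dblMap : Dbl M N →ₗ[K] Dbl M' N' where
  toFun e i j := Fam.map F.f F'.f (e i j)
  map_add' e e' := by
    funext i j
    simp only [Pi.add_apply, map_add]
  map_smul' c e := by
    funext i j
    simp only [Pi.smul_apply, map_smul, RingHom.id_apply]

lemma dblMap_apply (e : Dbl M N) (i j : ℕ) : dblMap F F' e i j = Fam.map F.f F'.f (e i j) := rfl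

lemma dblMap_mem {n : ℕ} {e : Dbl M N} (he : e ∈ dblDeg M N n) :
    dblMap F F' e ∈ dblDeg M' N' n := fun i j p q hn => by
  rw [dblMap_apply, Fam.map_apply, he _ _ _ _ hn, map_zero]

lemma dblMap_dblD (e : Dbl M N) : dblMap F F' (dblD M N e) = dblD M' N' (dblMap F F' e) := by
  funext i j
  rw [dblMap_apply, dblD_apply, map_add, map_add, Fam.map_d F.comm_b F'.comm_b,
    Fam.map_upL F.comm_B,
    Fam.map_upR (φ := F.f) (TX' := fun _ => LinearMap.id) (fun _ => rfl) F'.comm_B]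
  rfl

lemma dblMap_dblσ (e : Dbl M N) : dblMap F F' (dblσ M N e) = dblσ M' N' (dblMap F F' e) := by
  funext i j
  rw [dblMap_apply, dblσ_apply, map_sub]
  rfl

lemma phi_map (w : Fam K M.Chain N.Chain) :
    phi (Fam.map F.chainMap F'.chainMap w) = dblMap F F' (phi w) := by
  funext i j p q
  rw [phi_apply _ rfl rfl, dblMap_apply, Fam.map_apply, Fam.map_apply, phi_apply _ rfl rfl,
    Fam.tmap_map, Fam.tmap_map, pr_chainMap, pr_chainMap]

/-- The map of tensors of homology classes induced by morphisms of mixed complexes. -/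
abbrev mapFamHC : FamHC M N →ₗ[K] FamHC M' N' :=
  Fam.map (fun n => (F.mapHC n).hom) fun n => (F'.mapHC n).hom

lemma mapHC_comp_toHC (n : ℕ) : (F.mapHC n).hom ∘ₗ toHC M n =
    toHC M' n ∘ₗ F.chainMap n ∘ₗ (retract M).ϖ n := by
  refine LinearMap.ext fun c => ?_
  refine Eq.trans ?_ (mapHC_toHC F (ϖ_mem M n c))
  exact congrArg (F.mapHC n).hom (LinearMap.congr_fun (toHC_ϖ n) c).symm

lemma dblToHC_dblMap {e : Dbl M N} (he : dblD M N e = 0) :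
    mapFamHC F F' (dblToHC M N e) = dblToHC M' N' (dblMap F F' e) := by
  obtain ⟨w, rfl⟩ := (phiEquiv M N).surjective e
  have hw : Fam.d M.chainD N.chainD w = 0 := phi_injective (by rw [phi_d, map_zero]; exact he)
  change mapFamHC F F' (dblToHC M N (phi w)) = dblToHC M' N' (dblMap F F' (phi w))
  rw [← phi_map, dblToHC_phi, dblToHC_phi]
  conv_rhs => rw [Fam.eq_of_cycle (retract M) (retract N) hw]
  rw [map_add, Fam.map_d (fun n => (F.chainMap_chainD n).symm) fun n => (F'.chainMap_chainD n).symm,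
    map_add, (isHomology_fam M' N').r_d, add_zero, Fam.map_map, Fam.map_map, Fam.map_map]
  congr 2 <;> funext n <;> exact mapHC_comp_toHC _ n

end Map

end Double

end

section

/-! ### Cyclic Alexander–Whitney maps -/

section CyclicAW

variable {K : Type w} [Field K]

/-- A quasi-isomorphism `g 0 : (P, b) → (M ⊗ N, b)`, together with higher corrections `g l` of
degree `2l`, which make `g` compatible with the operators `B`. The fields `exact_zero`, `exact_one`
and `exact_succ` say that the mapping cone of `g 0` is exact. -/
structure CyclicAW (P : MixedComplex.{w, z} K) (M : MixedComplex.{w, x} K)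
    (N : MixedComplex.{w, y} K) where
  g (l n : ℕ) : P.X n →ₗ[K] FamX M N
  supp (l n : ℕ) (a : P.X n) : Fam.Supp (n + 2 * l) (g l n a)
  g_b (n : ℕ) (a : P.X (n + 1)) : bT M N (g 0 (n + 1) a) = g 0 n (P.b n a)
  g_zero (l : ℕ) (a : P.X 0) :
    bT M N (g (l + 1) 0 a) + (BL M N (g l 0 a) + BR M N (g l 0 a)) = g l 1 (P.B 0 a)
  g_succ (l n : ℕ) (a : P.X (n + 1)) :
    bT M N (g (l + 1) (n + 1) a) + (BL M N (g l (n + 1) a) + BR M N (g l (n + 1) a)) =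
      g (l + 1) n (P.b n a) + g l (n + 2) (P.B (n + 1) a)
  exact_zero (w : FamX M N) : Fam.Supp 0 w → ∃ a s, Fam.Supp 1 s ∧ w - g 0 0 a = bT M N s
  exact_one (a : P.X 0) (w : FamX M N) : Fam.Supp 1 w → g 0 0 a = bT M N w →
    ∃ a' s, Fam.Supp 2 s ∧ P.b 0 a' = a ∧ w - g 0 1 a' = bT M N s
  exact_succ (n : ℕ) (a : P.X (n + 1)) (w : FamX M N) : Fam.Supp (n + 2) w → P.b n a = 0 →
    g 0 (n + 1) a = bT M N w →
      ∃ a' s, Fam.Supp (n + 3) s ∧ P.b (n + 1) a' = a ∧ w - g 0 (n + 2) a' = bT M N s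

namespace CyclicAW

variable {P : MixedComplex.{w, z} K} {M : MixedComplex.{w, x} K} {N : MixedComplex.{w, y} K}
  (g : CyclicAW P M N)

lemma b_zero (a : P.X 0) : bT M N (g.g 0 0 a) = 0 := (g.supp 0 0 a).d_zero

/-- The map from cyclic chains to the kernel of `S ⊗ 1 - 1 ⊗ S`, an element of which is a sequence
of families. Its entry of index `k` is the sum of the `g l` of the components of index `k + l`. -/
def seq (n : ℕ) : P.Chain n →ₗ[K] (ℕ → FamX M N) :=
  LinearMap.pi fun k => ∑ l ∈ Finset.range (n + 1), ∑ m ∈ Finset.range (n + 1),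
    g.g l m ∘ₗ pr P n m (k + l)

lemma seq_apply (n : ℕ) (c : P.Chain n) (k : ℕ) : g.seq n c k =
    ∑ l ∈ Finset.range (n + 1), ∑ m ∈ Finset.range (n + 1), g.g l m (pr P n m (k + l) c) := by
  rw [seq, LinearMap.pi_apply]
  simp only [LinearMap.sum_apply, LinearMap.comp_apply]

/-- If the components of index greater than `k` vanish, only the leading term contributes. -/
lemma seq_top {n m k : ℕ} (h : m + 2 * k = n) {c : P.Chain n}
    (hc : ∀ m' k', k < k' → pr P n m' k' c = 0) : g.seq n c k = g.g 0 m (pr P n m k c) := by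
  rw [seq_apply, Finset.sum_eq_single 0, Finset.sum_eq_single m]
  · rfl
  · intro m' _ hm'
    rw [pr_eq_zero (by omega), LinearMap.zero_apply, map_zero]
  · exact fun hm => absurd (Finset.mem_range.2 (by omega)) hm
  · intro l _ hl
    exact Finset.sum_eq_zero fun m' _ => by rw [hc _ _ (by omega), map_zero]
  · exact fun hm => absurd (Finset.mem_range.2 (by omega)) hm

lemma seq_incl {n m k l : ℕ} (h : m + 2 * (k + l) = n) (a : P.X m) :
    g.seq n (P.incl n m (k + l) a) k = g.g l m a := by
  rw [seq_apply, Finset.sum_eq_single l, Finset.sum_eq_single m, pr_incl h]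
  · intro m' _ hm'
    rw [pr_incl_of_ne' hm', map_zero]
  · exact fun hm => absurd (Finset.mem_range.2 (by omega)) hm
  · intro l' _ hl
    exact Finset.sum_eq_zero fun m' _ => by rw [pr_incl_of_ne (by omega), map_zero]
  · exact fun hm => absurd (Finset.mem_range.2 (by omega)) hm

lemma seq_incl_of_lt {n m k k' : ℕ} (h : k' < k) (a : P.X m) :
    g.seq n (P.incl n m k' a) k = 0 := by
  rw [seq_apply]
  exact Finset.sum_eq_zero fun l _ => Finset.sum_eq_zero fun m' _ => by
    rw [pr_incl_of_ne (by omega), map_zero]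

lemma seq_supp {n : ℕ} (c : P.Chain n) {k p q : ℕ} (h : p + q + 2 * k ≠ n) :
    g.seq n c k p q = 0 := by
  rw [seq_apply, Finset.sum_apply, Finset.sum_apply]
  refine Finset.sum_eq_zero fun l _ => ?_
  rw [Finset.sum_apply, Finset.sum_apply]
  refine Finset.sum_eq_zero fun m _ => ?_
  by_cases hm : m + 2 * (k + l) = n
  · exact g.supp l m _ _ _ (by omega)
  · rw [pr_eq_zero hm, LinearMap.zero_apply, map_zero]
    rfl

variable (M N) in
/-- The differential on the kernel of `S ⊗ 1 - 1 ⊗ S`. -/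
def seqD : (ℕ → FamX M N) →ₗ[K] (ℕ → FamX M N) where
  toFun t k := bT M N (t k) + (BL M N (t (k + 1)) + BR M N (t (k + 1)))
  map_add' t t' := by
    funext k
    simp only [Pi.add_apply, map_add]
    abel
  map_smul' c t := by
    funext k
    simp only [Pi.smul_apply, map_smul, smul_add, RingHom.id_apply]

lemma seqD_apply (t : ℕ → FamX M N) (k : ℕ) :
    seqD M N t k = bT M N (t k) + (BL M N (t (k + 1)) + BR M N (t (k + 1))) := rfl

/-- The map from cyclic chains to sequences is a chain map; this is the recursion for the `g l`. -/
lemma seqD_seq (n : ℕ) (c : P.Chain (n + 1)) :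
    seqD M N (g.seq (n + 1) c) = g.seq n (P.chainD n c) := by
  refine LinearMap.congr_fun (f := seqD M N ∘ₗ g.seq (n + 1)) (g := g.seq n ∘ₗ P.chainD n)
    (MixedComplex.chain_ext fun m k' h => LinearMap.ext fun a => funext fun k => ?_) c
  simp only [LinearMap.comp_apply]
  rw [MixedComplex.chainD_incl_apply h, seqD_apply, map_add, Pi.add_apply]
  rcases lt_trichotomy k k' with hk | rfl | hk
  · obtain ⟨l, rfl⟩ : ∃ l, k' = k + (l + 1) := ⟨k' - k - 1, by omega⟩
    rw [g.seq_incl h, show k + (l + 1) = k + 1 + l by omega, g.seq_incl (by omega),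
      show k + 1 + l = k + l + 1 by omega, MixedComplex.BPart_succ, g.seq_incl (by omega)]
    cases m with
    | zero => rw [MixedComplex.bPart_zero, map_zero, Pi.zero_apply, zero_add, g.g_zero]
    | succ m =>
      rw [MixedComplex.bPart_succ, show k + l + 1 = k + (l + 1) by omega, g.seq_incl (by omega),
        g.g_succ]
  · have h1 : g.seq (n + 1) (P.incl (n + 1) m k a) k = g.g 0 m a := g.seq_incl (l := 0) h a
    rw [h1, g.seq_incl_of_lt (by omega), map_zero, map_zero, add_zero, add_zero]
    have h2 : g.seq n (P.BPart n m k a) k = 0 := by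
      cases k with
      | zero => rw [MixedComplex.BPart_zero, map_zero]; rfl
      | succ k => rw [MixedComplex.BPart_succ, g.seq_incl_of_lt (by omega)]
    rw [h2, add_zero]
    cases m with
    | zero => rw [MixedComplex.bPart_zero, map_zero, g.b_zero]; rfl
    | succ m =>
      have h3 : g.seq n (P.incl n m k (P.b m a)) k = g.g 0 m (P.b m a) :=
        g.seq_incl (l := 0) (by omega) _
      rw [MixedComplex.bPart_succ, h3, g.g_b]
  · rw [g.seq_incl_of_lt hk, g.seq_incl_of_lt (by omega), map_zero, map_zero, map_zero, add_zero,
      add_zero]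
    have h1 : g.seq n (P.bPart n m k' a) k = 0 := by
      cases m with
      | zero => rw [MixedComplex.bPart_zero, map_zero]; rfl
      | succ m => rw [MixedComplex.bPart_succ, g.seq_incl_of_lt hk]
    have h2 : g.seq n (P.BPart n m k' a) k = 0 := by
      cases k' with
      | zero => rw [MixedComplex.BPart_zero, map_zero]; rfl
      | succ k' => rw [MixedComplex.BPart_succ, g.seq_incl_of_lt (by omega)]
    rw [h1, h2, add_zero]

variable (M N) in
/-- A sequence, regarded as an element of the kernel of `S ⊗ 1 - 1 ⊗ S`. -/
def seqDbl : (ℕ → FamX M N) →ₗ[K] Dbl M N where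
  toFun t i j := t (i + j)
  map_add' _ _ := rfl
  map_smul' _ _ := rfl

lemma seqDbl_apply (t : ℕ → FamX M N) (i j : ℕ) : seqDbl M N t i j = t (i + j) := rfl

lemma seqDbl_injective : Function.Injective (seqDbl M N) := fun t t' h => funext fun k => by
  have := congrFun (congrFun h 0) k
  rwa [seqDbl_apply, seqDbl_apply, zero_add] at this

lemma dblD_seqDbl (t : ℕ → FamX M N) : dblD M N (seqDbl M N t) = seqDbl M N (seqD M N t) := by
  funext i j
  rw [dblD_apply, seqDbl_apply, seqDbl_apply, seqDbl_apply, seqDbl_apply, seqD_apply,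
    show i + 1 + j = i + j + 1 by omega, show i + (j + 1) = i + j + 1 by omega, add_assoc]

lemma dblσ_seqDbl (t : ℕ → FamX M N) : dblσ M N (seqDbl M N t) = 0 := by
  funext i j
  rw [dblσ_apply, seqDbl_apply, seqDbl_apply, show i + 1 + j = i + (j + 1) by omega, sub_self]
  rfl

lemma seqD_seqD (t : ℕ → FamX M N) : seqD M N (seqD M N t) = 0 :=
  seqDbl_injective (by rw [← dblD_seqDbl, ← dblD_seqDbl, dblD_dblD, map_zero])

variable (M N) in
/-- The sequences of degree `n`. -/
def SeqSupp (n : ℕ) (t : ℕ → FamX M N) : Prop := ∀ k p q, p + q + 2 * k ≠ n → t k p q = 0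

lemma seqDbl_mem {n : ℕ} {t : ℕ → FamX M N} : SeqSupp M N n t ↔ seqDbl M N t ∈ dblDeg M N n := by
  refine ⟨fun h i j p q hn => h _ _ _ hn, fun h k p q hn => ?_⟩
  have := h 0 k p q (by omega)
  rwa [seqDbl_apply, zero_add] at this

lemma SeqSupp.seqD {n : ℕ} {t : ℕ → FamX M N} (h : SeqSupp M N (n + 1) t) :
    SeqSupp M N n (seqD M N t) := by
  rw [seqDbl_mem, ← dblD_seqDbl]
  exact dblD_mem (seqDbl_mem.1 h)

lemma SeqSupp.sub {n : ℕ} {t t' : ℕ → FamX M N} (h : SeqSupp M N n t) (h' : SeqSupp M N n t') :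
    SeqSupp M N n (t - t') := by
  rw [seqDbl_mem, map_sub]
  exact sub_mem (seqDbl_mem.1 h) (seqDbl_mem.1 h')

lemma SeqSupp.add {n : ℕ} {t t' : ℕ → FamX M N} (h : SeqSupp M N n t) (h' : SeqSupp M N n t') :
    SeqSupp M N n (t + t') := by
  rw [seqDbl_mem, map_add]
  exact add_mem (seqDbl_mem.1 h) (seqDbl_mem.1 h')

/-- The leading terms of a cycle in the mapping cone bound. -/
lemma exists_top {n m k : ℕ} (hm : m + 2 * k = n + 1) {c : P.Chain n} (hc : c ∈ cycles P n)
    {t : ℕ → FamX M N} (ht : SeqSupp M N (n + 1) t) (hct : g.seq n c = seqD M N t)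
    (hc' : ∀ m' k', k < k' → pr P n m' k' c = 0) (ht' : t (k + 1) = 0) :
    ∃ (a : P.X m) (s : FamX M N), Fam.Supp (m + 1) s ∧ t k - g.g 0 m a = bT M N s ∧
      P.bPart n m k a = ∑ m' ∈ Finset.range (n + 1), P.incl n m' k (pr P n m' k c) := by
  have hs : Fam.Supp m (t k) := fun p q h => ht k p q (by omega)
  have hD : g.seq n c k = bT M N (t k) := by
    rw [hct, seqD_apply, ht', map_zero, map_zero, add_zero, add_zero]
  have hsum : ∀ m', m' + 2 * k = n → ∑ m' ∈ Finset.range (n + 1), P.incl n m' k (pr P n m' k c) =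
      P.incl n m' k (pr P n m' k c) := fun m' hm' => by
    refine Finset.sum_eq_single m' (fun m'' _ h => ?_) fun h => ?_
    · rw [pr_eq_zero (by omega), LinearMap.zero_apply, map_zero]
    · exact absurd (Finset.mem_range.2 (by omega)) h
  rcases m with _ | _ | m
  · obtain ⟨a, s, h1, h2⟩ := g.exact_zero (t k) hs
    refine ⟨a, s, h1, h2, ?_⟩
    rw [MixedComplex.bPart_zero]
    exact (Finset.sum_eq_zero fun m' _ => by
      rw [pr_eq_zero (by omega), LinearMap.zero_apply, map_zero]).symm
  · rw [g.seq_top (m := 0) (by omega) hc'] at hD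
    obtain ⟨a, s, h1, h2, h3⟩ := g.exact_one _ (t k) hs hD
    exact ⟨a, s, h1, h3, by rw [MixedComplex.bPart_succ, hsum 0 (by omega), h2]⟩
  · rw [g.seq_top (m := m + 1) (by omega) hc'] at hD
    have hb : P.b m (pr P n (m + 1) k c) = 0 := by
      obtain ⟨n, rfl⟩ : ∃ n', n = n' + 1 := ⟨n - 1, by omega⟩
      have h1 := LinearMap.congr_fun (pr_chainD (M := P) (n := n) (m := m) (k := k) (by omega)) c
      rw [LinearMap.comp_apply, show P.chainD n c = 0 from hc, map_zero, LinearMap.add_apply,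
        LinearMap.comp_apply] at h1
      have h2 : prB (n + 1) k m c = 0 := by
        cases m with
        | zero => rfl
        | succ m => rw [prB, LinearMap.comp_apply, hc' _ _ (by omega), map_zero]
      rw [h2, add_zero] at h1
      exact h1.symm
    obtain ⟨a, s, h1, h2, h3⟩ := g.exact_succ m _ (t k) hs hb hD
    exact ⟨a, s, h1, h3, by rw [MixedComplex.bPart_succ, hsum (m + 1) (by omega), h2]⟩

/-- Exactness of the mapping cone of `seq`, for a cycle whose entries of index at least `k` vanish.
Removing the leading entry by means of `exists_top` decreases `k`. -/
lemma exists_of_bounded (n k : ℕ) : ∀ (c : P.Chain n) (t : ℕ → FamX M N), c ∈ cycles P n →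
    SeqSupp M N (n + 1) t → g.seq n c = seqD M N t →
    (∀ m' k', k ≤ k' → pr P n m' k' c = 0) → (∀ k', k ≤ k' → t k' = 0) →
    ∃ (y : P.Chain (n + 1)) (s : ℕ → FamX M N), SeqSupp M N (n + 2) s ∧ P.chainD n y = c ∧
      t - g.seq (n + 1) y = seqD M N s := by
  induction k with
  | zero =>
    intro c t _ _ _ hc' ht'
    refine ⟨0, 0, fun _ _ _ _ => rfl, ?_, ?_⟩
    · rw [map_zero, chain_eq_zero fun m k => hc' m k (Nat.zero_le _)]
    · rw [map_zero, map_zero, sub_zero]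
      exact funext fun k => ht' k (Nat.zero_le _)
  | succ k ih =>
    intro c t hc ht hct hc' ht'
    by_cases hk : n + 1 < 2 * k
    · refine ih c t hc ht hct (fun m' k' h => ?_) fun k' h => ?_
      · rw [pr_eq_zero (by omega), LinearMap.zero_apply]
      · exact funext fun p => funext fun q => ht k' p q (by omega)
    · obtain ⟨m, hm⟩ : ∃ m, m + 2 * k = n + 1 := ⟨n + 1 - 2 * k, by omega⟩
      obtain ⟨a, s, h1, h2, h3⟩ := g.exists_top hm hc ht hct (fun m' k' h => hc' m' k' h)
        (ht' _ le_rfl)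
      have hD : P.chainD n (P.incl (n + 1) m k a) = P.bPart n m k a + P.BPart n m k a :=
        MixedComplex.chainD_incl_apply hm a
      have hs : SeqSupp M N (n + 2) (Pi.single k s) := fun k' p q h => by
        by_cases hk' : k' = k
        · subst hk'
          rw [Pi.single_eq_same, h1 _ _ (by omega)]
        · rw [Pi.single_eq_of_ne hk']
          rfl
      suffices h : ∃ (y : P.Chain (n + 1)) (s' : ℕ → FamX M N), SeqSupp M N (n + 2) s' ∧
          P.chainD n y = c - P.chainD n (P.incl (n + 1) m k a) ∧
          t - g.seq (n + 1) (P.incl (n + 1) m k a) - seqD M N (Pi.single k s) -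
            g.seq (n + 1) y = seqD M N s' by
        obtain ⟨y, s', hs', hy, hys⟩ := h
        refine ⟨y + P.incl (n + 1) m k a, s' + Pi.single k s, hs'.add hs, ?_, ?_⟩
        · rw [map_add, hy, sub_add_cancel]
        · rw [map_add, map_add, ← hys]
          abel
      refine ih _ _ (sub_mem hc ?_) ((ht.sub fun k' p q h => g.seq_supp _ h).sub hs.seqD) ?_ ?_ ?_
      · cases n with
        | zero => trivial
        | succ n => exact chainD_chainD_apply P n _
      · rw [map_sub, map_sub, map_sub, hct, seqD_seqD, seqD_seq, sub_zero]
      · intro m' k' hk'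
        have hB : pr P n m' k' (P.BPart n m k a) = 0 := by
          cases k with
          | zero => rw [MixedComplex.BPart_zero, map_zero]
          | succ k => rw [MixedComplex.BPart_succ, pr_incl_of_ne (by omega)]
        rw [map_sub, hD, map_add, hB, add_zero, h3, map_sum]
        by_cases hkk : k' = k
        · subst hkk
          by_cases hn : m' + 2 * k' = n
          · rw [Finset.sum_eq_single m', pr_incl hn, sub_self]
            · intro m'' _ h
              rw [pr_incl_of_ne' h.symm]
            · exact fun h => absurd (Finset.mem_range.2 (by omega)) h
          · rw [pr_eq_zero hn]
            simp only [LinearMap.zero_apply, Finset.sum_const_zero, sub_zero]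
        · rw [hc' _ _ (by omega), Finset.sum_eq_zero fun m'' _ => pr_incl_of_ne hkk _, sub_zero]
      · intro k' hk'
        rw [Pi.sub_apply, Pi.sub_apply, seqD_apply,
          Pi.single_eq_of_ne (show k' + 1 ≠ k by omega), map_zero, map_zero, add_zero, add_zero]
        by_cases hkk : k' = k
        · subst hkk
          have h4 : g.seq (n + 1) (P.incl (n + 1) m k' a) k' = g.g 0 m a := g.seq_incl (l := 0) hm a
          rw [Pi.single_eq_same, h4, h2, sub_self]
        · rw [Pi.single_eq_of_ne hkk, g.seq_incl_of_lt (by omega), ht' _ (by omega), map_zero,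
            sub_zero, sub_zero]

/-- The mapping cone of `seq` is exact in positive degrees. -/
lemma exists_of_cycle {n : ℕ} {c : P.Chain n} {t : ℕ → FamX M N} (hc : c ∈ cycles P n)
    (ht : SeqSupp M N (n + 1) t) (hct : g.seq n c = seqD M N t) :
    ∃ (y : P.Chain (n + 1)) (s : ℕ → FamX M N), SeqSupp M N (n + 2) s ∧ P.chainD n y = c ∧
      t - g.seq (n + 1) y = seqD M N s :=
  g.exists_of_bounded n (n + 2) c t hc ht hct
    (fun m' k' h => by rw [pr_eq_zero (by omega), LinearMap.zero_apply])
    (fun k' h => funext fun p => funext fun q => ht k' p q (by omega))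

lemma exists_of_zero {t : ℕ → FamX M N} (ht : SeqSupp M N 0 t) :
    ∃ (y : P.Chain 0) (s : ℕ → FamX M N), t - g.seq 0 y = seqD M N s := by
  obtain ⟨a, s, h1, h2⟩ := g.exact_zero (t 0) fun p q h => ht 0 p q (by omega)
  refine ⟨P.incl 0 0 0 a, Pi.single 0 s, funext fun k => ?_⟩
  rw [Pi.sub_apply, seqD_apply, Pi.single_eq_of_ne (show k + 1 ≠ 0 by omega), map_zero, map_zero,
    add_zero, add_zero]
  cases k with
  | zero =>
    have h4 : g.seq 0 (P.incl 0 0 0 a) 0 = g.g 0 0 a := g.seq_incl (l := 0) rfl a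
    rw [h4, h2, Pi.single_eq_same]
  | succ k =>
    have h5 : t (k + 1) = 0 := funext fun p => funext fun q => ht _ p q (by omega)
    rw [g.seq_incl_of_lt (by omega), Pi.single_eq_of_ne (by omega), map_zero, h5, sub_zero]

/-- The map from families of cyclic chains to the kernel of `S ⊗ 1 - 1 ⊗ S`. -/
def toSeq : (∀ n, P.Chain n) →ₗ[K] (ℕ → FamX M N) :=
  LinearMap.pi fun k => LinearMap.pi fun p => LinearMap.pi fun q =>
    LinearMap.proj q ∘ₗ LinearMap.proj p ∘ₗ LinearMap.proj k ∘ₗ g.seq (p + q + 2 * k) ∘ₗ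
      LinearMap.proj (p + q + 2 * k)

lemma toSeq_apply (c : ∀ n, P.Chain n) {k p q n : ℕ} (h : p + q + 2 * k = n) :
    g.toSeq c k p q = g.seq n (c n) k p q := by
  subst h
  rfl

/-- The component of degree `n` of `seqD t` depends on the component of degree `n + 1` of `t`
only. -/
lemma seqD_congr {n : ℕ} {t t' : ℕ → FamX M N}
    (h : ∀ k p q, p + q + 2 * k = n + 1 → t k p q = t' k p q) {k p q : ℕ}
    (hn : p + q + 2 * k = n) : seqD M N t k p q = seqD M N t' k p q := by
  rw [seqD_apply, seqD_apply, Pi.add_apply, Pi.add_apply, Pi.add_apply, Pi.add_apply, Pi.add_apply,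
    Pi.add_apply, Pi.add_apply, Pi.add_apply, Fam.d_apply, Fam.d_apply, h _ _ _ (by omega),
    h _ _ _ (by omega)]
  have h1 : BL M N (t (k + 1)) p q = BL M N (t' (k + 1)) p q := by
    cases p with
    | zero => rfl
    | succ p => rw [Fam.upL_succ, Fam.upL_succ, h _ _ _ (by omega)]
  have h2 : BR M N (t (k + 1)) p q = BR M N (t' (k + 1)) p q := by
    cases q with
    | zero => rfl
    | succ q => rw [Fam.upR_succ, Fam.upR_succ, h _ _ _ (by omega)]
  rw [h1, h2]

lemma seqD_toSeq (c : ∀ n, P.Chain n) : seqD M N (g.toSeq c) = g.toSeq (chainDAll P c) := by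
  funext k p q
  rw [g.toSeq_apply _ rfl, chainDAll_apply, ← seqD_seq]
  exact seqD_congr (fun k p q h => g.toSeq_apply c h) rfl

lemma toSeq_single {n : ℕ} (c : P.Chain n) : g.toSeq (Pi.single n c) = g.seq n c := by
  funext k p q
  rw [g.toSeq_apply _ rfl]
  by_cases h : p + q + 2 * k = n
  · rw [h, Pi.single_eq_same]
  · rw [Pi.single_eq_of_ne h, map_zero, g.seq_supp c h]
    rfl

lemma toSeq_mem {n : ℕ} {z : ∀ n, P.Chain n} (hz : z ∈ degAll K P.Chain n) :
    SeqSupp M N n (g.toSeq z) := by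
  rw [eq_single hz, toSeq_single]
  exact fun k p q h => g.seq_supp _ h

lemma quasi {n : ℕ} {z : ∀ n, P.Chain n} {t : Dbl M N} (hz : z ∈ degAll K P.Chain n)
    (ht : t ∈ dblDeg M N (n + 1)) (hd : chainDAll P z = 0) (hσ : dblσ M N t = 0)
    (hG : seqDbl M N (g.toSeq z) = dblD M N t) : ∃ z' ∈ degAll K P.Chain (n + 1),
      ∃ t' ∈ dblDeg M N (n + 2), dblσ M N t' = 0 ∧ chainDAll P z' = z ∧
        t - seqDbl M N (g.toSeq z') = dblD M N t' := by
  obtain ⟨t, rfl⟩ : ∃ t', t = seqDbl M N t' :=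
    ⟨t 0, funext fun i => funext fun j => eq_of_dblσ hσ i j⟩
  rw [dblD_seqDbl] at hG
  have hG' : g.toSeq z = seqD M N t := seqDbl_injective hG
  rw [eq_single hz, toSeq_single] at hG'
  obtain ⟨y, s, h1, h2, h3⟩ := g.exists_of_cycle (mem_cycles_of hd n) (seqDbl_mem.2 ht) hG'
  refine ⟨Pi.single (n + 1) y, single_mem_degAll _ _, seqDbl M N s, seqDbl_mem.1 h1,
    dblσ_seqDbl s, ?_, ?_⟩
  · rw [chainDAll_single_succ, h2, ← eq_single hz]
  · rw [toSeq_single, ← map_sub, h3, dblD_seqDbl]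

lemma quasi_zero {t : Dbl M N} (ht : t ∈ dblDeg M N 0) : ∃ z' ∈ degAll K P.Chain 0,
    ∃ t', chainDAll P z' = 0 ∧ t - seqDbl M N (g.toSeq z') = dblD M N t' := by
  obtain ⟨t, rfl⟩ : ∃ t', t = seqDbl M N t' :=
    ⟨t 0, funext fun i => funext fun j => eq_of_dblσ (dblσ_low (by norm_num) ht) i j⟩
  obtain ⟨y, s, h⟩ := g.exists_of_zero (seqDbl_mem.2 ht)
  refine ⟨Pi.single 0 y, single_mem_degAll _ _, seqDbl M N s,
    chainDAll_single (n := 0) trivial, ?_⟩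
  rw [toSeq_single, ← map_sub, h, dblD_seqDbl]

/-- The long exact sequence in cyclic homology given by a cyclic Alexander–Whitney map. -/
def gysin : Gysin K (∀ n, P.Chain n) (Dbl M N) (∀ n, P.HC n) (FamHC M N) where
  deg := degAll K P.Chain
  degE := dblDeg M N
  degHZ := degAll K fun n => P.HC n
  degH := Fam.deg
  d := chainDAll P
  D := dblD M N
  σ := dblσ M N
  G := seqDbl M N ∘ₗ g.toSeq
  r := toHCAll P
  ρ := dblToHC M N
  σH := homologyσ M N
  isHomology := isHomology_chain P
  isHomologyE := isHomology_dbl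
  D_D := dblD_dblD
  D_mem _ _ := dblD_mem
  D_σ := dblD_dblσ
  D_G z := by
    rw [LinearMap.comp_apply, dblD_seqDbl, g.seqD_toSeq]
    rfl
  σ_G z := dblσ_seqDbl (g.toSeq z)
  G_mem _ _ hz := seqDbl_mem.1 (g.toSeq_mem hz)
  σ_mem _ _ := dblσ_mem
  σ_low _ _ := dblσ_low
  σ_surj n e he := ⟨dblLift e, dblLift_mem he, dblσ_dblLift e⟩
  ρ_σ _ := dblToHC_dblσ
  quasi _ _ _ := g.quasi
  quasi_zero _ := g.quasi_zero

end CyclicAW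

end CyclicAW

end

section

/-! ### The exact sequence from a natural cyclic Alexander–Whitney map -/

section Families

variable {K : Type w} [Field K] (A : SuperCat.{w, u₁, v₁} K) (B : SuperCat.{w, u₂, v₂} K)

open SuperCat in
/-- The components of an element of the Künneth term of degree `n`, as a family. -/
def toFam (n : ℕ) : HCTensor A B n →ₗ[K] FamHC A.mixed B.mixed :=
  LinearMap.pi fun p => LinearMap.pi fun q =>
    if h : p + q = n then
      DirectSum.component K {p : ℕ × ℕ // p.1 + p.2 = n} (fun p => A.HC p.1.1 ⊗[K] B.HC p.1.2)
        ⟨(p, q), h⟩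
    else 0

variable {A B}

open SuperCat

lemma toFam_apply {n p q : ℕ} (h : p + q = n) (c : HCTensor A B n) : toFam A B n c p q =
    DirectSum.component K {p : ℕ × ℕ // p.1 + p.2 = n} (fun p => A.HC p.1.1 ⊗[K] B.HC p.1.2)
      ⟨(p, q), h⟩ c := by
  rw [toFam, LinearMap.pi_apply, LinearMap.pi_apply, dif_pos h]

lemma toFam_supp (n : ℕ) (c : HCTensor A B n) : toFam A B n c ∈ Fam.deg n := fun p q h => by
  rw [toFam, LinearMap.pi_apply, LinearMap.pi_apply, dif_neg h, LinearMap.zero_apply]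

lemma toFam_injective (n : ℕ) : Function.Injective (toFam A B n) := by
  refine (injective_iff_map_eq_zero _).2 fun c hc => ?_
  refine DirectSum.ext_component K fun ⟨⟨p, q⟩, h⟩ => ?_
  rw [← toFam_apply h, hc, map_zero]
  rfl

lemma toFam_hcIncl {n p q : ℕ} (h : p + q = n) (t : A.HC p ⊗[K] B.HC q) :
    toFam A B n (hcIncl A B n p q t) p q = t := by
  rw [toFam_apply h, hcIncl, dif_pos h, DirectSum.component.lof_self]

lemma toFam_hcIncl_of_ne {n p q p' q' : ℕ} (h : p ≠ p' ∨ q ≠ q') (t : A.HC p ⊗[K] B.HC q) :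
    toFam A B n (hcIncl A B n p q t) p' q' = 0 := by
  by_cases hn : p + q = n
  · by_cases hn' : p' + q' = n
    · rw [toFam_apply hn', hcIncl, dif_pos hn, DirectSum.component.of, dif_neg]
      intro h'
      have h1 := congrArg (fun p => p.1.1) h'
      have h2 := congrArg (fun p => p.1.2) h'
      rcases h with h | h
      · exact h h1
      · exact h h2
    · exact toFam_supp n _ _ _ hn'
  · rw [hcIncl, dif_neg hn, LinearMap.zero_apply, map_zero]
    rfl

lemma exists_toFam {n : ℕ} {f : FamHC A.mixed B.mixed} (hf : f ∈ Fam.deg n) :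
    ∃ c, toFam A B n c = f := by
  refine ⟨∑ p ∈ Finset.range (n + 1), ∑ q ∈ Finset.range (n + 1), hcIncl A B n p q (f p q),
    funext fun p => funext fun q => ?_⟩
  by_cases h : p + q = n
  · rw [map_sum, Finset.sum_apply, Finset.sum_apply, Finset.sum_eq_single p, map_sum,
      Finset.sum_apply, Finset.sum_apply, Finset.sum_eq_single q, toFam_hcIncl h]
    · exact fun q' _ hq => toFam_hcIncl_of_ne (Or.inr hq) _
    · exact fun hq => absurd (Finset.mem_range.2 (by omega)) hq
    · intro p' _ hp
      rw [map_sum, Finset.sum_apply, Finset.sum_apply]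
      exact Finset.sum_eq_zero fun q' _ => toFam_hcIncl_of_ne (Or.inl hp) _
    · exact fun hp => absurd (Finset.mem_range.2 (by omega)) hp
  · rw [toFam_supp n _ _ _ h, hf _ _ h]

lemma hcTensor_ext {n : ℕ} {E : Type*} [AddCommMonoid E] [Module K E]
    {φ ψ : HCTensor A B n →ₗ[K] E}
    (h : ∀ p q, p + q = n → ∀ t, φ (hcIncl A B n p q t) = ψ (hcIncl A B n p q t)) : φ = ψ := by
  refine DirectSum.linearMap_ext K fun ⟨⟨p, q⟩, hp⟩ => LinearMap.ext fun t => ?_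
  have := h p q hp t
  rw [hcIncl, dif_pos hp] at this
  exact this

lemma sDiff_hcIncl {n p q : ℕ} (h : p + q = n + 2) (t : A.HC p ⊗[K] B.HC q) :
    sDiff A B n (hcIncl A B (n + 2) p q t) = leftPart A B n p q t - rightPart A B n p q t := by
  rw [hcIncl, dif_pos h, sDiff, DirectSum.toModule_lof, LinearMap.sub_apply]

lemma toFam_leftPart {n p q : ℕ} (h : p + q = n + 2) (t : A.HC p ⊗[K] B.HC q) (P Q : ℕ) :
    toFam A B n (leftPart A B n p q t) P Q =
      TensorProduct.map (A.mixed.S P).hom LinearMap.id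
        (toFam A B (n + 2) (hcIncl A B (n + 2) p q t) (P + 2) Q) := by
  rcases p with _ | _ | p
  · rw [toFam_hcIncl_of_ne (Or.inl (by omega)), map_zero, leftPart, LinearMap.zero_apply, map_zero]
    rfl
  · rw [toFam_hcIncl_of_ne (Or.inl (by omega)), map_zero, leftPart, LinearMap.zero_apply, map_zero]
    rfl
  · rw [leftPart, LinearMap.comp_apply]
    by_cases hP : p = P ∧ q = Q
    · obtain ⟨rfl, rfl⟩ := hP
      rw [toFam_hcIncl (by omega), toFam_hcIncl (by omega)]
      rfl
    · rw [toFam_hcIncl_of_ne (by omega), toFam_hcIncl_of_ne (by omega), map_zero]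

lemma toFam_rightPart {n p q : ℕ} (h : p + q = n + 2) (t : A.HC p ⊗[K] B.HC q) (P Q : ℕ) :
    toFam A B n (rightPart A B n p q t) P Q =
      TensorProduct.map LinearMap.id (B.mixed.S Q).hom
        (toFam A B (n + 2) (hcIncl A B (n + 2) p q t) P (Q + 2)) := by
  rcases q with _ | _ | q
  · rw [toFam_hcIncl_of_ne (Or.inr (by omega)), map_zero, rightPart, LinearMap.zero_apply,
      map_zero]
    rfl
  · rw [toFam_hcIncl_of_ne (Or.inr (by omega)), map_zero, rightPart, LinearMap.zero_apply,
      map_zero]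
    rfl
  · rw [rightPart, LinearMap.comp_apply]
    by_cases hP : p = P ∧ q = Q
    · obtain ⟨rfl, rfl⟩ := hP
      rw [toFam_hcIncl (by omega), toFam_hcIncl (by omega)]
      rfl
    · rw [toFam_hcIncl_of_ne (by omega), toFam_hcIncl_of_ne (by omega), map_zero]

lemma toFam_sDiff (n : ℕ) (c : HCTensor A B (n + 2)) :
    toFam A B n (sDiff A B n c) = homologyσ A.mixed B.mixed (toFam A B (n + 2) c) := by
  refine LinearMap.congr_fun (f := toFam A B n ∘ₗ sDiff A B n)
    (g := homologyσ A.mixed B.mixed ∘ₗ toFam A B (n + 2)) (hcTensor_ext fun p q h t => ?_) c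
  funext P Q
  rw [LinearMap.comp_apply, LinearMap.comp_apply, sDiff_hcIncl h, map_sub, homologyσ_apply,
    Pi.sub_apply, Pi.sub_apply, toFam_leftPart h, toFam_rightPart h]

lemma toFam_map {A' : SuperCat.{w, u₁, v₁} K} {B' : SuperCat.{w, u₂, v₂} K}
    (F : GradedFunctor A A') (G : GradedFunctor B B') (n : ℕ) (c : HCTensor A B n) :
    toFam A' B' n (mapHCTensor F G n c) =
      mapFamHC (mixedMap F) (mixedMap G) (toFam A B n c) := by
  refine LinearMap.congr_fun (f := toFam A' B' n ∘ₗ mapHCTensor F G n)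
    (g := mapFamHC (mixedMap F) (mixedMap G) ∘ₗ toFam A B n) (hcTensor_ext fun p q h t => ?_) c
  have h1 : mapHCTensor F G n (hcIncl A B n p q t) =
      hcIncl A' B' n p q (TensorProduct.map (mapHC F p) (mapHC G q) t) := by
    rw [hcIncl, hcIncl, dif_pos h, dif_pos h]
    exact DirectSum.lmap_lof _ _ _
  funext P Q
  rw [LinearMap.comp_apply, LinearMap.comp_apply, h1, Fam.map_apply]
  by_cases hP : p = P ∧ q = Q
  · obtain ⟨rfl, rfl⟩ := hP
    rw [toFam_hcIncl h, toFam_hcIncl h]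
    rfl
  · rw [toFam_hcIncl_of_ne (by omega), toFam_hcIncl_of_ne (by omega), map_zero]

end Families

section Naturality

variable {K : Type w} [Field K] {P P' : MixedComplex.{w, z} K} {M M' : MixedComplex.{w, x} K}
  {N N' : MixedComplex.{w, y} K} (φ : P.Hom P') (F : M.Hom M') (F' : N.Hom N')

/-- The map induced on families of cyclic chains. -/
def chainMapAll : (∀ n, P.Chain n) →ₗ[K] ∀ n, P'.Chain n :=
  LinearMap.pi fun n => φ.chainMap n ∘ₗ LinearMap.proj n

/-- The map induced on families of cyclic homology classes. -/
def mapHCAll : (∀ n, P.HC n) →ₗ[K] ∀ n, P'.HC n :=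
  LinearMap.pi fun n => (φ.mapHC n).hom ∘ₗ LinearMap.proj n

lemma mapHCAll_single {n : ℕ} (c : P.HC n) :
    mapHCAll φ (Pi.single n c) = Pi.single n ((φ.mapHC n).hom c) := by
  funext m
  change (φ.mapHC m).hom ((Pi.single n c : ∀ n, P.HC n) m) = _
  by_cases h : m = n
  · subst h
    rw [Pi.single_eq_same, Pi.single_eq_same]
  · rw [Pi.single_eq_of_ne h, Pi.single_eq_of_ne h, map_zero]

lemma chainMapAll_d (c : ∀ n, P.Chain n) :
    chainMapAll φ (chainDAll P c) = chainDAll P' (chainMapAll φ c) :=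
  funext fun n => (LinearMap.congr_fun (φ.chainMap_chainD n) (c (n + 1))).symm

lemma chainMapAll_mem {n : ℕ} {c : ∀ n, P.Chain n} (hc : c ∈ degAll K P.Chain n) :
    chainMapAll φ c ∈ degAll K P'.Chain n := fun m hm => by
  change φ.chainMap m (c m) = 0
  rw [hc m hm, map_zero]

lemma mapHCAll_toHC {c : ∀ n, P.Chain n} (hc : chainDAll P c = 0) :
    mapHCAll φ (toHCAll P c) = toHCAll P' (chainMapAll φ c) :=
  funext fun n => mapHC_toHC φ (mem_cycles_of hc n)

variable {φ F F'} {g : CyclicAW P M N} {g' : CyclicAW P' M' N'}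

/-- The map to the kernel of `S ⊗ 1 - 1 ⊗ S` is natural if all the `g l` are. -/
lemma dblMap_toSeq (h : ∀ l n a, Fam.map F.f F'.f (g.g l n a) = g'.g l n (φ.f n a))
    (c : ∀ n, P.Chain n) : dblMap F F' (CyclicAW.seqDbl M N (g.toSeq c)) =
      CyclicAW.seqDbl M' N' (g'.toSeq (chainMapAll φ c)) := by
  have h1 : ∀ n (c : P.Chain n) k, Fam.map F.f F'.f (g.seq n c k) =
      g'.seq n (φ.chainMap n c) k := fun n c k => by
    rw [g.seq_apply, g'.seq_apply, map_sum]
    refine Finset.sum_congr rfl fun l _ => ?_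
    rw [map_sum]
    refine Finset.sum_congr rfl fun m _ => ?_
    rw [h]
    exact congrArg _ (LinearMap.congr_fun (pr_chainMap φ) c).symm
  funext i j p q
  rw [dblMap_apply, Fam.map_apply, CyclicAW.seqDbl_apply, CyclicAW.seqDbl_apply,
    g.toSeq_apply c rfl, g'.toSeq_apply _ rfl, ← Fam.map_apply F.f F'.f, h1]
  rfl

lemma gysin_map_α (h : ∀ l n a, Fam.map F.f F'.f (g.g l n a) = g'.g l n (φ.f n a)) {n : ℕ}
    {c : ∀ n, P.HC n} (hc : c ∈ degAll K (fun n => P.HC n) n) :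
    mapFamHC F F' (g.gysin.α c) = g'.gysin.α (mapHCAll φ c) :=
  Gysin.map_α (L := g.gysin) (L' := g'.gysin) (φ := chainMapAll φ) (ψ := dblMap F F')
    (fun _ _ => chainMapAll_mem φ) (chainMapAll_d φ) (dblMap_toSeq h) (fun _ => mapHCAll_toHC φ)
    (fun _ => dblToHC_dblMap F F') hc

lemma gysin_map_graph (h : ∀ l n a, Fam.map F.f F'.f (g.g l n a) = g'.g l n (φ.f n a)) {n : ℕ}
    {f : FamHC M N} {c : ∀ n, P.HC n} (hc : (f, c) ∈ g.gysin.graph n) :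
    (mapFamHC F F' f, mapHCAll φ c) ∈ g'.gysin.graph n :=
  Gysin.map_graph (L := g.gysin) (L' := g'.gysin) (φ := chainMapAll φ) (ψ := dblMap F F')
    (fun _ _ => chainMapAll_mem φ) (fun _ _ => dblMap_mem F F') (chainMapAll_d φ)
    (dblMap_dblD F F') (dblMap_dblσ F F') (dblMap_toSeq h) (fun _ => mapHCAll_toHC φ)
    (fun _ => dblToHC_dblMap F F') hc

end Naturality

section Sequence

variable {K : Type w} [Field K] {A : SuperCat.{w, u₁, v₁} K} {B : SuperCat.{w, u₂, v₂} K}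
  (g : CyclicAW (A.tensor B).mixed A.mixed B.mixed)

open SuperCat

/-- A homogeneous homology class as an element of the product of all cyclic homology modules. -/
abbrev hcSingle {C : SuperCat.{w, u, v} K} (n : ℕ) : C.HC n →ₗ[K] ∀ n, C.mixed.HC n :=
  LinearMap.single K (fun n => C.mixed.HC n) n

lemma hcSingle_mem {C : SuperCat.{w, u, v} K} {n : ℕ} (c : C.HC n) :
    hcSingle n c ∈ degAll K (fun n => C.mixed.HC n) n :=
  single_mem_degAll (X := fun n => C.mixed.HC n) n c

lemma exists_alpha (n : ℕ) : ∃ α : (A.tensor B).HC n →ₗ[K] HCTensor A B n,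
    ∀ c, toFam A B n (α c) = g.gysin.α (hcSingle n c) := by
  have h : ∀ c : (A.tensor B).HC n, ∃ x, toFam A B n x = g.gysin.α (hcSingle n c) :=
    fun c => exists_toFam (g.gysin.α_mem (hcSingle_mem c))
  choose f hf using h
  exact ⟨{ toFun := f
           map_add' := fun c c' => toFam_injective n (by rw [map_add, hf, hf, hf, map_add, map_add])
           map_smul' := fun r c => toFam_injective n (by
             rw [hf, map_smul, map_smul, map_smul, hf]; rfl) }, hf⟩

/-- The map `HC_n(A ⊗ B) → ⊕ HC_p(A) ⊗ HC_q(B)`. -/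
def alpha (n : ℕ) : (A.tensor B).HC n →ₗ[K] HCTensor A B n := (exists_alpha g n).choose

lemma toFam_alpha (n : ℕ) (c : (A.tensor B).HC n) :
    toFam A B n (alpha g n c) = g.gysin.α (hcSingle n c) := (exists_alpha g n).choose_spec c

/-- The elements of degree `n` in the graph of the connecting homomorphism are the graph of a linear
map. -/
lemma exists_beta (n : ℕ) : ∃ β : HCTensor A B n →ₗ[K] (A.tensor B).HC (n + 1),
    ∀ x, (toFam A B n x, hcSingle (n + 1) (β x)) ∈ g.gysin.graph n := by
  refine exists_linearMap_of_graph ((g.gysin.graph n).comap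
    ((toFam A B n).prodMap (hcSingle (n + 1)))) (fun x => ?_) fun c hc => ?_
  · obtain ⟨c, hc⟩ := g.gysin.exists_graph (toFam_supp n x)
    refine ⟨c (n + 1), ?_⟩
    have hm : c ∈ degAll K (fun n => (A.tensor B).mixed.HC n) (n + 1) := by
      obtain ⟨e, -, z, hz, -, -, -, rfl⟩ := hc
      exact g.gysin.isHomology.r_mem _ _ hz
    rw [eq_single hm] at hc
    exact hc
  · have h : ((0 : FamHC A.mixed B.mixed), hcSingle (n + 1) c) ∈ g.gysin.graph n := by
      rw [← map_zero (toFam A B n)]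
      exact hc
    exact Pi.single_injective (n + 1) ((g.gysin.graph_zero h).trans (Pi.single_zero _).symm)

/-- The connecting map `⊕ HC_p(A) ⊗ HC_q(B) → HC_{n+1}(A ⊗ B)`. -/
def beta (n : ℕ) : HCTensor A B n →ₗ[K] (A.tensor B).HC (n + 1) := (exists_beta g n).choose

lemma beta_mem (n : ℕ) (x : HCTensor A B n) :
    (toFam A B n x, hcSingle (n + 1) (beta g n x)) ∈ g.gysin.graph n :=
  (exists_beta g n).choose_spec x

lemma beta_unique {n : ℕ} {x : HCTensor A B n} {c : (A.tensor B).HC (n + 1)}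
    (h : (toFam A B n x, hcSingle (n + 1) c) ∈ g.gysin.graph n) : beta g n x = c := by
  have := Submodule.sub_mem _ (beta_mem g n x) h
  rw [Prod.mk_sub_mk, sub_self] at this
  exact Pi.single_injective (n + 1) (sub_eq_zero.1 (g.gysin.graph_zero this))

theorem exact_alpha_sDiff (n : ℕ) : Function.Exact (alpha g (n + 2)) (sDiff A B n) := by
  intro x
  constructor
  · intro h
    have h1 : homologyσ A.mixed B.mixed (toFam A B (n + 2) x) = 0 := by
      rw [← toFam_sDiff, h, map_zero]
    obtain ⟨c, hc, hc'⟩ := g.gysin.exists_α_eq (toFam_supp _ x) h1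
    refine ⟨c (n + 2), toFam_injective _ ?_⟩
    rw [toFam_alpha, ← hc']
    exact congrArg _ (eq_single hc).symm
  · rintro ⟨c, rfl⟩
    refine toFam_injective _ ?_
    rw [toFam_sDiff, toFam_alpha, map_zero]
    exact g.gysin.σH_α _

theorem exact_sDiff_beta (n : ℕ) : Function.Exact (sDiff A B n) (beta g n) := by
  intro x
  constructor
  · intro h
    have h1 := beta_mem g n x
    rw [h, map_zero] at h1
    obtain ⟨f, hf, hf'⟩ := g.gysin.exists_σH_eq h1
    obtain ⟨y, rfl⟩ := exists_toFam hf
    exact ⟨y, toFam_injective _ ((toFam_sDiff n y).trans hf')⟩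
  · rintro ⟨y, rfl⟩
    refine beta_unique g ?_
    rw [toFam_sDiff, map_zero]
    exact g.gysin.graph_σH (toFam_supp _ y)

theorem exact_beta_alpha (n : ℕ) : Function.Exact (beta g n) (alpha g (n + 1)) := by
  intro c
  constructor
  · intro h
    have h1 : g.gysin.α (hcSingle (n + 1) c) = 0 := by rw [← toFam_alpha, h, map_zero]
    obtain ⟨f, hf, hf'⟩ := g.gysin.exists_graph_of_α (hcSingle_mem c) h1
    obtain ⟨x, rfl⟩ := exists_toFam hf
    exact ⟨x, beta_unique g hf'⟩
  · rintro ⟨x, rfl⟩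
    refine toFam_injective _ ?_
    rw [toFam_alpha, map_zero]
    exact g.gysin.graph_α (beta_mem g n x)

theorem alpha_surjective {n : ℕ} (hn : n < 2) : Function.Surjective (alpha g n) := by
  intro x
  have h1 : homologyσ A.mixed B.mixed (toFam A B n x) = 0 := by
    funext p q
    rw [homologyσ_apply, toFam_supp n x _ _ (by omega), toFam_supp n x _ _ (by omega), map_zero,
      map_zero, sub_zero]
    rfl
  obtain ⟨c, hc, hc'⟩ := g.gysin.exists_α_eq (toFam_supp _ x) h1
  refine ⟨c n, toFam_injective _ ?_⟩
  rw [toFam_alpha, ← hc']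
  exact congrArg _ (eq_single hc).symm

theorem alpha_zero_injective : Function.Injective (alpha g 0) := by
  refine (injective_iff_map_eq_zero _).2 fun c hc => ?_
  have h1 : g.gysin.α (hcSingle 0 c) = 0 := by rw [← toFam_alpha, hc, map_zero]
  exact Pi.single_injective 0 ((g.gysin.eq_zero_of_α (hcSingle_mem c) h1).trans
    (Pi.single_zero _).symm)

variable {A' : SuperCat.{w, u₁, v₁} K} {B' : SuperCat.{w, u₂, v₂} K} {F : GradedFunctor A A'}
  {G : GradedFunctor B B'} {g} {g' : CyclicAW (A'.tensor B').mixed A'.mixed B'.mixed}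

lemma mapHCTensor_alpha (h : ∀ l n a, Fam.map (mixedMap F).f (mixedMap G).f (g.g l n a) =
    g'.g l n ((mixedMap (F.tensor G)).f n a)) (n : ℕ) (c : (A.tensor B).HC n) :
    mapHCTensor F G n (alpha g n c) = alpha g' n (mapHC (F.tensor G) n c) := by
  refine toFam_injective _ ?_
  rw [toFam_map, toFam_alpha, toFam_alpha, gysin_map_α h (hcSingle_mem c)]
  exact congrArg _ (mapHCAll_single _ c)

lemma mapHC_beta (h : ∀ l n a, Fam.map (mixedMap F).f (mixedMap G).f (g.g l n a) =
    g'.g l n ((mixedMap (F.tensor G)).f n a)) (n : ℕ) (x : HCTensor A B n) :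
    mapHC (F.tensor G) (n + 1) (beta g n x) = beta g' n (mapHCTensor F G n x) := by
  refine (beta_unique g' ?_).symm
  rw [toFam_map]
  have := gysin_map_graph h (beta_mem g n x)
  rw [show mapHCAll (mixedMap (F.tensor G)) (hcSingle (n + 1) (beta g n x)) = _ from
    mapHCAll_single _ _] at this
  exact this

end Sequence

end

section

/-! ### Generators of the paracyclic category -/

namespace LHom

variable {m n : ℕ}

/-- The inverse of the full turn. -/
def unturn (m : ℕ) : LHom m m :=
  ⟨fun i => i + (m + 1), fun _ _ h => by simpa using h, fun _ => by ring⟩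

@[simp] lemma unturn_apply (i : ℤ) : unturn m i = i + (m + 1) := rfl

lemma mono_le (f : LHom m n) {i j : ℤ} (h : i ≤ j) : f i ≤ f j := f.mono h

lemma ex_zero : ex m 0 = 0 := by
  have h := (ex m).per 0
  rw [zero_add, ex_apply (by omega) (by push_cast; omega)] at h
  push_cast at h
  omega

/-- A morphism which does not take the value `1`, which is the one omitted by `δ 0`, factors through
`δ 0`. -/
lemma ex_δ_one {f : LHom m (n + 1)} (h : ∀ i, f i ≠ 1) :
    (δ n 0).comp ((ex n).comp f) = f := by
  have key : ∀ y : ℤ, (∀ k : ℤ, y ≠ 1 + (n + 2) * k) → δ n 0 (ex n y) = y := by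
    intro y hy
    have h1 := Int.emod_add_mul_ediv (y - 1) (n + 2)
    have h2 := Int.emod_nonneg (y - 1) (b := n + 2) (by omega)
    have h3 := Int.emod_lt_of_pos (y - 1) (b := n + 2) (by omega)
    have h4 := hy ((y - 1) / (n + 2))
    set r := (y - 1) % (n + 2)
    set k := (y - 1) / (n + 2)
    have e1 : ex n y = r + (n + 1) * k := by
      rw [show y = (r + 1) + (((n + 1 : ℕ) : ℤ) + 1) * k by push_cast; linarith, per_mul,
        ex_apply (by omega) (by omega)]
      ring
    have hr : r ≠ 0 := fun h0 => h4 (by linarith)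
    rw [e1, per_mul, δ_apply (by omega) (by omega), if_neg (by push_cast; omega)]
    push_cast
    linarith
  refine ext' fun i => key _ fun k hk => h (i - (m + 1) * k) ?_
  have := f.per_mul i (-k)
  rw [mul_neg, ← sub_eq_add_neg] at this
  rw [this, hk]
  push_cast
  ring

/-- Every morphism of the paracyclic category is a composite of the morphisms `δ 0`, the rotation,
the extra degeneracies and the inverse of the full turn. -/
theorem induction {C : ∀ {m n : ℕ}, LHom m n → Prop}
    (comp : ∀ {m n p : ℕ} (f : LHom n p) (g : LHom m n), C f → C g → C (f.comp g))
    (hτ : ∀ m, C (τ m)) (hu : ∀ m, C (unturn m)) (hδ : ∀ m, C (δ m 0)) (he : ∀ m, C (ex m))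
    (f : LHom m n) : C f := by
  have sneg : ∀ (m k : ℕ), C (shift m (-(k + 1 : ℕ))) := by
    intro m k
    induction k with
    | zero => exact hτ m
    | succ k ih =>
      have : shift m (-((k + 1 + 1 : ℕ) : ℤ)) = (τ m).comp (shift m (-((k + 1 : ℕ) : ℤ))) :=
        ext' fun i => by simp only [shift_apply, comp_apply, τ_apply]; push_cast; ring
      rw [this]
      exact comp _ _ (hτ m) ih
  have s0 : ∀ m, C (shift m 0) := by
    intro m
    have : shift m 0 = (unturn m).comp (shift m (-((m + 1 : ℕ) : ℤ))) :=
      ext' fun i => by simp only [shift_apply, comp_apply, unturn_apply]; push_cast; ring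
    rw [this]
    exact comp _ _ (hu m) (sneg m m)
  have s1 : ∀ m, C (shift m 1) := by
    intro m
    cases m with
    | zero => exact hu 0
    | succ m =>
      have : shift (m + 1) 1 = (unturn (m + 1)).comp (shift (m + 1) (-((m + 1 : ℕ) : ℤ))) :=
        ext' fun i => by simp only [shift_apply, comp_apply, unturn_apply]; push_cast; ring
      rw [this]
      exact comp _ _ (hu _) (sneg _ _)
  have spos : ∀ (m k : ℕ), C (shift m (k : ℤ)) := by
    intro m k
    induction k with
    | zero => exact s0 m
    | succ k ih =>
      have : shift m ((k + 1 : ℕ) : ℤ) = (shift m 1).comp (shift m (k : ℤ)) :=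
        ext' fun i => by simp only [shift_apply, comp_apply]; push_cast; ring
      rw [this]
      exact comp _ _ (s1 m) ih
  have hs : ∀ (m : ℕ) (c : ℤ), C (shift m c) := by
    intro m c
    obtain ⟨k, rfl | rfl⟩ := c.eq_nat_or_neg
    · exact spos m k
    · cases k with
      | zero => exact s0 m
      | succ k => exact sneg m k
  -- a morphism without repeated or omitted values is a translation; the others are reduced to
  -- morphisms with smaller `m + n`
  suffices H : ∀ (N m n : ℕ) (f : LHom m n), m + n = N → C f from H _ m n f rfl
  intro N
  induction N using Nat.strong_induction_on with
  | _ N ih =>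
  intro m n f hN
  by_cases hinj : ∃ i, f i = f (i + 1)
  · -- a repeated vertex is moved to the positions `0` and `1`, where it is a value of `ex`
    obtain ⟨i, hi⟩ := hinj
    cases m with
    | zero => have := f.per i; push_cast at this; omega
    | succ m =>
      set g := f.comp (shift (m + 1) i) with hg
      have hg0 : g 0 = g 1 := by
        simp only [hg, comp_apply, shift_apply]; rw [zero_add, add_comm 1 i]; exact hi
      have h1 : (g.comp (δ m 0)).comp (ex m) = g := by
        refine ext_window 1 fun x h1 h2 => ?_
        push_cast at h2
        rw [comp_apply, comp_apply, ex_apply h1 (by omega)]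
        rcases eq_or_lt_of_le h1 with rfl | h1'
        · rw [sub_self, δ_zero, if_neg (by omega), hg0]
        · rw [δ_apply (by omega) (by omega), if_neg (by push_cast; omega), sub_add_cancel]
      have h2 : f = g.comp (shift (m + 1) (-i)) := ext' fun x => by simp [hg]
      rw [h2, ← h1]
      exact comp _ _ (comp _ _ (ih (m + n) (by omega) m n _ rfl) (he m)) (hs _ _)
  · push Not at hinj
    have hlt : ∀ i, f i + 1 ≤ f (i + 1) := fun i => by
      have := f.mono_le (show i ≤ i + 1 by omega)
      have := hinj i
      omega
    by_cases hsurj : ∃ v, ∀ i, f i ≠ v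
    · -- a value which is not taken is moved to `1`, the value omitted by `δ 0`
      obtain ⟨v, hv⟩ := hsurj
      cases n with
      | zero =>
        exfalso
        have h1 := f.per_mul 0 (v - f 0)
        by_cases hm : m = 0
        · subst hm
          apply hv (0 + (v - f 0))
          push_cast at h1
          simp only [zero_add, one_mul] at h1 ⊢
          rw [h1]
          ring
        · have h2 := hlt 0
          have h3 := hlt (0 + 1)
          have h4 := f.per 0
          have h5 := f.mono_le (show (0 : ℤ) + 1 + 1 ≤ 0 + (m + 1) by omega)
          push_cast at h4
          omega
      | succ n =>
        set g := (shift (n + 1) (1 - v)).comp f with hg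
        have h1 : (δ n 0).comp ((ex n).comp g) = g := ex_δ_one fun i h => hv i (by
          simp only [hg, comp_apply, shift_apply] at h; omega)
        have h2 : f = (shift (n + 1) (v - 1)).comp g :=
          ext' fun x => by simp only [hg, comp_apply, shift_apply]; ring
        rw [h2, ← h1]
        exact comp _ _ (hs _ _) (comp _ _ (hδ n) (ih (m + n) (by omega) m n _ rfl))
    · push Not at hsurj
      have hsucc : ∀ i, f (i + 1) = f i + 1 := by
        intro i
        by_contra hne
        obtain ⟨j, hj⟩ := hsurj (f i + 1)
        have := hlt i
        rcases le_or_gt j i with h | h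
        · have := f.mono_le h; omega
        · have := f.mono_le (show i + 1 ≤ j by omega); omega
      have hf : ∀ i : ℤ, f i = i + f 0 := by
        intro i
        induction i using Int.induction_on with
        | zero => simp
        | succ i ih => rw [hsucc, ih]; ring
        | pred i ih =>
          have := hsucc (-(i : ℤ) - 1)
          rw [sub_add_cancel] at this
          linarith
      have hmn : m = n := by
        have := f.per 0
        rw [hf] at this
        omega
      subst hmn
      have : f = shift m (f 0) := ext' hf
      rw [this]
      exact hs _ _

end LHom

end

section

/-! ### Periodic loops -/

/-- The sign `(-1)^(ij)` of two signs `u = (-1)^i` and `v = (-1)^j`. -/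
def koz (u v : ℤˣ) : ℤˣ := if u = 1 then 1 else v

lemma units_mul_self (u : ℤˣ) : u * u = 1 := by decide +revert

/-- A function on the integers with prescribed increments, normalized to be `1` at `0`. -/
def integral (c : ℤ → ℤˣ) : ℤ → ℤˣ
  | Int.ofNat k => ∏ i ∈ Finset.range k, c i
  | Int.negSucc k => ∏ i ∈ Finset.range (k + 1), c (-(i + 1))

lemma integral_zero (c : ℤ → ℤˣ) : integral c 0 = 1 := Finset.prod_range_zero _

lemma integral_succ (c : ℤ → ℤˣ) (k : ℤ) : integral c (k + 1) = integral c k * c k := by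
  rcases k with k | k
  · exact Finset.prod_range_succ _ k
  · have h : integral c (Int.negSucc k + 1) = ∏ i ∈ Finset.range k, c (-(i + 1)) := by
      cases k with
      | zero => exact integral_zero c
      | succ k => rfl
    have e : integral c (Int.negSucc k) = ∏ i ∈ Finset.range (k + 1), c (-(i + 1)) := rfl
    rw [h, e, Finset.prod_range_succ, mul_assoc, Int.negSucc_eq, units_mul_self, mul_one]

lemma eq_of_increments {α : Type*} {F : ℤ → α} (h : ∀ k, F (k + 1) = F k) (k : ℤ) : F k = F 0 := by
  induction k using Int.induction_on with
  | zero => rfl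
  | succ k ih => rw [h, ih]
  | pred k ih => rw [← ih, ← h (-k - 1), sub_add_cancel]

variable {K : Type w} [Field K]

/-- A homogeneous loop with `n + 1` arrows, extended periodically to a functor from the ordered
set `ℤ` to `A`. The arrow from `p` to `q`, for `p ≤ q`, is `path p q`, and its parity is the
quotient of the values of `par` at `q` and `p`. The parity of the loop as a whole is `tot`. -/
structure Loop (A : SuperCat.{w, u, v} K) (n : ℕ) where
  ob : ℤ → A.Obj
  path : ℤ → ℤ → A.Tot
  par : ℤ → ℤˣ
  tot : ℤˣ
  exists_hom {p q : ℤ} : p ≤ q → ∃ f : ob p ⟶ ob q, path p q = SuperCat.inc f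
  path_self (p : ℤ) : path p p = SuperCat.inc (𝟙 (ob p))
  path_mul {p q r : ℤ} : p ≤ q → q ≤ r → A.totMul (path p q) (path q r) = path p r
  isHomog {p q : ℤ} : p ≤ q → A.IsHomog (path p q) (par p * par q)
  ob_per (p : ℤ) : ob (p + (n + 1)) = ob p
  path_per (p q : ℤ) : path (p + (n + 1)) (q + (n + 1)) = path p q
  par_per (p : ℤ) : par (p + (n + 1)) = par p * tot

namespace Loop

variable {A : SuperCat.{w, u, v} K} {m n p : ℕ}

/-- The tensor of the arrows of a loop. -/
def ten (L : Loop A n) : A.Ten n :=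
  PiTensorProduct.tprod K fun i => L.path ((i : ℕ) : ℤ) ((i : ℕ) + 1)

lemma cast_add_one (i : Fin (n + 1)) :
    ∃ c : ℤ, (((i + 1 : Fin (n + 1)) : ℕ) : ℤ) + (n + 1) * c = (i : ℕ) + 1 := by
  by_cases h : i = Fin.last n
  · subst h
    exact ⟨1, by simp⟩
  · refine ⟨0, ?_⟩
    rw [Fin.val_add_one, if_neg h]
    push_cast
    ring

lemma ob_per_mul (L : Loop A n) (p c : ℤ) : L.ob (p + (n + 1) * c) = L.ob p := by
  have := eq_of_increments (F := fun c => L.ob (p + (n + 1) * c))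
    (fun k => by rw [← L.ob_per (p + (n + 1) * k)]; congr 1; ring) c
  simpa using this

lemma path_per_mul (L : Loop A n) (p q c : ℤ) :
    L.path (p + (n + 1) * c) (q + (n + 1) * c) = L.path p q := by
  have := eq_of_increments (F := fun c => L.path (p + (n + 1) * c) (q + (n + 1) * c))
    (fun k => by
      rw [← L.path_per (p + (n + 1) * k)]; congr 1 <;> ring) c
  simpa using this

lemma isLoop (L : Loop A n) : SuperCat.IsLoop (A := A) (fun i : Fin (n + 1) => L.ob (i : ℕ))
    fun i => L.path ((i : ℕ) : ℤ) ((i : ℕ) + 1) := by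
  intro i
  obtain ⟨c, hc⟩ := cast_add_one i
  beta_reduce
  rw [← L.ob_per_mul ((i + 1 : Fin (n + 1)) : ℕ) c, hc]
  exact L.exists_hom (by omega)

/-- The tensor of the arrows of a loop as an element of the nerve. -/
def elt (L : Loop A n) : A.nerve n := ⟨L.ten, SuperCat.tprod_mem_nerve L.isLoop⟩

/-- The loop obtained by composing with a morphism of the paracyclic category. -/
@[simps ob path par tot] def pull (L : Loop A n) (f : LHom m n) : Loop A m where
  ob p := L.ob (f p)
  path p q := L.path (f p) (f q)
  par p := L.par (f p)
  tot := L.tot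
  exists_hom h := L.exists_hom (f.mono h)
  path_self _ := L.path_self _
  path_mul h h' := L.path_mul (f.mono h) (f.mono h')
  isHomog h := L.isHomog (f.mono h)
  ob_per p := by rw [f.per, L.ob_per]
  path_per p q := by rw [f.per, f.per, L.path_per]
  par_per p := by rw [f.per, L.par_per]

/-- The Koszul sign of the rotation of a loop which moves the start to `f 0`. The part of the loop
between `0` and `f 0`, of parity `c`, is moved past the rest, of parity `tot - c`; the exponent
`c (tot - c)` equals `c (tot + 1)` modulo two. -/
def sgn (L : Loop A n) (f : LHom m n) : ℤˣ := koz (L.par 0 * L.par (f 0)) (-L.tot)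

/-- The signs satisfy the cocycle condition which makes the nerve a paracyclic module. -/
lemma sgn_comp (L : Loop A p) (f : LHom n p) (g : LHom m n) :
    L.sgn (f.comp g) = L.sgn f * (L.pull f).sgn g := by
  simp only [sgn, pull_par, pull_tot, LHom.comp_apply]
  generalize L.par 0 = a
  generalize L.par (f 0) = b
  generalize L.par (f (g 0)) = c
  generalize L.tot = d
  decide +revert

end Loop

/-! ### Every homogeneous loop is periodic -/

section Extend

variable {A : SuperCat.{w, u, v} K} {n : ℕ}

/-- The residue of `k` modulo `n + 1`. -/
def res (n : ℕ) (k : ℤ) : Fin (n + 1) :=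
  ⟨(k % (n + 1)).toNat, by
    have := Int.emod_nonneg k (b := n + 1) (by omega)
    have := Int.emod_lt_of_pos k (b := n + 1) (by omega)
    omega⟩

lemma res_coe (i : Fin (n + 1)) : res n ((i : ℕ) : ℤ) = i :=
  Fin.ext (by
    have := i.2
    simp only [res]
    rw [Int.emod_eq_of_lt (by omega) (by omega)]; simp)

lemma res_add (k : ℤ) : res n (k + (n + 1)) = res n k :=
  Fin.ext (by simp only [res]; rw [Int.add_emod_right])

lemma res_succ (k : ℤ) : res n (k + 1) = res n k + 1 := by
  have h2 := Int.emod_nonneg k (b := n + 1) (by omega)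
  have h3 := Int.emod_lt_of_pos k (b := n + 1) (by omega)
  have h4 : (k + 1) % (n + 1) = (k % (n + 1) + 1) % (n + 1) := by rw [Int.emod_add_emod]
  refine Fin.ext ?_
  rw [Fin.val_add_one]
  simp only [res, Fin.ext_iff, Fin.val_last]
  rw [h4]
  split_ifs with h
  · rw [show k % (n + 1) + 1 = n + 1 by omega, Int.emod_self]; rfl
  · rw [Int.emod_eq_of_lt (by omega) (by omega)]; omega

/-- The composite of `k` consecutive arrows, starting with the one of index `p`. -/
def chain (Y : Fin (n + 1) → A.Obj) (a : Fin (n + 1) → A.Tot) (p : ℤ) : ℕ → A.Tot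
  | 0 => SuperCat.inc (𝟙 (Y (res n p)))
  | k + 1 => A.totMul (chain Y a p k) (a (res n (p + k)))

variable {Y : Fin (n + 1) → A.Obj} {a : Fin (n + 1) → A.Tot}

lemma chain_hom (h : SuperCat.IsLoop Y a) (p : ℤ) (k : ℕ) :
    ∃ f : Y (res n p) ⟶ Y (res n (p + k)), chain Y a p k = SuperCat.inc f := by
  induction k with
  | zero => rw [Nat.cast_zero, add_zero]; exact ⟨𝟙 _, rfl⟩
  | succ k ih =>
    obtain ⟨f, hf⟩ := ih
    obtain ⟨g, hg⟩ : ∃ g : Y (res n (p + k)) ⟶ Y (res n (p + (k + 1 : ℕ))),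
        a (res n (p + k)) = SuperCat.inc g := by
      rw [Nat.cast_succ, ← add_assoc, res_succ]
      exact h _
    exact ⟨f ≫ g, by rw [chain, hf, hg, SuperCat.totMul_comp]⟩

lemma chain_add (h : SuperCat.IsLoop Y a) (p : ℤ) (k l : ℕ) :
    A.totMul (chain Y a p k) (chain Y a (p + k) l) = chain Y a p (k + l) := by
  induction l with
  | zero =>
    obtain ⟨f, hf⟩ := chain_hom h p k
    rw [hf, chain, SuperCat.totMul_comp, Category.comp_id, add_zero, hf]
  | succ l ih =>
    rw [chain, ← SuperCat.totMul_assoc, ih, ← add_assoc k l 1, chain]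
    push_cast
    rw [add_assoc]

lemma chain_per (p : ℤ) (k : ℕ) : chain Y a (p + (n + 1)) k = chain Y a p k := by
  induction k with
  | zero => rw [chain, chain, res_add]
  | succ k ih => rw [chain, chain, ih, add_right_comm, res_add]

lemma isHomog_one (X : A.Obj) : A.IsHomog (SuperCat.inc (𝟙 X)) 1 :=
  SuperCat.Gen.isHomog ⟨X, X, 𝟙 X, 1, Or.inl ⟨rfl, SuperCat.id_even X⟩⟩

lemma chain_homog {s : Fin (n + 1) → ℤˣ} (hs : ∀ i, A.IsHomog (a i) (s i)) (p : ℤ) (k : ℕ) :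
    A.IsHomog (chain Y a p k)
      (integral (fun k => s (res n k)) p * integral (fun k => s (res n k)) (p + k)) := by
  induction k with
  | zero => rw [Nat.cast_zero, add_zero, units_mul_self]; exact isHomog_one _
  | succ k ih =>
    rw [Nat.cast_succ, ← add_assoc, integral_succ, ← mul_assoc]
    exact ih.mul (hs _)

/-- The periodic extension of a tuple of composable homogeneous arrows. -/
def Loop.extend (h : SuperCat.IsLoop Y a) {s : Fin (n + 1) → ℤˣ}
    (hs : ∀ i, A.IsHomog (a i) (s i)) : Loop A n where
  ob p := Y (res n p)
  path p q := chain Y a p (q - p).toNat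
  par := integral fun k => s (res n k)
  tot := integral (fun k => s (res n k)) (n + 1)
  exists_hom {p q} hpq := by
    have := chain_hom h p (q - p).toNat
    rwa [Int.toNat_of_nonneg (by omega), add_sub_cancel] at this
  path_self p := by rw [sub_self]; rfl
  path_mul {p q r} hpq hqr := by
    have := chain_add h p (q - p).toNat (r - q).toNat
    rwa [Int.toNat_of_nonneg (by omega), add_sub_cancel,
      ← Int.toNat_add (by omega) (by omega), sub_add_sub_cancel'] at this
  isHomog {p q} hpq := by
    have := chain_homog (Y := Y) hs p (q - p).toNat
    rwa [Int.toNat_of_nonneg (by omega), add_sub_cancel] at this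
  ob_per p := by rw [res_add]
  path_per p q := by rw [chain_per, add_sub_add_right_eq_sub]
  par_per p := by
    set F := integral fun k => s (res n k) with hF
    have := eq_of_increments (F := fun k => F (k + (n + 1)) * F k) (fun k => by
      rw [add_right_comm, hF, integral_succ, integral_succ, res_add, mul_mul_mul_comm,
        units_mul_self, mul_one]) p
    rw [hF, integral_zero, mul_one, zero_add, ← hF] at this
    rw [← this, mul_comm, mul_assoc, units_mul_self, mul_one]

lemma Loop.ten_extend (h : SuperCat.IsLoop Y a) {s : Fin (n + 1) → ℤˣ}
    (hs : ∀ i, A.IsHomog (a i) (s i)) : (Loop.extend h hs).ten = PiTensorProduct.tprod K a := by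
  rw [Loop.ten]
  congr 1
  funext i
  change chain Y a ((i : ℕ) : ℤ) ((((i : ℕ) : ℤ) + 1) - ((i : ℕ) : ℤ)).toNat = a i
  rw [add_sub_cancel_left]
  obtain ⟨f, hf⟩ := h i
  change A.totMul (SuperCat.inc (𝟙 (Y (res n ((i : ℕ) : ℤ))))) (a (res n _)) = a i
  rw [Nat.cast_zero, add_zero, res_coe, hf, SuperCat.totMul_comp, Category.id_comp]

variable (A n) in
/-- The nerve is spanned by the homogeneous loops. -/
theorem Loop.span_elt : Submodule.span K (Set.range (Loop.elt (A := A) (n := n))) = ⊤ := by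
  have key : A.nerve n ≤ (Submodule.span K (Set.range (Loop.elt (A := A) (n := n)))).map
      (A.nerve n).subtype := by
    refine SuperCat.nerve_le fun Y a h => ?_
    choose f hf using h
    -- the arrows are split into their even and odd parts, and the tensor is expanded
    have ha : a = (fun i => SuperCat.inc (A.ev _ _ (f i))) +
        fun i => SuperCat.inc (A.od _ _ (f i)) := by
      funext i
      rw [Pi.add_apply, ← map_add, SuperCat.ev_add_od, hf]
    rw [ha, MultilinearMap.map_add_univ]
    refine Submodule.sum_mem _ fun S _ => ?_
    have hl : SuperCat.IsLoop Y (S.piecewise (fun i => SuperCat.inc (A.ev _ _ (f i)))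
        fun i => SuperCat.inc (A.od _ _ (f i))) := by
      intro i
      by_cases hi : i ∈ S
      · exact ⟨_, Finset.piecewise_eq_of_mem _ _ _ hi⟩
      · exact ⟨_, Finset.piecewise_eq_of_notMem _ _ _ hi⟩
    have hh : ∀ i, A.IsHomog (S.piecewise (fun i => SuperCat.inc (A.ev _ _ (f i)))
        (fun i => SuperCat.inc (A.od _ _ (f i))) i) (if i ∈ S then 1 else -1) := by
      intro i
      by_cases hi : i ∈ S
      · rw [Finset.piecewise_eq_of_mem _ _ _ hi, if_pos hi]
        exact SuperCat.Gen.isHomog ⟨_, _, _, 1, Or.inl ⟨rfl, SuperCat.ev_mem _⟩⟩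
      · rw [Finset.piecewise_eq_of_notMem _ _ _ hi, if_neg hi]
        exact SuperCat.Gen.isHomog ⟨_, _, _, -1, Or.inr ⟨rfl, SuperCat.od_mem _⟩⟩
    exact ⟨_, Submodule.subset_span ⟨Loop.extend hl hh, rfl⟩, Loop.ten_extend hl hh⟩
  rw [Submodule.eq_top_iff']
  intro x
  obtain ⟨y, hy, hyx⟩ := key x.2
  rwa [← Subtype.ext hyx]

/-- Linear maps on the nerve are determined by their values on homogeneous loops. -/
lemma Loop.hom_ext {E : Type*} [AddCommMonoid E] [Module K E] {φ ψ : A.nerve n →ₗ[K] E}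
    (h : ∀ L : Loop A n, φ L.elt = ψ L.elt) : φ = ψ :=
  LinearMap.ext_on_range (Loop.span_elt A n) h

end Extend

/-! ### The nerve as a cyclic module -/

section Realize

variable (A : SuperCat.{w, u, v} K)

variable {A} {m n : ℕ}

lemma prod_increments (P : ℤ → ℤˣ) (k : ℕ) :
    ∏ i ∈ Finset.range k, P (i : ℕ) * P ((i : ℕ) + 1) = P 0 * P k := by
  induction k with
  | zero => rw [Finset.prod_range_zero, Nat.cast_zero, units_mul_self]
  | succ k ih =>
    rw [Finset.prod_range_succ, ih, mul_assoc, ← mul_assoc (P k), units_mul_self, one_mul,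
      Nat.cast_succ]

lemma Loop.par_neg_one (L : Loop A n) : L.par n = L.par (-1) * L.tot := by
  rw [← L.par_per]; congr 1; ring

lemma Loop.par_succ (L : Loop A n) : L.par (n + 1) = L.par 0 * L.tot := by
  rw [← L.par_per, zero_add]

lemma Loop.tau_ten (L : Loop A n) :
    A.tau n L.ten = ((L.sgn (LHom.τ n) : ℤ) : K) • (L.pull (LHom.τ n)).ten := by
  rw [Loop.ten, SuperCat.tau_homog (fun i => L.isHomog (by omega))]
  congr 1
  · congr 2
    change koz (L.par ((Fin.last n : Fin (n + 1)) : ℕ) *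
      L.par (((Fin.last n : Fin (n + 1)) : ℕ) + 1)) (-∏ i : Fin (n + 1),
      L.par (i : ℕ) * L.par ((i : ℕ) + 1)) = koz (L.par 0 * L.par (0 - 1)) (-L.tot)
    rw [Fin.prod_univ_eq_prod_range (fun i => L.par (i : ℕ) * L.par ((i : ℕ) + 1)) (n + 1),
      prod_increments, Nat.cast_succ, Fin.val_last, L.par_succ, L.par_neg_one, zero_sub]
    generalize L.par 0 = a
    generalize L.par (-1) = b
    generalize L.tot = c
    decide +revert
  · rw [Loop.ten]
    congr 1
    funext i
    simp only [SuperCat.rot, pull_path, LHom.τ_apply]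
    obtain ⟨c, hc⟩ := cast_add_one (i - 1)
    rw [sub_add_cancel] at hc
    rw [← L.path_per_mul ((i : ℕ) - 1) _ c]
    congr 1 <;> linarith

lemma Loop.sgn_of_eq {f : LHom m n} (L : Loop A n) (h : f 0 = 0) : L.sgn f = 1 := by
  rw [sgn, h, units_mul_self]; rfl

lemma Loop.innerFace_ten (L : Loop A (n + 1)) (j : Fin (n + 1)) :
    A.innerFace n j L.ten = (L.pull (LHom.δ n j)).ten := by
  rw [Loop.ten, SuperCat.innerFace_tprod, Loop.ten]
  congr 1
  funext i
  have hi := i.2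
  have hj := j.2
  simp only [Fin.contractNth, pull_path, Fin.val_castSucc, Fin.val_succ]
  have h1 : LHom.δ n j ((i : ℕ) + 1) = if (i : ℕ) < (j : ℕ) then (i : ℤ) + 1 else i + 2 := by
    rw [LHom.δ_apply (by omega) (by omega)]
    split_ifs <;> omega
  have h0 : LHom.δ n j (i : ℕ) = if (i : ℕ) ≤ (j : ℕ) then (i : ℤ) else i + 1 := by
    by_cases h : (i : ℕ) = 0
    · rw [h, Nat.cast_zero, LHom.δ_zero, if_neg (by omega), if_pos (Nat.zero_le _)]
    · rw [LHom.δ_apply (by omega) (by omega)]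
      split_ifs <;> omega
  rw [h0, h1]
  rcases lt_trichotomy (i : ℕ) (j : ℕ) with h | h | h
  · rw [if_pos h, if_pos h, if_pos h.le]
  · rw [if_neg h.not_lt, if_pos h, if_neg h.not_lt, if_pos h.le, Nat.cast_succ,
      L.path_mul (by omega) (by omega), add_assoc]
    rfl
  · rw [if_neg h.not_gt, if_neg h.ne', if_neg h.not_gt, if_neg h.not_ge]
    congr 1

lemma Loop.extra_ten (L : Loop A n) : A.extra n L.ten = (L.pull (LHom.ex n)).ten := by
  obtain ⟨f, hf⟩ := L.exists_hom (show (0 : ℤ) ≤ 0 + 1 by omega)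
  rw [Loop.ten, A.extra_tprod (X := L.ob 0) (f := f) (by simpa using hf), Loop.ten]
  congr 1
  funext i
  rw [pull_path]
  cases i using Fin.cases with
  | zero =>
    rw [Fin.cons_zero, Fin.val_zero, Nat.cast_zero, LHom.ex_zero,
      LHom.ex_apply (by omega) (by push_cast; omega), zero_add, sub_self, L.path_self]
  | succ i =>
    have := i.2
    rw [Fin.cons_succ, Fin.val_succ, LHom.ex_apply (by push_cast; omega) (by push_cast; omega),
      LHom.ex_apply (by push_cast; omega) (by push_cast; omega)]
    push_cast
    congr 1 <;> ring

variable (A) in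
/-- A morphism of the paracyclic category acts on the tensors of loops by composition, up to the
Koszul sign. It suffices to extend this action linearly for generators of the category, where it
is given by the operators in the definition of cyclic homology. -/
lemma exists_act (f : LHom m n) : ∃ F : A.nerve n →ₗ[K] A.nerve m,
    ∀ L : Loop A n, F L.elt = ((L.sgn f : ℤ) : K) • (L.pull f).elt := by
  induction f using LHom.induction with
  | comp f g hf hg =>
    obtain ⟨F, hF⟩ := hf
    obtain ⟨G, hG⟩ := hg
    refine ⟨G ∘ₗ F, fun L => ?_⟩
    rw [LinearMap.comp_apply, hF, map_smul, hG, smul_smul, L.sgn_comp]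
    push_cast
    rfl
  | hτ m =>
    exact ⟨(A.tau m).restrict fun _ hx => SuperCat.tau_mem hx, fun L => Subtype.ext L.tau_ten⟩
  | hu m =>
    refine ⟨LinearMap.id, fun L => Subtype.ext ?_⟩
    have h1 : L.sgn (LHom.unturn m) = 1 := by
      rw [Loop.sgn, LHom.unturn_apply, L.par_per, ← mul_assoc, units_mul_self, one_mul]
      generalize L.tot = u
      decide +revert
    have h2 : (L.pull (LHom.unturn m)).ten = L.ten := by
      rw [Loop.ten, Loop.ten]
      congr 1
      funext i
      rw [Loop.pull_path, LHom.unturn_apply, LHom.unturn_apply, L.path_per]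
    simp only [h1, LinearMap.id_apply, Units.val_one, Int.cast_one, one_smul]
    exact h2.symm
  | hδ m =>
    refine ⟨(A.innerFace m 0).restrict fun _ hx => SuperCat.innerFace_mem 0 hx,
      fun L => Subtype.ext ?_⟩
    rw [L.sgn_of_eq (by rw [LHom.δ_zero, if_neg (by omega)]), Units.val_one, Int.cast_one, one_smul]
    exact L.innerFace_ten 0
  | he m =>
    refine ⟨(A.extra m).restrict fun _ hx => SuperCat.extra_mem hx, fun L => Subtype.ext ?_⟩
    rw [L.sgn_of_eq LHom.ex_zero, Units.val_one, Int.cast_one, one_smul]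
    exact L.extra_ten

variable (A) in
/-- The action of the paracyclic category on the nerve. -/
def nerveAct (f : LHom m n) : A.nerve n →ₗ[K] A.nerve m := (exists_act A f).choose

lemma nerveAct_elt (f : LHom m n) (L : Loop A n) :
    nerveAct A f L.elt = ((L.sgn f : ℤ) : K) • (L.pull f).elt := (exists_act A f).choose_spec L

lemma nerveAct_of_eq {f : LHom m n} (h : f 0 = 0) (L : Loop A n) :
    nerveAct A f L.elt = (L.pull f).elt := by
  rw [nerveAct_elt, L.sgn_of_eq h, Units.val_one, Int.cast_one, one_smul]

variable (A) in
/-- The nerve as a paracyclic module. -/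
abbrev nerveL : LMod.{w, max u v w} K where
  obj n := A.nerve n
  act f := nerveAct A f
  act_id n x := LinearMap.congr_fun (f := nerveAct A (LHom.id n)) (g := LinearMap.id)
    (Loop.hom_ext fun L => nerveAct_of_eq rfl L) x
  act_comp f g x := LinearMap.congr_fun (f := nerveAct A (f.comp g))
    (g := nerveAct A g ∘ₗ nerveAct A f) (Loop.hom_ext fun L => by
      rw [LinearMap.comp_apply, nerveAct_elt, nerveAct_elt, map_smul, nerveAct_elt, smul_smul,
        L.sgn_comp]
      push_cast
      rfl) x

lemma nerveAct_τ (x : A.nerve n) : (nerveAct A (LHom.τ n) x).1 = A.tau n x.1 :=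
  LinearMap.congr_fun (f := (A.nerve n).subtype ∘ₗ nerveAct A (LHom.τ n))
    (g := A.tau n ∘ₗ (A.nerve n).subtype) (Loop.hom_ext fun L => by
      rw [LinearMap.comp_apply, nerveAct_elt]; exact L.tau_ten.symm) x

lemma nerveAct_ex (x : A.nerve n) : (nerveAct A (LHom.ex n) x).1 = A.extra n x.1 :=
  LinearMap.congr_fun (f := (A.nerve (n + 1)).subtype ∘ₗ nerveAct A (LHom.ex n))
    (g := A.extra n ∘ₗ (A.nerve n).subtype) (Loop.hom_ext fun L => by
      rw [LinearMap.comp_apply, nerveAct_of_eq LHom.ex_zero]; exact L.extra_ten.symm) x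

lemma nerveAct_δ (j : Fin (n + 1)) (x : A.nerve (n + 1)) :
    (nerveAct A (LHom.δ n j) x).1 = A.innerFace n j x.1 :=
  LinearMap.congr_fun (f := (A.nerve n).subtype ∘ₗ nerveAct A (LHom.δ n j))
    (g := A.innerFace n j ∘ₗ (A.nerve (n + 1)).subtype) (Loop.hom_ext fun L => by
      rw [LinearMap.comp_apply, nerveAct_of_eq (by rw [LHom.δ_zero, if_neg (by omega)])]
      exact (L.innerFace_ten j).symm) x

lemma nerveAct_face (i : Fin (n + 2)) (x : A.nerve (n + 1)) :
    (nerveAct A (LHom.δ n i) x).1 = A.face n i x.1 := by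
  cases i using Fin.lastCases with
  | cast i => rw [SuperCat.face_castSucc, Fin.val_castSucc, nerveAct_δ]
  | last =>
    have h := (nerveL A).act_comp (LHom.τ (n + 1)) (LHom.δ n 0) x
    rw [LHom.τ_comp_δ_zero] at h
    change nerveAct A (LHom.δ n (n + 1)) x = nerveAct A (LHom.δ n 0) (nerveAct A _ x) at h
    rw [SuperCat.face_last, Fin.val_last, h, SuperCat.lastFace, LinearMap.comp_apply,
      ← nerveAct_τ]
    exact nerveAct_δ 0 _

lemma nerveL_b (x : A.nerve (n + 1)) : (nerveL A).b n x = A.mixed.b n x := by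
  rw [LMod.b_apply]
  refine Subtype.ext ?_
  change _ = A.bd n x.1
  rw [SuperCat.bd, LinearMap.sum_apply, AddSubmonoidClass.coe_finsetSum,
    ← Fin.sum_univ_eq_sum_range
      (fun i => (((-1 : K) ^ i • nerveAct A (LHom.δ n i) x : A.nerve n) : A.Ten n))]
  refine Finset.sum_congr rfl fun i _ => ?_
  rw [LinearMap.smul_apply, ← nerveAct_face]
  rfl

lemma nerveL_t (x : A.nerve n) : ((nerveL A).t n x).1 = A.cyc n x.1 := by
  rw [LMod.t_apply, SuperCat.cyc, LinearMap.smul_apply, ← nerveAct_τ]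
  rfl

lemma nerveL_t_pow (k : ℕ) (x : A.nerve n) :
    (((nerveL A).t n ^ k) x).1 = (A.cyc n ^ k) x.1 := by
  induction k with
  | zero => rfl
  | succ k ih => rw [pow_succ', pow_succ', Module.End.mul_apply, Module.End.mul_apply, ← ih,
      nerveL_t]

lemma nerveL_N (x : A.nerve n) : ((nerveL A).N n x).1 = A.nrm n x.1 := by
  rw [LMod.N_apply, SuperCat.nrm, LinearMap.sum_apply]
  refine (AddSubmonoidClass.coe_finsetSum _ _).trans ?_
  exact Finset.sum_congr rfl fun k _ => nerveL_t_pow k x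

lemma nerveL_B (x : A.nerve n) : (nerveL A).B n x = A.mixed.B n x := by
  refine Subtype.ext ?_
  change _ = A.connes n x.1
  rw [SuperCat.connes, LinearMap.comp_apply, LinearMap.comp_apply, LinearMap.sub_apply,
    ← nerveL_N, ← nerveAct_ex]
  rw [LMod.B_apply]
  refine congrArg₂ (· - ·) rfl (nerveL_t _)

/-- A full turn takes a loop to itself, with sign one. -/
lemma nerveL_isCyclic : (nerveL A).IsCyclic := fun n x =>
  LinearMap.congr_fun (f := nerveAct A (LHom.turn n)) (g := LinearMap.id)
    (Loop.hom_ext fun L => by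
      have h0 := L.par_per (-(n + 1))
      rw [neg_add_cancel] at h0
      have h1 : L.sgn (LHom.turn n) = 1 := by
        rw [Loop.sgn, LHom.turn_apply, zero_sub, h0]
        generalize L.par (-(n + 1)) = a
        generalize L.tot = u
        decide +revert
      rw [nerveAct_elt, h1, Units.val_one, Int.cast_one, one_smul]
      refine Subtype.ext (congrArg (PiTensorProduct.tprod K) (funext fun i => ?_))
      have h2 := L.path_per ((i : ℕ) - (n + 1)) ((i : ℕ) + 1 - (n + 1))
      rw [sub_add_cancel, sub_add_cancel] at h2
      exact h2.symm) x

end Realize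

end

section

/-! ### The total morphism space of a tensor product -/

variable {K : Type w} [Field K]

section TensorTot

variable (A : SuperCat.{w, u₁, v₁} K) (B : SuperCat.{w, u₂, v₂} K)

/-- The inclusion of a morphism space of `A ⊗ B` into the total morphism space. -/
def tincl (X X' : A.Obj) (Y Y' : B.Obj) :
    (X ⟶ X') ⊗[K] (Y ⟶ Y') →ₗ[K] (A.tensor B).Tot :=
  SuperCat.inc (A := A.tensor B) (X := (⟨X, Y⟩ : SuperCat.TensorObj A B))
    (Y := (⟨X', Y'⟩ : SuperCat.TensorObj A B))

/-- The tensor product of morphisms, on total morphism spaces. -/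
def mu : A.Tot →ₗ[K] B.Tot →ₗ[K] (A.tensor B).Tot :=
  SuperCat.totLift fun X X' => (SuperCat.totLift fun Y Y' =>
    ((TensorProduct.mk K (X ⟶ X') (Y ⟶ Y')).compr₂ (tincl A B X X' Y Y')).flip).flip

variable {A B}

lemma mu_inc {X X' : A.Obj} {Y Y' : B.Obj} (f : X ⟶ X') (g : Y ⟶ Y') :
    mu A B (SuperCat.inc f) (SuperCat.inc g) = tincl A B X X' Y Y' (f ⊗ₜ g) := by
  rw [mu, SuperCat.totLift_inc, LinearMap.flip_apply, SuperCat.totLift_inc]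
  rfl

lemma totEv_inc {X X' : A.Obj} (f : X ⟶ X') :
    A.totEv (SuperCat.inc f) = SuperCat.inc (A.ev X X' f) := A.totLift_inc _ f

lemma totOd_inc {X X' : A.Obj} (f : X ⟶ X') :
    A.totOd (SuperCat.inc f) = SuperCat.inc (A.od X X' f) := A.totLift_inc _ f

lemma inc_injective {X X' : A.Obj} :
    Function.Injective (SuperCat.inc : (X ⟶ X') →ₗ[K] A.Tot) := by
  classical
  exact DirectSum.of_injective (β := fun p : A.Obj × A.Obj => (p.1 ⟶ p.2)) (X, X')

lemma mem_deg_of_isHomog {X X' : A.Obj} {f : X ⟶ X'} {s : ℤˣ} (h : A.IsHomog (SuperCat.inc f) s) :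
    (s = 1 ∧ f ∈ A.deg X X' 0) ∨ (s = -1 ∧ f ∈ A.deg X X' 1) := by
  rw [SuperCat.IsHomog, totEv_inc, totOd_inc] at h
  rcases h with ⟨hs, h, -⟩ | ⟨hs, -, h⟩
  · exact Or.inl ⟨hs, inc_injective h ▸ SuperCat.ev_mem f⟩
  · exact Or.inr ⟨hs, inc_injective h ▸ SuperCat.od_mem f⟩

lemma isHomog_smul {x : A.Tot} {s : ℤˣ} (h : A.IsHomog x s) (c : K) : A.IsHomog (c • x) s := by
  rcases h with ⟨hs, h1, h2⟩ | ⟨hs, h1, h2⟩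
  · exact Or.inl ⟨hs, by rw [map_smul, h1], by rw [map_smul, h2, smul_zero]⟩
  · exact Or.inr ⟨hs, by rw [map_smul, h1, smul_zero], by rw [map_smul, h2]⟩

lemma mu_isHomog {X X' : A.Obj} {Y Y' : B.Obj} {f : X ⟶ X'} {g : Y ⟶ Y'} {s t : ℤˣ}
    (hf : A.IsHomog (SuperCat.inc f) s) (hg : B.IsHomog (SuperCat.inc g) t) :
    (A.tensor B).IsHomog (mu A B (SuperCat.inc f) (SuperCat.inc g)) (s * t) := by
  rw [mu_inc]
  refine SuperCat.Gen.isHomog (A := A.tensor B) ⟨⟨X, Y⟩, ⟨X', Y'⟩, f ⊗ₜ[K] g, s * t, ?_⟩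
  rcases mem_deg_of_isHomog hf with ⟨rfl, hf'⟩ | ⟨rfl, hf'⟩ <;>
    rcases mem_deg_of_isHomog hg with ⟨rfl, hg'⟩ | ⟨rfl, hg'⟩
  · exact Or.inl ⟨rfl, SuperCat.tmul_mem_tensorDeg' hf' hg' (by decide)⟩
  · exact Or.inr ⟨rfl, SuperCat.tmul_mem_tensorDeg' hf' hg' (by decide)⟩
  · exact Or.inr ⟨rfl, SuperCat.tmul_mem_tensorDeg' hf' hg' (by decide)⟩
  · exact Or.inl ⟨rfl, SuperCat.tmul_mem_tensorDeg' hf' hg' (by decide)⟩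

/-- The composition of `A ⊗ B`, for homogeneous inner factors. -/
lemma mu_mul {X X' X'' : A.Obj} {Y Y' Y'' : B.Obj} {f : X ⟶ X'} {g : Y ⟶ Y'} {h : X' ⟶ X''}
    {k : Y' ⟶ Y''} {s t : ℤˣ} (hg : B.IsHomog (SuperCat.inc g) t)
    (hf : A.IsHomog (SuperCat.inc h) s) :
    (A.tensor B).totMul (mu A B (SuperCat.inc f) (SuperCat.inc g))
      (mu A B (SuperCat.inc h) (SuperCat.inc k)) =
    ((koz t s : ℤ) : K) • mu A B (SuperCat.inc (f ≫ h)) (SuperCat.inc (g ≫ k)) := by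
  rw [mu_inc, mu_inc, mu_inc]
  refine ((A.tensor B).totMul_comp (X := (⟨X, Y⟩ : SuperCat.TensorObj A B))
    (Y := (⟨X', Y'⟩ : SuperCat.TensorObj A B)) (Z := (⟨X'', Y''⟩ : SuperCat.TensorObj A B))
    (f ⊗ₜ[K] g) (h ⊗ₜ[K] k)).trans ?_
  rw [← map_smul]
  refine congrArg (tincl A B X X'' Y Y'') ((SuperCat.tensorComp_tmul ⟨X, Y⟩ ⟨X', Y'⟩ ⟨X'', Y''⟩
    f g h k).trans ?_)
  rcases mem_deg_of_isHomog hg with ⟨rfl, hg'⟩ | ⟨rfl, hg'⟩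
  · rw [SuperCat.ev_of_even hg', SuperCat.od_of_even hg', Limits.zero_comp, TensorProduct.tmul_zero,
      add_zero]
    simp [koz]
  · rw [SuperCat.ev_of_odd hg', SuperCat.od_of_odd hg', Limits.zero_comp, TensorProduct.tmul_zero,
      zero_add]
    rcases mem_deg_of_isHomog hf with ⟨rfl, hf'⟩ | ⟨rfl, hf'⟩
    · rw [SuperCat.par_of_even hf']
      simp [koz]
    · rw [SuperCat.par_of_odd hf', Preadditive.comp_neg, TensorProduct.neg_tmul]
      simp [koz]

end TensorTot

/-! ### Products of loops -/

namespace Loop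

variable {A : SuperCat.{w, u₁, v₁} K} {B : SuperCat.{w, u₂, v₂} K} {m n : ℕ}
  (L : Loop A n) (L' : Loop B n)

/-- The accumulated sign `(-1)^(|b₀ ⋯ bᵢ₋₁||aᵢ|)`, where `aᵢ` and `bᵢ` are the arrows of two
loops, up to the choice of the parity of `L'` at `0`. -/
def twist : ℤ → ℤˣ := integral fun k => koz (L'.par k) (L.par k * L.par (k + 1))

lemma twist_zero : twist L L' 0 = 1 := integral_zero _

lemma twist_succ (k : ℤ) :
    twist L L' (k + 1) = twist L L' k * koz (L'.par k) (L.par k * L.par (k + 1)) :=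
  integral_succ _ k

/-- The twist is periodic up to the sign of moving the whole of `L'` past a part of `L`. -/
lemma twist_per (k : ℤ) : twist L L' (k + (n + 1)) =
    twist L L' k * twist L L' (n + 1) * koz L'.tot (L.par 0 * L.par k) := by
  have h := eq_of_increments
    (F := fun k => twist L L' (k + (n + 1)) * twist L L' k * koz L'.tot (L.par 0 * L.par k))
    (fun k => by
      rw [add_right_comm, twist_succ, twist_succ, L'.par_per, L.par_per, add_right_comm, L.par_per]
      generalize twist L L' (k + (n + 1)) = a
      generalize twist L L' k = b
      generalize L'.par k = c
      generalize L.par k = d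
      generalize L.par (k + 1) = e
      generalize L.par 0 = f
      rw [mul_mul_mul_comm d, units_mul_self L.tot, mul_one]
      generalize L'.tot = g
      decide +revert) k
  beta_reduce at h
  rw [twist_zero, zero_add] at h
  revert h
  generalize twist L L' (k + (n + 1)) = a
  generalize twist L L' k = b
  generalize twist L L' (n + 1) = c
  generalize L.par k = d
  generalize L.par 0 = e
  generalize L'.tot = f
  decide +revert

/-- The sign relating `path p q` of a product of loops to the tensor product of the `path p q`
of the factors. -/
def psgn (p q : ℤ) : ℤˣ := twist L L' p * twist L L' q * koz (L'.par p) (L.par p * L.par q)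

/-- The product of two loops; its arrows are the `aᵢ ⊗ bᵢ`. -/
def prod : Loop (A.tensor B) n where
  ob p := (⟨L.ob p, L'.ob p⟩ : SuperCat.TensorObj A B)
  path p q := ((psgn L L' p q : ℤ) : K) • mu A B (L.path p q) (L'.path p q)
  par p := L.par p * L'.par p
  tot := L.tot * L'.tot
  exists_hom {p q} h := by
    obtain ⟨f, hf⟩ := L.exists_hom h
    obtain ⟨g, hg⟩ := L'.exists_hom h
    rw [hf, hg, mu_inc, ← map_smul]
    exact ⟨_, rfl⟩
  path_self p := by
    have : psgn L L' p p = 1 := by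
      rw [psgn, units_mul_self, units_mul_self, one_mul]
      generalize L'.par p = u
      decide +revert
    rw [L.path_self, L'.path_self, mu_inc, this, Units.val_one, Int.cast_one, one_smul]
    rfl
  path_mul {p q r} h h' := by
    have hA := L.path_mul h h'
    have hB := L'.path_mul h h'
    have h2 := L.isHomog h'
    have h3 := L'.isHomog h
    obtain ⟨f, hf⟩ := L.exists_hom h
    obtain ⟨g, hg⟩ := L'.exists_hom h
    obtain ⟨f', hf'⟩ := L.exists_hom h'
    obtain ⟨g', hg'⟩ := L'.exists_hom h'
    rw [hf, hf', A.totMul_comp] at hA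
    rw [hg, hg', B.totMul_comp] at hB
    rw [hf'] at h2
    rw [hg] at h3
    rw [hf, hg, hf', hg', map_smul, map_smul, LinearMap.smul_apply, mu_mul h3 h2, ← hA, ← hB,
      smul_smul, smul_smul]
    congr 1
    rw [← Int.cast_mul, ← Int.cast_mul, ← Units.val_mul, ← Units.val_mul]
    congr 2
    rw [psgn, psgn, psgn]
    generalize twist L L' p = a
    generalize twist L L' q = b
    generalize twist L L' r = c
    generalize L.par p = d
    generalize L.par q = e
    generalize L.par r = i
    generalize L'.par p = j
    generalize L'.par q = k
    clear * -
    decide +revert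
  isHomog {p q} h := by
    have h1 := L.isHomog h
    have h2 := L'.isHomog h
    obtain ⟨f, hf⟩ := L.exists_hom h
    obtain ⟨g, hg⟩ := L'.exists_hom h
    rw [hf] at h1 ⊢
    rw [hg] at h2 ⊢
    rw [mul_mul_mul_comm]
    exact isHomog_smul (mu_isHomog h1 h2) _
  ob_per p := by rw [L.ob_per, L'.ob_per]
  path_per p q := by
    rw [L.path_per, L'.path_per]
    congr 3
    rw [psgn, psgn, twist_per, twist_per, L.par_per, L.par_per, L'.par_per]
    rw [mul_mul_mul_comm (L.par p), units_mul_self L.tot, mul_one]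
    generalize twist L L' p = a
    generalize twist L L' q = b
    generalize twist L L' (n + 1) = c
    generalize L.par 0 = d
    generalize L.par p = e
    generalize L.par q = f
    generalize L'.par p = g
    generalize L'.tot = h
    decide +revert
  par_per p := by rw [L.par_per, L'.par_per, mul_mul_mul_comm]

end Loop

end

section

/-! ### The nerve of a tensor product -/

variable {K : Type w} [Field K]

section PowerTensor

/-- The canonical map from the tensor product of two tensor powers to the tensor power of the
tensor product, over a field, is injective. -/
lemma map₂_mk_injective {ι : Type*} [Finite ι] {V W : Type*} [AddCommGroup V] [Module K V]
    [AddCommGroup W] [Module K W] : Function.Injective (TensorProduct.lift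
      (PiTensorProduct.map₂ (ι := ι) fun _ => TensorProduct.mk K V W)) := by
  let b := Module.Basis.ofVectorSpace K V
  let c := Module.Basis.ofVectorSpace K W
  let e := Module.Basis.equiv
    ((Basis.piTensorProduct fun _ : ι => b).tensorProduct (Basis.piTensorProduct fun _ : ι => c))
    (Basis.piTensorProduct fun _ : ι => b.tensorProduct c)
    (Equiv.arrowProdEquivProdArrow ι _ _).symm
  have h : TensorProduct.lift (PiTensorProduct.map₂ (ι := ι) fun _ => TensorProduct.mk K V W) =
      e.toLinearMap := by
    refine Module.Basis.ext ((Basis.piTensorProduct fun _ : ι => b).tensorProduct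
      (Basis.piTensorProduct fun _ : ι => c)) fun i => ?_
    rw [LinearEquiv.coe_coe, Module.Basis.equiv_apply, Module.Basis.tensorProduct_apply,
      TensorProduct.lift.tmul, Basis.piTensorProduct_apply, Basis.piTensorProduct_apply,
      Basis.piTensorProduct_apply, PiTensorProduct.map₂_tprod_tprod]
    congr 1
    funext j
    rw [Module.Basis.tensorProduct_apply]
    rfl
  rw [h]
  exact e.injective

end PowerTensor

section TenMul

variable (A : SuperCat.{w, u₁, v₁} K) (B : SuperCat.{w, u₂, v₂} K) (n : ℕ)

/-- The map `(⨂ aᵢ) ⊗ (⨂ bᵢ) ↦ ⨂ (aᵢ ⊗ bᵢ)`, without signs. -/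
def tenMul : A.Ten n ⊗[K] B.Ten n →ₗ[K] (A.tensor B).Ten n :=
  TensorProduct.lift (PiTensorProduct.map₂ fun _ => mu A B)

variable {A B n}

lemma tenMul_tprod (a : Fin (n + 1) → A.Tot) (b : Fin (n + 1) → B.Tot) :
    tenMul A B n (PiTensorProduct.tprod K a ⊗ₜ PiTensorProduct.tprod K b) =
      PiTensorProduct.tprod K fun i => mu A B (a i) (b i) := by
  rw [tenMul, TensorProduct.lift.tmul, PiTensorProduct.map₂_tprod_tprod]

lemma Loop.psgn_succ (L : Loop A n) (L' : Loop B n) (k : ℤ) : psgn L L' k (k + 1) = 1 := by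
  rw [psgn, twist_succ, ← mul_assoc, units_mul_self, one_mul, units_mul_self]

/-- No signs occur between consecutive indices. -/
lemma tenMul_ten (L : Loop A n) (L' : Loop B n) :
    tenMul A B n (L.ten ⊗ₜ L'.ten) = (L.prod L').ten := by
  rw [Loop.ten, Loop.ten, tenMul_tprod, Loop.ten]
  congr 1
  funext i
  change _ = ((Loop.psgn L L' _ _ : ℤ) : K) • _
  rw [L.psgn_succ, Units.val_one, Int.cast_one, one_smul]

variable (A B n) in
/-- Composition with the map from the total morphism space of `A ⊗ B` to the tensor product of those
of `A` and `B` yields the canonical map between tensor powers of vector spaces, which is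
injective. -/
lemma tenMul_injective : Function.Injective (tenMul A B n) := by
  let ρ : (A.tensor B).Tot →ₗ[K] A.Tot ⊗[K] B.Tot :=
    SuperCat.totLift (A := A.tensor B) fun P Q : SuperCat.TensorObj A B =>
      TensorProduct.map (SuperCat.inc : (P.fst ⟶ Q.fst) →ₗ[K] A.Tot)
        (SuperCat.inc : (P.snd ⟶ Q.snd) →ₗ[K] B.Tot)
  have hρ : (mu A B).compr₂ ρ = TensorProduct.mk K A.Tot B.Tot := by
    refine SuperCat.tot_ext fun X X' f => SuperCat.tot_ext fun Y Y' g => ?_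
    rw [LinearMap.compr₂_apply, mu_inc]
    exact ((A.tensor B).totLift_inc _ _).trans (TensorProduct.map_tmul _ _ _ _)
  have h : PiTensorProduct.map (fun _ => ρ) ∘ₗ tenMul A B n =
      TensorProduct.lift (PiTensorProduct.map₂ fun _ => TensorProduct.mk K A.Tot B.Tot) := by
    refine TensorProduct.ext (PiTensorProduct.ext (MultilinearMap.ext fun a =>
      PiTensorProduct.ext (MultilinearMap.ext fun b => ?_)))
    change PiTensorProduct.map _ (tenMul A B n (PiTensorProduct.tprod K a ⊗ₜ
      PiTensorProduct.tprod K b)) = PiTensorProduct.map₂ (fun _ => TensorProduct.mk K A.Tot B.Tot)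
        (PiTensorProduct.tprod K a) (PiTensorProduct.tprod K b)
    rw [tenMul_tprod, PiTensorProduct.map_tprod, PiTensorProduct.map₂_tprod_tprod]
    congr 1
    funext i
    exact LinearMap.congr_fun (LinearMap.congr_fun hρ (a i)) (b i)
  have h2 : Function.Injective (PiTensorProduct.map (fun _ => ρ) ∘ₗ tenMul A B n) :=
    h ▸ map₂_mk_injective
  exact Function.Injective.of_comp h2

variable (A B n) in
/-- The inclusion of the tensor product of the nerves. -/
def nerveIncl₂ : A.nerve n ⊗[K] B.nerve n →ₗ[K] A.Ten n ⊗[K] B.Ten n :=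
  TensorProduct.map (A.nerve n).subtype (B.nerve n).subtype

variable (A B n) in
lemma nerveIncl₂_injective : Function.Injective (nerveIncl₂ A B n) :=
  TensorProduct.map_injective_of_flat_flat _ _ (A.nerve n).subtype_injective
    (B.nerve n).subtype_injective

lemma span_elt_tmul : Submodule.span K (Set.range fun p : Loop A n × Loop B n =>
    p.1.elt ⊗ₜ[K] p.2.elt) = ⊤ := by
  rw [← TensorProduct.map₂_mk_top_top_eq_top, ← Loop.span_elt A n, ← Loop.span_elt B n,
    Submodule.map₂_span_span, Set.image2_range]
  rfl

lemma hom_ext₂ {E : Type*} [AddCommMonoid E] [Module K E]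
    {φ ψ : A.nerve n ⊗[K] B.nerve n →ₗ[K] E}
    (h : ∀ (L : Loop A n) (L' : Loop B n), φ (L.elt ⊗ₜ L'.elt) = ψ (L.elt ⊗ₜ L'.elt)) : φ = ψ :=
  LinearMap.ext_on_range span_elt_tmul fun p => h p.1 p.2

variable (A B n) in
/-- The nerve of the tensor product is the tensor product of the nerves, as a vector space. -/
lemma exists_nerveMul : ∃ e : (A.nerve n ⊗[K] B.nerve n) ≃ₗ[K] (A.tensor B).nerve n,
    ∀ (L : Loop A n) (L' : Loop B n), e (L.elt ⊗ₜ L'.elt) = (L.prod L').elt := by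
  have hφ : ∀ x, (tenMul A B n ∘ₗ nerveIncl₂ A B n) x ∈ (A.tensor B).nerve n := by
    intro x
    have hx : x ∈ Submodule.span K (Set.range fun p : Loop A n × Loop B n =>
      p.1.elt ⊗ₜ[K] p.2.elt) := by
      rw [span_elt_tmul]; exact Submodule.mem_top
    induction hx using Submodule.span_induction with
    | zero => rw [map_zero]; exact zero_mem _
    | add x y _ _ hx hy => rw [map_add]; exact add_mem hx hy
    | smul c x _ hx => rw [map_smul]; exact Submodule.smul_mem _ _ hx
    | mem x hx =>
      obtain ⟨⟨L, L'⟩, rfl⟩ := hx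
      exact (tenMul_ten L L').symm ▸ (L.prod L').elt.2
  let φ := (tenMul A B n ∘ₗ nerveIncl₂ A B n).codRestrict _ hφ
  have hinj : Function.Injective φ := fun x y h => nerveIncl₂_injective A B n
    (tenMul_injective A B n (congrArg Subtype.val h))
  have hsurj : Function.Surjective φ := by
    have hle : (A.tensor B).nerve n ≤ LinearMap.range (tenMul A B n ∘ₗ nerveIncl₂ A B n) := by
      refine SuperCat.nerve_le fun Z c hc => ?_
      choose f hf using hc
      -- a loop in `A ⊗ B` is a combination of loops whose arrows are pure tensors
      let ι : ∀ i, ((Z i : SuperCat.TensorObj A B).fst ⟶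
          (Z (i + 1) : SuperCat.TensorObj A B).fst) ⊗[K] ((Z i : SuperCat.TensorObj A B).snd ⟶
          (Z (i + 1) : SuperCat.TensorObj A B).snd) →ₗ[K] (A.tensor B).Tot := fun i =>
        tincl A B _ _ _ _
      have key : (LinearMap.range (tenMul A B n ∘ₗ nerveIncl₂ A B n)).mkQ ∘ₗ
          PiTensorProduct.map ι = 0 := by
        refine PiTensorProduct.ext_of_span_eq_top
          (γ := fun i => ((Z i : SuperCat.TensorObj A B).fst ⟶
            (Z (i + 1) : SuperCat.TensorObj A B).fst) × ((Z i : SuperCat.TensorObj A B).snd ⟶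
            (Z (i + 1) : SuperCat.TensorObj A B).snd))
          (g := fun i p => p.1 ⊗ₜ[K] p.2) (fun i => ?_) fun g => ?_
        · rw [← TensorProduct.span_tmul_eq_top]
          congr 1
          ext t
          simp
        · rw [LinearMap.comp_apply, PiTensorProduct.map_tprod, LinearMap.zero_apply]
          refine (Submodule.Quotient.mk_eq_zero _).2 ⟨⟨_, SuperCat.tprod_mem_nerve
            (Y := fun i => (Z i : SuperCat.TensorObj A B).fst)
            (a := fun i => SuperCat.inc (g i).1) fun i => ⟨_, rfl⟩⟩ ⊗ₜ
            ⟨_, SuperCat.tprod_mem_nerve (Y := fun i => (Z i : SuperCat.TensorObj A B).snd)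
              (a := fun i => SuperCat.inc (g i).2) fun i => ⟨_, rfl⟩⟩, ?_⟩
          refine (tenMul_tprod _ _).trans ?_
          congr 1
          funext i
          exact mu_inc _ _
      have h2 : (LinearMap.range (tenMul A B n ∘ₗ nerveIncl₂ A B n)).mkQ
          (PiTensorProduct.map ι (PiTensorProduct.tprod K (show ∀ i, _ ⊗[K] _ from f))) = 0 :=
        LinearMap.congr_fun key _
      rw [PiTensorProduct.map_tprod] at h2
      have h3 := (Submodule.Quotient.mk_eq_zero _).1 h2
      rwa [show (fun i => ι i (f i)) = c from funext fun i => (hf i).symm] at h3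
    intro y
    obtain ⟨x, hx⟩ := hle y.2
    exact ⟨x, Subtype.ext hx⟩
  exact ⟨LinearEquiv.ofBijective φ ⟨hinj, hsurj⟩, fun L L' => Subtype.ext (tenMul_ten L L')⟩

end TenMul

end

section

/-! ### The shuffle isomorphism -/

variable {K : Type w} [Field K]

section Shuffle

variable {A : SuperCat.{w, u₁, v₁} K} {B : SuperCat.{w, u₂, v₂} K} {m n : ℕ}

/-- The Koszul sign `(-1)^(∑_{i < j} |bᵢ||aⱼ|)` of the shuffle which takes
`a₀ ⊗ ⋯ ⊗ aₙ ⊗ b₀ ⊗ ⋯ ⊗ bₙ` to `a₀ ⊗ b₀ ⊗ ⋯ ⊗ aₙ ⊗ bₙ`. -/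
def Loop.cross (L : Loop A n) (L' : Loop B n) : ℤˣ :=
  L.twist L' (n + 1) * koz (L'.par 0) L.tot

variable (A B n) in
/-- The operator `(-1)^(|b₀ ⋯ bₖ₋₁||aₖ|)`. -/
def signOp (k : Fin (n + 1)) : A.Ten n ⊗[K] B.Ten n →ₗ[K] A.Ten n ⊗[K] B.Ten n :=
  TensorProduct.map (PiTensorProduct.map fun i => if i = k then A.totEv else LinearMap.id)
      LinearMap.id +
    TensorProduct.map (PiTensorProduct.map fun i => if i = k then A.totOd else LinearMap.id)
      (PiTensorProduct.map fun i => if i < k then B.totPar else LinearMap.id)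

lemma map_single {a : Fin (n + 1) → A.Tot} {k : Fin (n + 1)} {f : A.Tot →ₗ[K] A.Tot}
    (h : f (a k) = a k) : PiTensorProduct.map (fun i => if i = k then f else LinearMap.id)
      (PiTensorProduct.tprod K a) = PiTensorProduct.tprod K a := by
  rw [PiTensorProduct.map_tprod]
  congr 1
  funext i
  split_ifs with hi
  · rw [hi, h]
  · rfl

lemma map_single_zero {a : Fin (n + 1) → A.Tot} {k : Fin (n + 1)} {f : A.Tot →ₗ[K] A.Tot}
    (h : f (a k) = 0) : PiTensorProduct.map (fun i => if i = k then f else LinearMap.id)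
      (PiTensorProduct.tprod K a) = 0 := by
  rw [PiTensorProduct.map_tprod]
  exact MultilinearMap.map_coord_zero _ k (by rw [if_pos rfl, h])

lemma map_par (L : Loop B n) (k : Fin (n + 1)) :
    PiTensorProduct.map (fun i => if i < k then B.totPar else LinearMap.id) L.ten =
      (((L.par 0 * L.par (k : ℕ) : ℤˣ) : ℤ) : K) • L.ten := by
  rw [Loop.ten, PiTensorProduct.map_tprod]
  have h : (fun i : Fin (n + 1) => (if i < k then B.totPar else LinearMap.id)
      (L.path ((i : ℕ) : ℤ) ((i : ℕ) + 1))) = fun i : Fin (n + 1) =>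
      (if (i : ℕ) < (k : ℕ) then (((L.par (i : ℕ) * L.par ((i : ℕ) + 1) : ℤˣ) : ℤ) : K) else 1) •
        L.path ((i : ℕ) : ℤ) ((i : ℕ) + 1) := by
    funext i
    by_cases hi : i < k
    · rw [if_pos hi, if_pos (show (i : ℕ) < k from hi), (L.isHomog (by omega)).par]
    · rw [if_neg hi, if_neg (show ¬(i : ℕ) < k from hi), one_smul, LinearMap.id_apply]
  rw [h, MultilinearMap.map_smul_univ]
  congr 1
  rw [Fin.prod_univ_eq_prod_range (fun i => if i < (k : ℕ) then
    (((L.par (i : ℕ) * L.par ((i : ℕ) + 1) : ℤˣ) : ℤ) : K) else 1) (n + 1), ← prod_increments,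
    ← Finset.prod_filter, show (Finset.range (n + 1)).filter (· < (k : ℕ)) = Finset.range k by
      ext i; have := k.2; simp only [Finset.mem_filter, Finset.mem_range]; omega]
  push_cast
  rfl

lemma signOp_ten (L : Loop A n) (L' : Loop B n) (k : Fin (n + 1)) :
    signOp A B n k (L.ten ⊗ₜ L'.ten) = (((koz (L'.par 0 * L'.par (k : ℕ))
      (L.par (k : ℕ) * L.par ((k : ℕ) + 1)) : ℤˣ) : ℤ) : K) • (L.ten ⊗ₜ[K] L'.ten) := by
  rw [signOp, LinearMap.add_apply, TensorProduct.map_tmul, TensorProduct.map_tmul, map_par,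
    LinearMap.id_apply]
  rcases L.isHomog (show ((k : ℕ) : ℤ) ≤ (k : ℕ) + 1 by omega) with ⟨h, h1, h2⟩ | ⟨h, h1, h2⟩
  · rw [h, Loop.ten, map_single (f := A.totEv) h1,
      map_single_zero (f := A.totOd) h2, TensorProduct.zero_tmul, add_zero]
    generalize L'.par 0 * L'.par (k : ℕ) = u
    rw [show koz u 1 = 1 by decide +revert, Units.val_one, Int.cast_one, one_smul]
  · rw [h, Loop.ten, map_single (f := A.totOd) h2,
      map_single_zero (f := A.totEv) h1, TensorProduct.zero_tmul, zero_add]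
    generalize L'.par 0 * L'.par (k : ℕ) = u
    rw [show koz u (-1) = u by decide +revert, TensorProduct.tmul_smul]

/-- The signs of a shuffle are realized by a linear map, one factor at a time. -/
lemma exists_signOp (k : ℕ) (hk : k ≤ n + 1) :
    ∃ J : A.Ten n ⊗[K] B.Ten n →ₗ[K] A.Ten n ⊗[K] B.Ten n, ∀ (L : Loop A n) (L' : Loop B n),
      J (L.ten ⊗ₜ L'.ten) = (((L.twist L' k * koz (L'.par 0) (L.par 0 * L.par k) : ℤˣ) : ℤ) : K) •
        (L.ten ⊗ₜ[K] L'.ten) := by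
  induction k with
  | zero =>
    refine ⟨LinearMap.id, fun L L' => ?_⟩
    rw [Nat.cast_zero, Loop.twist_zero, units_mul_self, one_mul]
    generalize L'.par 0 = u
    rw [show koz u 1 = 1 by decide +revert, Units.val_one, Int.cast_one, one_smul,
      LinearMap.id_apply]
  | succ k ih =>
    obtain ⟨J, hJ⟩ := ih (by omega)
    refine ⟨J ∘ₗ signOp A B n ⟨k, by omega⟩, fun L L' => ?_⟩
    rw [LinearMap.comp_apply, signOp_ten, map_smul, hJ, smul_smul, ← Int.cast_mul, ← Units.val_mul]
    congr 3
    rw [Nat.cast_succ, Loop.twist_succ]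
    generalize L.twist L' k = a
    generalize L.par k = b
    generalize L.par (k + 1) = c
    generalize L.par 0 = d
    generalize L'.par k = e
    generalize L'.par 0 = f
    decide +revert

variable (A B n) in
/-- The nerve of the tensor product is, by shuffling, the tensor product of the nerves. -/
lemma exists_unshuffle : ∃ D : (A.tensor B).nerve n ≃ₗ[K] (A.nerve n ⊗[K] B.nerve n),
    ∀ (L : Loop A n) (L' : Loop B n), D (L.prod L').elt =
      ((L.cross L' : ℤ) : K) • (L.elt ⊗ₜ[K] L'.elt) := by
  obtain ⟨J, hJ⟩ := exists_signOp (A := A) (B := B) (n + 1) le_rfl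
  have hJ' : ∀ (L : Loop A n) (L' : Loop B n), J (L.ten ⊗ₜ L'.ten) =
      nerveIncl₂ A B n (((L.cross L' : ℤ) : K) • (L.elt ⊗ₜ[K] L'.elt)) := by
    intro L L'
    rw [hJ, map_smul, Nat.cast_succ, L.par_succ, ← mul_assoc,
      units_mul_self, one_mul]
    rfl
  have hr : ∀ x, (J ∘ₗ nerveIncl₂ A B n) x ∈ LinearMap.range (nerveIncl₂ A B n) := by
    intro x
    have hx : x ∈ Submodule.span K (Set.range fun p : Loop A n × Loop B n =>
        p.1.elt ⊗ₜ[K] p.2.elt) := by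
      rw [span_elt_tmul]; exact Submodule.mem_top
    induction hx using Submodule.span_induction with
    | zero => rw [map_zero]; exact zero_mem _
    | add x y _ _ hx hy => rw [map_add]; exact add_mem hx hy
    | smul c x _ hx => rw [map_smul]; exact Submodule.smul_mem _ _ hx
    | mem x hx =>
      obtain ⟨⟨L, L'⟩, rfl⟩ := hx
      exact ⟨_, (hJ' L L').symm⟩
  let ι := LinearEquiv.ofInjective (nerveIncl₂ A B n) (nerveIncl₂_injective A B n)
  let J' : A.nerve n ⊗[K] B.nerve n →ₗ[K] A.nerve n ⊗[K] B.nerve n :=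
    ι.symm.toLinearMap ∘ₗ (J ∘ₗ nerveIncl₂ A B n).codRestrict _ hr
  have hJ'' : ∀ (L : Loop A n) (L' : Loop B n), J' (L.elt ⊗ₜ L'.elt) =
      ((L.cross L' : ℤ) : K) • (L.elt ⊗ₜ[K] L'.elt) := by
    intro L L'
    refine (LinearEquiv.symm_apply_eq ι).2 (Subtype.ext ?_)
    exact hJ' L L'
  -- the signs square to one
  have hinv : J' ∘ₗ J' = LinearMap.id := hom_ext₂ fun L L' => by
    rw [LinearMap.comp_apply, hJ'', map_smul, hJ'', smul_smul, LinearMap.id_apply, ← Int.cast_mul,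
      ← Units.val_mul, units_mul_self, Units.val_one, Int.cast_one, one_smul]
  obtain ⟨e, he⟩ := exists_nerveMul A B n
  let j : (A.nerve n ⊗[K] B.nerve n) ≃ₗ[K] (A.nerve n ⊗[K] B.nerve n) :=
    LinearEquiv.ofLinearMap J' J' hinv hinv
  refine ⟨e.symm.trans j, fun L L' => ?_⟩
  rw [LinearEquiv.trans_apply, ← he, LinearEquiv.symm_apply_apply]
  exact hJ'' L L'

variable (A B n) in
/-- The identification of the nerve of a tensor product with the tensor product of the nerves. -/
def unshuffle : (A.tensor B).nerve n ≃ₗ[K] (A.nerve n ⊗[K] B.nerve n) :=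
  (exists_unshuffle A B n).choose

lemma unshuffle_prod (L : Loop A n) (L' : Loop B n) : unshuffle A B n (L.prod L').elt =
    ((L.cross L' : ℤ) : K) • (L.elt ⊗ₜ[K] L'.elt) := (exists_unshuffle A B n).choose_spec L L'

lemma unshuffle_symm (L : Loop A n) (L' : Loop B n) : (unshuffle A B n).symm (L.elt ⊗ₜ L'.elt) =
    ((L.cross L' : ℤ) : K) • (L.prod L').elt := by
  rw [LinearEquiv.symm_apply_eq, map_smul, unshuffle_prod, smul_smul, ← Int.cast_mul,
    ← Units.val_mul, units_mul_self, Units.val_one, Int.cast_one, one_smul]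

lemma prod_hom_ext {E : Type*} [AddCommMonoid E] [Module K E]
    {φ ψ : (A.tensor B).nerve n →ₗ[K] E}
    (h : ∀ (L : Loop A n) (L' : Loop B n), φ (L.prod L').elt = ψ (L.prod L').elt) : φ = ψ := by
  have h2 : φ ∘ₗ (unshuffle A B n).symm.toLinearMap = ψ ∘ₗ (unshuffle A B n).symm.toLinearMap :=
    hom_ext₂ fun L L' => by
      rw [LinearMap.comp_apply, LinearMap.comp_apply, LinearEquiv.coe_coe, unshuffle_symm, map_smul,
        map_smul, h]
  refine LinearMap.ext fun x => ?_
  have h3 := LinearMap.congr_fun h2 (unshuffle A B n x)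
  rwa [LinearMap.comp_apply, LinearMap.comp_apply, LinearEquiv.coe_coe,
    LinearEquiv.symm_apply_apply] at h3

/-- Pulling back a product of loops multiplies it by the signs of its arrows. -/
lemma Loop.pull_prod_ten (L : Loop A n) (L' : Loop B n) (f : LHom m n) :
    ((L.prod L').pull f).ten = (((L.twist L' (f 0) * L.twist L' (f 0 + (n + 1)) *
      ((L.pull f).twist (L'.pull f) (m + 1)) : ℤˣ) : ℤ) : K) •
        ((L.pull f).prod (L'.pull f)).ten := by
  have hprod : ∀ k : ℕ, ∏ i ∈ Finset.range k, psgn L L' (f (i : ℕ)) (f ((i : ℕ) + 1)) =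
      L.twist L' (f 0) * L.twist L' (f k) * (L.pull f).twist (L'.pull f) k := by
    intro k
    induction k with
    | zero =>
      rw [Finset.prod_range_zero, Nat.cast_zero, twist_zero, units_mul_self, one_mul]
    | succ k ih =>
      rw [Finset.prod_range_succ, ih, Nat.cast_succ, twist_succ, psgn, pull_par, pull_par, pull_par]
      generalize L.twist L' (f 0) = a
      generalize L.twist L' (f k) = b
      generalize L.twist L' (f (k + 1)) = c
      generalize (L.pull f).twist (L'.pull f) k = d
      generalize koz (L'.par (f k)) (L.par (f k) * L.par (f (k + 1))) = e
      decide +revert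
  rw [← tenMul_ten, Loop.ten, Loop.ten, Loop.ten, tenMul_tprod]
  change PiTensorProduct.tprod K (fun i : Fin (m + 1) =>
    ((psgn L L' (f ((i : ℕ) : ℤ)) (f ((i : ℕ) + 1)) : ℤ) : K) • mu A B
      (L.path (f ((i : ℕ) : ℤ)) (f ((i : ℕ) + 1)))
      (L'.path (f ((i : ℕ) : ℤ)) (f ((i : ℕ) + 1)))) = _
  rw [MultilinearMap.map_smul_univ]
  congr 1
  have h := hprod (m + 1)
  rw [Nat.cast_succ, ← f.per 0, zero_add] at *
  rw [← h, Fin.prod_univ_eq_prod_range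
    (fun i => ((psgn L L' (f ((i : ℕ) : ℤ)) (f ((i : ℕ) + 1)) : ℤ) : K)) (m + 1)]
  push_cast
  rfl

/-- Shuffling is compatible with the signs of the rotations. -/
lemma Loop.sgn_prod (L : Loop A n) (L' : Loop B n) (f : LHom m n) :
    (L.prod L').sgn f * ((L.twist L' (f 0) * L.twist L' (f 0 + (n + 1)) *
      ((L.pull f).twist (L'.pull f) (m + 1)))) * (L.pull f).cross (L'.pull f) =
      L.cross L' * (L.sgn f * L'.sgn f) := by
  rw [cross, cross, sgn, sgn, sgn, twist_per]
  change koz (L.par 0 * L'.par 0 * (L.par (f 0) * L'.par (f 0))) (-(L.tot * L'.tot)) * _ *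
    (_ * koz (L'.par (f 0)) L.tot) = _
  generalize (L.pull f).twist (L'.pull f) (m + 1) = a
  generalize L.twist L' (f 0) = b
  generalize L.twist L' (n + 1) = c
  rw [show b * (b * c * koz L'.tot (L.par 0 * L.par (f 0))) * a =
      (b * b) * (a * c * koz L'.tot (L.par 0 * L.par (f 0))) by ac_rfl, units_mul_self, one_mul,
    show ∀ x y z : ℤˣ, x * (a * c * y) * (a * z) = (a * a) * (c * (x * y * z)) by
      intros; ac_rfl, units_mul_self, one_mul, mul_assoc c]
  congr 1
  generalize L.par 0 = d
  generalize L.par (f 0) = e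
  generalize L'.par 0 = g
  generalize L'.par (f 0) = h
  generalize L.tot = i
  generalize L'.tot = j
  decide +revert

/-- The diagonal of the nerves of `A` and `B` is the nerve of `A ⊗ B`. -/
lemma unshuffle_act (f : LHom m n) (x : (A.tensor B).nerve n) :
    unshuffle A B m (nerveAct (A.tensor B) f x) =
      ((nerveL A).diag (nerveL B)).act f (unshuffle A B n x) :=
  LinearMap.congr_fun
    (f := (unshuffle A B m).toLinearMap ∘ₗ nerveAct (A.tensor B) f)
    (g := TensorProduct.map (nerveAct A f) (nerveAct B f) ∘ₗ (unshuffle A B n).toLinearMap)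
    (prod_hom_ext fun L L' => by
      have h : ((L.prod L').pull f).elt = (((L.twist L' (f 0) * L.twist L' (f 0 + (n + 1)) *
          ((L.pull f).twist (L'.pull f) (m + 1)) : ℤˣ) : ℤ) : K) •
          ((L.pull f).prod (L'.pull f)).elt := Subtype.ext (L.pull_prod_ten L' f)
      rw [LinearMap.comp_apply, LinearMap.comp_apply, LinearEquiv.coe_coe, LinearEquiv.coe_coe,
        nerveAct_elt, unshuffle_prod, h, map_smul, map_smul, map_smul, unshuffle_prod,
        TensorProduct.map_tmul, nerveAct_elt, nerveAct_elt, TensorProduct.smul_tmul_smul, smul_smul,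
        smul_smul, smul_smul, ← Int.cast_mul, ← Int.cast_mul, ← Int.cast_mul, ← Int.cast_mul,
        ← Units.val_mul, ← Units.val_mul, ← Units.val_mul, ← Units.val_mul, ← L.sgn_prod L' f]) x

variable (A B) in
/-- The isomorphism of paracyclic modules from the nerve of `A ⊗ B` to the diagonal. -/
def unshuffleHom : (nerveL (A.tensor B)).Hom ((nerveL A).diag (nerveL B)) :=
  ⟨fun n => (unshuffle A B n).toLinearMap, fun f x => unshuffle_act f x⟩

end Shuffle

/-! ### Naturality of the nerve -/

section Map

variable {A : SuperCat.{w, u₁, v₁} K} {A' : SuperCat.{w, u₁, v₁} K} {n : ℕ}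
  (F : SuperCat.GradedFunctor A A')

/-- The image of a loop under a graded functor. -/
def Loop.map (L : Loop A n) : Loop A' n where
  ob p := F.toFunctor.obj (L.ob p)
  path p q := SuperCat.totMap F (L.path p q)
  par := L.par
  tot := L.tot
  exists_hom h := by
    obtain ⟨f, hf⟩ := L.exists_hom h
    exact ⟨F.toFunctor.map f, by rw [hf, SuperCat.totMap_inc]⟩
  path_self p := by rw [L.path_self, SuperCat.totMap_inc, CategoryTheory.Functor.map_id]
  path_mul {p q r} h h' := by
    have hc := L.path_mul h h'
    obtain ⟨f, hf⟩ := L.exists_hom h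
    obtain ⟨g, hg⟩ := L.exists_hom h'
    rw [← hc, hf, hg, SuperCat.totMul_comp, SuperCat.totMap_inc, SuperCat.totMap_inc,
      SuperCat.totMul_comp, SuperCat.totMap_inc, CategoryTheory.Functor.map_comp]
  isHomog h := by
    rcases L.isHomog h with ⟨hs, h1, h2⟩ | ⟨hs, h1, h2⟩
    · exact Or.inl ⟨hs, by rw [← SuperCat.totMap_ev, h1],
        by rw [← SuperCat.totMap_od, h2, map_zero]⟩
    · exact Or.inr ⟨hs, by rw [← SuperCat.totMap_ev, h1, map_zero],
        by rw [← SuperCat.totMap_od, h2]⟩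
  ob_per p := by rw [L.ob_per]
  path_per p q := by rw [L.path_per]
  par_per p := L.par_per p

/-- The map of nerves induced by a graded functor. -/
abbrev nerveMap (n : ℕ) : A.nerve n →ₗ[K] A'.nerve n := (SuperCat.mixedMap F).f n

lemma nerveMap_elt (L : Loop A n) : nerveMap F n L.elt = (L.map F).elt :=
  Subtype.ext (SuperCat.tenMap_tprod F _)

/-- The morphism of paracyclic modules induced by a graded functor. -/
def nerveHom : (nerveL A).Hom (nerveL A') where
  f n := nerveMap F n
  comm {m n} g x := LinearMap.congr_fun (f := nerveMap F m ∘ₗ nerveAct A g)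
    (g := nerveAct A' g ∘ₗ nerveMap F n) (Loop.hom_ext fun L => by
      rw [LinearMap.comp_apply, LinearMap.comp_apply, nerveAct_elt, map_smul, nerveMap_elt,
        nerveMap_elt, nerveAct_elt]
      rfl) x

end Map

section MapTensor

variable {A A' : SuperCat.{w, u₁, v₁} K} {B B' : SuperCat.{w, u₂, v₂} K} {n : ℕ}
  (F : SuperCat.GradedFunctor A A') (G : SuperCat.GradedFunctor B B')

lemma totMap_mu (x : A.Tot) (y : B.Tot) : SuperCat.totMap (F.tensor G) (mu A B x y) =
    mu A' B' (SuperCat.totMap F x) (SuperCat.totMap G y) := by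
  have h : (mu A B).compr₂ (SuperCat.totMap (F.tensor G)) =
      (mu A' B').compl₁₂ (SuperCat.totMap F) (SuperCat.totMap G) := by
    refine SuperCat.tot_ext fun X X' f => SuperCat.tot_ext fun Y Y' g => ?_
    rw [LinearMap.compr₂_apply, LinearMap.compl₁₂_apply, mu_inc, SuperCat.totMap_inc,
      SuperCat.totMap_inc, mu_inc]
    exact SuperCat.totMap_inc (F.tensor G) _
  exact LinearMap.congr_fun (LinearMap.congr_fun h x) y

lemma Loop.map_prod (L : Loop A n) (L' : Loop B n) :
    (L.prod L').map (F.tensor G) = (L.map F).prod (L'.map G) := by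
  have h : ∀ p q, SuperCat.totMap (F.tensor G) (((psgn L L' p q : ℤ) : K) •
      mu A B (L.path p q) (L'.path p q)) = ((psgn L L' p q : ℤ) : K) •
        mu A' B' (SuperCat.totMap F (L.path p q)) (SuperCat.totMap G (L'.path p q)) :=
    fun p q => by rw [map_smul, totMap_mu]
  simp only [prod, map, h]
  rfl

lemma map_unshuffle (x : (A.tensor B).nerve n) :
    unshuffle A' B' n (nerveMap (F.tensor G) n x) =
      TensorProduct.map (nerveMap F n) (nerveMap G n) (unshuffle A B n x) :=
  LinearMap.congr_fun
    (f := (unshuffle A' B' n).toLinearMap ∘ₗ nerveMap (F.tensor G) n)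
    (g := TensorProduct.map (nerveMap F n) (nerveMap G n) ∘ₗ (unshuffle A B n).toLinearMap)
    (prod_hom_ext fun L L' => by
      rw [LinearMap.comp_apply, LinearMap.comp_apply, LinearEquiv.coe_coe, LinearEquiv.coe_coe,
        nerveMap_elt, L.map_prod F G L', unshuffle_prod, unshuffle_prod, map_smul,
        TensorProduct.map_tmul, nerveMap_elt, nerveMap_elt]
      rfl) x

end MapTensor

end

section

variable {K : Type w} [Field K]

/-! ### The Eilenberg–Zilber theorem for paracyclic modules -/

section EilenbergZilber

variable (X : LMod.{w, x} K) (Y : LMod.{w, y} K)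

/-- The Alexander–Whitney map is surjective in homology of degree zero. -/
lemma ez_exact_zero (w : Fam K X.obj Y.obj) (hw : Fam.Supp 0 w) :
    ∃ a s, Fam.Supp 1 s ∧ w - LMod.awOne X Y 0 a = Fam.d X.b Y.b s := by
  have h0 : SMod.coneD X.toSMod Y.toSMod (0, w) = 0 := by
    rw [SMod.coneD_apply]
    refine Prod.ext (map_zero _) ?_
    change SMod.aw X.toSMod Y.toSMod 0 - Fam.d X.b Y.b w = 0
    rw [map_zero, hw.d_zero, sub_zero]
  obtain ⟨v, ⟨h1, h2⟩, hv⟩ := SMod.coneExact 0 X.toSMod Y.toSMod (0, w)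
    ⟨fun _ _ => rfl, hw⟩ h0
  rw [SMod.coneD_apply] at hv
  have h3 : v.1 = Pi.single 0 (v.1 0) := by
    funext n
    by_cases hn : n = 0
    · subst hn; rw [Pi.single_eq_same]
    · rw [Pi.single_eq_of_ne hn, h1 n (by omega)]
  refine ⟨v.1 0, -v.2, h2.neg, ?_⟩
  have h4 : SMod.aw X.toSMod Y.toSMod v.1 - Fam.d X.b Y.b v.2 = w := congrArg Prod.snd hv
  rw [h3, LMod.aw_single] at h4
  rw [map_neg, ← h4]
  abel

/-- The mapping cone of the Alexander–Whitney map is exact in positive degrees. The hypothesis on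
`a` says that `a` is a cycle, and is void for `n = 0`. -/
lemma ez_exact (n : ℕ) (a : (X.diag Y).obj n) (w : Fam K X.obj Y.obj) (hw : Fam.Supp (n + 1) w)
    (ha : ∀ m (h : m + 1 = n), (X.diag Y).b m (h ▸ a) = 0)
    (h : LMod.awOne X Y n a = Fam.d X.b Y.b w) :
    ∃ a' s, Fam.Supp (n + 2) s ∧ (X.diag Y).b n a' = a ∧
      w - LMod.awOne X Y (n + 1) a' = Fam.d X.b Y.b s := by
  have h0 : SMod.coneD X.toSMod Y.toSMod (Pi.single n a, w) = 0 := by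
    rw [SMod.coneD_apply]
    refine Prod.ext (funext fun m => ?_) ?_
    · change (X.diag Y).b m ((Pi.single n a : ∀ n, (X.diag Y).obj n) (m + 1)) = 0
      by_cases hm : m + 1 = n
      · subst hm
        rw [Pi.single_eq_same]
        exact ha m rfl
      · rw [Pi.single_eq_of_ne hm, map_zero]
    · change SMod.aw X.toSMod Y.toSMod (Pi.single n a) - Fam.d X.b Y.b w = 0
      rw [LMod.aw_single, h, sub_self]
  obtain ⟨v, ⟨h1, h2⟩, hv⟩ := SMod.coneExact (n + 1) X.toSMod Y.toSMod (Pi.single n a, w)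
    ⟨fun m hm => Pi.single_eq_of_ne (by omega) _, hw⟩ h0
  rw [SMod.coneD_apply] at hv
  have h3 : v.1 = Pi.single (n + 1) (v.1 (n + 1)) := by
    funext m
    by_cases hm : m = n + 1
    · subst hm; rw [Pi.single_eq_same]
    · rw [Pi.single_eq_of_ne hm, h1 m (by omega)]
  have h5 : (X.diag Y).b n (v.1 (n + 1)) = (Pi.single n a : ∀ n, (X.diag Y).obj n) n :=
    congrFun (congrArg Prod.fst hv) n
  rw [Pi.single_eq_same] at h5
  refine ⟨v.1 (n + 1), -v.2, h2.neg, h5, ?_⟩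
  have h4 : SMod.aw X.toSMod Y.toSMod v.1 - Fam.d X.b Y.b v.2 = w := congrArg Prod.snd hv
  rw [h3, LMod.aw_single] at h4
  rw [map_neg, ← h4]
  abel

end EilenbergZilber

/-! ### The operations on the nerve -/

section Nerve

variable (K) in
/-- A choice of the universal elements. -/
def universal : ℕ → ∀ n, LMod.Univ K n := (LMod.exists_universal (K := K)).choose

lemma universal_zero : universal K 0 = LMod.awU K := (LMod.exists_universal (K := K)).choose_spec.1

lemma universal_supp (l n : ℕ) : Fam.Supp (n + 2 * l) (universal K l n) :=
  (LMod.exists_universal (K := K)).choose_spec.2.1 l n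

lemma universal_rec {X : LMod.{w, x} K} {Y : LMod.{w, y} K} (hX : X.IsCyclic) (hY : Y.IsCyclic)
    (l n : ℕ) (a : (X.diag Y).obj n) :
    Fam.d X.b Y.b (LMod.ops X Y (universal K (l + 1)) n a) =
      LMod.rhs (LMod.ops X Y (universal K (l + 1))) (LMod.ops X Y (universal K l)) n a :=
  LMod.rec_of_bar hX hY ((LMod.exists_universal (K := K)).choose_spec.2.2 l n) a

variable (A : SuperCat.{w, u₁, v₁} K) (B : SuperCat.{w, u₂, v₂} K)

/-- Families of elements of the tensor products of two nerves. -/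
abbrev NFam := Fam K (nerveL A).obj (nerveL B).obj

variable {A B}

lemma bT_nerve (w : NFam A B) : bT A.mixed B.mixed w = Fam.d (nerveL A).b (nerveL B).b w := by
  have hA : (nerveL A).b = A.mixed.b := funext fun n => LinearMap.ext nerveL_b
  have hB : (nerveL B).b = B.mixed.b := funext fun n => LinearMap.ext nerveL_b
  exact congrArg₂ (fun b b' => Fam.d (K := K) (X := (nerveL A).obj) (Y := (nerveL B).obj) b b' w)
    hA.symm hB.symm

lemma upB_nerve (w : NFam A B) :
    BL A.mixed B.mixed w + BR A.mixed B.mixed w = LMod.upB (nerveL A) (nerveL B) w := by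
  have hA : (nerveL A).B = A.mixed.B := funext fun n => LinearMap.ext nerveL_B
  have hB : (nerveL B).B = B.mixed.B := funext fun n => LinearMap.ext nerveL_B
  have hT : (nerveL A).T = fun _ => LinearMap.id :=
    funext fun n => LinearMap.ext (nerveL_isCyclic n)
  rw [LMod.upB, hA, hB, hT]
  rfl

variable (A B) in
/-- The components of the cyclic Alexander–Whitney map: shuffling, followed by the natural
operations. -/
def awMap (l n : ℕ) : (A.tensor B).nerve n →ₗ[K] NFam A B :=
  LMod.ops (nerveL A) (nerveL B) (universal K l) n ∘ₗ (unshuffle A B n).toLinearMap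

lemma awMap_apply (l n : ℕ) (a : (A.tensor B).nerve n) :
    awMap A B l n a = LMod.ops (nerveL A) (nerveL B) (universal K l) n (unshuffle A B n a) := rfl

lemma awMap_zero (n : ℕ) (a : (A.tensor B).nerve n) :
    awMap A B 0 n a = LMod.awOne (nerveL A) (nerveL B) n (unshuffle A B n a) := by
  rw [awMap_apply, universal_zero, LMod.ops_awU]

lemma unshuffle_b (n : ℕ) (a : (A.tensor B).nerve (n + 1)) :
    unshuffle A B n ((A.tensor B).mixed.b n a) =
      ((nerveL A).diag (nerveL B)).b n (unshuffle A B (n + 1) a) := by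
  rw [← nerveL_b]
  exact (unshuffleHom A B).comm_b n a

lemma unshuffle_B (n : ℕ) (a : (A.tensor B).nerve n) :
    unshuffle A B (n + 1) ((A.tensor B).mixed.B n a) =
      ((nerveL A).diag (nerveL B)).B n (unshuffle A B n a) := by
  rw [← nerveL_B]
  exact (unshuffleHom A B).comm_B n a

lemma awMap_rec (l n : ℕ) (a : (A.tensor B).nerve n) :
    bT A.mixed B.mixed (awMap A B (l + 1) n a) +
      (BL A.mixed B.mixed (awMap A B l n a) + BR A.mixed B.mixed (awMap A B l n a)) =
    LMod.preB (LMod.ops (nerveL A) (nerveL B) (universal K (l + 1))) n (unshuffle A B n a) +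
      awMap A B l (n + 1) ((A.tensor B).mixed.B n a) := by
  have h1 := universal_rec (nerveL_isCyclic (A := A)) (nerveL_isCyclic (A := B)) l n
    (unshuffle A B n a)
  rw [LMod.rhs_apply, eq_sub_iff_add_eq] at h1
  refine (congrArg₂ (· + ·) (bT_nerve (awMap A B (l + 1) n a))
    (upB_nerve (awMap A B l n a))).trans (h1.trans (congrArg (_ + ·) ?_))
  exact congrArg (LMod.ops (nerveL A) (nerveL B) (universal K l) (n + 1)) (unshuffle_B n a).symm

lemma awMap_exact (n : ℕ) (a : (A.tensor B).nerve n) (w : NFam A B) (hw : Fam.Supp (n + 1) w)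
    (ha : ∀ m (h : m + 1 = n), (A.tensor B).mixed.b m (h ▸ a) = 0)
    (h : awMap A B 0 n a = bT A.mixed B.mixed w) :
    ∃ (a' : (A.tensor B).nerve (n + 1)) (s : NFam A B), Fam.Supp (n + 2) s ∧
      (A.tensor B).mixed.b n a' = a ∧ w - awMap A B 0 (n + 1) a' = bT A.mixed B.mixed s := by
  rw [awMap_zero, bT_nerve] at h
  obtain ⟨c, s, hs, hc, hcs⟩ := ez_exact (nerveL A) (nerveL B) n (unshuffle A B n a) w hw
    (fun m hm => by
      subst hm
      have := ha m rfl
      exact (unshuffle_b m a).symm.trans ((congrArg (unshuffle A B m) this).trans (map_zero _))) h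
  refine ⟨(unshuffle A B (n + 1)).symm c, s, hs, (unshuffle A B n).injective ?_, ?_⟩
  · rw [unshuffle_b, LinearEquiv.apply_symm_apply, hc]
  · rw [awMap_zero, LinearEquiv.apply_symm_apply, bT_nerve, hcs]

variable (A B) in
/-- The cyclic Alexander–Whitney map from the nerve of `A ⊗ B` to the tensor product of the nerves
of `A` and `B`. -/
def nerveAW : CyclicAW (A.tensor B).mixed A.mixed B.mixed where
  g l n := awMap A B l n
  supp l n a := LMod.op_supp _ _ (universal_supp l n) _
  g_b n a := by
    refine (bT_nerve (awMap A B 0 (n + 1) a)).trans ?_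
    refine (congrArg (Fam.d (nerveL A).b (nerveL B).b) (awMap_zero (n + 1) a)).trans ?_
    refine (LMod.b_awOne _ _ (n + 1) _).trans (Eq.trans ?_ (awMap_zero n _).symm)
    exact congrArg (LMod.awOne (nerveL A) (nerveL B) n) (unshuffle_b n a).symm
  g_zero l a := (awMap_rec l 0 a).trans (zero_add _)
  g_succ l n a := (awMap_rec l (n + 1) a).trans (congrArg₂ (· + ·)
    (congrArg (LMod.ops (nerveL A) (nerveL B) (universal K (l + 1)) n) (unshuffle_b n a).symm) rfl)
  exact_zero w hw := by
    obtain ⟨c, s, hs, hcs⟩ := ez_exact_zero (nerveL A) (nerveL B) w hw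
    refine ⟨(unshuffle A B 0).symm c, s, hs, ?_⟩
    refine Eq.trans ?_ (hcs.trans (bT_nerve s).symm)
    refine congrArg (w - ·) ((awMap_zero 0 _).trans ?_)
    rw [LinearEquiv.apply_symm_apply]
  exact_one a w hw h := awMap_exact 0 a w hw (fun m hm => absurd hm (by omega)) h
  exact_succ n a w hw ha h := awMap_exact (n + 1) a w hw (fun m hm => by
    obtain rfl : m = n := by omega
    exact ha) h

end Nerve

section Natural

variable {A A' : SuperCat.{w, u₁, v₁} K} {B B' : SuperCat.{w, u₂, v₂} K}
  (F : SuperCat.GradedFunctor A A') (G : SuperCat.GradedFunctor B B')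

/-- The cyclic Alexander–Whitney map is natural, being given by natural operations. -/
lemma map_nerveAW (l n : ℕ) (a : (A.tensor B).mixed.X n) :
    Fam.map (SuperCat.mixedMap F).f (SuperCat.mixedMap G).f ((nerveAW A B).g l n a) =
      (nerveAW A' B').g l n ((SuperCat.mixedMap (F.tensor G)).f n a) := by
  refine (LMod.map_op (nerveHom F) (nerveHom G) (universal K l n) (unshuffle A B n a)).trans ?_
  exact congrArg (LMod.op (nerveL A') (nerveL B') (universal K l n)) (map_unshuffle F G a).symm

end Natural

end

end CyclicKunneth

end

open CyclicKunneth in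
theorem mainTheorem3 (K : Type w) [Field K] :
    ∃ (α : ∀ (A : SuperCat.{w, u₁, v₁} K) (B : SuperCat.{w, u₂, v₂} K) (n : ℕ),
          (A.tensor B).HC n →ₗ[K] SuperCat.HCTensor A B n)
      (β : ∀ (A : SuperCat.{w, u₁, v₁} K) (B : SuperCat.{w, u₂, v₂} K) (n : ℕ),
          SuperCat.HCTensor A B n →ₗ[K] (A.tensor B).HC (n + 1)),
      (∀ (A A' : SuperCat.{w, u₁, v₁} K) (B B' : SuperCat.{w, u₂, v₂} K)
          (F : SuperCat.GradedFunctor A A') (G : SuperCat.GradedFunctor B B') (n : ℕ),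
          SuperCat.mapHCTensor F G n ∘ₗ α A B n =
              α A' B' n ∘ₗ SuperCat.mapHC (F.tensor G) n ∧
            SuperCat.mapHC (F.tensor G) (n + 1) ∘ₗ β A B n =
              β A' B' n ∘ₗ SuperCat.mapHCTensor F G n) ∧
        ∀ (A : SuperCat.{w, u₁, v₁} K) (B : SuperCat.{w, u₂, v₂} K),
          (∀ n : ℕ, Function.Exact (α A B (n + 2)) (SuperCat.sDiff A B n)) ∧
          (∀ n : ℕ, Function.Exact (SuperCat.sDiff A B n) (β A B n)) ∧
          (∀ n : ℕ, Function.Exact (β A B n) (α A B (n + 1))) ∧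
          Function.Surjective (α A B 1) ∧ Function.Bijective (α A B 0) := by
  refine ⟨fun A B n => alpha (nerveAW A B) n, fun A B n => beta (nerveAW A B) n,
    fun A A' B B' F G n => ⟨LinearMap.ext fun c => ?_, LinearMap.ext fun c => ?_⟩,
    fun A B => ⟨exact_alpha_sDiff _, exact_sDiff_beta _, exact_beta_alpha _,
      alpha_surjective _ (by omega), alpha_zero_injective _, alpha_surjective _ (by omega)⟩⟩
  · exact mapHCTensor_alpha (map_nerveAW F G) n c
  · exact mapHC_beta (map_nerveAW F G) n c
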